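/- Notation. $\Omega\subset\mathbb R^n$ ($n\ge 1$) is a bounded Lipschitz domain, $\Omega_e=\mathbb R^n\setminus\overline\Omega$, $T>0$, $\Omega_T=\Omega\times(0,T)$, $(\Omega_e)_T=\Omega_e\times(0,T)$, $s>0$, $\alpha,c\in\mathbb R$, $b>0$. All functions are real valued. $(-\Delta)^{s}$ is the Fourier multiplier with symbol $|\xi|^{2s}$, $\widetilde H^s(\Omega)$ is the closure of $C_c^\infty(\Omega)$ in $H^s(\mathbb R^n)$, with the norm $\|u\|_{\widetilde H^s(\Omega)}=\|(-\Delta)^{s/2}u\|_{L^2(\mathbb R^n)}$, $\widetilde L^2(\Omega)$ is the closure of $C_c^\infty(\Omega)$ in $L^2(\mathbb R^n)$, and $H^{-s}(\Omega)$ is the dual of $\widetilde H^s(\Omega)$. Let $$X=W^{1,\infty}(0,T;\widetilde H^s(\Omega))\cap W^{2,\infty}(0,T;\widetilde L^2(\Omega)),\qquad \|u\|_X=\|u\|_{W^{1,\infty}(0,T;\widetilde H^s(\Omega))}+\|\partial_t^2u\|_{L^\infty(0,T;L^2(\Omega))},$$ where $\|u\|_{W^{1,\infty}(0,T;\widetilde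 H^s(\Omega))}=\max\big(\|u\|_{L^\infty(0,T;\widetilde H^s(\Omega))},\|\partial_tu\|_{L^\infty(0,T;\widetilde H^s(\Omega))}\big)$, and $X_\delta=\{u\in X:\|u\|_X\le\delta\}$. Data are quadruples $(u_0,u_1,u_2,F)\in\widetilde H^s(\Omega)\times\widetilde H^s(\Omega)\times\widetilde L^2(\Omega)\times L^2(0,T;\widetilde L^2(\Omega))$, with $$N(u_0,u_1,u_2,F)=\|(-\Delta)^{s/2}u_0\|_{L^2(\mathbb R^n)}+\|(-\Delta)^{s/2}u_1\|_{L^2(\mathbb R^n)}+\|u_2\|_{L^2(\Omega)}+\|F\|_{L^2(\Omega_T)}.$$ Let $q\in L^\infty(0,T;L^p(\Omega))$, where $2\le p\le\infty$, $p\ge n/s$ if $2s<n$, and $p>2$ if $2s=n$. Consider the problem $$(\partial_t^3+\alpha\partial_t^2+b(-\Delta)^s\partial_t+c(-\Delta)^s+q)u+f(u)=F\text{ in }\Omega_T,\quad u=0\text{ in }(\Omega_e)_T,\quad u(0)=u_0,\ \partial_tu(0)=u_1,\ \partial_t^2u(0)=u_2\text{ in }\Omega, \tag{P}$$ with $f(u)(x,t)=f(x,t,u(x,t))$.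 A (weak) solution is a $u\in X$ with $u(0)=u_0$, $\partial_tu(0)=u_1$ such that for all $\varphi\in C_c^\infty(\Omega\times[0,T))$ $$-\int_{\Omega_T}\partial_t^2u\,\partial_t\varphi+\int_0^T\Big(\alpha\langle\partial_t^2u,\varphi\rangle+b\langle(-\Delta)^{s/2}\partial_tu,(-\Delta)^{s/2}\varphi\rangle+c\langle(-\Delta)^{s/2}u,(-\Delta)^{s/2}\varphi\rangle+\langle qu,\varphi\rangle\Big)dt+\int_{\Omega_T}f(u)\varphi=\int_{\Omega_T}F\varphi+\int_\Omega u_2\varphi(0),$$ where $\langle\cdot,\cdot\rangle$ is the $L^2(\mathbb R^n)$ inner product (terms containing $q$ are integrated over $\Omega$). Theorem (Homogeneous, semilinear MGT equations). There is a constant $C_0>0$ such that, for all data, every weak solution $u$ of the linear problem ((P) with $f=0$) satisfies $\|u\|_X\le C_0N(u_0,u_1,u_2,F)$. Let $C_0>0$ be any constant with this property. Let $0<\gamma\le r<\infty$, with $r\le\frac{2s}{n-2s}$ if $2s<n$, and let $f\colon\Omega_T\times\mathbb R\to\mathbb R$ be a Carathéodory function with $f(x,t,0)=0$ for a.e. $(x,t)\in\Omega_T$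 that is differentiable in its last variable $\tau$ for a.e. $(x,t)\in\Omega_T$, such that $\partial_\tau f$ is a Carathéodory function and $|\partial_\tau f(x,t,\tau)|\lesssim|\tau|^\gamma+|\tau|^r$ for a.e. $(x,t)\in\Omega_T$ and all $\tau\in\mathbb R$. Then there are constants $\delta_0>0$ and $C>0$ such that the following holds. (i) For all $0<\delta\le\delta_0$ and all data with $N(u_0,u_1,u_2,F)\le\frac{\delta}{2C_0}$, problem (P) has a weak solution $u_\delta\in X_\delta$, it is the only weak solution in $X_\delta$, it belongs to $H^3(0,T;H^{-s}(\Omega))$, and it satisfies $$\|u_\delta\|_X\le C\Big(N(u_0,u_1,u_2,F)+\|u_\delta\|_{L^\infty(0,T;\widetilde H^s(\Omega))}^{\gamma+1}+\|u_\delta\|_{L^\infty(0,T;\widetilde H^s(\Omega))}^{r+1}\Big).$$ (ii) If $0<\delta_1\le\delta_2\le\delta_0$ and the data satisfy $N(u_0,u_1,u_2,F)\le\frac{\delta_1}{2C_0}$, then $u_{\delta_1}=u_{\delta_2}$. -/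

import Mathlib

open MeasureTheory Set Filter Topology
open scoped ENNReal NNReal ContDiff InnerProductSpace FourierTransform

noncomputable section

namespace MGT

/-! ### Fractional Sobolev spaces -/

/-- The Euclidean space `ℝⁿ`. -/
abbrev Space (n : ℕ) : Type := EuclideanSpace ℝ (Fin n)

/-- The real space `L²(ℝⁿ)`. -/
abbrev L2 (n : ℕ) : Type := Lp ℝ 2 (volume : Measure (Space n))

/-- The complex valued square integrable functions on `ℝⁿ`, as a real Hilbert space. -/
abbrev L2C (n : ℕ) : Type := Lp ℂ 2 (volume : Measure (Space n))

/-- A real valued `L²` function seen as a complex valued one. -/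
def complexify (n : ℕ) : L2 n →L[ℝ] L2C n :=
  Complex.ofRealCLM.compLpL 2 (volume : Measure (Space n))

/-- The symbol of `(-Δ)^{s/2}`. Mathlib's Fourier transform is `û(ξ) = ∫ e^{-2πi x·ξ} u(x) dx`, so
that `-Δ` corresponds to `|2πξ|²`, and `(-Δ)^{s/2}` to `|2πξ|^s`. -/
def fracSymbol {n : ℕ} (s : ℝ≥0) (ξ : Space n) : ℝ := (2 * Real.pi * ‖ξ‖) ^ (s : ℝ)

/-- `w = (-Δ)^{s/2} u`, that is `ŵ(ξ) = |2πξ|^s û(ξ)`. -/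
def IsFracLap {n : ℕ} (s : ℝ≥0) (u : L2 n) (w : L2C n) : Prop :=
  (𝓕 w : L2C n) =ᵐ[volume] fun ξ => (fracSymbol s ξ : ℂ) * (𝓕 (complexify n u) : L2C n) ξ

/-- The Hilbert space `H^s(ℝⁿ)`, `s ≥ 0`, of all real `u ∈ L²(ℝⁿ)` with `(-Δ)^{s/2} u ∈ L²(ℝⁿ)`. An
element is a pair `(u, (-Δ)^{s/2} u)` (the second entry is determined by the first), and the norm is
`(‖u‖² + ‖(-Δ)^{s/2} u‖²)^{1/2}`. -/
def Hs (n : ℕ) (s : ℝ≥0) : Submodule ℝ (WithLp 2 (L2 n × L2C n)) where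
  carrier := {p | IsFracLap s p.fst p.snd}
  zero_mem' := by
    change IsFracLap s (0 : L2 n) (0 : L2C n)
    unfold IsFracLap
    have h : (𝓕 (0 : L2C n) : L2C n) = 0 := (Lp.fourierTransformₗᵢ (Space n) ℂ).map_zero
    rw [map_zero, h]
    filter_upwards [Lp.coeFn_zero ℂ 2 (volume : Measure (Space n))] with ξ _
    simp
  add_mem' := by
    intro a b ha hb
    change IsFracLap s (a.fst + b.fst) (a.snd + b.snd)
    change IsFracLap s a.fst a.snd at ha
    change IsFracLap s b.fst b.snd at hb
    unfold IsFracLap at *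
    have h (x y : L2C n) : (𝓕 (x + y) : L2C n) = 𝓕 x + 𝓕 y :=
      (Lp.fourierTransformₗᵢ (Space n) ℂ).map_add x y
    rw [map_add, h, h]
    filter_upwards [ha, hb, Lp.coeFn_add (𝓕 a.snd : L2C n) (𝓕 b.snd : L2C n),
      Lp.coeFn_add (𝓕 (complexify n a.fst) : L2C n) (𝓕 (complexify n b.fst) : L2C n)]
      with ξ h1 h2 h3 h4
    rw [h3, h4, Pi.add_apply, Pi.add_apply, h1, h2, mul_add]
  smul_mem' := by
    intro c a ha
    change IsFracLap s (c • a.fst) (c • a.snd)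
    change IsFracLap s a.fst a.snd at ha
    unfold IsFracLap at *
    have h (x : L2C n) : (𝓕 (c • x) : L2C n) = c • (𝓕 x : L2C n) :=
      ((Lp.fourierTransformₗᵢ (Space n) ℂ).toLinearEquiv.toLinearMap.restrictScalars ℝ).map_smul c x
    rw [map_smul, h, h]
    filter_upwards [ha, Lp.coeFn_smul c (𝓕 a.snd : L2C n),
      Lp.coeFn_smul c (𝓕 (complexify n a.fst) : L2C n)] with ξ h1 h3 h4
    rw [h3, h4, Pi.smul_apply, Pi.smul_apply, h1, mul_smul_comm]

/-- `H^s(ℝⁿ)` is a closed subspace, hence complete. -/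
theorem isClosed_Hs (n : ℕ) (s : ℝ≥0) :
    IsClosed ((Hs n s : Submodule ℝ (WithLp 2 (L2 n × L2C n))) : Set (WithLp 2 (L2 n × L2C n))) := by
  rw [← isSeqClosed_iff_isClosed]
  intro p q hp hpq
  have hF : Continuous fun x : L2C n => (𝓕 x : L2C n) :=
    (Lp.fourierTransformₗᵢ (Space n) ℂ).continuous
  have h1 : Tendsto (fun k => (𝓕 (p k).snd : L2C n)) atTop (𝓝 (𝓕 q.snd)) :=
    ((hF.comp (WithLp.sndL 2 ℝ (L2 n) (L2C n)).continuous).tendsto q).comp hpq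
  have h2 : Tendsto (fun k => (𝓕 (complexify n (p k).fst) : L2C n)) atTop
      (𝓝 (𝓕 (complexify n q.fst))) :=
    ((hF.comp ((complexify n).continuous.comp
      (WithLp.fstL 2 ℝ (L2 n) (L2C n)).continuous)).tendsto q).comp hpq
  obtain ⟨ns, hns, h3⟩ := (tendstoInMeasure_of_tendsto_Lp h1).exists_seq_tendsto_ae
  obtain ⟨ms, hms, h4⟩ :=
    (tendstoInMeasure_of_tendsto_Lp (h2.comp hns.tendsto_atTop)).exists_seq_tendsto_ae
  change IsFracLap s q.fst q.snd
  have hall : ∀ᵐ ξ ∂(volume : Measure (Space n)), ∀ k, (𝓕 (p k).snd : L2C n) ξ =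
      (fracSymbol s ξ : ℂ) * (𝓕 (complexify n (p k).fst) : L2C n) ξ :=
    ae_all_iff.2 fun k => hp k
  unfold IsFracLap
  filter_upwards [h3, h4, hall] with ξ h5 h6 h7
  refine tendsto_nhds_unique (h5.comp hms.tendsto_atTop) ?_
  refine (h6.const_mul (fracSymbol s ξ : ℂ)).congr fun k => ?_
  exact (h7 _).symm

instance instCompleteSpaceHs (n : ℕ) (s : ℝ≥0) : CompleteSpace ↥(Hs n s) :=
  (isClosed_Hs n s).completeSpace_coe

/-- `φ ∈ C_c^∞(Ω)`. -/
def IsTest {n : ℕ} (Ω : Set (Space n)) (φ : Space n → ℝ) : Prop :=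
  ContDiff ℝ ∞ φ ∧ HasCompactSupport φ ∧ tsupport φ ⊆ Ω

theorem IsTest.zero {n : ℕ} {Ω : Set (Space n)} : IsTest Ω (0 : Space n → ℝ) :=
  ⟨contDiff_const, HasCompactSupport.zero, by
    rw [tsupport_eq_empty_iff.2 rfl]; exact empty_subset _⟩

theorem IsTest.add {n : ℕ} {Ω : Set (Space n)} {φ ψ : Space n → ℝ} (hφ : IsTest Ω φ)
    (hψ : IsTest Ω ψ) : IsTest Ω (φ + ψ) :=
  ⟨hφ.1.add hψ.1, hφ.2.1.add hψ.2.1, (tsupport_add φ ψ).trans (union_subset hφ.2.2 hψ.2.2)⟩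

theorem IsTest.smul {n : ℕ} {Ω : Set (Space n)} {φ : Space n → ℝ} (c : ℝ) (hφ : IsTest Ω φ) :
    IsTest Ω (c • φ) :=
  ⟨contDiff_const.smul hφ.1, HasCompactSupport.smul_left (f := fun _ => c) hφ.2.1,
    (tsupport_smul_subset_right (fun _ => c) φ).trans hφ.2.2⟩

/-- `C_c^∞(Ω)` as a subspace of `L²(ℝⁿ)`. -/
def testL2 {n : ℕ} (Ω : Set (Space n)) : Submodule ℝ (L2 n) where
  carrier := {u | ∃ φ : Space n → ℝ, IsTest Ω φ ∧ u =ᵐ[volume] φ}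
  zero_mem' := ⟨0, IsTest.zero, Lp.coeFn_zero ℝ 2 _⟩
  add_mem' := by
    rintro a b ⟨φ, hφ, h1⟩ ⟨ψ, hψ, h2⟩
    exact ⟨φ + ψ, hφ.add hψ, (Lp.coeFn_add a b).trans (h1.add h2)⟩
  smul_mem' := by
    rintro c a ⟨φ, hφ, h1⟩
    exact ⟨c • φ, hφ.smul c, (Lp.coeFn_smul c a).trans (h1.const_smul c)⟩

/-- `H̃^s(Ω)`, the closure of `C_c^∞(Ω)` in `H^s(ℝⁿ)`. -/
def HTilde {n : ℕ} (s : ℝ≥0) (Ω : Set (Space n)) : Submodule ℝ ↥(Hs n s) :=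
  ((testL2 Ω).comap
    ((WithLp.fstL 2 ℝ (L2 n) (L2C n)).toLinearMap ∘ₗ (Hs n s).subtype)).topologicalClosure

/-- `L̃²(Ω)`, the closure of `C_c^∞(Ω)` in `L²(ℝⁿ)`. -/
def LTilde {n : ℕ} (Ω : Set (Space n)) : Submodule ℝ (L2 n) := (testL2 Ω).topologicalClosure

instance instCompleteSpaceHTilde {n : ℕ} (s : ℝ≥0) (Ω : Set (Space n)) :
    CompleteSpace ↥(HTilde s Ω) :=
  (Submodule.isClosed_topologicalClosure _).completeSpace_coe

instance instCompleteSpaceLTilde {n : ℕ} (Ω : Set (Space n)) : CompleteSpace ↥(LTilde Ω) :=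
  (Submodule.isClosed_topologicalClosure _).completeSpace_coe

/-- The embedding of `H̃^s(Ω)` into `L²(ℝⁿ)`. -/
def toL2 {n : ℕ} {s : ℝ≥0} {Ω : Set (Space n)} : ↥(HTilde s Ω) →L[ℝ] L2 n :=
  WithLp.fstL 2 ℝ (L2 n) (L2C n) ∘L (Hs n s).subtypeL ∘L (HTilde s Ω).subtypeL

/-- The map `u ↦ (-Δ)^{s/2} u` from `H̃^s(Ω)` to `L²(ℝⁿ)`. -/
def fracLap {n : ℕ} {s : ℝ≥0} {Ω : Set (Space n)} : ↥(HTilde s Ω) →L[ℝ] L2C n :=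
  WithLp.sndL 2 ℝ (L2 n) (L2C n) ∘L (Hs n s).subtypeL ∘L (HTilde s Ω).subtypeL

/-- The embedding of `L̃²(Ω)` into `H^{-s}(Ω)`, the dual space of `H̃^s(Ω)`. -/
def toDual {n : ℕ} (s : ℝ≥0) {Ω : Set (Space n)} (v : ↥(LTilde Ω)) : StrongDual ℝ ↥(HTilde s Ω) :=
  (innerSL ℝ (v : L2 n)) ∘L toL2

/-- Test functions belong to `H^s(ℝⁿ)`. -/
theorem IsTest.exists_fracLap {n : ℕ} {Ω : Set (Space n)} {φ : Space n → ℝ} (hφ : IsTest Ω φ)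
    (s : ℝ≥0) : ∃ (u : L2 n) (w : L2C n), u =ᵐ[volume] φ ∧ IsFracLap s u w := by
  have hmem : MemLp φ 2 (volume : Measure (Space n)) :=
    hφ.1.continuous.memLp_of_hasCompactSupport hφ.2.1
  have hs : HasCompactSupport fun x => (φ x : ℂ) :=
    hφ.2.1.comp_left (g := fun y : ℝ => (y : ℂ)) Complex.ofReal_zero
  have hd : ContDiff ℝ ∞ fun x => (φ x : ℂ) := Complex.ofRealCLM.contDiff.comp hφ.1
  set g : SchwartzMap (Space n) ℂ := hs.toSchwartzMap hd with hg
  have hc : complexify n (hmem.toLp φ) = g.toLp 2 := by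
    apply Lp.ext
    filter_upwards [Complex.ofRealCLM.coeFn_compLpL (p := 2) (hmem.toLp φ), hmem.coeFn_toLp,
      g.coeFn_toLp 2 volume] with x h1 h2 h3
    rw [h3, complexify, h1, h2]
    rfl
  have hF : (𝓕 (complexify n (hmem.toLp φ)) : L2C n) = (𝓕 g).toLp 2 := by
    rw [hc, SchwartzMap.toLp_fourier_eq]
  have htg : Function.HasTemperateGrowth
      fun ξ : Space n => (((1 + ‖ξ‖ ^ 2) ^ ((s : ℝ) / 2) : ℝ) : ℂ) := by fun_prop
  have hsym : Continuous fun ξ : Space n => fracSymbol s ξ := by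
    unfold fracSymbol
    exact (continuous_const.mul continuous_norm).rpow_const fun _ => Or.inr s.2
  have hw : MemLp (fun ξ : Space n => (fracSymbol s ξ : ℂ) * (𝓕 g) ξ) 2 volume := by
    refine MemLp.mono (((SchwartzMap.smulLeftCLM ℂ
      (fun ξ : Space n => (((1 + ‖ξ‖ ^ 2) ^ ((s : ℝ) / 2) : ℝ) : ℂ)) (𝓕 g)).memLp 2 volume).const_mul
      (((2 * Real.pi) ^ (s : ℝ) : ℝ) : ℂ)) ?_ ?_
    · exact ((Complex.continuous_ofReal.comp hsym).mul (𝓕 g).continuous).aestronglyMeasurable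
    · refine Eventually.of_forall fun ξ => ?_
      rw [SchwartzMap.smulLeftCLM_apply_apply htg, norm_mul, norm_mul, smul_eq_mul, norm_mul,
        ← mul_assoc]
      refine mul_le_mul_of_nonneg_right ?_ (norm_nonneg _)
      rw [Complex.norm_real, Complex.norm_real, Complex.norm_real, ← norm_mul, fracSymbol,
        Real.mul_rpow (by positivity) (norm_nonneg _)]
      rw [Real.norm_of_nonneg (by positivity), Real.norm_of_nonneg (by positivity)]
      refine mul_le_mul_of_nonneg_left ?_ (by positivity)
      calc ‖ξ‖ ^ (s : ℝ) = (‖ξ‖ ^ 2) ^ ((s : ℝ) / 2) := by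
            rw [← Real.rpow_natCast, ← Real.rpow_mul (norm_nonneg _)]; congr 1; push_cast; ring
        _ ≤ _ := Real.rpow_le_rpow (by positivity) (by linarith) (by positivity)
  refine ⟨hmem.toLp φ, 𝓕⁻ (hw.toLp _), hmem.coeFn_toLp, ?_⟩
  unfold IsFracLap
  have hinv : (𝓕 (𝓕⁻ (hw.toLp _) : L2C n) : L2C n) = hw.toLp _ :=
    (Lp.fourierTransformₗᵢ (Space n) ℂ).apply_symm_apply _
  rw [hinv, hF]
  filter_upwards [hw.coeFn_toLp, (𝓕 g).coeFn_toLp 2 volume] with ξ h1 h2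
  rw [h1, h2]

/-- A test function as an element of `H̃^s(Ω)`. -/
def IsTest.toHTilde {n : ℕ} {Ω : Set (Space n)} {φ : Space n → ℝ} (hφ : IsTest Ω φ) (s : ℝ≥0) :
    ↥(HTilde s Ω) :=
  ⟨⟨WithLp.toLp 2 ((hφ.exists_fracLap s).choose, (hφ.exists_fracLap s).choose_spec.choose),
      (hφ.exists_fracLap s).choose_spec.choose_spec.2⟩,
    Submodule.le_topologicalClosure _
      ⟨φ, hφ, (hφ.exists_fracLap s).choose_spec.choose_spec.1⟩⟩

theorem IsTest.toL2_toHTilde {n : ℕ} {Ω : Set (Space n)} {φ : Space n → ℝ} (hφ : IsTest Ω φ)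
    (s : ℝ≥0) : toL2 (hφ.toHTilde s) =ᵐ[volume] φ :=
  (hφ.exists_fracLap s).choose_spec.choose_spec.1

/-! ### Domains -/

/-- A bounded Lipschitz domain: a bounded, connected, nonempty open set which near each of its
boundary points is, in suitable Cartesian coordinates with last coordinate direction `e`, the region
strictly above the graph of a Lipschitz function `g` of the remaining coordinates. -/
def IsBoundedLipschitzDomain {n : ℕ} (Ω : Set (Space n)) : Prop :=
  IsOpen Ω ∧ IsConnected Ω ∧ Bornology.IsBounded Ω ∧
    ∀ x ∈ frontier Ω, ∃ (ρ : ℝ) (e : Space n) (K : ℝ≥0) (g : Space n → ℝ), 0 < ρ ∧ ‖e‖ = 1 ∧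
      LipschitzWith K g ∧
      ∀ y ∈ Metric.ball x ρ, (y ∈ Ω ↔ g (y - ⟪e, y⟫_ℝ • e) < ⟪e, y⟫_ℝ)

/-- The space-time cylinder `Ω_T = Ω × (0,T)`. -/
def cylinder {n : ℕ} (Ω : Set (Space n)) (T : ℝ) : Set (Space n × ℝ) := Ω ×ˢ Ioo 0 T

/-- Lebesgue measure on `(0,T)`. -/
abbrev timeMeasure (T : ℝ) : Measure ℝ := volume.restrict (Ioo 0 T)

/-! ### Time dependent functions

Elements of `L^p(0,T;X)` are functions `u : ℝ → X` with `MemLp u p (timeMeasure T)`, considered up to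
equality almost everywhere in `(0,T)`. -/

section Time

variable {X : Type*} [NormedAddCommGroup X] [NormedSpace ℝ X]

/-- `v` is the weak derivative of `u` on `(0,T)`. -/
def HasWeakDeriv (T : ℝ) (u v : ℝ → X) : Prop :=
  ∀ η : ℝ → ℝ, ContDiff ℝ ∞ η → HasCompactSupport η → tsupport η ⊆ Ioo 0 T →
    ∫ t in Ioo 0 T, deriv η t • u t = -∫ t in Ioo 0 T, η t • v t

/-- The continuous representative of `u` on `[0,T]` exists and has the value `x` at `t = 0`. -/
def HasInitialValue (T : ℝ) (u : ℝ → X) (x : X) : Prop :=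
  ∃ v : ℝ → X, ContinuousOn v (Icc 0 T) ∧ v =ᵐ[timeMeasure T] u ∧ v 0 = x

/-- The norm of `L^p(0,T;X)`. -/
def timeNorm (T : ℝ) (p : ℝ≥0∞) (u : ℝ → X) : ℝ := (eLpNorm u p (timeMeasure T)).toReal

end Time

/-- An element `u` of `X = W^{1,∞}(0,T;H̃^s(Ω)) ∩ W^{2,∞}(0,T;L̃²(Ω))` together with (representatives
of) its weak derivatives `dt = ∂_t u` and `dtt = ∂_t² u`, which are determined almost everywhere by
`u`. -/
structure EnergyFun {n : ℕ} (s : ℝ≥0) (Ω : Set (Space n)) (T : ℝ) where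
  toFun : ℝ → ↥(HTilde s Ω)
  dt : ℝ → ↥(HTilde s Ω)
  dtt : ℝ → ↥(LTilde Ω)
  memLp : MemLp toFun ∞ (timeMeasure T)
  memLp_dt : MemLp dt ∞ (timeMeasure T)
  memLp_dtt : MemLp dtt ∞ (timeMeasure T)
  hasWeakDeriv : HasWeakDeriv T toFun dt
  hasWeakDeriv_dt : HasWeakDeriv T (fun t => toL2 (dt t)) (fun t => (dtt t : L2 n))

/-- The norm of `L^∞(0,T;H̃^s(Ω))`, where `H̃^s(Ω)` carries the norm `‖(-Δ)^{s/2} u‖_{L²(ℝⁿ)}`. -/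
def supNorm {n : ℕ} {s : ℝ≥0} {Ω : Set (Space n)} (T : ℝ) (u : ℝ → ↥(HTilde s Ω)) : ℝ :=
  timeNorm T ∞ fun t => fracLap (u t)

/-- `‖u‖_X = ‖u‖_{W^{1,∞}(0,T;H̃^s(Ω))} + ‖∂_t² u‖_{L^∞(0,T;L²(Ω))}`. -/
def EnergyFun.norm {n : ℕ} {s : ℝ≥0} {Ω : Set (Space n)} {T : ℝ} (u : EnergyFun s Ω T) : ℝ :=
  max (supNorm T u.toFun) (supNorm T u.dt) + timeNorm T ∞ u.dtt

/-- `∂_t³ u ∈ L²(0,T;H^{-s}(Ω))`. For `u ∈ X` this says that `u ∈ H³(0,T;H^{-s}(Ω))`. -/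
def EnergyFun.MemH3 {n : ℕ} {s : ℝ≥0} {Ω : Set (Space n)} {T : ℝ} (u : EnergyFun s Ω T) : Prop :=
  ∃ w : ℝ → StrongDual ℝ ↥(HTilde s Ω), MemLp w 2 (timeMeasure T) ∧
    HasWeakDeriv T (fun t => toDual s (u.dtt t)) w

/-- Two elements of `X` coincide: `u(t) = v(t)` for almost every `t ∈ (0,T)`. -/
def EnergyFun.Same {n : ℕ} {s : ℝ≥0} {Ω : Set (Space n)} {T : ℝ} (u v : EnergyFun s Ω T) : Prop :=
  u.toFun =ᵐ[timeMeasure T] v.toFun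

/-! ### Coefficients -/

/-- The integrability exponent `p ∈ [2,∞]` of the potential is admissible. -/
def AdmissiblePotentialExponent (n : ℕ) (s : ℝ≥0) (p : ℝ≥0∞) : Prop :=
  2 ≤ p ∧ (2 * (s : ℝ) < n → ENNReal.ofReal (n / s) ≤ p) ∧ (2 * (s : ℝ) = n → 2 < p)

/-- The growth exponent `r` is admissible. -/
def AdmissibleGrowthExponent (n : ℕ) (s : ℝ≥0) (r : ℝ) : Prop :=
  0 < r ∧ (2 * (s : ℝ) < n → r ≤ 2 * s / (n - 2 * s))

/-- `q ∈ L^∞(0,T;L^p(Ω))`, for a real function `q` on `Ω_T`. -/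
def IsPotential {n : ℕ} (Ω : Set (Space n)) (T : ℝ) (p : ℝ≥0∞) (q : Space n × ℝ → ℝ) : Prop :=
  AEStronglyMeasurable q (volume.restrict (cylinder Ω T)) ∧
    ∃ M : ℝ≥0, ∀ᵐ t ∂(timeMeasure T), eLpNorm (fun x => q (x, t)) p (volume.restrict Ω) ≤ M

/-- `f : Ω_T × ℝ → ℝ` is a Carathéodory function (measurability is Lebesgue measurability). -/
def IsCaratheodory {n : ℕ} (Ω : Set (Space n)) (T : ℝ) (f : Space n × ℝ → ℝ → ℝ) : Prop :=
  (∀ᵐ z ∂(volume.restrict (cylinder Ω T)), Continuous (f z)) ∧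
    ∀ τ : ℝ, AEMeasurable (fun z => f z τ) (volume.restrict (cylinder Ω T))

/-- `f` is a Carathéodory function with `f(0) = 0`, differentiable in the last variable, `∂_τ f` is a
Carathéodory function, and `|∂_τ f(x,t,τ)| ≤ C (|τ|^γ + |τ|^r)`. -/
def IsNonlinearity {n : ℕ} (Ω : Set (Space n)) (T γ r : ℝ) (f : Space n × ℝ → ℝ → ℝ) : Prop :=
  IsCaratheodory Ω T f ∧
    (∀ᵐ z ∂(volume.restrict (cylinder Ω T)), f z 0 = 0) ∧
    (∀ᵐ z ∂(volume.restrict (cylinder Ω T)), Differentiable ℝ (f z)) ∧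
    IsCaratheodory Ω T (fun z τ => deriv (f z) τ) ∧
    ∃ C : ℝ, ∀ᵐ z ∂(volume.restrict (cylinder Ω T)), ∀ τ : ℝ,
      |deriv (f z) τ| ≤ C * (|τ| ^ γ + |τ| ^ r)

/-! ### Weak solutions -/

/-- A test function in `C_c^∞(Ω × [0,T))`. -/
structure SpaceTimeTest {n : ℕ} (Ω : Set (Space n)) (T : ℝ) where
  toFun : Space n × ℝ → ℝ
  contDiff : ContDiff ℝ ∞ toFun
  hasCompactSupport : HasCompactSupport toFun
  tsupport_subset : tsupport toFun ⊆ Ω ×ˢ Iio T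

theorem SpaceTimeTest.isTest {n : ℕ} {Ω : Set (Space n)} {T : ℝ} (φ : SpaceTimeTest Ω T) (t : ℝ) :
    IsTest Ω fun x => φ.toFun (x, t) := by
  have hcl : IsClosed {x : Space n | (x, t) ∈ tsupport φ.toFun} :=
    (isClosed_tsupport _).preimage (Continuous.prodMk_left t)
  have hsub : tsupport (fun x => φ.toFun (x, t)) ⊆ {x : Space n | (x, t) ∈ tsupport φ.toFun} :=
    closure_minimal (fun x hx => subset_tsupport _ hx) hcl
  refine ⟨φ.contDiff.comp (contDiff_prodMk_left t), ?_, fun x hx => (φ.tsupport_subset (hsub hx)).1⟩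
  refine (φ.hasCompactSupport.isCompact.image continuous_fst).of_isClosed_subset
    (isClosed_tsupport _) fun x hx => ⟨(x, t), hsub hx, rfl⟩

/-- The function `φ(t)` as an element of `H̃^s(Ω)`. -/
def SpaceTimeTest.slice {n : ℕ} (s : ℝ≥0) {Ω : Set (Space n)} {T : ℝ} (φ : SpaceTimeTest Ω T)
    (t : ℝ) : ↥(HTilde s Ω) := (φ.isTest t).toHTilde s

/-- `u` is a weak solution of
`(∂_t³ + α ∂_t² + b (-Δ)^s ∂_t + c (-Δ)^s + q) u + f(u) = F` in `Ω_T`, `u = 0` in `(Ω_e)_T`,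
`u(0) = u₀`, `∂_t u(0) = u₁`, `∂_t² u(0) = u₂` in `Ω`. The duality pairing `⟨(-Δ)^s v, φ⟩` is
`⟨(-Δ)^{s/2} v, (-Δ)^{s/2} φ⟩_{L²(ℝⁿ)}`, and the exterior condition is encoded by
`u(t) ∈ H̃^s(Ω)`. For `f = 0` this is the linear equation. -/
structure IsWeakSolution {n : ℕ} {s : ℝ≥0} {Ω : Set (Space n)} {T : ℝ} (α b c : ℝ)
    (q : Space n × ℝ → ℝ) (f : Space n × ℝ → ℝ → ℝ) (u₀ u₁ : ↥(HTilde s Ω)) (u₂ : ↥(LTilde Ω))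
    (F : ℝ → ↥(LTilde Ω)) (u : EnergyFun s Ω T) : Prop where
  initial : HasInitialValue T u.toFun u₀
  initial_dt : HasInitialValue T (fun t => toL2 (u.dt t)) (toL2 u₁)
  weak : ∀ φ : SpaceTimeTest Ω T,
    -(∫ t in Ioo 0 T, ∫ x in Ω,
        (u.dtt t : L2 n) x * deriv (fun τ => φ.toFun (x, τ)) t)
      + (∫ t in Ioo 0 T,
          (α * (∫ x in Ω, (u.dtt t : L2 n) x * φ.toFun (x, t))
            + b * ⟪fracLap (u.dt t), fracLap (φ.slice s t)⟫_ℝ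
            + c * ⟪fracLap (u.toFun t), fracLap (φ.slice s t)⟫_ℝ
            + ∫ x in Ω, q (x, t) * toL2 (u.toFun t) x * φ.toFun (x, t)))
      + (∫ t in Ioo 0 T, ∫ x in Ω, f (x, t) (toL2 (u.toFun t) x) * φ.toFun (x, t))
    = (∫ t in Ioo 0 T, ∫ x in Ω, (F t : L2 n) x * φ.toFun (x, t))
      + ∫ x in Ω, (u₂ : L2 n) x * φ.toFun (x, 0)

/-- `‖(-Δ)^{s/2}u₀‖_{L²(ℝⁿ)} + ‖(-Δ)^{s/2}u₁‖_{L²(ℝⁿ)} + ‖u₂‖_{L²(Ω)} + ‖F‖_{L²(Ω_T)}`. -/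
def dataNorm {n : ℕ} {s : ℝ≥0} {Ω : Set (Space n)} (T : ℝ) (u₀ u₁ : ↥(HTilde s Ω))
    (u₂ : ↥(LTilde Ω)) (F : ℝ → ↥(LTilde Ω)) : ℝ :=
  ‖fracLap u₀‖ + ‖fracLap u₁‖ + ‖u₂‖ + timeNorm T 2 F

/-- `C₀` is a constant for the energy estimate of the linear equation (`f = 0`): weak solutions satisfy
`‖u‖_X ≤ C₀ (‖(-Δ)^{s/2}u₀‖ + ‖(-Δ)^{s/2}u₁‖ + ‖u₂‖ + ‖F‖)`. -/
def IsEnergyConstant {n : ℕ} (s : ℝ≥0) (Ω : Set (Space n)) (T α b c : ℝ) (q : Space n × ℝ → ℝ)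
    (C₀ : ℝ) : Prop :=
  ∀ (u₀ u₁ : ↥(HTilde s Ω)) (u₂ : ↥(LTilde Ω)) (F : ℝ → ↥(LTilde Ω)), MemLp F 2 (timeMeasure T) →
    ∀ u : EnergyFun s Ω T, IsWeakSolution α b c q (fun _ _ => 0) u₀ u₁ u₂ F u →
      u.norm ≤ C₀ * dataNorm T u₀ u₁ u₂ F

end MGT

end

/-!
Write `A = b(-Δ)^s` on `H̃^s(Ω)` and `κ = c / b`. The equation is
`u''' + α u'' + A u' + κ A u = F - q u - f(u)`, and `z = u' + κ u` satisfies the wave equation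
`z'' + A z = F - q u - f(u) - (α - κ) u''`. Since `u` is recovered from `z` by integration, the
third order equation is a wave equation with a perturbation of lower order.

To make this rigorous for weak solutions, everything is integrated in time and `A` is inverted. By
the Poincaré inequality (`MGT.exists_poincare`), `H̃^s(Ω)` with the scalar product
`b ⟨(-Δ)^{s/2}·, (-Δ)^{s/2}·⟩` is a Hilbert space `V`; if `j` is its embedding into `L̃²(Ω)`, then
the adjoint `j†` is the inverse of `A`. A weak solution is the same as a solution of the
integrated equation `MGT.IsThirdOrder` in `V` (`MGT.IsWeakSolution.isThirdOrder`,
`MGT.isWeakSolution_of_isThirdOrder`), by the lemma of du Bois-Reymond. For this equation the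
substitution above is exact (`MGT.IsThirdOrder.isWave`), and the wave equation, as a system in
`V × L̃²(Ω)`, has a generator with bounded skew inverse `MGT.waveInv`. Solutions of such evolution
equations are unique (`MGT.skew_unique`), and they are limits of solutions with the resolvents as
bounded generators (`MGT.exists_skew_solution`); so the energy estimate, proved for the
approximations, holds for every weak solution. Grönwall's inequality gives the constant `C₀`
(`MGT.thirdOrder_estimate`, `MGT.exists_isEnergyConstant`), and a fixed point argument for causal
maps solves the equation with a globally Lipschitz nonlinearity (`MGT.exists_thirdOrder`).

The Sobolev embeddings of `H̃^s(Ω)` (`MGT.embedsIn_of_subcritical`, from the homogeneous Sobolev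
inequality `MGT.exists_homogeneous_sobolev`) and Hölder's inequality show that `u ↦ q u` is
bounded and that `u ↦ f(u)` is locally Lipschitz from `H̃^s(Ω)` to `L²(Ω)`, with Lipschitz
constant of order `δ^γ + δ^r` on the ball with radius `δ` (`MGT.exists_potential_bound`,
`MGT.exists_nemytskii_lipschitz`). The radius `δ₀` is chosen such that the energy estimate absorbs
this constant with a factor `1/2`. Existence then follows by composing `f` with the retraction to
a ball: the solution of the modified equation satisfies `‖u‖ ≤ δ` by the energy estimate, hence it
solves the original equation (`MGT.exists_weakSolution`). The energy estimate for the difference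
of two solutions gives uniqueness (`MGT.IsWeakSolution.same`), which also contains the
independence of `δ`, and the regularity of the third derivative is read off from the equation
(`MGT.IsWeakSolution.memH3`).
-/

noncomputable section

namespace MGT

/-! ### Evolution equations with a skew-adjoint generator -/

section SkewEvolution

variable {E : Type*} [NormedAddCommGroup E] [InnerProductSpace ℝ E]

/-- A skew operator `K` with dense range is injective: its kernel is orthogonal to its range. -/
theorem skew_injective {K : E →L[ℝ] E} (hK : ∀ x, ⟪K x, x⟫_ℝ = 0) (hd : DenseRange K) {x : E}
    (hx : K x = 0) : x = 0 := by
  have h1 : ∀ y, ⟪x, K y⟫_ℝ = 0 := by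
    intro y
    have h := hK (x + y)
    rw [map_add, inner_add_left, inner_add_right, inner_add_right, hK, hK, hx, inner_zero_left,
      zero_add, zero_add, add_zero, real_inner_comm] at h
    exact h
  have h2 : ∀ z, ⟪x, z⟫_ℝ = 0 := fun z => hd.induction_on z
    (isClosed_eq (by fun_prop) continuous_const) h1
  exact inner_self_eq_zero.1 (h2 x)

/-- `K y` and `y` are orthogonal, so `‖(K - ε) y‖` controls both of them. -/
theorem skew_norm_resolvent {K : E →L[ℝ] E} (hK : ∀ x, ⟪K x, x⟫_ℝ = 0) (ε : ℝ) (y : E) :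
    ‖K y - ε • y‖ ^ 2 = ‖K y‖ ^ 2 + (ε * ‖y‖) ^ 2 := by
  rw [norm_sub_sq_real, inner_smul_right, hK, norm_smul, mul_pow, mul_pow, Real.norm_eq_abs,
    sq_abs]
  ring

/-- The energy estimate for `U' = L U + Φ` with a dissipative operator `L`; the constant does not
depend on `L`. -/
theorem dissipative_estimate {L : E →L[ℝ] E} (hL : ∀ x, ⟪L x, x⟫_ℝ ≤ 0) {U Φ : ℝ → E}
    (hΦ : Continuous Φ) (hU : ∀ t, HasDerivAt U (L (U t) + Φ t) t) {t : ℝ} (ht : 0 ≤ t) :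
    ‖U t‖ ^ 2 ≤ Real.exp t * (‖U 0‖ ^ 2 + ∫ τ in 0..t, ‖Φ τ‖ ^ 2) := by
  have hc : Continuous fun τ => ‖Φ τ‖ ^ 2 := by fun_prop
  let g : ℝ → ℝ := fun t => Real.exp (-t) * ‖U t‖ ^ 2 - ∫ τ in 0..t, ‖Φ τ‖ ^ 2
  have hg : ∀ t, HasDerivAt g ((Real.exp (-t) * (-1)) * ‖U t‖ ^ 2
      + Real.exp (-t) * (2 * ⟪U t, L (U t) + Φ t⟫_ℝ) - ‖Φ t‖ ^ 2) t := fun t =>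
    (((hasDerivAt_neg t).exp).mul (hU t).norm_sq).sub
      (intervalIntegral.integral_hasDerivAt_right (hc.intervalIntegrable _ _)
      hc.stronglyMeasurable.stronglyMeasurableAtFilter hc.continuousAt)
  have hanti : AntitoneOn g (Ici 0) := by
    refine antitoneOn_of_deriv_nonpos (convex_Ici 0)
      (fun t _ => (hg t).continuousAt.continuousWithinAt)
      (fun t _ => (hg t).differentiableAt.differentiableWithinAt) fun t ht => ?_
    rw [interior_Ici, mem_Ioi] at ht
    rw [(hg t).deriv, inner_add_right, real_inner_comm]
    have h1 := hL (U t)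
    have h2 : ⟪U t, Φ t⟫_ℝ ≤ ‖U t‖ * ‖Φ t‖ := real_inner_le_norm _ _
    have h3 : Real.exp (-t) ≤ 1 := Real.exp_le_one_iff.2 (by linarith)
    have h4 : 0 < Real.exp (-t) := Real.exp_pos _
    have h5 : 2 * (‖U t‖ * ‖Φ t‖) ≤ ‖U t‖ ^ 2 + ‖Φ t‖ ^ 2 := by
      nlinarith [sq_nonneg (‖U t‖ - ‖Φ t‖)]
    have h6 : Real.exp (-t) * (2 * (⟪L (U t), U t⟫_ℝ + ⟪U t, Φ t⟫_ℝ))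
        ≤ Real.exp (-t) * (‖U t‖ ^ 2 + ‖Φ t‖ ^ 2) :=
      mul_le_mul_of_nonneg_left (by linarith) h4.le
    have h7 : Real.exp (-t) * ‖Φ t‖ ^ 2 ≤ ‖Φ t‖ ^ 2 := mul_le_of_le_one_left (sq_nonneg _) h3
    linarith
  have h0 := hanti (mem_Ici.2 le_rfl) (mem_Ici.2 ht) ht
  simp only [g, neg_zero, Real.exp_zero, intervalIntegral.integral_same, one_mul, sub_zero] at h0
  have h1 : Real.exp (-t) * ‖U t‖ ^ 2 ≤ ‖U 0‖ ^ 2 + ∫ τ in 0..t, ‖Φ τ‖ ^ 2 := by linarith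
  calc ‖U t‖ ^ 2 = Real.exp t * (Real.exp (-t) * ‖U t‖ ^ 2) := by
        rw [← mul_assoc, ← Real.exp_add]; simp
    _ ≤ _ := mul_le_mul_of_nonneg_left h1 (Real.exp_pos _).le

variable [CompleteSpace E]

/-- The resolvent `(K - ε)⁻¹` of a skew operator, by the Lax–Milgram theorem. -/
theorem exists_skew_resolvent {K : E →L[ℝ] E} (hK : ∀ x, ⟪K x, x⟫_ℝ = 0) {ε : ℝ} (hε : 0 < ε) :
    ∃ L : E →L[ℝ] E, (∀ x, K (L x) - ε • L x = x) ∧ ∀ x, L (K x) - ε • L x = x := by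
  let B : E →L[ℝ] E →L[ℝ] ℝ := (innerSL ℝ).comp (ε • ContinuousLinearMap.id ℝ E - K)
  have hB : IsCoercive B := by
    refine ⟨ε, hε, fun u => ?_⟩
    have : B u u = ⟪ε • u - K u, u⟫_ℝ := rfl
    rw [this, inner_sub_left, hK, inner_smul_left, real_inner_self_eq_norm_sq, conj_trivial]
    apply le_of_eq; ring
  have h1 : ∀ v, hB.continuousLinearEquivOfBilin v = ε • v - K v := by
    intro v
    refine ext_inner_right ℝ fun w => ?_
    rw [hB.continuousLinearEquivOfBilin_apply]
    rfl
  refine ⟨-(hB.continuousLinearEquivOfBilin.symm : E →L[ℝ] E), fun x => ?_, fun x => ?_⟩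
  · have := h1 (hB.continuousLinearEquivOfBilin.symm x)
    rw [ContinuousLinearEquiv.apply_symm_apply] at this
    simp only [neg_apply, ContinuousLinearEquiv.coe_coe, map_neg, smul_neg]
    rw [sub_neg_eq_add, neg_add_eq_sub, ← this]
  · have h2 : hB.continuousLinearEquivOfBilin.symm (ε • x - K x) = x := by
      rw [← h1, ContinuousLinearEquiv.symm_apply_apply]
    simp only [neg_apply, ContinuousLinearEquiv.coe_coe, smul_neg]
    rw [map_sub, map_smul] at h2
    rw [sub_neg_eq_add, neg_add_eq_sub, h2]

/-- Uniqueness for the integrated equation `K W = ∫ W` of a skew operator. With `Y = ∫₀ᵗ W` and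
`Z = ∫₀ᵗ Y` one has `K Y = Z = ∫₀ᵗ Y`, so that `(‖Z‖²)' = 2 ⟪Z, Y⟫ = 2 ⟪K Y, Y⟫ = 0`; the two
integrations make room for `W` that is merely integrable. -/
theorem skew_unique {K : E →L[ℝ] E} (hK : ∀ x, ⟪K x, x⟫_ℝ = 0) (hd : DenseRange K) {T : ℝ}
    {W : ℝ → E} (hW : IntegrableOn W (Ioo 0 T))
    (h : ∀ᵐ t ∂timeMeasure T, K (W t) = ∫ τ in 0..t, W τ) : W =ᵐ[timeMeasure T] 0 := by
  set W' : ℝ → E := (Ioo 0 T).indicator W with hW'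
  have hWi : Integrable W' := hW.integrable_indicator measurableSet_Ioo
  have hcongr : ∀ t ∈ Icc 0 T, ∫ τ in 0..t, W τ = ∫ τ in 0..t, W' τ := by
    intro t ht
    rw [intervalIntegral.integral_of_le ht.1, intervalIntegral.integral_of_le ht.1,
      integral_Ioc_eq_integral_Ioo, integral_Ioc_eq_integral_Ioo]
    refine setIntegral_congr_fun measurableSet_Ioo fun x hx => ?_
    rw [hW', indicator_of_mem (show x ∈ Ioo 0 T from ⟨hx.1, hx.2.trans_le ht.2⟩)]
  set Y : ℝ → E := fun t => ∫ τ in 0..t, W' τ with hY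
  have hYc : Continuous Y := intervalIntegral.continuous_primitive (fun a b => hWi.intervalIntegrable) 0
  set Z : ℝ → E := fun t => ∫ τ in 0..t, Y τ with hZ
  have hZd : ∀ t, HasDerivAt Z (Y t) t := fun t =>
    intervalIntegral.integral_hasDerivAt_right (hYc.intervalIntegrable _ _)
      hYc.stronglyMeasurable.stronglyMeasurableAtFilter hYc.continuousAt
  have hKY : ∀ t ∈ Icc 0 T, K (Y t) = Z t := by
    intro t ht
    rw [hY, hZ]
    simp only
    rw [← K.intervalIntegral_comp_comm hWi.intervalIntegrable]
    rw [intervalIntegral.integral_of_le ht.1, intervalIntegral.integral_of_le ht.1,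
      integral_Ioc_eq_integral_Ioo, integral_Ioc_eq_integral_Ioo]
    refine integral_congr_ae ?_
    have h' := ae_restrict_of_ae_restrict_of_subset (Ioo_subset_Ioo_right ht.2) h
    filter_upwards [h', ae_restrict_mem measurableSet_Ioo] with x hx hxm
    rw [hW', indicator_of_mem (show x ∈ Ioo 0 T from ⟨hxm.1, hxm.2.trans_le ht.2⟩), hx,
      hcongr x ⟨hxm.1.le, (hxm.2.trans_le ht.2).le⟩]
  have hn : ∀ t ∈ Icc 0 T, ‖Z t‖ ^ 2 = ‖Z 0‖ ^ 2 := by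
    refine constant_of_has_deriv_right_zero (f := fun t => ‖Z t‖ ^ 2) ?_ ?_
    · exact ((continuous_iff_continuousAt.2 fun t => (hZd t).continuousAt).norm.pow 2).continuousOn
    · intro t ht
      have := ((hZd t).norm_sq).hasDerivWithinAt (s := Ici t)
      rwa [← hKY t (Ico_subset_Icc_self ht), hK, mul_zero] at this
  have hZ0 : Z 0 = 0 := by simp [hZ]
  have hZ' : ∀ t ∈ Icc 0 T, Z t = 0 := by
    intro t ht
    have := hn t ht
    rw [hZ0, norm_zero] at this
    simpa using this
  filter_upwards [h, ae_restrict_mem measurableSet_Ioo] with t ht htm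
  have hmem : t ∈ Icc 0 T := Ioo_subset_Icc_self htm
  refine skew_injective hK hd ?_
  rw [ht, hcongr t hmem]
  exact skew_injective hK hd ((hKY t hmem).trans (hZ' t hmem))

/-- Duhamel's formula for a bounded generator. -/
theorem exists_linear_ode (L : E →L[ℝ] E) (x₀ : E) {Φ : ℝ → E} (hΦ : Continuous Φ) :
    ∃ U : ℝ → E, U 0 = x₀ ∧ ∀ t, HasDerivAt U (L (U t) + Φ t) t := by
  let e : ℝ → E →L[ℝ] E := fun t => NormedSpace.exp (t • L)
  have he : ∀ t, HasDerivAt e (L * e t) t := fun t => hasDerivAt_exp_smul_const' L t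
  have hec : Continuous e := continuous_iff_continuousAt.2 fun t => (he t).continuousAt
  have hcont : Continuous fun τ => e (-τ) (Φ τ) := (hec.comp continuous_neg).clm_apply hΦ
  let I : ℝ → E := fun t => x₀ + ∫ τ in 0..t, e (-τ) (Φ τ)
  have hI : ∀ t, HasDerivAt I (e (-t) (Φ t)) t := fun t =>
    (intervalIntegral.integral_hasDerivAt_right (hcont.intervalIntegrable _ _)
      hcont.stronglyMeasurable.stronglyMeasurableAtFilter hcont.continuousAt).const_add x₀
  refine ⟨fun t => e t (I t), ?_, fun t => ?_⟩
  · simp [e, I]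
  · have := (he t).clm_apply (hI t)
    convert this using 1
    have h1 : e t * e (-t) = 1 := by
      let _ : NormedAlgebra ℚ (E →L[ℝ] E) := NormedAlgebra.restrictScalars ℚ ℝ _
      simp only [e]
      rw [← NormedSpace.exp_add_of_commute]
      · simp
      · exact ((Commute.refl L).smul_left t).smul_right (-t)
    have h2 : e t (e (-t) (Φ t)) = Φ t := by
      rw [← mul_apply_eq_comp, h1]; rfl
    rw [h2]; rfl

end SkewEvolution

/-! ### Existence for skew evolution equations -/

section SkewExistence

/-- `‖g‖²_{L²} = ∫ ‖g‖²`. -/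
theorem integral_norm_sq_eq {α F : Type*} [MeasurableSpace α] {μ : Measure α}
    [NormedAddCommGroup F] {g : α → F} (hg : MemLp g 2 μ) :
    ∫ a, ‖g a‖ ^ 2 ∂μ = (eLpNorm g 2 μ).toReal ^ 2 := by
  have h0 : 0 ≤ ∫ a, ‖g a‖ ^ 2 ∂μ := integral_nonneg fun _ => sq_nonneg _
  rw [hg.eLpNorm_eq_integral_rpow_norm (by norm_num) (by norm_num)]
  simp only [ENNReal.toReal_ofNat, Real.rpow_ofNat]
  rw [ENNReal.toReal_ofReal (Real.rpow_nonneg h0 _), ← Real.rpow_natCast, ← Real.rpow_mul h0]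
  norm_num

theorem intervalIntegral_eq_integral_timeMeasure {F : Type*} [NormedAddCommGroup F]
    [NormedSpace ℝ F] {T : ℝ} (hT : 0 ≤ T) (g : ℝ → F) :
    ∫ τ in 0..T, g τ = ∫ τ in Ioo 0 T, g τ := by
  rw [intervalIntegral.integral_of_le hT, integral_Ioc_eq_integral_Ioo]

theorem intervalIntegrable_of_timeMeasure {F : Type*} [NormedAddCommGroup F] {T : ℝ} {g : ℝ → F}
    (hg : Integrable g (timeMeasure T)) {t : ℝ} (ht : t ∈ Icc 0 T) :
    IntervalIntegrable g volume 0 t := by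
  rw [intervalIntegrable_iff_integrableOn_Ioo_of_le ht.1]
  exact IntegrableOn.mono_set hg (Ioo_subset_Ioo_right ht.2)

theorem intervalIntegral_congr_timeMeasure {F : Type*} [NormedAddCommGroup F] [NormedSpace ℝ F]
    {T : ℝ} {g h : ℝ → F} (hgh : g =ᵐ[timeMeasure T] h) {t : ℝ} (ht : t ∈ Icc 0 T) :
    ∫ τ in 0..t, g τ = ∫ τ in 0..t, h τ := by
  rw [intervalIntegral_eq_integral_timeMeasure ht.1, intervalIntegral_eq_integral_timeMeasure ht.1]
  exact integral_congr_ae (ae_restrict_of_ae_restrict_of_subset (Ioo_subset_Ioo_right ht.2) hgh)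

theorem intervalIntegral_le_timeMeasure {T : ℝ} {g : ℝ → ℝ} (hg : Integrable g (timeMeasure T))
    (h0 : ∀ t, 0 ≤ g t) {t : ℝ} (ht : t ∈ Icc 0 T) :
    ∫ τ in 0..t, g τ ≤ ∫ τ in Ioo 0 T, g τ := by
  rw [intervalIntegral_eq_integral_timeMeasure ht.1]
  exact setIntegral_mono_set hg (Eventually.of_forall h0) (Ioo_subset_Ioo_right ht.2).eventuallyLE

theorem memLp_timeMeasure_mono {F : Type*} [NormedAddCommGroup F] {T t : ℝ} {p : ℝ≥0∞}
    {g : ℝ → F} (hg : MemLp g p (timeMeasure T)) (ht : t ≤ T) : MemLp g p (timeMeasure t) :=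
  hg.mono_measure (Measure.restrict_mono (Ioo_subset_Ioo_right ht) le_rfl)

theorem integrable_norm_sq_of_memLp {α F : Type*} [MeasurableSpace α] {μ : Measure α}
    [NormedAddCommGroup F] {g : α → F} (hg : MemLp g 2 μ) : Integrable (fun a => ‖g a‖ ^ 2) μ :=
  hg.integrable_norm_pow (p := 2) (by norm_num)

theorem _root_.Continuous.memLp_timeMeasure {F : Type*} [NormedAddCommGroup F] {g : ℝ → F}
    (hg : Continuous g) (T : ℝ) (p : ℝ≥0∞) : MemLp g p (timeMeasure T) := by
  obtain ⟨C, hC⟩ := isCompact_Icc.exists_bound_of_continuousOn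
    (hg.continuousOn (s := Icc 0 T))
  refine MemLp.of_bound hg.aestronglyMeasurable C ?_
  filter_upwards [ae_restrict_mem measurableSet_Ioo] with t ht
  exact hC t (Ioo_subset_Icc_self ht)

theorem _root_.Continuous.integrable_timeMeasure {F : Type*} [NormedAddCommGroup F] {g : ℝ → F}
    (hg : Continuous g) (T : ℝ) : Integrable g (timeMeasure T) :=
  (hg.memLp_timeMeasure T 1).integrable le_rfl

variable {E : Type*} [NormedAddCommGroup E]

/-- A uniformly Cauchy sequence of continuous curves on `[0,T]` has a continuous limit. -/
theorem exists_uniform_limit [CompleteSpace E] {T : ℝ} (hT : 0 ≤ T) {u : ℕ → ℝ → E}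
    (hu : ∀ k, Continuous (u k)) {b : ℕ → ℝ} (hb : Tendsto b atTop (𝓝 0)) (hb0 : ∀ N, 0 ≤ b N)
    (h : ∀ n m N, N ≤ n → N ≤ m → ∀ t ∈ Icc 0 T, ‖u n t - u m t‖ ≤ b N) :
    ∃ U : ℝ → E, Continuous U ∧ ∀ k, ∀ t ∈ Icc 0 T, ‖u k t - U t‖ ≤ b k := by
  let v : ℕ → C(Icc 0 T, E) := fun k => ⟨fun t => u k t, (hu k).comp continuous_subtype_val⟩
  have hd : ∀ n m N, N ≤ n → N ≤ m → dist (v n) (v m) ≤ b N := fun n m N hn hm =>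
    (ContinuousMap.dist_le (hb0 N)).2 fun t => by
      rw [dist_eq_norm]; exact h n m N hn hm t t.2
  have hc : CauchySeq v := cauchySeq_of_le_tendsto_0 b hd hb
  obtain ⟨w, hw⟩ := cauchySeq_tendsto_of_complete hc
  refine ⟨IccExtend hT w, w.continuous.Icc_extend', fun k t ht => ?_⟩
  have h1 : dist (v k) w ≤ b k := by
    refine le_of_tendsto (tendsto_const_nhds.dist hw) ?_
    filter_upwards [eventually_ge_atTop k] with m hm
    exact hd k m k le_rfl hm
  rw [IccExtend_of_mem hT _ ht, ← dist_eq_norm]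
  exact (ContinuousMap.dist_apply_le_dist (f := v k) (g := w) ⟨t, ht⟩).trans h1

theorem tendsto_intervalIntegral_of_uniform [NormedSpace ℝ E] [CompleteSpace E] {T : ℝ}
    {u : ℕ → ℝ → E} {U : ℝ → E} (hu : ∀ k, Continuous (u k)) (hU : Continuous U)
    {b : ℕ → ℝ} (hb : Tendsto b atTop (𝓝 0))
    (h : ∀ k, ∀ t ∈ Icc 0 T, ‖u k t - U t‖ ≤ b k) {t : ℝ} (ht : t ∈ Icc 0 T) :
    Tendsto (fun k => ∫ τ in 0..t, u k τ) atTop (𝓝 (∫ τ in 0..t, U τ)) := by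
  rw [tendsto_iff_norm_sub_tendsto_zero]
  have hb' : Tendsto (fun k => b k * |t - 0|) atTop (𝓝 0) := by simpa using hb.mul_const |t - 0|
  refine squeeze_zero (fun _ => norm_nonneg _) (fun k => ?_) hb'
  rw [← intervalIntegral.integral_sub ((hu k).intervalIntegrable _ _) (hU.intervalIntegrable _ _)]
  refine intervalIntegral.norm_integral_le_of_norm_le_const fun x hx => h k x ?_
  rw [uIoc_of_le ht.1] at hx
  exact ⟨hx.1.le, hx.2.trans ht.2⟩

variable [InnerProductSpace ℝ E]

/-- The resolvents `L k = (K - εₖ)⁻¹` of `K` along a decreasing sequence `εₖ → 0` of positive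
numbers: dissipative bounded approximations of the unbounded generator `K⁻¹`. -/
structure SkewResolvents (K : E →L[ℝ] E) where
  L : ℕ → E →L[ℝ] E
  ε : ℕ → ℝ
  ε_pos : ∀ k, 0 < ε k
  ε_anti : Antitone ε
  ε_tendsto : Tendsto ε atTop (𝓝 0)
  right_inv : ∀ k x, K (L k x) - ε k • L k x = x
  left_inv : ∀ k x, L k (K x) - ε k • L k x = x

theorem exists_skewResolvents [CompleteSpace E] {K : E →L[ℝ] E} (hK : ∀ x, ⟪K x, x⟫_ℝ = 0) :
    Nonempty (SkewResolvents K) := by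
  have h : ∀ k : ℕ, (0 : ℝ) < 1 / ((k : ℝ) + 1) := fun k => by positivity
  choose L h1 h2 using fun k : ℕ => exists_skew_resolvent hK (h k)
  refine ⟨⟨L, fun k => 1 / ((k : ℝ) + 1), h, fun a b hab => ?_,
    tendsto_one_div_add_atTop_nhds_zero_nat, h1, h2⟩⟩
  have : (a : ℝ) ≤ b := by exact_mod_cast hab
  exact one_div_le_one_div_of_le (by positivity) (by linarith)

namespace SkewResolvents

variable {K : E →L[ℝ] E} (R : SkewResolvents K)

theorem comm (k : ℕ) (x : E) : R.L k (K x) = K (R.L k x) := by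
  rw [← sub_left_inj (a := R.ε k • R.L k x), R.left_inv, R.right_inv]

theorem resolvent_identity (k l : ℕ) (x : E) :
    R.L k x - R.L l x = (R.ε k - R.ε l) • R.L k (R.L l x) := by
  have h := R.left_inv k (R.L l x)
  have h1 : R.L k x = R.L k (K (R.L l x)) - R.ε l • R.L k (R.L l x) := by
    rw [← map_smul, ← map_sub, R.right_inv]
  rw [h1, sub_smul, sub_eq_iff_eq_add.1 h]
  abel

theorem norm_sq (hK : ∀ x, ⟪K x, x⟫_ℝ = 0) (k : ℕ) (x : E) :
    ‖x‖ ^ 2 = ‖K (R.L k x)‖ ^ 2 + (R.ε k * ‖R.L k x‖) ^ 2 := by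
  rw [← skew_norm_resolvent hK, R.right_inv]

theorem norm_K_L_le (hK : ∀ x, ⟪K x, x⟫_ℝ = 0) (k : ℕ) (x : E) : ‖K (R.L k x)‖ ≤ ‖x‖ := by
  refine (sq_le_sq₀ (norm_nonneg _) (norm_nonneg _)).1 ?_
  rw [R.norm_sq hK k x]
  linarith [sq_nonneg (R.ε k * ‖R.L k x‖)]

theorem dissipative (hK : ∀ x, ⟪K x, x⟫_ℝ = 0) (k : ℕ) (x : E) : ⟪R.L k x, x⟫_ℝ ≤ 0 := by
  nth_rewrite 2 [← R.right_inv k x]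
  rw [inner_sub_right, real_inner_comm, hK, inner_smul_right, real_inner_self_eq_norm_sq, zero_sub]
  have := R.ε_pos k
  have : 0 ≤ R.ε k * ‖R.L k x‖ ^ 2 := by positivity
  linarith

/-- `K (K - εₖ)⁻¹ → 1` strongly: on the range of `K` the error is at most `εₖ ‖y‖`, and the
operators are contractions. -/
theorem tendsto_K_L (hK : ∀ x, ⟪K x, x⟫_ℝ = 0) (hd : DenseRange K) (x : E) :
    Tendsto (fun k => K (R.L k x)) atTop (𝓝 x) := by
  rw [Metric.tendsto_atTop]
  intro δ hδ
  obtain ⟨y, hy⟩ := hd.exists_dist_lt x (show (0 : ℝ) < δ / 3 by positivity)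
  obtain ⟨N, hN⟩ := (Metric.tendsto_atTop.1 R.ε_tendsto) (δ / (3 * (‖y‖ + 1))) (by positivity)
  refine ⟨N, fun k hk => ?_⟩
  have h1 : K (R.L k (K y)) - K y = R.ε k • K (R.L k y) := by
    rw [R.comm, ← map_sub, ← map_smul]
    congr 1
    rw [sub_eq_iff_eq_add, ← R.right_inv k y]
    rw [R.right_inv k y, add_comm, ← sub_eq_iff_eq_add, R.right_inv]
  have h2 : ‖K (R.L k (K y)) - K y‖ ≤ R.ε k * ‖y‖ := by
    rw [h1, norm_smul, Real.norm_of_nonneg (R.ε_pos k).le]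
    exact mul_le_mul_of_nonneg_left (R.norm_K_L_le hK k y) (R.ε_pos k).le
  have h3 : ‖K (R.L k (x - K y))‖ ≤ ‖x - K y‖ := R.norm_K_L_le hK k _
  have h4 : R.ε k < δ / (3 * (‖y‖ + 1)) := by
    have := hN k hk
    rwa [Real.dist_eq, sub_zero, abs_of_pos (R.ε_pos k)] at this
  have h5 : R.ε k * ‖y‖ ≤ δ / 3 := by
    calc R.ε k * ‖y‖ ≤ δ / (3 * (‖y‖ + 1)) * (‖y‖ + 1) :=
          mul_le_mul h4.le (by linarith) (norm_nonneg _) (by positivity)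
      _ = δ / 3 := by field_simp
  rw [dist_eq_norm] at hy ⊢
  have h6 : K (R.L k x) - x = K (R.L k (x - K y)) + (K (R.L k (K y)) - K y) - (x - K y) := by
    rw [map_sub, map_sub]; abel
  rw [h6]
  calc _ ≤ ‖K (R.L k (x - K y))‖ + ‖K (R.L k (K y)) - K y‖ + ‖x - K y‖ :=
        (norm_sub_le _ _).trans (add_le_add_left (norm_add_le _ _) _)
    _ < δ := by linarith

theorem tendsto_sq (hK : ∀ x, ⟪K x, x⟫_ℝ = 0) (hd : DenseRange K) (x : E) :
    Tendsto (fun k => K (K (R.L k (R.L k x)))) atTop (𝓝 x) := by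
  have h1 := R.tendsto_K_L hK hd x
  have h2 : Tendsto (fun k => K (R.L k (K (R.L k x) - x))) atTop (𝓝 0) := by
    refine squeeze_zero_norm (fun k => R.norm_K_L_le hK k _) ?_
    have := (h1.sub_const x).norm
    simpa using this
  have h3 := h2.add h1
  rw [zero_add] at h3
  refine h3.congr fun k => ?_
  rw [map_sub, map_sub, sub_add_cancel, R.comm]

theorem norm_sq_le (hK : ∀ x, ⟪K x, x⟫_ℝ = 0) (k : ℕ) (x : E) :
    ‖K (K (R.L k (R.L k x)))‖ ≤ ‖x‖ := by
  rw [← R.comm k (R.L k x)]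
  exact (R.norm_K_L_le hK k _).trans (R.norm_K_L_le hK k _)

end SkewResolvents

/-- The equation `U' = K⁻¹ U + Φ` for data `U(0) = K² y`, `Φ = K² ψ` in the range of `K²`, in
integrated form. The solutions `u k` with generator `L k` in place of `K⁻¹` form a Cauchy sequence
with rate `εₖ`, since `L n - L m = (εₙ - εₘ) L n L m` and the operators `K L k` are contractions;
their limit is the solution. -/
theorem exists_skew_solution_smooth [CompleteSpace E] {K : E →L[ℝ] E}
    (hK : ∀ x, ⟪K x, x⟫_ℝ = 0) {T : ℝ} (hT : 0 ≤ T) (y : E) {ψ : ℝ → E} (hψ : Continuous ψ) :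
    ∃ U : ℝ → E, Continuous U ∧
      (∀ t ∈ Icc 0 T, K (U t) = K (K (K y)) + ∫ τ in 0..t, (U τ + K (K (K (ψ τ))))) ∧
      ∀ t ∈ Icc 0 T, ‖U t‖ ^ 2 ≤
        Real.exp T * (‖K (K y)‖ ^ 2 + ∫ τ in 0..t, ‖K (K (ψ τ))‖ ^ 2) := by
  obtain ⟨R⟩ := exists_skewResolvents hK
  choose Y hY0 hY using fun k => exists_linear_ode (R.L k) y hψ
  have hYc : ∀ k, Continuous (Y k) := fun k =>
    continuous_iff_continuousAt.2 fun t => (hY k t).continuousAt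
  -- `Y k` solves the approximate equation with data `y`, `ψ`, and `u k = K² (Y k)` solves it with
  -- data `K² y`, `K² ψ`
  set u : ℕ → ℝ → E := fun k t => K (K (Y k t)) with hu
  have huc : ∀ k, Continuous (u k) := fun k => by fun_prop
  have hud : ∀ k t, HasDerivAt (u k) (R.L k (u k t) + K (K (ψ t))) t := by
    intro k t
    have h := K.hasFDerivAt.comp_hasDerivAt t (K.hasFDerivAt.comp_hasDerivAt t (hY k t))
    refine h.congr_deriv ?_
    simp only [hu, map_add, R.comm]
  have hΦc : Continuous fun t => K (K (ψ t)) := by fun_prop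
  have hexp : ∀ {t : ℝ}, t ∈ Icc 0 T → Real.exp t ≤ Real.exp T := fun ht => Real.exp_le_exp.2 ht.2
  have hest : ∀ k, ∀ t ∈ Icc 0 T, ‖u k t‖ ^ 2 ≤
      Real.exp T * (‖K (K y)‖ ^ 2 + ∫ τ in 0..t, ‖K (K (ψ τ))‖ ^ 2) := by
    intro k t ht
    have h := dissipative_estimate (R.dissipative hK k) hΦc (hud k) ht.1
    simp only [hu, hY0] at h
    refine h.trans (mul_le_mul_of_nonneg_right (hexp ht) ?_)
    exact add_nonneg (sq_nonneg _)
      (intervalIntegral.integral_nonneg ht.1 fun _ _ => sq_nonneg _)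
  set B : ℝ := Real.exp T * (‖y‖ ^ 2 + ∫ τ in Ioo 0 T, ‖ψ τ‖ ^ 2) with hB
  have hB0 : 0 ≤ B := mul_nonneg (Real.exp_pos _).le
    (add_nonneg (sq_nonneg _) (integral_nonneg fun _ => sq_nonneg _))
  have hYb : ∀ k, ∀ t ∈ Icc 0 T, ‖Y k t‖ ^ 2 ≤ B := by
    intro k t ht
    have h := dissipative_estimate (R.dissipative hK k) hψ (hY k) ht.1
    rw [hY0] at h
    refine h.trans (mul_le_mul (hexp ht) (add_le_add_right ?_ _) ?_ (Real.exp_pos _).le)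
    · exact intervalIntegral_le_timeMeasure
        (integrable_norm_sq_of_memLp (hψ.memLp_timeMeasure T 2)) (fun _ => sq_nonneg _) ht
    · exact add_nonneg (sq_nonneg _)
        (intervalIntegral.integral_nonneg ht.1 fun _ _ => sq_nonneg _)
  -- The difference of two approximations solves the equation with generator `L n` and source
  -- `(L n - L m)(u m) = (εₙ - εₘ) (L n K) (L m K) (Y m)`, which is bounded by `ε_N √B`.
  set b : ℕ → ℝ := fun N => Real.sqrt (Real.exp T * (T * B)) * R.ε N with hb
  have hbt : Tendsto b atTop (𝓝 0) := by simpa using R.ε_tendsto.const_mul _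
  have hdiff : ∀ n m N, N ≤ n → N ≤ m → ∀ t ∈ Icc 0 T, ‖u n t - u m t‖ ≤ b N := by
    intro n m N hn hm t ht
    have hd : ∀ t, HasDerivAt (fun t => u n t - u m t)
        (R.L n (u n t - u m t) + (R.L n (u m t) - R.L m (u m t))) t := by
      intro t
      have h := (hud n t).sub (hud m t)
      refine h.congr_deriv ?_
      rw [map_sub]; abel
    have hc : Continuous fun t => R.L n (u m t) - R.L m (u m t) := by fun_prop
    have h := dissipative_estimate (R.dissipative hK n) hc hd ht.1
    have hε : (R.ε n - R.ε m) ^ 2 ≤ R.ε N ^ 2 := by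
      refine sq_le_sq' ?_ ?_ <;>
      linarith [R.ε_anti hn, R.ε_anti hm, R.ε_pos n, R.ε_pos m]
    have hp : ∀ τ ∈ Icc 0 T, ‖R.L n (u m τ) - R.L m (u m τ)‖ ^ 2 ≤ R.ε N ^ 2 * B := by
      intro τ hτ
      rw [R.resolvent_identity, norm_smul, mul_pow, Real.norm_eq_abs, sq_abs]
      refine mul_le_mul hε ?_ (sq_nonneg _) (sq_nonneg _)
      refine le_trans (pow_le_pow_left₀ (norm_nonneg _) ?_ 2) (hYb m τ hτ)
      rw [hu]
      simp only
      rw [R.comm, R.comm, R.comm, R.comm]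
      rw [← R.comm n (R.L m (Y m τ)), ← R.comm n, R.comm n]
      exact (R.norm_K_L_le hK n _).trans (R.norm_K_L_le hK m _)
    have hint : ∫ τ in 0..t, ‖R.L n (u m τ) - R.L m (u m τ)‖ ^ 2 ≤ T * (R.ε N ^ 2 * B) := by
      calc _ ≤ ∫ τ in 0..t, R.ε N ^ 2 * B :=
            intervalIntegral.integral_mono_on ht.1 ((hc.norm.pow 2).intervalIntegrable _ _)
              (by simp) fun τ hτ => hp τ ⟨hτ.1, hτ.2.trans ht.2⟩
        _ = t * (R.ε N ^ 2 * B) := by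
            rw [intervalIntegral.integral_const, sub_zero, smul_eq_mul]
        _ ≤ _ := mul_le_mul_of_nonneg_right ht.2 (by positivity)
    have h0 : u n 0 - u m 0 = 0 := by simp [hu, hY0]
    simp only [h0, norm_zero] at h
    refine (sq_le_sq₀ (norm_nonneg _)
      (mul_nonneg (Real.sqrt_nonneg _) (R.ε_pos N).le)).1 ?_
    rw [mul_pow, Real.sq_sqrt (by positivity)]
    refine h.trans ?_
    calc _ ≤ Real.exp T * (T * (R.ε N ^ 2 * B)) :=
          mul_le_mul (hexp ht) (by linarith)
            (add_nonneg (by norm_num)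
              (intervalIntegral.integral_nonneg ht.1 fun _ _ => sq_nonneg _)) (Real.exp_pos _).le
      _ = _ := by ring
  obtain ⟨U, hU, hUu⟩ := exists_uniform_limit hT huc hbt
    (fun N => mul_nonneg (Real.sqrt_nonneg _) (R.ε_pos N).le) hdiff
  have hlim : ∀ t ∈ Icc 0 T, Tendsto (fun k => u k t) atTop (𝓝 (U t)) := fun t ht =>
    tendsto_iff_norm_sub_tendsto_zero.2
      (squeeze_zero (fun _ => norm_nonneg _) (fun k => hUu k t ht) hbt)
  refine ⟨U, hU, fun t ht => ?_, fun t ht => ?_⟩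
  -- Apply `K - εₖ` to the integrated approximate equation, in order to let `k → ∞`.
  · have hk : ∀ k, K (u k t) - R.ε k • u k t = K (K (K y)) - R.ε k • K (K y)
        + ((∫ τ in 0..t, u k τ) + (∫ τ in 0..t, K (K (K (ψ τ))))
          - R.ε k • ∫ τ in 0..t, K (K (ψ τ))) := by
      intro k
      have hi : IntervalIntegrable (fun t => R.L k (u k t) + K (K (ψ t))) volume 0 t :=
        Continuous.intervalIntegrable (by fun_prop) _ _
      have h1 := intervalIntegral.integral_eq_sub_of_hasDerivAt (fun τ _ => hud k τ) hi
      have h0 : u k 0 = K (K y) := by simp only [hu, hY0]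
      have h2 : u k t = K (K y) + ∫ τ in 0..t, (R.L k (u k τ) + K (K (ψ τ))) := by
        rw [h1, h0]; abel
      have h3 : (K - R.ε k • ContinuousLinearMap.id ℝ E) (∫ τ in 0..t,
          (R.L k (u k τ) + K (K (ψ τ)))) = ∫ τ in 0..t,
            ((u k τ + K (K (K (ψ τ)))) - R.ε k • K (K (ψ τ))) := by
        rw [← ContinuousLinearMap.intervalIntegral_comp_comm _ hi]
        congr 1
        ext τ
        change K (R.L k (u k τ) + K (K (ψ τ))) - R.ε k • (R.L k (u k τ) + K (K (ψ τ))) = _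
        rw [map_add, smul_add, sub_eq_iff_eq_add.1 (R.right_inv k (u k τ))]; abel
      rw [← intervalIntegral.integral_smul, ← intervalIntegral.integral_add
        ((huc k).intervalIntegrable _ _) (Continuous.intervalIntegrable (by fun_prop) _ _),
        ← intervalIntegral.integral_sub (Continuous.intervalIntegrable (by fun_prop) _ _)
        (Continuous.intervalIntegrable (by fun_prop) _ _), ← h3, h2]
      simp only [map_add, smul_add, sub_apply, smul_apply,
        ContinuousLinearMap.id_apply]
      abel
    have hl := ((K.continuous.tendsto _).comp (hlim t ht)).sub (R.ε_tendsto.smul (hlim t ht))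
    have hr := ((R.ε_tendsto.smul_const (K (K y))).const_sub (K (K (K y)))).add
      (((tendsto_intervalIntegral_of_uniform huc hU hbt hUu ht).add_const
        (∫ τ in 0..t, K (K (K (ψ τ))))).sub
        (R.ε_tendsto.smul_const (∫ τ in 0..t, K (K (ψ τ)))))
    have := tendsto_nhds_unique (hl.congr fun k => hk k) hr
    rw [zero_smul, zero_smul, zero_smul, sub_zero, sub_zero, sub_zero] at this
    rw [this, intervalIntegral.integral_add (hU.intervalIntegrable _ _)
      (Continuous.intervalIntegrable (by fun_prop) _ _)]
  · exact le_of_tendsto ((hlim t ht).norm.pow 2) (Eventually.of_forall fun k => hest k t ht)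

/-- Data in the range of `K²` are dense: replace `Φ` by a continuous function `h`, and approximate
`h` by `K² (L k)² h`. -/
theorem exists_smooth_data [CompleteSpace E] {K : E →L[ℝ] E} (hK : ∀ x, ⟪K x, x⟫_ℝ = 0)
    (hd : DenseRange K) {T : ℝ} (x : E) {Φ : ℝ → E} (hΦ : MemLp Φ 2 (timeMeasure T)) {δ : ℝ}
    (hδ : 0 < δ) : ∃ (y : E) (ψ : ℝ → E), Continuous ψ ∧ ‖K (K y) - x‖ ^ 2 ≤ δ ∧
      ∫ τ in Ioo 0 T, ‖K (K (ψ τ)) - Φ τ‖ ^ 2 ≤ δ := by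
  obtain ⟨R⟩ := exists_skewResolvents hK
  obtain ⟨h, -, hh, hc, -⟩ := hΦ.exists_hasCompactSupport_eLpNorm_sub_le (by norm_num)
    (ε := ENNReal.ofReal (Real.sqrt (δ / 4))) (by simp; positivity)
  have hhm : MemLp h 2 (timeMeasure T) := hc.memLp_timeMeasure T 2
  have hhΦ : MemLp (fun τ => h τ - Φ τ) 2 (timeMeasure T) := hhm.sub hΦ
  have h1 : ∫ τ in Ioo 0 T, ‖h τ - Φ τ‖ ^ 2 ≤ δ / 4 := by
    rw [integral_norm_sq_eq hhΦ, ← Real.sq_sqrt (show 0 ≤ δ / 4 by positivity)]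
    refine pow_le_pow_left₀ ENNReal.toReal_nonneg ?_ 2
    refine ENNReal.toReal_le_of_le_ofReal (Real.sqrt_nonneg _) ?_
    have := eLpNorm_sub_comm h Φ 2 (timeMeasure T)
    exact this.trans_le hh
  have ha : ∀ᶠ k in atTop, ‖K (K (R.L k (R.L k x))) - x‖ ^ 2 ≤ δ := by
    have := ((R.tendsto_sq hK hd x).sub_const x).norm.pow 2
    rw [sub_self, norm_zero] at this
    exact this.eventually (eventually_le_nhds (by simpa using hδ))
  have hb : ∀ᶠ k in atTop, ∫ τ in Ioo 0 T, ‖K (K (R.L k (R.L k (h τ)))) - h τ‖ ^ 2 ≤ δ / 4 := by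
    have hlim : Tendsto (fun k => ∫ τ in Ioo 0 T, ‖K (K (R.L k (R.L k (h τ)))) - h τ‖ ^ 2) atTop
        (𝓝 (∫ τ in Ioo 0 T, (0 : ℝ))) := by
      refine tendsto_integral_of_dominated_convergence (fun τ => (2 * ‖h τ‖) ^ 2) (fun k => ?_) ?_
        (fun k => Eventually.of_forall fun τ => ?_) (Eventually.of_forall fun τ => ?_)
      · exact (Continuous.aestronglyMeasurable (by fun_prop))
      · have := (integrable_norm_sq_of_memLp hhm).const_mul 4
        refine this.congr (Eventually.of_forall fun τ => ?_)
        simp only; ring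
      · rw [norm_pow, norm_norm]
        refine pow_le_pow_left₀ (norm_nonneg _) ((norm_sub_le _ _).trans ?_) 2
        linarith [R.norm_sq_le hK k (h τ)]
      · have := ((R.tendsto_sq hK hd (h τ)).sub_const (h τ)).norm.pow 2
        simpa using this
    rw [integral_zero] at hlim
    exact hlim.eventually (eventually_le_nhds (by positivity))
  obtain ⟨k, hk1, hk2⟩ := (ha.and hb).exists
  refine ⟨R.L k (R.L k x), fun τ => R.L k (R.L k (h τ)), by fun_prop, hk1, ?_⟩
  have hm1 : MemLp (fun τ => K (K (R.L k (R.L k (h τ)))) - h τ) 2 (timeMeasure T) :=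
    Continuous.memLp_timeMeasure (by fun_prop) T 2
  calc _ ≤ ∫ τ in Ioo 0 T, (2 * ‖K (K (R.L k (R.L k (h τ)))) - h τ‖ ^ 2 + 2 * ‖h τ - Φ τ‖ ^ 2) := by
        refine integral_mono_of_nonneg (Eventually.of_forall fun _ => sq_nonneg _)
          (((integrable_norm_sq_of_memLp hm1).const_mul 2).add
            ((integrable_norm_sq_of_memLp hhΦ).const_mul 2))
          (Eventually.of_forall fun τ => ?_)
        simp only
        have : K (K (R.L k (R.L k (h τ)))) - Φ τ
          = (K (K (R.L k (R.L k (h τ)))) - h τ) + (h τ - Φ τ) := by abel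
        rw [this]
        have h2 := norm_add_le (K (K (R.L k (R.L k (h τ)))) - h τ) (h τ - Φ τ)
        have h3 := pow_le_pow_left₀ (norm_nonneg _) h2 2
        nlinarith [sq_nonneg (‖K (K (R.L k (R.L k (h τ)))) - h τ‖ - ‖h τ - Φ τ‖)]
    _ = 2 * (∫ τ in Ioo 0 T, ‖K (K (R.L k (R.L k (h τ)))) - h τ‖ ^ 2)
        + 2 * ∫ τ in Ioo 0 T, ‖h τ - Φ τ‖ ^ 2 := by
        rw [integral_add ((integrable_norm_sq_of_memLp hm1).const_mul 2)
          ((integrable_norm_sq_of_memLp hhΦ).const_mul 2), integral_const_mul,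
          integral_const_mul]
    _ ≤ δ := by linarith

theorem norm_add_sq_le_two {E : Type*} [NormedAddCommGroup E] (a b : E) :
    ‖a + b‖ ^ 2 ≤ 2 * ‖a‖ ^ 2 + 2 * ‖b‖ ^ 2 := by
  have h3 := pow_le_pow_left₀ (norm_nonneg _) (norm_add_le a b) 2
  nlinarith [sq_nonneg (‖a‖ - ‖b‖)]

theorem integral_norm_le_sqrt {α F : Type*} [MeasurableSpace α] {μ : Measure α} [IsFiniteMeasure μ]
    [NormedAddCommGroup F] {g : α → F} (hg : MemLp g 2 μ) :
    ∫ a, ‖g a‖ ∂μ ≤ Real.sqrt (μ.real univ * ∫ a, ‖g a‖ ^ 2 ∂μ) := by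
  refine Real.le_sqrt_of_sq_le ?_
  have h := integral_mul_le_Lp_mul_Lq_of_nonneg Real.HolderConjugate.two_two (μ := μ)
    (f := fun _ => (1 : ℝ)) (g := fun a => ‖g a‖) (Eventually.of_forall fun _ => zero_le_one)
    (Eventually.of_forall fun _ => norm_nonneg _) (memLp_const 1)
    (by rw [show ENNReal.ofReal 2 = 2 by norm_num]; exact hg.norm)
  simp only [one_mul, Real.rpow_ofNat, one_pow, integral_const, smul_eq_mul, mul_one] at h
  have h0 : 0 ≤ ∫ a, ‖g a‖ ^ 2 ∂μ := integral_nonneg fun _ => sq_nonneg _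
  calc (∫ a, ‖g a‖ ∂μ) ^ 2 ≤ _ :=
        pow_le_pow_left₀ (integral_nonneg fun _ => norm_nonneg _) h 2
    _ = _ := by
        rw [mul_pow, ← Real.sqrt_eq_rpow, ← Real.sqrt_eq_rpow, Real.sq_sqrt measureReal_nonneg,
          Real.sq_sqrt h0]

/-- Existence for the skew evolution equation `U' = K⁻¹ U + Φ`, `U(0) = x`, in the integrated form
`K U(t) = K x + ∫₀ᵗ (U + K Φ)`. -/
theorem exists_skew_solution [CompleteSpace E] {K : E →L[ℝ] E} (hK : ∀ x, ⟪K x, x⟫_ℝ = 0)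
    (hd : DenseRange K) {T : ℝ} (hT : 0 ≤ T) (x : E) {Φ : ℝ → E}
    (hΦ : MemLp Φ 2 (timeMeasure T)) :
    ∃ U : ℝ → E, Continuous U ∧
      (∀ t ∈ Icc 0 T, K (U t) = K x + ∫ τ in 0..t, (U τ + K (Φ τ))) ∧
      ∀ t ∈ Icc 0 T, ‖U t‖ ^ 2 ≤ 2 * Real.exp T * (‖x‖ ^ 2 + ∫ τ in 0..t, ‖Φ τ‖ ^ 2) := by
  let d : ℕ → ℝ := fun k => (1 / 2 : ℝ) ^ k
  have hd0 : ∀ k, 0 < d k := fun k => by positivity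
  have hdt : Tendsto d atTop (𝓝 0) :=
    tendsto_pow_atTop_nhds_zero_of_lt_one (by norm_num) (by norm_num)
  have hda : Antitone d := pow_right_anti₀ (by norm_num) (by norm_num)
  choose y ψ hψ hy hψΦ using fun k => exists_smooth_data hK hd x hΦ (hd0 k)
  choose u huc hueq huest using fun k => exists_skew_solution_smooth hK hT (y k) (hψ k)
  have hψm : ∀ k, MemLp (fun τ => K (K (ψ k τ))) 2 (timeMeasure T) := fun k =>
    Continuous.memLp_timeMeasure (by have := hψ k; fun_prop) T 2
  have hψd : ∀ k, MemLp (fun τ => K (K (ψ k τ)) - Φ τ) 2 (timeMeasure T) := fun k =>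
    (hψm k).sub hΦ
  set b : ℕ → ℝ := fun N => Real.sqrt (8 * Real.exp T * d N) with hb
  have hbt : Tendsto b atTop (𝓝 0) := by
    have := (hdt.const_mul (8 * Real.exp T)).sqrt
    simpa using this
  have hdiff : ∀ n m N, N ≤ n → N ≤ m → ∀ t ∈ Icc 0 T, ‖u n t - u m t‖ ≤ b N := by
    intro n m N hn hm
    obtain ⟨V, hVc, hVeq, hVest⟩ := exists_skew_solution_smooth hK hT (y n - y m)
      (ψ := fun τ => ψ n τ - ψ m τ) ((hψ n).sub (hψ m))
    have hW : (fun t => u n t - u m t - V t) =ᵐ[timeMeasure T] 0 := by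
      refine skew_unique hK hd
        (((((huc n).sub (huc m)).sub hVc).memLp_timeMeasure T 1).integrable le_rfl) ?_
      filter_upwards [ae_restrict_mem measurableSet_Ioo] with t ht
      have ht' := Ioo_subset_Icc_self ht
      have i1 : ∀ k, IntervalIntegrable (fun τ => u k τ + K (K (K (ψ k τ)))) volume 0 t :=
        fun k => Continuous.intervalIntegrable (by have := hψ k; have := huc k; fun_prop) _ _
      have i2 : IntervalIntegrable (fun τ => V τ + K (K (K (ψ n τ - ψ m τ)))) volume 0 t :=
        Continuous.intervalIntegrable (by have := hψ n; have := hψ m; fun_prop) _ _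
      have e : ∀ τ, u n τ - u m τ - V τ = (u n τ + K (K (K (ψ n τ))))
          - (u m τ + K (K (K (ψ m τ)))) - (V τ + K (K (K (ψ n τ - ψ m τ)))) := by
        intro τ
        simp only [map_sub]; abel
      simp only [e]
      rw [intervalIntegral.integral_sub ((i1 n).sub (i1 m)) i2,
        intervalIntegral.integral_sub (i1 n) (i1 m)]
      rw [← e, map_sub, map_sub, hueq n t ht', hueq m t ht', hVeq t ht']
      simp only [map_sub]; abel
    have hcont : Continuous fun t => u n t - u m t - V t := ((huc n).sub (huc m)).sub hVc
    have hWz : ∀ t ∈ Icc 0 T, u n t - u m t - V t = 0 := by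
      rcases hT.eq_or_lt with rfl | hT'
      · intro t ht
        obtain rfl : t = 0 := le_antisymm ht.2 ht.1
        refine skew_injective hK hd ?_
        rw [map_sub, map_sub, hueq n 0 ht, hueq m 0 ht, hVeq 0 ht]
        simp
      · have h1 := Measure.eqOn_Icc_of_ae_eq volume hT'.ne
          (ae_restrict_of_ae_eq_of_ae_restrict Ioo_ae_eq_Icc hW) hcont.continuousOn
          continuousOn_const
        exact h1
    intro t ht
    have h2 : u n t - u m t = V t := sub_eq_zero.1 (hWz t ht)
    rw [h2]
    refine Real.le_sqrt_of_sq_le ((hVest t ht).trans ?_)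
    have h3 : ‖K (K (y n - y m))‖ ^ 2 ≤ 4 * d N := by
      have e : K (K (y n - y m)) = (K (K (y n)) - x) + -(K (K (y m)) - x) := by
        rw [map_sub, map_sub]; abel
      rw [e]
      refine (norm_add_sq_le_two _ _).trans ?_
      rw [norm_neg]
      linarith [hy n, hy m, hda hn, hda hm]
    have h4 : ∫ τ in 0..t, ‖K (K (ψ n τ - ψ m τ))‖ ^ 2 ≤ 4 * d N := by
      have hi1 := (integrable_norm_sq_of_memLp (hψd n)).const_mul 2
      have hi2 := (integrable_norm_sq_of_memLp (hψd m)).const_mul 2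
      refine (intervalIntegral_le_timeMeasure (integrable_norm_sq_of_memLp
        (Continuous.memLp_timeMeasure (by have := hψ n; have := hψ m; fun_prop) T 2))
        (fun _ => sq_nonneg _) ht).trans ?_
      calc _ ≤ ∫ τ in Ioo 0 T, (2 * ‖K (K (ψ n τ)) - Φ τ‖ ^ 2 + 2 * ‖K (K (ψ m τ)) - Φ τ‖ ^ 2) := by
            refine integral_mono_of_nonneg (Eventually.of_forall fun _ => sq_nonneg _)
              (hi1.add hi2) (Eventually.of_forall fun τ => ?_)
            simp only
            have e : K (K (ψ n τ - ψ m τ)) = (K (K (ψ n τ)) - Φ τ) + -(K (K (ψ m τ)) - Φ τ) := by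
              rw [map_sub, map_sub]; abel
            rw [e]
            refine (norm_add_sq_le_two _ _).trans ?_
            rw [norm_neg]
        _ = 2 * (∫ τ in Ioo 0 T, ‖K (K (ψ n τ)) - Φ τ‖ ^ 2)
            + 2 * ∫ τ in Ioo 0 T, ‖K (K (ψ m τ)) - Φ τ‖ ^ 2 := by
            rw [integral_add hi1 hi2, integral_const_mul, integral_const_mul]
        _ ≤ 4 * d N := by linarith [hψΦ n, hψΦ m, hda hn, hda hm]
    calc _ ≤ Real.exp T * (4 * d N + 4 * d N) :=
          mul_le_mul_of_nonneg_left (add_le_add h3 h4) (Real.exp_pos _).le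
      _ = _ := by ring
  obtain ⟨U, hU, hUu⟩ := exists_uniform_limit hT huc hbt (fun N => Real.sqrt_nonneg _) hdiff
  have hlim : ∀ t ∈ Icc 0 T, Tendsto (fun k => u k t) atTop (𝓝 (U t)) := fun t ht =>
    tendsto_iff_norm_sub_tendsto_zero.2
      (squeeze_zero (fun _ => norm_nonneg _) (fun k => hUu k t ht) hbt)
  have hylim : Tendsto (fun k => K (K (y k))) atTop (𝓝 x) := by
    rw [tendsto_iff_norm_sub_tendsto_zero]
    have hs : Tendsto (fun k => Real.sqrt (d k)) atTop (𝓝 0) := by simpa using hdt.sqrt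
    exact squeeze_zero (fun _ => norm_nonneg _) (fun k => Real.le_sqrt_of_sq_le (hy k)) hs
  have hΦi : Integrable Φ (timeMeasure T) := hΦ.integrable (by norm_num)
  refine ⟨U, hU, fun t ht => ?_, fun t ht => ?_⟩
  · have hKΦ : IntervalIntegrable (fun τ => K (Φ τ)) volume 0 t :=
      intervalIntegrable_of_timeMeasure (K.integrable_comp hΦi) ht
    have h1 : Tendsto (fun k => ∫ τ in 0..t, K (K (K (ψ k τ)))) atTop
        (𝓝 (∫ τ in 0..t, K (Φ τ))) := by
      have hs : Tendsto (fun k => ‖K‖ * Real.sqrt ((timeMeasure T).real univ * d k)) atTop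
          (𝓝 0) := by
        have := ((hdt.const_mul ((timeMeasure T).real univ)).sqrt).const_mul ‖K‖
        simpa using this
      rw [tendsto_iff_norm_sub_tendsto_zero]
      refine squeeze_zero (fun _ => norm_nonneg _) (fun k => ?_) hs
      have hψk := hψ k
      rw [← intervalIntegral.integral_sub (Continuous.intervalIntegrable (by fun_prop) _ _) hKΦ]
      refine (intervalIntegral.norm_integral_le_integral_norm ht.1).trans ?_
      have hi : Integrable (fun τ => ‖K (K (ψ k τ)) - Φ τ‖) (timeMeasure T) :=
        ((hψd k).integrable (by norm_num)).norm
      calc _ ≤ ∫ τ in 0..t, ‖K‖ * ‖K (K (ψ k τ)) - Φ τ‖ := by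
            refine intervalIntegral.integral_mono_on ht.1 ?_ ?_ fun τ _ => ?_
            · exact ((Continuous.intervalIntegrable (by fun_prop) _ _).sub hKΦ).norm
            · exact (intervalIntegrable_of_timeMeasure hi ht).const_mul _
            · rw [← map_sub]; exact K.le_opNorm _
        _ = ‖K‖ * ∫ τ in 0..t, ‖K (K (ψ k τ)) - Φ τ‖ := by
            rw [intervalIntegral.integral_const_mul]
        _ ≤ ‖K‖ * ∫ τ in Ioo 0 T, ‖K (K (ψ k τ)) - Φ τ‖ :=
            mul_le_mul_of_nonneg_left
              (intervalIntegral_le_timeMeasure hi (fun _ => norm_nonneg _) ht) (norm_nonneg _)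
        _ ≤ _ := by
            refine mul_le_mul_of_nonneg_left ((integral_norm_le_sqrt (hψd k)).trans ?_)
              (norm_nonneg _)
            exact Real.sqrt_le_sqrt (mul_le_mul_of_nonneg_left (hψΦ k) measureReal_nonneg)
    have hr := ((K.continuous.tendsto _).comp hylim).add
      ((tendsto_intervalIntegral_of_uniform huc hU hbt hUu ht).add h1)
    have hl := (K.continuous.tendsto _).comp (hlim t ht)
    rw [intervalIntegral.integral_add (hU.intervalIntegrable _ _) hKΦ]
    refine tendsto_nhds_unique (hl.congr fun k => ?_) hr
    have hψk := hψ k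
    simp only [Function.comp_apply]
    rw [hueq k t ht, intervalIntegral.integral_add ((huc k).intervalIntegrable _ _)
      (Continuous.intervalIntegrable (by fun_prop) _ _)]
  · have hΦ2 := integrable_norm_sq_of_memLp hΦ
    have hk : ∀ k, ‖u k t‖ ^ 2 ≤ Real.exp T * (‖K (K (y k))‖ ^ 2
        + (2 * (∫ τ in 0..t, ‖Φ τ‖ ^ 2) + 2 * d k)) := by
      intro k
      refine (huest k t ht).trans (mul_le_mul_of_nonneg_left (add_le_add_right ?_ _)
        (Real.exp_pos _).le)
      have hi := intervalIntegrable_of_timeMeasure (integrable_norm_sq_of_memLp (hψd k)) ht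
      have hi' := intervalIntegrable_of_timeMeasure hΦ2 ht
      calc _ ≤ ∫ τ in 0..t, (2 * ‖Φ τ‖ ^ 2 + 2 * ‖K (K (ψ k τ)) - Φ τ‖ ^ 2) := by
            refine intervalIntegral.integral_mono_on ht.1 ?_
              ((hi'.const_mul 2).add (hi.const_mul 2)) fun τ _ => ?_
            · have := hψ k
              exact Continuous.intervalIntegrable (by fun_prop) _ _
            · have e : K (K (ψ k τ)) = Φ τ + (K (K (ψ k τ)) - Φ τ) := by abel
              nth_rewrite 1 [e]
              exact norm_add_sq_le_two _ _
        _ = 2 * (∫ τ in 0..t, ‖Φ τ‖ ^ 2) + 2 * ∫ τ in 0..t, ‖K (K (ψ k τ)) - Φ τ‖ ^ 2 := by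
            rw [intervalIntegral.integral_add (hi'.const_mul 2) (hi.const_mul 2),
              intervalIntegral.integral_const_mul, intervalIntegral.integral_const_mul]
        _ ≤ _ := by
            have := intervalIntegral_le_timeMeasure (integrable_norm_sq_of_memLp (hψd k))
              (fun _ => sq_nonneg _) ht
            linarith [hψΦ k]
    have hr := (((hylim.norm.pow 2).add ((hdt.const_mul 2).const_add
      (2 * ∫ τ in 0..t, ‖Φ τ‖ ^ 2))).const_mul (Real.exp T))
    refine (le_of_tendsto_of_tendsto' ((hlim t ht).norm.pow 2) hr hk).trans ?_
    rw [mul_zero, add_zero, mul_comm 2 (Real.exp T), mul_assoc]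
    refine mul_le_mul_of_nonneg_left ?_ (Real.exp_pos _).le
    linarith [sq_nonneg ‖x‖]

end SkewExistence

/-! ### Grönwall's inequality, causal fixed points and abstract wave equations -/

section Gronwall

/-- Grönwall's inequality in integrated form, holding almost everywhere. -/
theorem gronwall_ae {T a C : ℝ} (ha : 0 ≤ a) (hC : 0 ≤ C) {y : ℝ → ℝ}
    (hy : Integrable y (timeMeasure T)) (h : ∀ᵐ t ∂timeMeasure T, y t ≤ a + C * ∫ τ in 0..t, y τ) :
    ∀ᵐ t ∂timeMeasure T, y t ≤ a * Real.exp (C * T) := by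
  set y' : ℝ → ℝ := (Ioo 0 T).indicator y with hy'
  have hyi : Integrable y' := IntegrableOn.integrable_indicator hy measurableSet_Ioo
  have hyy : y =ᵐ[timeMeasure T] y' := by
    filter_upwards [ae_restrict_mem measurableSet_Ioo] with t ht
    rw [hy', indicator_of_mem ht]
  set f : ℝ → ℝ := fun t => a + C * ∫ τ in 0..t, y' τ with hf
  have hfc : Continuous f := continuous_const.add (continuous_const.mul
    (intervalIntegral.continuous_primitive (fun a b => hyi.intervalIntegrable) 0))
  have hyf : ∀ᵐ t ∂timeMeasure T, y t ≤ f t := by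
    filter_upwards [h, ae_restrict_mem measurableSet_Ioo] with t ht htm
    simp only [hf]
    rwa [← intervalIntegral_congr_timeMeasure hyy (Ioo_subset_Icc_self htm)]
  set g : ℝ → ℝ := fun t => a + C * ∫ τ in 0..t, f τ with hg
  have hfg : ∀ t ∈ Icc 0 T, f t ≤ g t := by
    intro t ht
    refine add_le_add_right (mul_le_mul_of_nonneg_left ?_ hC) _
    refine intervalIntegral.integral_mono_ae_restrict ht.1 hyi.intervalIntegrable
      (hfc.intervalIntegrable _ _) ?_
    have h1 : ∀ᵐ τ ∂timeMeasure t, y' τ ≤ f τ := by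
      filter_upwards [ae_restrict_of_ae_restrict_of_subset (Ioo_subset_Ioo_right ht.2) hyf,
        ae_restrict_of_ae_restrict_of_subset (Ioo_subset_Ioo_right ht.2) hyy] with τ h2 h3
      rw [← h3]; exact h2
    exact ae_restrict_of_ae_eq_of_ae_restrict Ioo_ae_eq_Icc h1
  have hgd : ∀ t, HasDerivAt g (C * f t) t := fun t =>
    ((intervalIntegral.integral_hasDerivAt_right (hfc.intervalIntegrable _ _)
      hfc.stronglyMeasurable.stronglyMeasurableAtFilter hfc.continuousAt).const_mul C).const_add a
  have hanti : AntitoneOn (fun t => g t * Real.exp (-(C * t))) (Icc 0 T) := by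
    have hd : ∀ t, HasDerivAt (fun t => g t * Real.exp (-(C * t)))
        (C * f t * Real.exp (-(C * t)) + g t * (Real.exp (-(C * t)) * -(C * 1))) t := fun t =>
      (hgd t).mul ((((hasDerivAt_id t).const_mul C).neg).exp)
    refine antitoneOn_of_deriv_nonpos (convex_Icc 0 T)
      (fun t _ => (hd t).continuousAt.continuousWithinAt)
      (fun t _ => (hd t).differentiableAt.differentiableWithinAt) fun t ht => ?_
    rw [(hd t).deriv]
    have h1 := hfg t (interior_subset ht)
    have h2 : 0 ≤ C * Real.exp (-(C * t)) * (g t - f t) :=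
      mul_nonneg (mul_nonneg hC (Real.exp_pos _).le) (by linarith)
    linarith
  filter_upwards [hyf, ae_restrict_mem measurableSet_Ioo] with t ht htm
  have hmem := Ioo_subset_Icc_self htm
  have h0 := hanti (left_mem_Icc.2 (hmem.1.trans hmem.2)) hmem hmem.1
  simp only [mul_zero, neg_zero, Real.exp_zero, mul_one] at h0
  have hg0 : g 0 = a := by simp [hg]
  rw [hg0] at h0
  calc y t ≤ g t := ht.trans (hfg t hmem)
    _ = g t * Real.exp (-(C * t)) * Real.exp (C * t) := by
        rw [mul_assoc, ← Real.exp_add]; simp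
    _ ≤ a * Real.exp (C * t) := mul_le_mul_of_nonneg_right h0 (Real.exp_pos _).le
    _ ≤ a * Real.exp (C * T) :=
        mul_le_mul_of_nonneg_left (Real.exp_le_exp.2 (mul_le_mul_of_nonneg_left hmem.2 hC)) ha

/-- A causal map of Volterra type on `C([0,T];X)` has a fixed point: some iterate is a
contraction. -/
theorem exists_fixedPoint_of_causal {X : Type*} [NormedAddCommGroup X] [CompleteSpace X]
    {T : ℝ} (hT : 0 ≤ T) {C : ℝ} (hC : 0 ≤ C) (Ψ : C(Icc 0 T, X) → C(Icc 0 T, X))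
    (h : ∀ u v : C(Icc 0 T, X), ∀ t : Icc 0 T, ‖Ψ u t - Ψ v t‖ ^ 2 ≤
      C * ∫ τ in (0 : ℝ)..t, ‖IccExtend hT u τ - IccExtend hT v τ‖ ^ 2) :
    ∃ u, Ψ u = u := by
  have hiter : ∀ (n : ℕ) (u v : C(Icc 0 T, X)) (t : Icc 0 T),
      ‖Ψ^[n] u t - Ψ^[n] v t‖ ^ 2 ≤ (C * t) ^ n / n.factorial * dist u v ^ 2 := by
    intro n
    induction n with
    | zero =>
      intro u v t
      simp only [Function.iterate_zero, id_eq, pow_zero, Nat.factorial_zero, Nat.cast_one, div_one,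
        one_mul]
      refine pow_le_pow_left₀ (norm_nonneg _) ?_ 2
      rw [← dist_eq_norm]
      exact ContinuousMap.dist_apply_le_dist t
    | succ n ih =>
      intro u v t
      rw [Function.iterate_succ_apply', Function.iterate_succ_apply']
      refine (h _ _ t).trans ?_
      have hcont : ∀ w : C(Icc 0 T, X), Continuous (IccExtend hT w) := fun w =>
        w.continuous.Icc_extend'
      have h1 : ∫ τ in (0 : ℝ)..t, ‖IccExtend hT (Ψ^[n] u) τ - IccExtend hT (Ψ^[n] v) τ‖ ^ 2
          ≤ ∫ τ in (0 : ℝ)..t, (C ^ n / n.factorial * dist u v ^ 2) * τ ^ n := by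
        refine intervalIntegral.integral_mono_on t.2.1 ?_ ?_ fun τ hτ => ?_
        · exact ((((hcont _).sub (hcont _)).norm).pow 2).intervalIntegrable _ _
        · exact Continuous.intervalIntegrable (by fun_prop) _ _
        · have hτ' : τ ∈ Icc 0 T := ⟨hτ.1, hτ.2.trans t.2.2⟩
          rw [IccExtend_of_mem hT _ hτ', IccExtend_of_mem hT _ hτ']
          refine (ih u v ⟨τ, hτ'⟩).trans (le_of_eq ?_)
          simp only [mul_pow]; ring
      refine (mul_le_mul_of_nonneg_left h1 hC).trans (le_of_eq ?_)
      rw [intervalIntegral.integral_const_mul, integral_pow, Nat.factorial_succ]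
      push_cast
      have : (n.factorial : ℝ) ≠ 0 := by positivity
      have : (n : ℝ) + 1 ≠ 0 := by positivity
      field_simp
      ring
  have hlim := (FloorSemiring.tendsto_pow_div_factorial_atTop (C * T)).eventually
    (eventually_le_nhds (show (0 : ℝ) < 1 / 4 by norm_num))
  obtain ⟨n, hn⟩ := hlim.exists
  have hcontr : ContractingWith (1 / 2) Ψ^[n] := by
    refine ⟨by norm_num, LipschitzWith.of_dist_le_mul fun u v => ?_⟩
    refine (ContinuousMap.dist_le (by positivity)).2 fun t => ?_
    rw [dist_eq_norm]
    refine (sq_le_sq₀ (norm_nonneg _) (by positivity)).1 ?_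
    refine (hiter n u v t).trans ?_
    rw [mul_pow _ (dist u v)]
    refine mul_le_mul_of_nonneg_right ?_ (sq_nonneg _)
    have h2 : (C * t) ^ n / n.factorial ≤ (C * T) ^ n / n.factorial :=
      div_le_div_of_nonneg_right (pow_le_pow_left₀ (mul_nonneg hC t.2.1)
        (mul_le_mul_of_nonneg_left t.2.2 hC) n) (by positivity)
    refine (h2.trans hn).trans (le_of_eq ?_)
    norm_num
  have : Nonempty C(Icc 0 T, X) := ⟨0⟩
  exact ⟨_, hcontr.isFixedPt_fixedPoint_iterate⟩

end Gronwall

theorem memLp_withLp_two {V H : Type*} [NormedAddCommGroup V] [InnerProductSpace ℝ V]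
    [NormedAddCommGroup H] [InnerProductSpace ℝ H] {p : ℝ≥0∞} {μ : Measure ℝ} {z : ℝ → V}
    {ζ : ℝ → H} (hz : MemLp z p μ)
    (hζ : MemLp ζ p μ) : MemLp (fun t => WithLp.toLp 2 (z t, ζ t)) p μ := by
  let e : V × H →L[ℝ] WithLp 2 (V × H) := (WithLp.prodContinuousLinearEquiv 2 ℝ V H).symm
  have h := ((e ∘L ContinuousLinearMap.inl ℝ V H).comp_memLp' hz).add
    ((e ∘L ContinuousLinearMap.inr ℝ V H).comp_memLp' hζ)
  refine (memLp_congr_ae (Eventually.of_forall fun t => ?_)).1 h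
  change e (z t, 0) + e (0, ζ t) = e (z t, ζ t)
  rw [← map_add]
  simp

section Wave

variable {V H : Type*} [NormedAddCommGroup V] [InnerProductSpace ℝ V] [CompleteSpace V]
  [NormedAddCommGroup H] [InnerProductSpace ℝ H] [CompleteSpace H]

/-- The inverse `(f, g) ↦ (-j†g, j f)` of the wave generator on the energy space `V × H`. Here `j`
is the embedding of `V` into `H`, so that `j†` is the inverse of the operator `A` defined by the
inner product of `V`. -/
def waveInv (j : V →L[ℝ] H) : WithLp 2 (V × H) →L[ℝ] WithLp 2 (V × H) :=
  ((WithLp.prodContinuousLinearEquiv 2 ℝ V H).symm : V × H →L[ℝ] WithLp 2 (V × H)) ∘L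
    ((-(j.adjoint ∘L WithLp.sndL 2 ℝ V H)).prod (j ∘L WithLp.fstL 2 ℝ V H))

theorem waveInv_skew (j : V →L[ℝ] H) (x : WithLp 2 (V × H)) : ⟪waveInv j x, x⟫_ℝ = 0 := by
  rw [WithLp.prod_inner_apply]
  change ⟪-j.adjoint x.snd, x.fst⟫_ℝ + ⟪j x.fst, x.snd⟫_ℝ = 0
  rw [inner_neg_left, ContinuousLinearMap.adjoint_inner_left, real_inner_comm]
  ring

theorem waveInv_denseRange {j : V →L[ℝ] H} (hj : Function.Injective j) (hd : DenseRange j) :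
    DenseRange (waveInv j) := by
  have h : (LinearMap.range (waveInv j).toLinearMap).topologicalClosure = ⊤ := by
    rw [Submodule.topologicalClosure_eq_top_iff, Submodule.eq_bot_iff]
    intro x hx
    have h1 : ∀ y, ⟪waveInv j y, x⟫_ℝ = 0 := fun y =>
      (Submodule.mem_orthogonal _ _).1 hx _ ⟨y, rfl⟩
    have h2 : ∀ f g, -⟪j.adjoint g, x.fst⟫_ℝ + ⟪j f, x.snd⟫_ℝ = 0 := by
      intro f g
      have := h1 (WithLp.toLp 2 (f, g))
      rw [WithLp.prod_inner_apply] at this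
      change ⟪-j.adjoint g, x.fst⟫_ℝ + ⟪j f, x.snd⟫_ℝ = 0 at this
      rwa [inner_neg_left] at this
    have hs : x.snd = 0 := by
      have h3 : ∀ z, ⟪z, x.snd⟫_ℝ = 0 := fun z => hd.induction_on z
        (isClosed_eq (by fun_prop) continuous_const) fun f => by simpa using h2 f 0
      exact inner_self_eq_zero.1 (h3 _)
    have hf : x.fst = 0 := by
      have h3 := h2 0 (j x.fst)
      rw [ContinuousLinearMap.adjoint_inner_left] at h3
      simp only [map_zero, inner_zero_left, add_zero, neg_eq_zero] at h3
      exact hj (by rw [inner_self_eq_zero.1 h3, map_zero])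
    exact (WithLp.equiv 2 (V × H)).injective (Prod.ext hf hs)
  have h' := congrArg (fun S : Submodule ℝ (WithLp 2 (V × H)) => (S : Set (WithLp 2 (V × H)))) h
  simp only [Submodule.topologicalClosure_coe, Submodule.top_coe] at h'
  rw [DenseRange, dense_iff_closure_eq]
  exact h'

/-- The pair `(z, ζ)` solves the wave equation `z' = ζ`, `ζ' + A z = G`, in the integrated form
obtained by applying `j` to the first and `j† = A⁻¹` to the second equation. -/
def IsWave (j : V →L[ℝ] H) (z₀ : V) (ζ₀ : H) (G : ℝ → H) (z : ℝ → V) (ζ : ℝ → H) (t : ℝ) : Prop :=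
  j (z t) = j z₀ + ∫ τ in 0..t, ζ τ ∧
    j.adjoint (ζ t) = j.adjoint ζ₀ - ∫ τ in 0..t, (z τ - j.adjoint (G τ))

/-- The integrated skew evolution equation with generator inverse `waveInv j` is the integrated wave
equation, written as a system. -/
theorem waveInv_eq_iff {j : V →L[ℝ] H} {z₀ : V} {ζ₀ : H} {G : ℝ → H} {z : ℝ → V} {ζ : ℝ → H}
    {T t : ℝ} (hz : Integrable z (timeMeasure T)) (hζ : Integrable ζ (timeMeasure T))
    (hG : Integrable G (timeMeasure T)) (ht : t ∈ Icc 0 T) :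
    waveInv j (WithLp.toLp 2 (z t, ζ t)) = waveInv j (WithLp.toLp 2 (z₀, ζ₀))
      + ∫ τ in 0..t, (WithLp.toLp 2 (z τ, ζ τ) + waveInv j (WithLp.toLp 2 (0, G τ))) ↔
    IsWave j z₀ ζ₀ G z ζ t := by
  have hi : IntervalIntegrable
      (fun τ => WithLp.toLp 2 (z τ, ζ τ) + waveInv j (WithLp.toLp 2 (0, G τ))) volume 0 t := by
    refine intervalIntegrable_of_timeMeasure (Integrable.add ?_ ?_) ht
    · exact memLp_one_iff_integrable.1 (memLp_withLp_two (memLp_one_iff_integrable.2 hz)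
        (memLp_one_iff_integrable.2 hζ))
    · exact (waveInv j).integrable_comp (memLp_one_iff_integrable.1
        (memLp_withLp_two (memLp_one_iff_integrable.2 (integrable_zero _ _ _))
        (memLp_one_iff_integrable.2 hG)))
  have h1 : (∫ τ in 0..t, (WithLp.toLp 2 (z τ, ζ τ)
      + waveInv j (WithLp.toLp 2 (0, G τ)))).fst = ∫ τ in 0..t, (z τ - j.adjoint (G τ)) := by
    refine ((WithLp.fstL 2 ℝ V H).intervalIntegral_comp_comm hi).symm.trans ?_
    refine intervalIntegral.integral_congr fun τ _ => ?_
    exact (sub_eq_add_neg _ _).symm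
  have h2 : (∫ τ in 0..t, (WithLp.toLp 2 (z τ, ζ τ)
      + waveInv j (WithLp.toLp 2 (0, G τ)))).snd = ∫ τ in 0..t, ζ τ := by
    refine ((WithLp.sndL 2 ℝ V H).intervalIntegral_comp_comm hi).symm.trans ?_
    refine intervalIntegral.integral_congr fun τ _ => ?_
    change ζ τ + j 0 = ζ τ
    rw [map_zero, add_zero]
  have key : ∀ a b : WithLp 2 (V × H), a = b ↔ a.snd = b.snd ∧ a.fst = b.fst := fun a b =>
    ⟨fun h => by rw [h]; exact ⟨rfl, rfl⟩,
      fun h => (WithLp.equiv 2 (V × H)).injective (Prod.ext h.2 h.1)⟩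
  rw [key, IsWave, WithLp.add_snd, WithLp.add_fst, h1, h2]
  refine and_congr Iff.rfl ?_
  change -j.adjoint (ζ t) = -j.adjoint ζ₀ + _ ↔ _
  rw [neg_eq_iff_eq_neg, neg_add, neg_neg, sub_eq_add_neg]

theorem exists_wave {j : V →L[ℝ] H} (hj : Function.Injective j) (hd : DenseRange j) {T : ℝ}
    (hT : 0 ≤ T) (z₀ : V) (ζ₀ : H) {G : ℝ → H} (hG : MemLp G 2 (timeMeasure T)) :
    ∃ (z : ℝ → V) (ζ : ℝ → H), Continuous z ∧ Continuous ζ ∧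
      (∀ t ∈ Icc 0 T, IsWave j z₀ ζ₀ G z ζ t) ∧
      ∀ t ∈ Icc 0 T, ‖z t‖ ^ 2 + ‖ζ t‖ ^ 2 ≤
        2 * Real.exp T * (‖z₀‖ ^ 2 + ‖ζ₀‖ ^ 2 + ∫ τ in 0..t, ‖G τ‖ ^ 2) := by
  obtain ⟨U, hUc, hU, hUe⟩ := exists_skew_solution (waveInv_skew j) (waveInv_denseRange hj hd) hT
    (WithLp.toLp 2 (z₀, ζ₀)) (memLp_withLp_two (MemLp.zero : MemLp (0 : ℝ → V) 2 (timeMeasure T)) hG)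
  have hzc : Continuous fun t => (U t).fst := (WithLp.fstL 2 ℝ V H).continuous.comp hUc
  have hζc : Continuous fun t => (U t).snd := (WithLp.sndL 2 ℝ V H).continuous.comp hUc
  refine ⟨fun t => (U t).fst, fun t => (U t).snd, hzc, hζc, fun t ht => ?_, fun t ht => ?_⟩
  · exact (waveInv_eq_iff ((hzc.memLp_timeMeasure T 1).integrable le_rfl)
      ((hζc.memLp_timeMeasure T 1).integrable le_rfl) (hG.integrable (by norm_num)) ht).1 (hU t ht)
  · have h := hUe t ht
    simp only [WithLp.prod_norm_sq_eq_of_L2] at h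
    simpa using h

theorem wave_unique {j : V →L[ℝ] H} (hj : Function.Injective j) (hd : DenseRange j) {T : ℝ}
    {z : ℝ → V} {ζ : ℝ → H} (hz : Integrable z (timeMeasure T))
    (hζ : Integrable ζ (timeMeasure T))
    (h : ∀ᵐ t ∂timeMeasure T, IsWave j 0 0 0 z ζ t) :
    z =ᵐ[timeMeasure T] 0 ∧ ζ =ᵐ[timeMeasure T] 0 := by
  have hi : Integrable (fun τ => WithLp.toLp 2 (z τ, ζ τ)) (timeMeasure T) :=
    memLp_one_iff_integrable.1 (memLp_withLp_two (memLp_one_iff_integrable.2 hz)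
        (memLp_one_iff_integrable.2 hζ))
  have h0 := skew_unique (waveInv_skew j) (waveInv_denseRange hj hd) hi (by
    filter_upwards [h, ae_restrict_mem measurableSet_Ioo] with t ht htm
    have := (waveInv_eq_iff hz hζ (integrable_zero _ _ _) (Ioo_subset_Icc_self htm)).2 ht
    have e : (WithLp.toLp 2 ((0 : V), (0 : H))) = 0 := rfl
    simpa [e] using this)
  constructor
  · filter_upwards [h0] with t ht
    exact congrArg WithLp.fst ht
  · filter_upwards [h0] with t ht
    exact congrArg WithLp.snd ht

theorem IsWave.sub {j : V →L[ℝ] H} {z₀ z₀' : V} {ζ₀ ζ₀' : H} {G G' : ℝ → H} {z z' : ℝ → V}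
    {ζ ζ' : ℝ → H} {T t : ℝ} (hz : Integrable z (timeMeasure T))
    (hζ : Integrable ζ (timeMeasure T)) (hG : Integrable G (timeMeasure T))
    (hz' : Integrable z' (timeMeasure T)) (hζ' : Integrable ζ' (timeMeasure T))
    (hG' : Integrable G' (timeMeasure T)) (ht : t ∈ Icc 0 T) (h : IsWave j z₀ ζ₀ G z ζ t)
    (h' : IsWave j z₀' ζ₀' G' z' ζ' t) :
    IsWave j (z₀ - z₀') (ζ₀ - ζ₀') (fun τ => G τ - G' τ) (fun τ => z τ - z' τ)
      (fun τ => ζ τ - ζ' τ) t := by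
  have i1 := intervalIntegrable_of_timeMeasure (hz.sub (j.adjoint.integrable_comp hG)) ht
  have i2 := intervalIntegrable_of_timeMeasure (hz'.sub (j.adjoint.integrable_comp hG')) ht
  constructor
  · rw [map_sub, map_sub, intervalIntegral.integral_sub (intervalIntegrable_of_timeMeasure hζ ht)
      (intervalIntegrable_of_timeMeasure hζ' ht), h.1, h'.1]
    abel
  · have e : ∀ τ, z τ - z' τ - j.adjoint (G τ - G' τ)
        = (z τ - j.adjoint (G τ)) - (z' τ - j.adjoint (G' τ)) := by
      intro τ; rw [map_sub]; abel
    simp only [e]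
    have := intervalIntegral.integral_sub i1 i2
    simp only [Pi.sub_apply] at this
    rw [map_sub, map_sub, this, h.2, h'.2]
    abel

/-- The energy estimate for an arbitrary bounded solution of the wave equation: it agrees with the
solution constructed in `exists_wave`. -/
theorem wave_estimate {j : V →L[ℝ] H} (hj : Function.Injective j) (hd : DenseRange j) {T : ℝ}
    (hT : 0 ≤ T) {z₀ : V} {ζ₀ : H} {G : ℝ → H} (hG : MemLp G 2 (timeMeasure T))
    {z : ℝ → V} {ζ : ℝ → H} (hz : Integrable z (timeMeasure T))
    (hζ : Integrable ζ (timeMeasure T)) (h : ∀ᵐ t ∂timeMeasure T, IsWave j z₀ ζ₀ G z ζ t) :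
    ∀ᵐ t ∂timeMeasure T, ‖z t‖ ^ 2 + ‖ζ t‖ ^ 2 ≤
        2 * Real.exp T * (‖z₀‖ ^ 2 + ‖ζ₀‖ ^ 2 + ∫ τ in 0..t, ‖G τ‖ ^ 2) := by
  obtain ⟨z', ζ', hzc, hζc, hw, he⟩ := exists_wave hj hd hT z₀ ζ₀ hG
  have hz' := (hzc.memLp_timeMeasure T 1).integrable le_rfl
  have hζ' := (hζc.memLp_timeMeasure T 1).integrable le_rfl
  have hGi := hG.integrable (by norm_num)
  obtain ⟨h1, h2⟩ := wave_unique hj hd (hz.sub hz') (hζ.sub hζ') (by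
    filter_upwards [h, ae_restrict_mem measurableSet_Ioo] with t ht htm
    have := IsWave.sub hz hζ hGi hz' hζ' hGi (Ioo_subset_Icc_self htm) ht
      (hw t (Ioo_subset_Icc_self htm))
    simp only [sub_self] at this
    exact this)
  filter_upwards [h1, h2, ae_restrict_mem measurableSet_Ioo] with t h3 h4 htm
  rw [sub_eq_zero.1 h3, sub_eq_zero.1 h4]
  exact he t (Ioo_subset_Icc_self htm)

theorem wave_sub_estimate {j : V →L[ℝ] H} (hj : Function.Injective j) (hd : DenseRange j) {T : ℝ}
    (hT : 0 < T) {z₀ : V} {ζ₀ : H} {G G' : ℝ → H} (hG : MemLp G 2 (timeMeasure T))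
    (hG' : MemLp G' 2 (timeMeasure T)) {z z' : ℝ → V} {ζ ζ' : ℝ → H} (hz : Continuous z)
    (hζ : Continuous ζ) (hz' : Continuous z') (hζ' : Continuous ζ')
    (h : ∀ t ∈ Icc 0 T, IsWave j z₀ ζ₀ G z ζ t) (h' : ∀ t ∈ Icc 0 T, IsWave j z₀ ζ₀ G' z' ζ' t) :
    ∀ t ∈ Icc 0 T, ‖z t - z' t‖ ^ 2 + ‖ζ t - ζ' t‖ ^ 2 ≤
      2 * Real.exp T * ∫ τ in 0..t, ‖G τ - G' τ‖ ^ 2 := by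
  obtain ⟨y, η, hyc, hηc, hw, he⟩ := exists_wave hj hd hT.le 0 0 (hG.sub hG')
  have hGi := hG.integrable (by norm_num)
  have hGi' := hG'.integrable (by norm_num)
  obtain ⟨h1, h2⟩ := wave_unique hj hd
    (((hz.sub hz').integrable_timeMeasure T).sub (hyc.integrable_timeMeasure T))
    (((hζ.sub hζ').integrable_timeMeasure T).sub (hηc.integrable_timeMeasure T)) (by
    filter_upwards [ae_restrict_mem measurableSet_Ioo] with t htm
    have ht := Ioo_subset_Icc_self htm
    have := IsWave.sub ((hz.sub hz').integrable_timeMeasure T)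
      ((hζ.sub hζ').integrable_timeMeasure T) (hGi.sub hGi') (hyc.integrable_timeMeasure T)
      (hηc.integrable_timeMeasure T) (hGi.sub hGi') ht
      (IsWave.sub (hz.integrable_timeMeasure T) (hζ.integrable_timeMeasure T) hGi
        (hz'.integrable_timeMeasure T) (hζ'.integrable_timeMeasure T) hGi' ht (h t ht) (h' t ht))
      (hw t ht)
    simp only [sub_self] at this
    exact this)
  have e1 := Measure.eqOn_Icc_of_ae_eq volume hT.ne (ae_restrict_of_ae_eq_of_ae_restrict
    Ioo_ae_eq_Icc h1) ((hz.sub hz').sub hyc).continuousOn continuousOn_const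
  have e2 := Measure.eqOn_Icc_of_ae_eq volume hT.ne (ae_restrict_of_ae_eq_of_ae_restrict
    Ioo_ae_eq_Icc h2) ((hζ.sub hζ').sub hηc).continuousOn continuousOn_const
  intro t ht
  have h3 := he t ht
  rw [← sub_eq_zero.1 (e1 ht), ← sub_eq_zero.1 (e2 ht)] at h3
  simpa using h3

end Wave

/-! ### Third order equations in a Hilbert space -/

section ThirdOrder

variable {V H : Type*} [NormedAddCommGroup V] [InnerProductSpace ℝ V] [CompleteSpace V]
  [NormedAddCommGroup H] [InnerProductSpace ℝ H] [CompleteSpace H]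

/-- `(u, v, w) = (u, u', u'')` solves `u''' + α u'' + A u' + κ A u + g = 0` with initial values
`u₀, u₁, u₂`, in integrated form; `j† = A⁻¹` has been applied to the equation. -/
def IsThirdOrder (j : V →L[ℝ] H) (κ α : ℝ) (u₀ u₁ : V) (u₂ : H) (g : ℝ → H) (u v : ℝ → V)
    (w : ℝ → H) (t : ℝ) : Prop :=
  u t = u₀ + ∫ τ in 0..t, v τ ∧ j (v t) = j u₁ + ∫ τ in 0..t, w τ ∧
    j.adjoint (w t) = j.adjoint u₂
      - ∫ τ in 0..t, (v τ + κ • u τ + j.adjoint (α • w τ + g τ))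

theorem integral_wave_velocity {j : V →L[ℝ] H} {κ : ℝ} {v : ℝ → V} {w : ℝ → H} {t : ℝ}
    (hv : IntervalIntegrable v volume 0 t) (hw : IntervalIntegrable w volume 0 t) :
    ∫ τ in 0..t, (w τ + κ • j (v τ)) = (∫ τ in 0..t, w τ) + κ • j (∫ τ in 0..t, v τ) := by
  have h : IntervalIntegrable (fun τ => κ • j (v τ)) volume 0 t :=
    ⟨(j.integrable_comp hv.1).smul κ, (j.integrable_comp hv.2).smul κ⟩
  rw [intervalIntegral.integral_add hw h, intervalIntegral.integral_smul,
    j.intervalIntegral_comp_comm hv]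

theorem integral_wave_force {j : V →L[ℝ] H} {κ α : ℝ} {g : ℝ → H} {u v : ℝ → V} {w : ℝ → H}
    {T t : ℝ} (hu : Integrable u (timeMeasure T)) (hv : Integrable v (timeMeasure T))
    (hw : Integrable w (timeMeasure T)) (hg : Integrable g (timeMeasure T)) (ht : t ∈ Icc 0 T) :
    ∫ τ in 0..t, (v τ + κ • u τ - j.adjoint (-g τ - (α - κ) • w τ))
      = (∫ τ in 0..t, (v τ + κ • u τ + j.adjoint (α • w τ + g τ)))
        - κ • j.adjoint (∫ τ in 0..t, w τ) := by
  have h : IntervalIntegrable (fun τ => κ • j.adjoint (w τ)) volume 0 t :=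
    intervalIntegrable_of_timeMeasure ((j.adjoint.integrable_comp hw).smul κ) ht
  have ijg : IntervalIntegrable (fun τ => v τ + κ • u τ + j.adjoint (α • w τ + g τ)) volume 0 t :=
    intervalIntegrable_of_timeMeasure ((hv.add (hu.smul κ)).add
      (j.adjoint.integrable_comp ((hw.smul α).add hg))) ht
  have e : ∀ τ, v τ + κ • u τ - j.adjoint (-g τ - (α - κ) • w τ)
        = (v τ + κ • u τ + j.adjoint (α • w τ + g τ)) - κ • j.adjoint (w τ) := by
    intro τ
    simp only [map_sub, map_neg, map_add, map_smul, sub_smul]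
    abel
  simp only [e]
  rw [intervalIntegral.integral_sub ijg h, intervalIntegral.integral_smul,
    j.adjoint.intervalIntegral_comp_comm (intervalIntegrable_of_timeMeasure hw ht)]

/-- The substitution `z = u' + κ u` turns the third order equation into a wave equation. -/
theorem IsThirdOrder.isWave {j : V →L[ℝ] H} {κ α : ℝ} {u₀ u₁ : V} {u₂ : H} {g : ℝ → H}
    {u v : ℝ → V} {w : ℝ → H} {T t : ℝ} (hu : Integrable u (timeMeasure T))
    (hv : Integrable v (timeMeasure T)) (hw : Integrable w (timeMeasure T))
    (hg : Integrable g (timeMeasure T)) (ht : t ∈ Icc 0 T)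
    (h : IsThirdOrder j κ α u₀ u₁ u₂ g u v w t) :
    IsWave j (u₁ + κ • u₀) (u₂ + κ • j u₁) (fun τ => -g τ - (α - κ) • w τ)
      (fun τ => v τ + κ • u τ) (fun τ => w τ + κ • j (v τ)) t := by
  obtain ⟨h1, h2, h3⟩ := h
  constructor
  · simp only
    rw [integral_wave_velocity (intervalIntegrable_of_timeMeasure hv ht)
      (intervalIntegrable_of_timeMeasure hw ht), h1, map_add, h2]
    simp only [map_add, map_smul, smul_add]
    abel
  · simp only
    rw [integral_wave_force hu hv hw hg ht, map_add, map_smul, h3, h2]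
    simp only [map_add, map_smul, smul_add]
    abel

/-- A solution of the wave equation for `z = u' + κ u` gives one of the third order equation. -/
theorem IsWave.isThirdOrder {j : V →L[ℝ] H} {κ α : ℝ} {u₀ u₁ : V} {u₂ : H} {g : ℝ → H}
    {u v : ℝ → V} {w : ℝ → H} {T t : ℝ} (hu : Integrable u (timeMeasure T))
    (hv : Integrable v (timeMeasure T)) (hw : Integrable w (timeMeasure T))
    (hg : Integrable g (timeMeasure T)) (ht : t ∈ Icc 0 T) (h1 : u t = u₀ + ∫ τ in 0..t, v τ)
    (h : IsWave j (u₁ + κ • u₀) (u₂ + κ • j u₁) (fun τ => -g τ - (α - κ) • w τ)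
      (fun τ => v τ + κ • u τ) (fun τ => w τ + κ • j (v τ)) t) :
    IsThirdOrder j κ α u₀ u₁ u₂ g u v w t := by
  obtain ⟨h2, h3⟩ := h
  simp only at h2 h3
  rw [integral_wave_velocity (intervalIntegrable_of_timeMeasure hv ht)
      (intervalIntegrable_of_timeMeasure hw ht), h1] at h2
  rw [integral_wave_force hu hv hw hg ht] at h3
  have h2' : j (v t) = j u₁ + ∫ τ in 0..t, w τ := by
    simp only [map_add, map_smul, smul_add] at h2
    rw [← sub_eq_zero] at h2 ⊢
    rw [← h2]; abel
  refine ⟨h1, h2', ?_⟩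
  rw [map_add, map_smul, h2'] at h3
  simp only [map_add, map_smul, smul_add] at h3 ⊢
  rw [← sub_eq_zero] at h3 ⊢
  rw [← h3]; abel

theorem norm_intervalIntegral_sq_le {F : Type*} [NormedAddCommGroup F] [NormedSpace ℝ F] {T : ℝ}
    {g : ℝ → F} (hg : MemLp g 2 (timeMeasure T)) {t : ℝ} (ht : t ∈ Icc 0 T) :
    ‖∫ τ in 0..t, g τ‖ ^ 2 ≤ T * ∫ τ in 0..t, ‖g τ‖ ^ 2 := by
  have hg' := memLp_timeMeasure_mono hg ht.2
  have h0 : 0 ≤ ∫ τ in Ioo 0 t, ‖g τ‖ ^ 2 := integral_nonneg fun _ => sq_nonneg _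
  rw [intervalIntegral_eq_integral_timeMeasure ht.1, intervalIntegral_eq_integral_timeMeasure ht.1]
  have h1 := (norm_integral_le_integral_norm g).trans (integral_norm_le_sqrt hg')
  have h2 : (timeMeasure t).real univ = t := by simp [timeMeasure, ht.1]
  rw [h2] at h1
  calc _ ≤ (Real.sqrt (t * ∫ τ in Ioo 0 t, ‖g τ‖ ^ 2)) ^ 2 := pow_le_pow_left₀ (norm_nonneg _) h1 2
    _ = t * ∫ τ in Ioo 0 t, ‖g τ‖ ^ 2 := Real.sq_sqrt (mul_nonneg ht.1 h0)
    _ ≤ _ := mul_le_mul_of_nonneg_right ht.2 h0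

theorem sq_intervalIntegral_mono {F F' : Type*} [NormedAddCommGroup F] [NormedAddCommGroup F']
    {T c : ℝ} {g : ℝ → F} {h : ℝ → F'} (hg : MemLp g 2 (timeMeasure T))
    (hh : MemLp h 2 (timeMeasure T)) (hgh : ∀ᵐ τ ∂timeMeasure T, ‖g τ‖ ≤ c * ‖h τ‖) {t : ℝ}
    (ht : t ∈ Icc 0 T) : ∫ τ in 0..t, ‖g τ‖ ^ 2 ≤ c ^ 2 * ∫ τ in 0..t, ‖h τ‖ ^ 2 := by
  rw [intervalIntegral_eq_integral_timeMeasure ht.1, intervalIntegral_eq_integral_timeMeasure ht.1,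
    ← integral_const_mul]
  refine integral_mono_ae (integrable_norm_sq_of_memLp (memLp_timeMeasure_mono hg ht.2))
    ((integrable_norm_sq_of_memLp (memLp_timeMeasure_mono hh ht.2)).const_mul _) ?_
  filter_upwards [ae_restrict_of_ae_restrict_of_subset (Ioo_subset_Ioo_right ht.2) hgh] with τ hτ
  rw [← mul_pow]
  exact pow_le_pow_left₀ (norm_nonneg _) hτ 2

/-- Existence for the semilinear third order equation with a globally Lipschitz nonlinearity, by a
fixed point in `C([0,T]; V × V × H)`: given `(u, z, ζ)`, solve the wave equation for
`z = u' + κ u` with the lower order terms evaluated at `(u, z, ζ)`, and recover the new `u` from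
`u' = z - κ u`. -/
theorem exists_thirdOrder {j : V →L[ℝ] H} (hj : Function.Injective j) (hd : DenseRange j) {T : ℝ}
    (hT : 0 < T) (κ α : ℝ) (u₀ u₁ : V) (u₂ : H) {g : ℝ → V → H} {M : ℝ} (hM : 0 ≤ M)
    (hmeas : ∀ u : ℝ → V, Continuous u →
      AEStronglyMeasurable (fun t => g t (u t)) (timeMeasure T))
    (hlip : ∀ᵐ t ∂timeMeasure T, ∀ u u', ‖g t u - g t u'‖ ≤ M * ‖u - u'‖)
    (h0 : MemLp (fun t => g t 0) 2 (timeMeasure T)) :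
    ∃ (u v : ℝ → V) (w : ℝ → H), Continuous u ∧ Continuous v ∧ Continuous w ∧
      MemLp (fun t => g t (u t)) 2 (timeMeasure T) ∧
      ∀ t ∈ Icc 0 T, IsThirdOrder j κ α u₀ u₁ u₂ (fun τ => g τ (u τ)) u v w t := by
  have hgL : ∀ u : ℝ → V, Continuous u → MemLp (fun t => g t (u t)) 2 (timeMeasure T) := by
    intro u hu
    refine MemLp.mono' (h0.norm.add ((hu.memLp_timeMeasure T 2).norm.const_mul M)) (hmeas u hu) ?_
    filter_upwards [hlip] with t ht
    have := ht (u t) 0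
    rw [sub_zero] at this
    calc ‖g t (u t)‖ = ‖g t 0 + (g t (u t) - g t 0)‖ := by congr 1; abel
      _ ≤ ‖g t 0‖ + M * ‖u t‖ := (norm_add_le _ _).trans (add_le_add_right this _)
  let X := V × V × H
  let p1 : C(Icc 0 T, X) → ℝ → V := fun U t => (IccExtend hT.le U t).1
  let p2 : C(Icc 0 T, X) → ℝ → V := fun U t => (IccExtend hT.le U t).2.1
  let p3 : C(Icc 0 T, X) → ℝ → H := fun U t => (IccExtend hT.le U t).2.2
  have hc : ∀ U : C(Icc 0 T, X), Continuous (IccExtend hT.le U) := fun U =>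
    U.continuous.Icc_extend'
  have hc1 : ∀ U, Continuous (p1 U) := fun U => (hc U).fst
  have hc2 : ∀ U, Continuous (p2 U) := fun U => (hc U).snd.fst
  have hc3 : ∀ U, Continuous (p3 U) := fun U => (hc U).snd.snd
  -- `pv` and `pw` are the velocity `u' = z - κ u` and the acceleration `u'' = ζ - κ j u'`.
  let pv : C(Icc 0 T, X) → ℝ → V := fun U t => p2 U t - κ • p1 U t
  let pw : C(Icc 0 T, X) → ℝ → H := fun U t => p3 U t - κ • j (pv U t)
  have hcv : ∀ U, Continuous (pv U) := fun U => (hc2 U).sub ((hc1 U).const_smul κ)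
  have hcw : ∀ U, Continuous (pw U) := fun U =>
    (hc3 U).sub ((j.continuous.comp (hcv U)).const_smul κ)
  let G : C(Icc 0 T, X) → ℝ → H := fun U t => -g t (p1 U t) - (α - κ) • pw U t
  have hG : ∀ U, MemLp (G U) 2 (timeMeasure T) := fun U =>
    (hgL _ (hc1 U)).neg.sub (((hcw U).memLp_timeMeasure T 2).const_smul (α - κ))
  choose Z Y hZ hY hZY using fun U => (by
    obtain ⟨z, ζ, h1, h2, h3, -⟩ := exists_wave hj hd hT.le (u₁ + κ • u₀) (u₂ + κ • j u₁) (hG U)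
    exact ⟨z, ζ, h1, h2, h3⟩ : ∃ (z : ℝ → V) (ζ : ℝ → H), Continuous z ∧ Continuous ζ ∧
      ∀ t ∈ Icc 0 T, IsWave j (u₁ + κ • u₀) (u₂ + κ • j u₁) (G U) z ζ t)
  have hcI : ∀ U, Continuous fun t => u₀ + ∫ τ in 0..t, pv U τ := fun U =>
    continuous_const.add (intervalIntegral.continuous_primitive
      (fun a b => (hcv U).intervalIntegrable _ _) 0)
  let Ψ : C(Icc 0 T, X) → C(Icc 0 T, X) := fun U =>
    ⟨fun t => (u₀ + ∫ τ in (0 : ℝ)..t, pv U τ, Z U t, Y U t),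
      (((hcI U).prodMk ((hZ U).prodMk (hY U)))).comp continuous_subtype_val⟩
  set c1 : ℝ := 1 + |κ| with hc1'
  set c2 : ℝ := M + |α - κ| * (1 + |κ| * (‖j‖ * c1)) with hc2'
  have hn : ∀ (U W : C(Icc 0 T, X)) (t : ℝ),
      ‖p1 U t - p1 W t‖ ≤ ‖IccExtend hT.le U t - IccExtend hT.le W t‖ ∧
      ‖p2 U t - p2 W t‖ ≤ ‖IccExtend hT.le U t - IccExtend hT.le W t‖ ∧
      ‖p3 U t - p3 W t‖ ≤ ‖IccExtend hT.le U t - IccExtend hT.le W t‖ := by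
    intro U W t
    set D := IccExtend hT.le U t - IccExtend hT.le W t with hD
    exact ⟨norm_fst_le D, (norm_fst_le D.2).trans (norm_snd_le D),
      (norm_snd_le D.2).trans (norm_snd_le D)⟩
  have hnv : ∀ (U W : C(Icc 0 T, X)) (t : ℝ),
      ‖pv U t - pv W t‖ ≤ c1 * ‖IccExtend hT.le U t - IccExtend hT.le W t‖ := by
    intro U W t
    obtain ⟨h1, h2, -⟩ := hn U W t
    have e : pv U t - pv W t = (p2 U t - p2 W t) - κ • (p1 U t - p1 W t) := by
      simp only [pv, smul_sub]; abel
    rw [e]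
    refine (norm_sub_le _ _).trans ?_
    rw [norm_smul, Real.norm_eq_abs, hc1', add_mul, one_mul]
    exact add_le_add h2 (mul_le_mul_of_nonneg_left h1 (abs_nonneg _))
  have hnw : ∀ (U W : C(Icc 0 T, X)) (t : ℝ), ‖pw U t - pw W t‖ ≤
      (1 + |κ| * (‖j‖ * c1)) * ‖IccExtend hT.le U t - IccExtend hT.le W t‖ := by
    intro U W t
    obtain ⟨-, -, h3⟩ := hn U W t
    have e : pw U t - pw W t = (p3 U t - p3 W t) - κ • j (pv U t - pv W t) := by
      simp only [pw, smul_sub, map_sub]; abel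
    rw [e]
    refine (norm_sub_le _ _).trans ?_
    rw [norm_smul, Real.norm_eq_abs, add_mul, one_mul, mul_assoc, mul_assoc]
    refine add_le_add h3 (mul_le_mul_of_nonneg_left ((j.le_opNorm _).trans ?_) (abs_nonneg _))
    exact mul_le_mul_of_nonneg_left (hnv U W t) (norm_nonneg _)
  have hnG : ∀ (U W : C(Icc 0 T, X)), ∀ᵐ t ∂timeMeasure T,
      ‖G U t - G W t‖ ≤ c2 * ‖IccExtend hT.le U t - IccExtend hT.le W t‖ := by
    intro U W
    filter_upwards [hlip] with t ht
    obtain ⟨h1, -, -⟩ := hn U W t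
    have e : G U t - G W t
        = -((g t (p1 U t) - g t (p1 W t)) + (α - κ) • (pw U t - pw W t)) := by
      simp only [G, smul_sub]; abel
    rw [e, norm_neg]
    refine (norm_add_le _ _).trans ?_
    rw [norm_smul, Real.norm_eq_abs, hc2', add_mul, mul_assoc]
    exact add_le_add ((ht _ _).trans (mul_le_mul_of_nonneg_left h1 hM))
      (mul_le_mul_of_nonneg_left (hnw U W t) (abs_nonneg _))
  obtain ⟨U, hU⟩ := exists_fixedPoint_of_causal hT.le
    (C := T * c1 ^ 2 + 2 * Real.exp T * c2 ^ 2) (by positivity) Ψ (by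
    intro U W t
    have hDm : MemLp (fun τ => IccExtend hT.le U τ - IccExtend hT.le W τ) 2 (timeMeasure T) :=
      ((hc U).sub (hc W)).memLp_timeMeasure T 2
    have hvm : MemLp (fun τ => pv U τ - pv W τ) 2 (timeMeasure T) :=
      ((hcv U).sub (hcv W)).memLp_timeMeasure T 2
    have a1 : ‖(Ψ U t).1 - (Ψ W t).1‖ ^ 2 ≤ T * (c1 ^ 2 *
        ∫ τ in (0 : ℝ)..t, ‖IccExtend hT.le U τ - IccExtend hT.le W τ‖ ^ 2) := by
      have e : (Ψ U t).1 - (Ψ W t).1 = ∫ τ in (0 : ℝ)..t, (pv U τ - pv W τ) := by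
        rw [intervalIntegral.integral_sub ((hcv U).intervalIntegrable _ _)
          ((hcv W).intervalIntegrable _ _)]
        change (u₀ + _) - (u₀ + _) = _
        abel
      rw [e]
      exact (norm_intervalIntegral_sq_le hvm t.2).trans (mul_le_mul_of_nonneg_left
        (sq_intervalIntegral_mono hvm hDm (Eventually.of_forall (hnv U W)) t.2) hT.le)
    have a2 := (wave_sub_estimate hj hd hT (hG U) (hG W) (hZ U) (hY U) (hZ W) (hY W) (hZY U)
      (hZY W) t t.2).trans (mul_le_mul_of_nonneg_left
        (sq_intervalIntegral_mono ((hG U).sub (hG W)) hDm (hnG U W) t.2) (by positivity))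
    have a3 : ‖Ψ U t - Ψ W t‖ ^ 2 ≤ ‖(Ψ U t).1 - (Ψ W t).1‖ ^ 2
        + (‖Z U t - Z W t‖ ^ 2 + ‖Y U t - Y W t‖ ^ 2) := by
      have e : ‖Ψ U t - Ψ W t‖ = max ‖(Ψ U t).1 - (Ψ W t).1‖
          (max ‖Z U t - Z W t‖ ‖Y U t - Y W t‖) := rfl
      rw [e]
      have s1 := sq_nonneg ‖(Ψ U t).1 - (Ψ W t).1‖
      have s2 := sq_nonneg ‖Z U t - Z W t‖
      have s3 := sq_nonneg ‖Y U t - Y W t‖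
      rcases max_choice ‖(Ψ U t).1 - (Ψ W t).1‖ (max ‖Z U t - Z W t‖ ‖Y U t - Y W t‖) with h | h
      · rw [h]; linarith
      · rw [h]
        rcases max_choice ‖Z U t - Z W t‖ ‖Y U t - Y W t‖ with h | h <;> rw [h] <;> linarith
    refine a3.trans ((add_le_add a1 a2).trans (le_of_eq ?_))
    ring)
  have hUt : ∀ t, ∀ ht : t ∈ Icc 0 T,
      p1 U t = u₀ + ∫ τ in 0..t, pv U τ ∧ p2 U t = Z U t ∧ p3 U t = Y U t := by
    intro t ht
    have h1 : IccExtend hT.le U t = Ψ U ⟨t, ht⟩ := by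
      rw [IccExtend_of_mem hT.le _ ht, hU]
    exact ⟨congrArg Prod.fst h1, congrArg (fun x => x.2.1) h1, congrArg (fun x => x.2.2) h1⟩
  refine ⟨p1 U, pv U, pw U, hc1 U, hcv U, hcw U, hgL _ (hc1 U), fun t ht => ?_⟩
  refine IsWave.isThirdOrder ((hc1 U).integrable_timeMeasure T) ((hcv U).integrable_timeMeasure T)
    ((hcw U).integrable_timeMeasure T) ((hgL _ (hc1 U)).integrable (by norm_num)) ht
    (hUt t ht).1 ?_
  have hw := hZY U t ht
  have ez : ∀ τ, pv U τ + κ • p1 U τ = p2 U τ := fun τ => by simp only [pv]; abel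
  have eζ : ∀ τ, pw U τ + κ • j (pv U τ) = p3 U τ := fun τ => by simp only [pw]; abel
  simp only [ez, eζ]
  refine ⟨?_, ?_⟩
  · simp only
    rw [(hUt t ht).2.1, hw.1]
    congr 1
    refine intervalIntegral.integral_congr fun τ hτ => ?_
    rw [uIcc_of_le ht.1] at hτ
    exact (hUt τ ⟨hτ.1, hτ.2.trans ht.2⟩).2.2.symm
  · simp only
    rw [(hUt t ht).2.2, hw.2]
    congr 1
    refine intervalIntegral.integral_congr fun τ hτ => ?_
    rw [uIcc_of_le ht.1] at hτ
    rw [(hUt τ ⟨hτ.1, hτ.2.trans ht.2⟩).2.1]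

/-- The energy estimate for the third order equation. -/
theorem thirdOrder_estimate {j : V →L[ℝ] H} (hj : Function.Injective j) (hd : DenseRange j)
    {T : ℝ} (hT : 0 ≤ T) (κ α M : ℝ) : ∃ C, 0 ≤ C ∧
    ∀ (u₀ u₁ : V) (u₂ : H) (g F : ℝ → H) (u v : ℝ → V) (w : ℝ → H),
      MemLp g 2 (timeMeasure T) → MemLp F 2 (timeMeasure T) → MemLp u ∞ (timeMeasure T) →
      MemLp v ∞ (timeMeasure T) → MemLp w ∞ (timeMeasure T) →
      (∀ᵐ t ∂timeMeasure T, ‖g t‖ ≤ M * ‖u t‖ + ‖F t‖) →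
      (∀ᵐ t ∂timeMeasure T, IsThirdOrder j κ α u₀ u₁ u₂ g u v w t) →
      ∀ᵐ t ∂timeMeasure T, ‖u t‖ ^ 2 + ‖v t‖ ^ 2 + ‖w t‖ ^ 2 ≤
        C * (‖u₀‖ ^ 2 + ‖u₁‖ ^ 2 + ‖u₂‖ ^ 2 + ∫ τ in Ioo 0 T, ‖F τ‖ ^ 2) := by
  set k2 : ℝ := κ ^ 2 with hk2
  set J : ℝ := ‖j‖ ^ 2 with hJ
  have hk0 : 0 ≤ k2 := sq_nonneg _
  have hJ0 : 0 ≤ J := sq_nonneg _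
  set e2 : ℝ := 2 * Real.exp T with he2
  have he0 : 0 < e2 := by positivity
  -- `y ≤ A (‖u‖² + ‖z‖² + ‖ζ‖²)` for `y = ‖u‖² + ‖v‖² + ‖w‖²`
  set A : ℝ := 1 + (2 + 2 * k2) + (2 + 2 * k2 * J * (2 + 2 * k2)) with hA
  -- `‖G‖² ≤ B (‖F‖² + y)`
  set B : ℝ := 2 * (2 * M ^ 2 + 2) + 2 * (α - κ) ^ 2 with hB
  set D : ℝ := 2 + 2 * k2 + (2 + 2 * k2 * J) with hD
  have hA0 : 0 ≤ A := by positivity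
  have hB0 : 0 ≤ B := by positivity
  have hD0 : 0 ≤ D := by positivity
  refine ⟨A * (2 + e2 * (D + B)) * Real.exp (A * (2 * T + e2 * B) * T), by positivity, ?_⟩
  intro u₀ u₁ u₂ g F u v w hg hF hu hv hw hgF h
  have hu2 := hu.mono_exponent (p := 2) le_top
  have hv2 := hv.mono_exponent (p := 2) le_top
  have hw2 := hw.mono_exponent (p := 2) le_top
  have hui := hu.integrable le_top
  have hvi := hv.integrable le_top
  have hwi := hw.integrable le_top
  have hgi := hg.integrable (by norm_num)
  set S : ℝ := ‖u₀‖ ^ 2 + ‖u₁‖ ^ 2 + ‖u₂‖ ^ 2 + ∫ τ in Ioo 0 T, ‖F τ‖ ^ 2 with hS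
  have hF0 : 0 ≤ ∫ τ in Ioo 0 T, ‖F τ‖ ^ 2 := integral_nonneg fun _ => sq_nonneg _
  have hS0 : 0 ≤ S := by positivity
  have hF2 := integrable_norm_sq_of_memLp hF
  have hyi : Integrable (fun t => ‖u t‖ ^ 2 + ‖v t‖ ^ 2 + ‖w t‖ ^ 2) (timeMeasure T) :=
    ((integrable_norm_sq_of_memLp hu2).add (integrable_norm_sq_of_memLp hv2)).add
      (integrable_norm_sq_of_memLp hw2)
  have hGm : MemLp (fun τ => -g τ - (α - κ) • w τ) 2 (timeMeasure T) :=
    hg.neg.sub (hw2.const_smul (α - κ))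
  have hwave := wave_estimate hj hd hT hGm (hvi.add (hui.smul κ))
    (hwi.add ((j.integrable_comp hvi).smul κ)) (by
      filter_upwards [h, ae_restrict_mem measurableSet_Ioo] with t ht htm
      exact ht.isWave hui hvi hwi hgi (Ioo_subset_Icc_self htm))
  have nj : ∀ x, ‖j x‖ ^ 2 ≤ J * ‖x‖ ^ 2 := by
    intro x
    rw [hJ, ← mul_pow]
    exact pow_le_pow_left₀ (norm_nonneg _) (j.le_opNorm x) 2
  have hdata : ‖u₁ + κ • u₀‖ ^ 2 + ‖u₂ + κ • j u₁‖ ^ 2 ≤ D * S := by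
    have a1 := norm_add_sq_le_two u₁ (κ • u₀)
    have a2 := norm_add_sq_le_two u₂ (κ • j u₁)
    rw [norm_smul, mul_pow, Real.norm_eq_abs, sq_abs] at a1 a2
    have a3 := mul_le_mul_of_nonneg_left (nj u₁) hk0
    have b0 : ‖u₀‖ ^ 2 ≤ S := by rw [hS]; linarith [sq_nonneg ‖u₁‖, sq_nonneg ‖u₂‖]
    have b1 : ‖u₁‖ ^ 2 ≤ S := by rw [hS]; linarith [sq_nonneg ‖u₀‖, sq_nonneg ‖u₂‖]
    have b2 : ‖u₂‖ ^ 2 ≤ S := by rw [hS]; linarith [sq_nonneg ‖u₁‖, sq_nonneg ‖u₀‖]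
    have c0 := mul_le_mul_of_nonneg_left b0 hk0
    have c1 := mul_le_mul_of_nonneg_left b1 (mul_nonneg hk0 hJ0)
    rw [hD]; linarith
  have hmain : ∀ᵐ t ∂timeMeasure T, ‖u t‖ ^ 2 + ‖v t‖ ^ 2 + ‖w t‖ ^ 2 ≤
      A * (2 + e2 * (D + B)) * S + A * (2 * T + e2 * B) *
        ∫ τ in 0..t, (‖u τ‖ ^ 2 + ‖v τ‖ ^ 2 + ‖w τ‖ ^ 2) := by
    filter_upwards [hwave, h, ae_restrict_mem measurableSet_Ioo] with t h1 h2 htm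
    have ht := Ioo_subset_Icc_self htm
    set I : ℝ := ∫ τ in 0..t, (‖u τ‖ ^ 2 + ‖v τ‖ ^ 2 + ‖w τ‖ ^ 2) with hI
    have hu' : ‖u t‖ ^ 2 ≤ 2 * S + 2 * T * I := by
      rw [h2.1]
      have a1 := norm_add_sq_le_two u₀ (∫ τ in 0..t, v τ)
      have a2 := norm_intervalIntegral_sq_le hv2 ht
      have a3 : ∫ τ in 0..t, ‖v τ‖ ^ 2 ≤ I := by
        refine intervalIntegral.integral_mono_on ht.1
          (intervalIntegrable_of_timeMeasure (integrable_norm_sq_of_memLp hv2) ht)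
          (intervalIntegrable_of_timeMeasure hyi ht) fun τ _ => ?_
        linarith [sq_nonneg ‖u τ‖, sq_nonneg ‖w τ‖]
      have a4 := mul_le_mul_of_nonneg_left a3 hT
      have b0 : ‖u₀‖ ^ 2 ≤ S := by rw [hS]; linarith [sq_nonneg ‖u₁‖, sq_nonneg ‖u₂‖]
      linarith
    have hGI : ∫ τ in 0..t, ‖-g τ - (α - κ) • w τ‖ ^ 2 ≤ B * (S + I) := by
      have iF := intervalIntegrable_of_timeMeasure hF2 ht
      have iy := intervalIntegrable_of_timeMeasure hyi ht
      have a1 : ∫ τ in 0..t, ‖-g τ - (α - κ) • w τ‖ ^ 2 ≤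
          ∫ τ in 0..t, B * (‖F τ‖ ^ 2 + (‖u τ‖ ^ 2 + ‖v τ‖ ^ 2 + ‖w τ‖ ^ 2)) := by
        rw [intervalIntegral_eq_integral_timeMeasure ht.1,
          intervalIntegral_eq_integral_timeMeasure ht.1]
        refine integral_mono_ae (integrable_norm_sq_of_memLp (memLp_timeMeasure_mono hGm ht.2))
          (Integrable.const_mul (IntegrableOn.mono_set (hF2.add hyi) (Ioo_subset_Ioo_right ht.2)) B)
          ?_
        filter_upwards [ae_restrict_of_ae_restrict_of_subset (Ioo_subset_Ioo_right ht.2) hgF]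
          with τ hτ
        have b1 := norm_add_sq_le_two (-g τ) (-((α - κ) • w τ))
        rw [← sub_eq_add_neg, norm_neg, norm_neg, norm_smul, mul_pow, Real.norm_eq_abs,
          sq_abs] at b1
        have b2 : ‖g τ‖ ^ 2 ≤ 2 * M ^ 2 * ‖u τ‖ ^ 2 + 2 * ‖F τ‖ ^ 2 := by
          refine (pow_le_pow_left₀ (norm_nonneg _) hτ 2).trans ?_
          linarith [sq_nonneg (M * ‖u τ‖ - ‖F τ‖)]
        have c1 : 0 ≤ M ^ 2 * ‖v τ‖ ^ 2 := by positivity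
        have c2 : 0 ≤ M ^ 2 * ‖w τ‖ ^ 2 := by positivity
        have c3 : 0 ≤ M ^ 2 * ‖F τ‖ ^ 2 := by positivity
        have c4 : 0 ≤ (α - κ) ^ 2 * ‖v τ‖ ^ 2 := by positivity
        have c5 : 0 ≤ (α - κ) ^ 2 * ‖u τ‖ ^ 2 := by positivity
        have c6 : 0 ≤ (α - κ) ^ 2 * ‖F τ‖ ^ 2 := by positivity
        rw [hB]
        linarith [sq_nonneg ‖u τ‖, sq_nonneg ‖v τ‖, sq_nonneg ‖w τ‖]
      refine a1.trans ?_
      rw [intervalIntegral.integral_const_mul, intervalIntegral.integral_add iF iy]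
      refine mul_le_mul_of_nonneg_left (add_le_add_left ?_ _) hB0
      refine (intervalIntegral_le_timeMeasure hF2 (fun _ => sq_nonneg _) ht).trans ?_
      rw [hS]; linarith [sq_nonneg ‖u₁‖, sq_nonneg ‖u₀‖, sq_nonneg ‖u₂‖]
    have hz : ‖v t + κ • u t‖ ^ 2 + ‖w t + κ • j (v t)‖ ^ 2 ≤ e2 * (D * S + B * (S + I)) :=
      h1.trans (mul_le_mul_of_nonneg_left (add_le_add hdata hGI) he0.le)
    set zz : ℝ := ‖v t + κ • u t‖ ^ 2 with hzz
    set ww : ℝ := ‖w t + κ • j (v t)‖ ^ 2 with hww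
    have hv' : ‖v t‖ ^ 2 ≤ 2 * zz + 2 * k2 * ‖u t‖ ^ 2 := by
      have := norm_add_sq_le_two (v t + κ • u t) (-(κ • u t))
      rw [add_neg_cancel_right, norm_neg, norm_smul, mul_pow, Real.norm_eq_abs, sq_abs] at this
      rw [hk2]; linarith
    have hw' : ‖w t‖ ^ 2 ≤ 2 * ww + 2 * k2 * (J * ‖v t‖ ^ 2) := by
      have := norm_add_sq_le_two (w t + κ • j (v t)) (-(κ • j (v t)))
      rw [add_neg_cancel_right, norm_neg, norm_smul, mul_pow, Real.norm_eq_abs, sq_abs] at this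
      have a := mul_le_mul_of_nonneg_left (nj (v t)) hk0
      rw [hk2] at a ⊢; linarith
    have zz0 : 0 ≤ zz := sq_nonneg _
    have ww0 : 0 ≤ ww := sq_nonneg _
    have hy : ‖u t‖ ^ 2 + ‖v t‖ ^ 2 + ‖w t‖ ^ 2 ≤ A * (‖u t‖ ^ 2 + (zz + ww)) := by
      have a := mul_le_mul_of_nonneg_left hv' (show 0 ≤ 2 * k2 * J by positivity)
      have uu0 := sq_nonneg ‖u t‖
      have c1 : 0 ≤ k2 * zz := by positivity
      have c2 : 0 ≤ k2 * ww := by positivity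
      have c3 : 0 ≤ k2 * J * zz := by positivity
      have c4 : 0 ≤ k2 * J * ww := by positivity
      have c5 : 0 ≤ k2 * J * ‖u t‖ ^ 2 := by positivity
      have c6 : 0 ≤ k2 * J * k2 * zz := by positivity
      have c7 : 0 ≤ k2 * J * k2 * ww := by positivity
      rw [hA]
      linarith
    refine hy.trans ((mul_le_mul_of_nonneg_left (add_le_add hu' hz) hA0).trans (le_of_eq ?_))
    ring
  have := gronwall_ae (mul_nonneg (by positivity) hS0) (by positivity) hyi hmain
  filter_upwards [this] with t ht
  refine ht.trans (le_of_eq ?_)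
  ring

end ThirdOrder

/-! ### Weak derivatives in time -/

section TimeCalculus

variable {X : Type*} [NormedAddCommGroup X] [InnerProductSpace ℝ X] [CompleteSpace X]

/-- Integration by parts in `(0,T)` for a primitive `c + ∫₀ᵗ h` and a curve `φ` with `φ' = ψ`,
`φ(T) = 0`. -/
theorem integral_inner_by_parts {T : ℝ} (hT : 0 ≤ T) {g h φ ψ : ℝ → X} {c : X}
    (hh : Integrable h (timeMeasure T)) (hψ : Integrable ψ (timeMeasure T))
    (hg : ∀ᵐ t ∂timeMeasure T, g t = c + ∫ τ in 0..t, h τ)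
    (hφ : ∀ t ∈ Icc 0 T, φ t = -∫ τ in t..T, ψ τ) :
    ∫ t in Ioo 0 T, ⟪g t, ψ t⟫_ℝ = -⟪c, φ 0⟫_ℝ - ∫ t in Ioo 0 T, ⟪h t, φ t⟫_ℝ := by
  let k : ℝ → ℝ → ℝ := fun t τ => (Iio t).indicator (fun τ => ⟪h τ, ψ t⟫_ℝ) τ
  have hk : Integrable (Function.uncurry k) ((timeMeasure T).prod (timeMeasure T)) := by
    refine Integrable.mono' (hψ.norm.mul_prod hh.norm) ?_ (Eventually.of_forall fun p => ?_)
    · have hm : AEStronglyMeasurable (fun p : ℝ × ℝ => ⟪h p.2, ψ p.1⟫_ℝ)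
          ((timeMeasure T).prod (timeMeasure T)) :=
        (hh.aestronglyMeasurable.comp_snd).inner (hψ.aestronglyMeasurable.comp_fst)
      exact hm.indicator (measurableSet_lt measurable_snd measurable_fst)
    · simp only [Function.uncurry, k]
      refine (norm_indicator_le_norm_self _ _).trans ?_
      rw [mul_comm]
      exact norm_inner_le_norm _ _
  have h1 : ∀ t ∈ Ioo 0 T, ∫ τ in Ioo 0 T, k t τ = ⟪∫ τ in 0..t, h τ, ψ t⟫_ℝ := by
    intro t ht
    rw [integral_indicator measurableSet_Iio, Measure.restrict_restrict measurableSet_Iio]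
    have e : Iio t ∩ Ioo 0 T = Ioo 0 t := by
      ext x; simp only [mem_inter_iff, mem_Iio, mem_Ioo]
      exact ⟨fun h => ⟨h.2.1, h.1⟩, fun h => ⟨h.2, h.1, h.2.trans ht.2⟩⟩
    rw [e, intervalIntegral_eq_integral_timeMeasure ht.1.le, real_inner_comm, ← integral_inner
      (IntegrableOn.mono_set hh (Ioo_subset_Ioo_right ht.2.le))]
    exact integral_congr_ae (Eventually.of_forall fun τ => real_inner_comm _ _)
  have h2 : ∀ τ ∈ Ioo 0 T, ∫ t in Ioo 0 T, k t τ = -⟪h τ, φ τ⟫_ℝ := by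
    intro τ hτ
    have e0 : ∀ t, k t τ = (Ioi τ).indicator (fun t => ⟪h τ, ψ t⟫_ℝ) t := by
      intro t
      simp only [k, indicator, mem_Iio, mem_Ioi]
    simp only [e0]
    rw [integral_indicator measurableSet_Ioi, Measure.restrict_restrict measurableSet_Ioi]
    have e : Ioi τ ∩ Ioo 0 T = Ioo τ T := by
      ext x; simp only [mem_inter_iff, mem_Ioi, mem_Ioo]
      exact ⟨fun h => ⟨h.1, h.2.2⟩, fun h => ⟨h.1, hτ.1.trans h.1, h.2⟩⟩
    rw [e, integral_inner (IntegrableOn.mono_set hψ (Ioo_subset_Ioo_left hτ.1.le)),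
      hφ τ (Ioo_subset_Icc_self hτ), inner_neg_right, neg_neg,
      intervalIntegral.integral_of_le hτ.2.le, integral_Ioc_eq_integral_Ioo]
  have hψφ : ∫ t in Ioo 0 T, ψ t = -φ 0 := by
    rw [hφ 0 (left_mem_Icc.2 hT), neg_neg, intervalIntegral_eq_integral_timeMeasure hT]
  have hki : Integrable (fun t => ⟪∫ τ in 0..t, h τ, ψ t⟫_ℝ) (timeMeasure T) := by
    refine hk.integral_prod_left.congr ?_
    filter_upwards [ae_restrict_mem measurableSet_Ioo] with t ht
    exact h1 t ht
  calc ∫ t in Ioo 0 T, ⟪g t, ψ t⟫_ℝ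
      = ∫ t in Ioo 0 T, (⟪c, ψ t⟫_ℝ + ⟪∫ τ in 0..t, h τ, ψ t⟫_ℝ) := by
        refine integral_congr_ae ?_
        filter_upwards [hg] with t ht
        rw [ht, inner_add_left]
    _ = -⟪c, φ 0⟫_ℝ + ∫ t in Ioo 0 T, ⟪∫ τ in 0..t, h τ, ψ t⟫_ℝ := by
        rw [integral_add (hψ.const_inner c) hki, integral_inner hψ, hψφ, inner_neg_right]
    _ = -⟪c, φ 0⟫_ℝ + ∫ t in Ioo 0 T, ∫ τ in Ioo 0 T, k t τ := by
        congr 1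
        exact setIntegral_congr_fun measurableSet_Ioo fun t ht => (h1 t ht).symm
    _ = -⟪c, φ 0⟫_ℝ + ∫ τ in Ioo 0 T, ∫ t in Ioo 0 T, k t τ := by
        rw [integral_integral_swap hk]
    _ = _ := by
        rw [setIntegral_congr_fun measurableSet_Ioo h2, integral_neg, sub_eq_add_neg]

/-- Integration by parts against a smooth scalar function vanishing at `T`. -/
theorem integral_smul_by_parts {T : ℝ} (hT : 0 ≤ T) {g h : ℝ → X} {c : X} {η : ℝ → ℝ}
    (hη : ContDiff ℝ ∞ η) (hηT : η T = 0) (hgi : Integrable g (timeMeasure T))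
    (hh : Integrable h (timeMeasure T))
    (hg : ∀ᵐ t ∂timeMeasure T, g t = c + ∫ τ in 0..t, h τ) :
    ∫ t in Ioo 0 T, deriv η t • g t = -(η 0 • c) - ∫ t in Ioo 0 T, η t • h t := by
  have hηc : Continuous η := hη.continuous
  have hη'c : Continuous (deriv η) := hη.continuous_deriv (by simp)
  have hbdd : ∀ {f : ℝ → ℝ}, Continuous f → ∀ {k : ℝ → X}, Integrable k (timeMeasure T) →
      Integrable (fun t => f t • k t) (timeMeasure T) := by
    intro f hf k hk
    obtain ⟨C, hC⟩ := isCompact_Icc.exists_bound_of_continuousOn (hf.continuousOn (s := Icc 0 T))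
    refine hk.bdd_smul C hf.aestronglyMeasurable ?_
    filter_upwards [ae_restrict_mem measurableSet_Ioo] with t ht
    exact hC t (Ioo_subset_Icc_self ht)
  refine ext_inner_left ℝ fun y => ?_
  have h1 := integral_inner_by_parts hT (φ := fun t => η t • y) (ψ := fun t => deriv η t • y) hh
    ((hη'c.smul continuous_const).integrable_timeMeasure T) hg (by
      intro t ht
      rw [intervalIntegral.integral_smul_const, intervalIntegral.integral_deriv_eq_sub
        (fun x _ => (hη.differentiable (by simp)).differentiableAt)
        (hη'c.intervalIntegrable _ _), hηT, zero_sub, neg_smul, neg_neg])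
  rw [inner_sub_right, inner_neg_right, ← integral_inner (hbdd hη'c hgi),
    ← integral_inner (hbdd hηc hh)]
  simp only [inner_smul_right] at h1 ⊢
  simp only [real_inner_comm y] at h1 ⊢
  exact h1

theorem hasWeakDeriv_of_primitive {T : ℝ} (hT : 0 ≤ T) {g h : ℝ → X} {c : X}
    (hgi : Integrable g (timeMeasure T)) (hh : Integrable h (timeMeasure T))
    (hg : ∀ᵐ t ∂timeMeasure T, g t = c + ∫ τ in 0..t, h τ) : HasWeakDeriv T g h := by
  intro η hη _ hsupp
  have h0 : η 0 = 0 := by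
    by_contra h
    exact lt_irrefl _ (hsupp (subset_tsupport _ h)).1
  have h1 : η T = 0 := by
    by_contra h
    exact lt_irrefl _ (hsupp (subset_tsupport _ h)).2
  rw [integral_smul_by_parts hT hη h1 hgi hh hg, h0, zero_smul, neg_zero, zero_sub]

/-- A test function with integral zero is the derivative of a test function. -/
theorem exists_smooth_primitive {T : ℝ} {ζ : ℝ → ℝ} (hζ : ContDiff ℝ ∞ ζ)
    (hc : HasCompactSupport ζ) (hs : tsupport ζ ⊆ Ioo 0 T) (h0 : ∫ t, ζ t = 0) :
    ∃ η : ℝ → ℝ, ContDiff ℝ ∞ η ∧ HasCompactSupport η ∧ tsupport η ⊆ Ioo 0 T ∧ deriv η = ζ := by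
  have hint : Integrable ζ := hζ.continuous.integrable_of_hasCompactSupport hc
  rcases (tsupport ζ).eq_empty_or_nonempty with he | hne
  · have hz : ζ = 0 := tsupport_eq_empty_iff.1 he
    refine ⟨0, contDiff_const, HasCompactSupport.zero, ?_, ?_⟩
    · rw [tsupport_eq_empty_iff.2 rfl]; exact empty_subset _
    · rw [hz]; ext t; simp
  obtain ⟨a, ha, hamin⟩ := IsCompact.exists_isLeast hc hne
  obtain ⟨b, hb, hbmax⟩ := IsCompact.exists_isGreatest hc hne
  have hout : ∀ t, t ∉ Icc a b → ζ t = 0 := by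
    intro t ht
    by_contra h
    exact ht ⟨hamin (subset_tsupport _ h), hbmax (subset_tsupport _ h)⟩
  let η : ℝ → ℝ := fun t => ∫ τ in Iic t, ζ τ
  have hηd : ∀ t, HasDerivAt η (ζ t) t := by
    intro t
    have e : η = fun t => (∫ τ in Iic (0 : ℝ), ζ τ) + ∫ τ in (0 : ℝ)..t, ζ τ := by
      ext t
      rw [← intervalIntegral.integral_Iic_sub_Iic hint.integrableOn hint.integrableOn,
        add_sub_cancel]
    rw [e]
    exact (intervalIntegral.integral_hasDerivAt_right (hζ.continuous.intervalIntegrable _ _)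
      hζ.continuous.stronglyMeasurable.stronglyMeasurableAtFilter
      hζ.continuous.continuousAt).const_add _
  have hderiv : deriv η = ζ := funext fun t => (hηd t).deriv
  have hηout : ∀ t, t ∉ Icc a b → η t = 0 := by
    intro t ht
    rw [mem_Icc, not_and_or, not_le, not_le] at ht
    rcases ht with ht | ht
    · exact setIntegral_eq_zero_of_forall_eq_zero fun x hx =>
        hout x fun h => absurd (h.1.trans hx) (not_le.2 ht)
    · rw [← h0]
      refine setIntegral_eq_integral_of_forall_compl_eq_zero fun x hx => ?_
      exact hout x fun h => hx (h.2.trans ht.le)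
  have hsub : tsupport η ⊆ Icc a b :=
    closure_minimal (fun t ht => by_contra fun h => ht (hηout t h)) isClosed_Icc
  refine ⟨η, ?_, ?_, ?_, hderiv⟩
  · rw [contDiff_infty_iff_deriv, hderiv]
    exact ⟨fun t => (hηd t).differentiableAt, hζ⟩
  · exact isCompact_Icc.of_isClosed_subset (isClosed_tsupport _) hsub
  · exact hsub.trans (Icc_subset_Ioo (hs ha).1 (hs hb).2)

/-- The lemma of du Bois-Reymond: a function with an integrable weak derivative is a primitive. -/
theorem exists_primitive_of_hasWeakDeriv {T : ℝ} (hT : 0 < T) {g h : ℝ → X}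
    (hgi : Integrable g (timeMeasure T)) (hh : Integrable h (timeMeasure T))
    (hw : HasWeakDeriv T g h) : ∃ c, ∀ᵐ t ∂timeMeasure T, g t = c + ∫ τ in 0..t, h τ := by
  set p : ℝ → X := fun t => ∫ τ in 0..t, (Ioo 0 T).indicator h τ with hp
  have hind : Integrable ((Ioo 0 T).indicator h) :=
    IntegrableOn.integrable_indicator hh measurableSet_Ioo
  have hpc : Continuous p :=
    intervalIntegral.continuous_primitive (fun a b => hind.intervalIntegrable) 0
  have hph : ∀ t ∈ Icc 0 T, p t = ∫ τ in 0..t, h τ := fun t ht => by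
    refine intervalIntegral_congr_timeMeasure ?_ ht
    filter_upwards [ae_restrict_mem measurableSet_Ioo] with τ hτ
    rw [indicator_of_mem hτ]
  have hpi := hpc.integrable_timeMeasure T
  have hpw : HasWeakDeriv T p h := hasWeakDeriv_of_primitive hT.le (c := 0) hpi hh (by
    filter_upwards [ae_restrict_mem measurableSet_Ioo] with t ht
    rw [zero_add, hph t (Ioo_subset_Icc_self ht)])
  have hbdd : ∀ {f : ℝ → ℝ}, Continuous f → ∀ {k : ℝ → X}, Integrable k (timeMeasure T) →
      Integrable (fun t => f t • k t) (timeMeasure T) := by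
    intro f hf k hk
    obtain ⟨C, hC⟩ := isCompact_Icc.exists_bound_of_continuousOn (hf.continuousOn (s := Icc 0 T))
    refine hk.bdd_smul C hf.aestronglyMeasurable ?_
    filter_upwards [ae_restrict_mem measurableSet_Ioo] with t ht
    exact hC t (Ioo_subset_Icc_self ht)
  set d : ℝ → X := fun t => g t - p t with hd
  have hdi : Integrable d (timeMeasure T) := hgi.sub hpi
  have hd0 : ∀ η : ℝ → ℝ, ContDiff ℝ ∞ η → HasCompactSupport η → tsupport η ⊆ Ioo 0 T →
      ∫ t in Ioo 0 T, deriv η t • d t = 0 := by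
    intro η hη hc hs
    have hη' : Continuous (deriv η) := hη.continuous_deriv (by simp)
    simp only [hd, smul_sub]
    rw [integral_sub (hbdd hη' hgi) (hbdd hη' hpi), hw η hη hc hs, hpw η hη hc hs, sub_self]
  let θ : ContDiffBump (T / 2) := ⟨T / 8, T / 4, by linarith, by linarith⟩
  set θ₀ : ℝ → ℝ := θ.normed volume with hθ₀
  have hθs : tsupport θ₀ ⊆ Ioo 0 T := by
    rw [hθ₀, θ.tsupport_normed_eq, Real.closedBall_eq_Icc]
    refine Icc_subset_Ioo ?_ ?_ <;> simp only [θ] <;> linarith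
  have hθc : HasCompactSupport θ₀ := θ.hasCompactSupport_normed
  have hθd : ContDiff ℝ ∞ θ₀ := θ.contDiff_normed
  have hθi : ∫ t, θ₀ t = 1 := θ.integral_normed
  have hθint : Integrable θ₀ := hθd.continuous.integrable_of_hasCompactSupport hθc
  set c : X := ∫ t in Ioo 0 T, θ₀ t • d t with hc
  have hall : ∀ θ₁ : ℝ → ℝ, ContDiff ℝ ∞ θ₁ → HasCompactSupport θ₁ → tsupport θ₁ ⊆ Ioo 0 T →
      ∫ t in Ioo 0 T, θ₁ t • (d t - c) = 0 := by
    intro θ₁ h1 h2 h3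
    have h1i : Integrable θ₁ := h1.continuous.integrable_of_hasCompactSupport h2
    set m : ℝ := ∫ t, θ₁ t with hm
    have hmI : ∫ t in Ioo 0 T, θ₁ t = m :=
      setIntegral_eq_integral_of_forall_compl_eq_zero fun x hx => by
        by_contra h; exact hx (h3 (subset_tsupport _ h))
    obtain ⟨η, he1, he2, he3, he4⟩ := exists_smooth_primitive (T := T)
      (ζ := fun t => θ₁ t - m * θ₀ t) (h1.sub (contDiff_const.mul hθd))
      (h2.sub (hθc.mul_left (f := fun _ => m)))
      ((tsupport_sub _ _).trans (union_subset h3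
        ((tsupport_mul_subset_right (f := fun _ => m)).trans hθs)))
      (by rw [integral_sub h1i (hθint.const_mul m), integral_const_mul, hθi, mul_one, sub_self])
    have h4 := hd0 η he1 he2 he3
    rw [he4] at h4
    simp only [sub_smul, mul_smul] at h4
    have hmd : Integrable (fun t => m • θ₀ t • d t) (timeMeasure T) :=
      (hbdd hθd.continuous hdi).smul m
    rw [integral_sub (hbdd h1.continuous hdi) hmd, integral_smul, ← hc, sub_eq_zero] at h4
    simp only [smul_sub]
    rw [integral_sub (hbdd h1.continuous hdi) (hbdd h1.continuous (integrable_const c)), h4,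
      integral_smul_const, hmI, sub_self]
  have h0 := isOpen_Ioo.ae_eq_zero_of_integral_contDiff_smul_eq_zero (μ := volume) (U := Ioo 0 T)
    (f := fun t => d t - c)
    (IntegrableOn.locallyIntegrableOn (hdi.sub (integrable_const c))) (by
      intro θ₁ h1 h2 h3
      rw [← hall θ₁ h1 h2 h3]
      refine (setIntegral_eq_integral_of_forall_compl_eq_zero fun x hx => ?_).symm
      have : θ₁ x = 0 := by by_contra h; exact hx (h3 (subset_tsupport _ h))
      rw [this, zero_smul])
  refine ⟨c, ?_⟩
  filter_upwards [(ae_restrict_iff' measurableSet_Ioo).2 h0, ae_restrict_mem measurableSet_Ioo]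
    with t ht htm
  rw [← hph t (Ioo_subset_Icc_self htm), ← sub_eq_iff_eq_add.1 (sub_eq_zero.1 ht)]

theorem primitive_of_initialValue {T : ℝ} (hT : 0 < T) {g h : ℝ → X} {x : X}
    (hgi : Integrable g (timeMeasure T)) (hh : Integrable h (timeMeasure T))
    (hw : HasWeakDeriv T g h) (hx : HasInitialValue T g x) :
    ∀ᵐ t ∂timeMeasure T, g t = x + ∫ τ in 0..t, h τ := by
  obtain ⟨c, hc⟩ := exists_primitive_of_hasWeakDeriv hT hgi hh hw
  obtain ⟨v, hvc, hvg, hv0⟩ := hx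
  have hind : Integrable ((Ioo 0 T).indicator h) :=
    IntegrableOn.integrable_indicator hh measurableSet_Ioo
  have hpc : Continuous fun t => c + ∫ τ in 0..t, (Ioo 0 T).indicator h τ := continuous_const.add
    (intervalIntegral.continuous_primitive (fun a b => hind.intervalIntegrable) 0)
  have h1 : v =ᵐ[timeMeasure T] fun t => c + ∫ τ in 0..t, (Ioo 0 T).indicator h τ := by
    filter_upwards [hvg, hc, ae_restrict_mem measurableSet_Ioo] with t h2 h3 htm
    rw [h2, h3]
    congr 1
    refine intervalIntegral_congr_timeMeasure ?_ (Ioo_subset_Icc_self htm)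
    filter_upwards [ae_restrict_mem measurableSet_Ioo] with τ hτ
    rw [indicator_of_mem hτ]
  have h2 := Measure.eqOn_Icc_of_ae_eq volume hT.ne
    (ae_restrict_of_ae_eq_of_ae_restrict Ioo_ae_eq_Icc h1) hvc hpc.continuousOn
    (left_mem_Icc.2 hT.le)
  simp only [intervalIntegral.integral_same, add_zero, hv0] at h2
  rwa [h2]

/-- The lemma of du Bois-Reymond for test functions on `[0,T)`, which also see the initial value. -/
theorem primitive_of_weak_initial {T : ℝ} (hT : 0 < T) {g h : ℝ → X} {x : X}
    (hgi : Integrable g (timeMeasure T)) (hh : Integrable h (timeMeasure T))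
    (hw : ∀ η : ℝ → ℝ, ContDiff ℝ ∞ η → HasCompactSupport η → tsupport η ⊆ Iio T →
      ∫ t in Ioo 0 T, deriv η t • g t = -(η 0 • x) - ∫ t in Ioo 0 T, η t • h t) :
    ∀ᵐ t ∂timeMeasure T, g t = x + ∫ τ in 0..t, h τ := by
  obtain ⟨c, hc⟩ := exists_primitive_of_hasWeakDeriv hT hgi hh (by
    intro η h1 h2 h3
    have h0 : η 0 = 0 := by
      by_contra h
      exact lt_irrefl _ (h3 (subset_tsupport _ h)).1
    rw [hw η h1 h2 (h3.trans Ioo_subset_Iio_self), h0, zero_smul, neg_zero, zero_sub])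
  let θ : ContDiffBump (0 : ℝ) := ⟨T / 4, T / 2, by linarith, by linarith⟩
  have hθs : tsupport θ ⊆ Iio T := by
    rw [θ.tsupport_eq, Real.closedBall_eq_Icc]
    intro t ht
    have := ht.2
    simp only [θ] at this
    rw [mem_Iio]; linarith
  have hθT : θ T = 0 := by
    by_contra h
    exact lt_irrefl T (hθs (subset_tsupport _ h))
  have h1 := hw θ θ.contDiff θ.hasCompactSupport hθs
  rw [integral_smul_by_parts hT.le θ.contDiff hθT hgi hh hc, θ.one_of_mem_closedBall (by
    rw [Metric.mem_closedBall, dist_self]; exact θ.rIn_pos.le), one_smul, one_smul,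
    sub_left_inj, neg_inj] at h1
  rwa [← h1]

end TimeCalculus

/-! ### The Fourier transform and the homogeneous Sobolev inequality -/

/-- For square integrable functions that are integrable, the Fourier transform on `L²` is given by
the Fourier integral. -/
theorem fourier_coeFn_ae_eq {n : ℕ} (g : L2C n) (hg : Integrable g) :
    (𝓕 g : L2C n) =ᵐ[volume] 𝓕 (g : Space n → ℂ) := by
  have hc : Continuous (𝓕 (g : Space n → ℂ)) :=
    VectorFourier.fourierIntegral_continuous Real.continuous_fourierChar
      (by exact continuous_inner) hg
  refine ae_eq_of_integral_contDiff_smul_eq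
    ((Lp.memLp (𝓕 g : L2C n)).locallyIntegrable (by norm_num)) hc.locallyIntegrable ?_
  intro φ hφ hφc
  have hs : HasCompactSupport fun x => (φ x : ℂ) :=
    hφc.comp_left (g := fun y : ℝ => (y : ℂ)) Complex.ofReal_zero
  have hd : ContDiff ℝ ∞ fun x => (φ x : ℂ) := Complex.ofRealCLM.contDiff.comp hφ
  set ψ : SchwartzMap (Space n) ℂ := hs.toSchwartzMap hd with hψ
  have h1 := congrArg (fun T => T ψ) (Lp.fourier_toTemperedDistribution_eq g)
  simp only [TemperedDistribution.fourier_apply, Lp.toTemperedDistribution_apply] at h1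
  have h2 := VectorFourier.integral_fourierIntegral_smul_eq_flip (μ := (volume : Measure (Space n)))
    (ν := (volume : Measure (Space n))) (L := innerₗ (Space n)) (e := Real.fourierChar)
    (f := ψ) (g := g) Real.continuous_fourierChar (by exact continuous_inner) ψ.integrable hg
  have h3 : (innerₗ (Space n)).flip = innerₗ (Space n) := by
    ext x y; simp
  rw [h3] at h2
  have h4 : ∀ x, (ψ x : ℂ) = φ x := fun x => rfl
  calc ∫ x, φ x • (𝓕 g : L2C n) x = ∫ x, ψ x • (𝓕 g : L2C n) x := by
        refine integral_congr_ae (Eventually.of_forall fun x => ?_)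
        simp only [h4]; simp
    _ = ∫ x, (𝓕 ψ) x • g x := h1.symm
    _ = ∫ x, ψ x • 𝓕 (g : Space n → ℂ) x := h2
    _ = _ := by
        refine integral_congr_ae (Eventually.of_forall fun x => ?_)
        simp only [h4]; simp

theorem norm_fourier_le {n : ℕ} (g : L2C n) (hg : Integrable g) :
    ∀ᵐ x, ‖(𝓕 g : L2C n) x‖ ≤ ∫ ξ, ‖g ξ‖ := by
  filter_upwards [fourier_coeFn_ae_eq g hg] with x hx
  rw [hx]
  exact VectorFourier.norm_fourierIntegral_le_integral_norm _ _ _ _ _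

theorem fourierInv_coeFn_ae_eq {n : ℕ} (g : L2C n) (hg : Integrable g) :
    (𝓕⁻ g : L2C n) =ᵐ[volume] 𝓕⁻ (g : Space n → ℂ) := by
  have hc : Continuous (𝓕⁻ (g : Space n → ℂ)) :=
    VectorFourier.fourierIntegral_continuous Real.continuous_fourierChar
      (by exact continuous_inner.neg) hg
  refine ae_eq_of_integral_contDiff_smul_eq
    ((Lp.memLp (𝓕⁻ g : L2C n)).locallyIntegrable (by norm_num)) hc.locallyIntegrable ?_
  intro φ hφ hφc
  have hs : HasCompactSupport fun x => (φ x : ℂ) :=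
    hφc.comp_left (g := fun y : ℝ => (y : ℂ)) Complex.ofReal_zero
  have hd : ContDiff ℝ ∞ fun x => (φ x : ℂ) := Complex.ofRealCLM.contDiff.comp hφ
  set ψ : SchwartzMap (Space n) ℂ := hs.toSchwartzMap hd with hψ
  have h1 := congrArg (fun T => T ψ) (Lp.fourierInv_toTemperedDistribution_eq g)
  simp only [TemperedDistribution.fourierInv_apply, Lp.toTemperedDistribution_apply] at h1
  have h2 := VectorFourier.integral_fourierIntegral_smul_eq_flip (μ := (volume : Measure (Space n)))
    (ν := (volume : Measure (Space n))) (L := -innerₗ (Space n)) (e := Real.fourierChar)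
    (f := ψ) (g := g) Real.continuous_fourierChar (by exact continuous_inner.neg) ψ.integrable hg
  have h3 : (-innerₗ (Space n)).flip = -innerₗ (Space n) := by
    ext x y; simpa using real_inner_comm x y
  rw [h3] at h2
  have h4 : ∀ x, (ψ x : ℂ) = φ x := fun x => rfl
  have h5 : ∀ x, (𝓕⁻ ψ) x =
      VectorFourier.fourierIntegral Real.fourierChar volume (-innerₗ (Space n)) ψ x := fun x => by
    rw [SchwartzMap.fourierInv_coe]; rfl
  calc ∫ x, φ x • (𝓕⁻ g : L2C n) x = ∫ x, ψ x • (𝓕⁻ g : L2C n) x := by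
        refine integral_congr_ae (Eventually.of_forall fun x => ?_)
        simp only [h4]; simp
    _ = ∫ x, (𝓕⁻ ψ) x • g x := h1.symm
    _ = ∫ x, ψ x • 𝓕⁻ (g : Space n → ℂ) x := by simp only [h5]; exact h2
    _ = _ := by
        refine integral_congr_ae (Eventually.of_forall fun x => ?_)
        simp only [h4]; simp

theorem norm_fourierInv_le {n : ℕ} (g : L2C n) (hg : Integrable g) :
    ∀ᵐ x, ‖(𝓕⁻ g : L2C n) x‖ ≤ ∫ ξ, ‖g ξ‖ := by
  filter_upwards [fourierInv_coeFn_ae_eq g hg] with x hx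
  rw [hx]
  exact VectorFourier.norm_fourierIntegral_le_integral_norm _ _ _ _ _

/-- If the distribution function of `f` is at most `K t⁻²` times that of `h`, then `∫ f ^ ρ` is
bounded by `∫ h ^ (ρ - 2)`, by the layer cake formula. -/
theorem lintegral_rpow_le_of_distribution {α β : Type*} [MeasurableSpace α] [MeasurableSpace β]
    {μ : Measure α} {ν : Measure β} {f : α → ℝ} {h : β → ℝ} {K : ℝ≥0∞} {ρ : ℝ} (hρ : 2 < ρ)
    (hKt : K ≠ ⊤)
    (hf : AEMeasurable f μ) (hf0 : ∀ x, 0 ≤ f x) (hh : AEMeasurable h ν) (hh0 : ∀ y, 0 ≤ h y)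
    (hK : ∀ t : ℝ, 0 < t → μ {x | t < f x} ≤ K * ENNReal.ofReal (t ^ (-2 : ℝ)) * ν {y | t < h y}) :
    ∫⁻ x, ENNReal.ofReal (f x ^ ρ) ∂μ ≤
      ENNReal.ofReal ρ * K * (ENNReal.ofReal (ρ - 2))⁻¹ * ∫⁻ y, ENNReal.ofReal (h y ^ (ρ - 2)) ∂ν := by
  rw [lintegral_rpow_eq_lintegral_meas_lt_mul μ (Eventually.of_forall hf0) hf (by linarith),
    lintegral_rpow_eq_lintegral_meas_lt_mul ν (Eventually.of_forall hh0) hh (by linarith)]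
  have h1 : (ENNReal.ofReal (ρ - 2))⁻¹ * ENNReal.ofReal (ρ - 2) = 1 :=
    ENNReal.inv_mul_cancel (by simpa using hρ) ENNReal.ofReal_ne_top
  rw [mul_assoc (ENNReal.ofReal ρ * K), ← mul_assoc (ENNReal.ofReal (ρ - 2))⁻¹, h1, one_mul,
    mul_assoc, ← lintegral_const_mul' K _ hKt]
  refine mul_le_mul_right (setLIntegral_mono_ae' measurableSet_Ioi (Eventually.of_forall ?_)) _
  intro t ht
  calc μ {x | t < f x} * ENNReal.ofReal (t ^ (ρ - 1))
      ≤ K * ENNReal.ofReal (t ^ (-2 : ℝ)) * ν {y | t < h y} * ENNReal.ofReal (t ^ (ρ - 1)) :=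
        mul_le_mul_left (hK t ht) _
    _ = K * (ν {y | t < h y} * (ENNReal.ofReal (t ^ (-2 : ℝ)) * ENNReal.ofReal (t ^ (ρ - 1)))) := by
        ring
    _ = _ := by
        rw [← ENNReal.ofReal_mul (Real.rpow_nonneg (le_of_lt ht) _), ← Real.rpow_add ht]
        congr 4; ring

/-- The integral of `|ξ| ^ (-2σ)` over a ball with radius `A` is of the order `A ^ (n - 2σ)`. -/
theorem lintegral_norm_rpow_ball {n : ℕ} (hn : 1 ≤ n) {σ : ℝ} (hσ : 2 * σ < n) :
    ∃ c : ℝ, 0 < c ∧ ∀ A : ℝ, 0 < A → ∫⁻ ξ in {ξ : Space n | ‖ξ‖ ≤ A}, ENNReal.ofReal (‖ξ‖ ^ (-2 * σ))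
      ≤ ENNReal.ofReal (c * A ^ ((n : ℝ) - 2 * σ)) := by
  have : Nontrivial (Space n) := by
    have : Nonempty (Fin n) := ⟨⟨0, hn⟩⟩
    infer_instance
  have h0 : 0 < (n : ℝ) - 2 * σ := by linarith
  refine ⟨n * (volume : Measure (Space n)).real (Metric.ball 0 1) * ((n : ℝ) - 2 * σ)⁻¹ + 1,
    by positivity, ?_⟩
  intro A hA
  have hfi : ∀ y : ℝ, y ∈ Ioi (0:ℝ) → y ^ (n - 1) • (indicator (Iic A) (fun y => y ^ (-2 * σ))) y =
      indicator (Ioc 0 A) (fun y => y ^ ((n : ℝ) - 1 - 2 * σ)) y := by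
    intro y hy
    by_cases hyA : y ≤ A
    · have : y ∈ Ioc 0 A := ⟨hy, hyA⟩
      rw [indicator_of_mem this, indicator_of_mem (by exact hyA), smul_eq_mul, ← Real.rpow_natCast,
        ← Real.rpow_add hy]
      congr 1
      rw [Nat.cast_sub hn]; push_cast; ring
    · rw [indicator_of_notMem (by simpa using hyA), indicator_of_notMem (by simp [hyA]), smul_zero]
  have hint : IntegrableOn (fun y : ℝ => y ^ ((n : ℝ) - 1 - 2 * σ)) (Ioc 0 A) := by
    rw [← intervalIntegrable_iff_integrableOn_Ioc_of_le hA.le]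
    exact intervalIntegral.intervalIntegrable_rpow' (by linarith)
  have hI := integral_fun_norm_addHaar (volume : Measure (Space n))
    (indicator (Iic A) (fun y => y ^ (-2 * σ)))
  have hJ : Integrable (fun ξ : Space n => (indicator (Iic A) (fun y => y ^ (-2 * σ))) ‖ξ‖) := by
    rw [integrable_fun_norm_addHaar]
    simp only [finrank_euclideanSpace, Fintype.card_fin]
    refine IntegrableOn.congr_fun ?_ (fun y hy => (hfi y hy).symm) measurableSet_Ioi
    exact ((integrable_indicator_iff measurableSet_Ioc).2 hint).integrableOn
  have hset : MeasurableSet {ξ : Space n | ‖ξ‖ ≤ A} := measurableSet_le measurable_norm measurable_const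
  have hval : ∫ y in Ioi (0:ℝ), y ^ (n - 1) • (indicator (Iic A) (fun y => y ^ (-2 * σ))) y =
      A ^ ((n : ℝ) - 2 * σ) * ((n : ℝ) - 2 * σ)⁻¹ := by
    rw [setIntegral_congr_fun measurableSet_Ioi hfi, setIntegral_indicator measurableSet_Ioc,
      inter_eq_self_of_subset_right (Ioc_subset_Ioi_self), ← intervalIntegral.integral_of_le hA.le,
      integral_rpow (Or.inl (by linarith))]
    rw [show (n : ℝ) - 1 - 2 * σ + 1 = n - 2 * σ by ring, Real.zero_rpow h0.ne', sub_zero,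
      div_eq_mul_inv]
  simp only [finrank_euclideanSpace, Fintype.card_fin] at hI
  rw [hval] at hI
  rw [← lintegral_indicator hset]
  calc _ = ∫⁻ ξ : Space n, ENNReal.ofReal ((indicator (Iic A) (fun y => y ^ (-2 * σ))) ‖ξ‖) := by
        refine lintegral_congr fun ξ => ?_
        by_cases h : ‖ξ‖ ≤ A
        · rw [indicator_of_mem (by exact h), indicator_of_mem (by exact h)]
        · rw [indicator_of_notMem (by exact h), indicator_of_notMem (by exact h), ENNReal.ofReal_zero]
    _ = ENNReal.ofReal (∫ ξ : Space n, (indicator (Iic A) (fun y => y ^ (-2 * σ))) ‖ξ‖) := by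
        rw [ofReal_integral_eq_lintegral_ofReal hJ]
        refine Eventually.of_forall fun ξ => ?_
        simp only [Pi.zero_apply, indicator_apply]
        split_ifs <;> positivity
    _ ≤ _ := by
        apply ENNReal.ofReal_le_ofReal
        rw [hI, nsmul_eq_mul, smul_eq_mul]
        have : 0 < A ^ ((n : ℝ) - 2 * σ) := by positivity
        nlinarith

theorem lintegral_enorm_sq_eq {n : ℕ} (g : L2C n) : ∫⁻ x, ‖g x‖ₑ ^ 2 = ‖g‖ₑ ^ 2 := by
  rw [Lp.enorm_def, eLpNorm_eq_lintegral_rpow_enorm_toReal (by norm_num) (by norm_num)]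
  simp only [ENNReal.toReal_ofNat, ENNReal.rpow_ofNat]
  rw [← ENNReal.rpow_natCast, ← ENNReal.rpow_mul]
  norm_num

theorem enorm_fourier_eq {n : ℕ} (g : L2C n) : ‖(𝓕 g : L2C n)‖ₑ = ‖g‖ₑ := by
  rw [← ofReal_norm, ← ofReal_norm, Lp.norm_fourier_eq]

theorem fourierInv_fourier_L2 {n : ℕ} (g : L2C n) : (𝓕⁻ (𝓕 g : L2C n) : L2C n) = g :=
  (Lp.fourierTransformₗᵢ (Space n) ℂ).symm_apply_apply g

theorem enorm_fourierInv_eq {n : ℕ} (g : L2C n) : ‖(𝓕⁻ g : L2C n)‖ₑ = ‖g‖ₑ := by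
  rw [← ofReal_norm, ← ofReal_norm]
  exact congrArg _ ((Lp.fourierTransformₗᵢ (Space n) ℂ).symm.norm_map g)

/-- Cauchy–Schwarz with a weight. -/
theorem lintegral_enorm_le_of_weight {α : Type*} [MeasurableSpace α] {μ : Measure α} {κ : α → ℝ}
    (hκ : AEMeasurable κ μ) (hpos : ∀ᵐ x ∂μ, 0 < κ x) {G : α → ℂ} (hG : AEStronglyMeasurable G μ) :
    ∫⁻ x, ‖G x‖ₑ ∂μ ≤ (∫⁻ x, ENNReal.ofReal (κ x)⁻¹ ∂μ) ^ (1 / 2 : ℝ) *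
      (∫⁻ x, ENNReal.ofReal (κ x) * ‖G x‖ₑ ^ 2 ∂μ) ^ (1 / 2 : ℝ) := by
  have h := ENNReal.lintegral_mul_le_Lp_mul_Lq μ (p := 2) (q := 2) (by constructor <;> norm_num)
    (f := fun x => ENNReal.ofReal (κ x)⁻¹ ^ (1 / 2 : ℝ))
    (g := fun x => ENNReal.ofReal (κ x) ^ (1 / 2 : ℝ) * ‖G x‖ₑ)
    (hκ.inv.ennreal_ofReal.pow_const _) ((hκ.ennreal_ofReal.pow_const _).mul hG.enorm)
  refine le_trans (le_of_eq ?_) (h.trans (le_of_eq ?_))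
  · refine lintegral_congr_ae ?_
    filter_upwards [hpos] with x hx
    simp only [Pi.mul_apply]
    rw [← mul_assoc, ← ENNReal.mul_rpow_of_nonneg _ _ (by norm_num), ← ENNReal.ofReal_mul (by positivity),
      inv_mul_cancel₀ hx.ne']
    simp
  · congr 2
    · refine lintegral_congr fun x => ?_
      rw [← ENNReal.rpow_mul]; norm_num
    · refine lintegral_congr fun x => ?_
      rw [ENNReal.mul_rpow_of_nonneg _ _ (by norm_num), ← ENNReal.rpow_mul]; norm_num

/-- The homogeneous Sobolev inequality `‖g‖_{L^ρ} ≲ ‖ |ξ|^σ ĝ ‖_{L²}` with `σ = n/2 - n/ρ`. In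
order to bound `|{|g| > t}|`, the frequencies are split at a radius `A` that depends on `t`,
chosen such that the low frequencies contribute at most `t/2` to `|g|`; then the high frequencies
contribute more than `t/2`, and Chebyshev's inequality bounds the measure by
`4 t⁻² ∫_{|ξ| > A} |ĝ|²`. This is an estimate between distribution functions, to which
`lintegral_rpow_le_of_distribution` applies. The `L^ρ` norm is stated as a lower integral, so that
its finiteness is part of the conclusion. -/
theorem exists_homogeneous_sobolev {n : ℕ} (hn : 1 ≤ n) {ρ : ℝ} (hρ : 2 < ρ) :
    ∃ C : ℝ, 0 < C ∧ ∀ (g : L2C n) (M : ℝ), 0 < M →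
      ∫⁻ ξ : Space n, ENNReal.ofReal (‖ξ‖ ^ (2 * ((n : ℝ) / 2 - n / ρ))) * ‖(𝓕 g : L2C n) ξ‖ₑ ^ 2
        ≤ ENNReal.ofReal (M ^ 2) →
      ∫⁻ x, ENNReal.ofReal (‖g x‖ ^ ρ) ≤ ENNReal.ofReal (C * M ^ ρ) := by
  have : Nontrivial (Space n) := by
    have : Nonempty (Fin n) := ⟨⟨0, hn⟩⟩
    infer_instance
  have hn0 : (0 : ℝ) < n := by exact_mod_cast hn
  set σ : ℝ := (n : ℝ) / 2 - n / ρ with hσ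
  have hθ : 0 < n / ρ := by positivity
  set θ : ℝ := n / ρ with hθd
  have hσn : 2 * σ < n := by rw [hσ]; linarith
  have hθ2 : θ * (ρ - 2) = 2 * σ := by rw [hσ, hθd]; field_simp
  have hnθ : (n : ℝ) - 2 * σ = 2 * θ := by rw [hσ]; ring
  obtain ⟨c, hc, hcA⟩ := lintegral_norm_rpow_ball hn hσn
  have hρ2 : 0 < ρ - 2 := by linarith
  refine ⟨ρ * 4 * (ρ - 2)⁻¹ * (2 * √c) ^ (ρ - 2), by positivity, fun g M hM hgM => ?_⟩
  set G : L2C n := 𝓕 g with hG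
  -- `|ξ| > A` is equivalent to `h ξ > t`, for the splitting radius `A` belonging to the height `t`.
  set ν : Measure (Space n) := volume.withDensity fun ξ => ‖G ξ‖ₑ ^ 2 with hν
  have hGm : AEMeasurable (fun ξ => ‖G ξ‖ₑ ^ 2) (volume : Measure (Space n)) :=
    (Lp.aestronglyMeasurable G).enorm.pow_const 2
  set h : Space n → ℝ := fun ξ => 2 * √c * M * ‖ξ‖ ^ θ with hh
  have hhm : Measurable h := by fun_prop
  have hmain := lintegral_rpow_le_of_distribution (μ := (volume : Measure (Space n))) (ν := ν)
    (f := fun x => ‖g x‖) (h := h) (K := 4) hρ (by norm_num)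
    (Lp.aestronglyMeasurable g).norm.aemeasurable
    (fun x => norm_nonneg _) hhm.aemeasurable (fun y => by positivity) ?_
  · refine hmain.trans ?_
    have h1 : ∫⁻ ξ, ENNReal.ofReal (h ξ ^ (ρ - 2)) ∂ν ≤
        ENNReal.ofReal ((2 * √c * M) ^ (ρ - 2)) * ENNReal.ofReal (M ^ 2) := by
      rw [hν, lintegral_withDensity_eq_lintegral_mul₀ hGm (by fun_prop)]
      refine le_trans (le_of_eq ?_) (mul_le_mul_right hgM _)
      rw [← lintegral_const_mul' _ _ ENNReal.ofReal_ne_top]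
      refine lintegral_congr fun ξ => ?_
      simp only [Pi.mul_apply, hh]
      rw [Real.mul_rpow (by positivity) (by positivity), ← Real.rpow_mul (norm_nonneg _), hθ2,
        ENNReal.ofReal_mul (by positivity)]
      ring
    refine (mul_le_mul_right h1 _).trans (le_of_eq ?_)
    have h4 : (4 : ℝ≥0∞) = ENNReal.ofReal 4 := by norm_num
    rw [h4, ← ENNReal.ofReal_inv_of_pos hρ2, ← ENNReal.ofReal_mul (by linarith),
      ← ENNReal.ofReal_mul (by linarith), ← ENNReal.ofReal_mul (by positivity),
      ← ENNReal.ofReal_mul (by positivity)]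
    congr 1
    rw [Real.mul_rpow (x := 2 * √c) (by positivity) hM.le]
    have : M ^ ρ = M ^ (ρ - 2) * M ^ 2 := by
      rw [← Real.rpow_natCast M 2, ← Real.rpow_add hM]; congr 1; push_cast; ring
    rw [this]; ring
  · intro t ht
    set A : ℝ := (t / (2 * √c * M)) ^ θ⁻¹ with hA
    have hsc : 0 < √c := Real.sqrt_pos.2 hc
    have hA0 : 0 < A := by positivity
    have hAθ : 2 * √c * M * A ^ θ = t := by
      rw [hA, ← Real.rpow_mul (by positivity), inv_mul_cancel₀ hθ.ne', Real.rpow_one]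
      field_simp
    set S : Set (Space n) := {ξ | ‖ξ‖ ≤ A} with hS
    have hSm : MeasurableSet S := measurableSet_le measurable_norm measurable_const
    have hm1 : MemLp (S.indicator G) 2 volume := (Lp.memLp G).indicator hSm
    have hm2 : MemLp (Sᶜ.indicator G) 2 volume := (Lp.memLp G).indicator hSm.compl
    set G1 : L2C n := hm1.toLp _ with hG1
    set G2 : L2C n := hm2.toLp _ with hG2
    have hsum : G = G1 + G2 := by
      apply Lp.ext
      filter_upwards [Lp.coeFn_add G1 G2, hm1.coeFn_toLp, hm2.coeFn_toLp] with ξ e1 e2 e3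
      rw [e1, Pi.add_apply, e2, e3]
      exact (congrFun (indicator_self_add_compl S (G : Space n → ℂ)) ξ).symm
    have hg : g = (𝓕⁻ G1 : L2C n) + 𝓕⁻ G2 := by
      rw [← fourierInv_fourier_L2 g, ← hG, hsum]
      exact (Lp.fourierTransformₗᵢ (Space n) ℂ).symm.map_add G1 G2
    -- Cauchy–Schwarz with the weight `|ξ|^{2σ}`.
    have hlow : ∫⁻ ξ, ‖G1 ξ‖ₑ ≤ ENNReal.ofReal (t / 2) := by
      have e1 : ∫⁻ ξ, ‖G1 ξ‖ₑ = ∫⁻ ξ in S, ‖G ξ‖ₑ := by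
        rw [← lintegral_indicator hSm]
        refine lintegral_congr_ae ?_
        filter_upwards [hm1.coeFn_toLp] with ξ e
        rw [e, enorm_indicator_eq_indicator_enorm]
      rw [e1]
      refine (lintegral_enorm_le_of_weight (μ := volume.restrict S) (κ := fun ξ => ‖ξ‖ ^ (2 * σ))
        (by fun_prop) ?_ (Lp.aestronglyMeasurable G).restrict).trans ?_
      · refine ae_restrict_of_ae ?_
        filter_upwards [Measure.ae_ne (volume : Measure (Space n)) 0] with ξ hξ
        exact Real.rpow_pos_of_pos (norm_pos_iff.2 hξ) _
      · have e2 : ∫⁻ ξ in S, ENNReal.ofReal (‖ξ‖ ^ (2 * σ))⁻¹ ≤ ENNReal.ofReal (c * A ^ (2 * θ)) := by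
          have := hcA A hA0
          rw [hnθ] at this
          refine le_trans (le_of_eq (lintegral_congr fun ξ => ?_)) this
          rw [← Real.rpow_neg (norm_nonneg _), neg_mul]
        have e3 := (setLIntegral_le_lintegral S _).trans hgM
        calc _ ≤ ENNReal.ofReal (c * A ^ (2 * θ)) ^ (1 / 2 : ℝ) * ENNReal.ofReal (M ^ 2) ^ (1 / 2 : ℝ) := by
              gcongr
          _ = ENNReal.ofReal (t / 2) := by
              rw [ENNReal.ofReal_rpow_of_nonneg (by positivity) (by norm_num),
                ENNReal.ofReal_rpow_of_nonneg (by positivity) (by norm_num),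
                ← ENNReal.ofReal_mul (by positivity), ← Real.sqrt_eq_rpow, ← Real.sqrt_eq_rpow,
                Real.sqrt_sq hM.le, Real.sqrt_mul hc.le]
              have : √(A ^ (2 * θ)) = A ^ θ := by
                rw [Real.sqrt_eq_rpow, ← Real.rpow_mul hA0.le]; congr 1; ring
              rw [this, ← hAθ]; congr 1; ring
    have hi1 : Integrable G1 :=
      ⟨Lp.aestronglyMeasurable G1, hlow.trans_lt ENNReal.ofReal_lt_top⟩
    have hlow' : ∀ᵐ x, ‖(𝓕⁻ G1 : L2C n) x‖ ≤ t / 2 := by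
      filter_upwards [norm_fourierInv_le G1 hi1] with x hx
      refine hx.trans ?_
      rw [integral_norm_eq_lintegral_enorm hi1.1]
      exact ENNReal.toReal_le_of_le_ofReal (by positivity) hlow
    have hset : {x | t < ‖g x‖} ≤ᵐ[volume] {x | ENNReal.ofReal (t / 2) ^ 2 ≤ ‖(𝓕⁻ G2 : L2C n) x‖ₑ ^ 2} := by
      filter_upwards [hlow', Lp.coeFn_add (𝓕⁻ G1 : L2C n) (𝓕⁻ G2)] with x e1 e2 (hx : t < ‖g x‖)
      change ENNReal.ofReal (t / 2) ^ 2 ≤ ‖(𝓕⁻ G2 : L2C n) x‖ₑ ^ 2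
      rw [hg, e2] at hx
      have := norm_add_le ((𝓕⁻ G1 : L2C n) x) ((𝓕⁻ G2 : L2C n) x)
      rw [Pi.add_apply] at hx
      gcongr
      rw [← ofReal_norm]
      exact ENNReal.ofReal_le_ofReal (by linarith)
    have hcheb := mul_meas_ge_le_lintegral₀ (μ := (volume : Measure (Space n)))
      ((Lp.aestronglyMeasurable (𝓕⁻ G2 : L2C n)).enorm.pow_const 2) (ENNReal.ofReal (t / 2) ^ 2)
    rw [lintegral_enorm_sq_eq, enorm_fourierInv_eq, ← lintegral_enorm_sq_eq] at hcheb
    have hν2 : ∫⁻ ξ, ‖G2 ξ‖ₑ ^ 2 = ν {ξ | t < h ξ} := by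
      have : {ξ | t < h ξ} = Sᶜ := by
        ext ξ
        simp only [hS, hh, mem_ofPred_eq, mem_compl_iff, not_le]
        rw [← hAθ, mul_lt_mul_iff_right₀ (by positivity),
          Real.rpow_lt_rpow_iff hA0.le (norm_nonneg _) hθ]
      rw [this, hν, withDensity_apply _ hSm.compl, ← lintegral_indicator hSm.compl]
      refine lintegral_congr_ae ?_
      filter_upwards [hm2.coeFn_toLp] with ξ e
      rw [e, enorm_indicator_eq_indicator_enorm]
      by_cases hξ : ξ ∈ Sᶜ
      · rw [indicator_of_mem hξ, indicator_of_mem hξ]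
      · rw [indicator_of_notMem hξ, indicator_of_notMem hξ]; simp
    rw [hν2] at hcheb
    refine (measure_mono_ae hset).trans ?_
    have e5 : (4 : ℝ≥0∞) * ENNReal.ofReal (t ^ (-2 : ℝ)) = (ENNReal.ofReal (t / 2) ^ 2)⁻¹ := by
      rw [← ENNReal.ofReal_pow (by positivity), ← ENNReal.ofReal_inv_of_pos (by positivity),
        show (4 : ℝ≥0∞) = ENNReal.ofReal 4 by norm_num, ← ENNReal.ofReal_mul (by norm_num)]
      congr 1
      rw [Real.rpow_neg ht.le]
      norm_num
      field_simp
      norm_num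
    rw [e5, mul_comm, ← div_eq_mul_inv]
    rw [ENNReal.le_div_iff_mul_le (Or.inl (by positivity)) (Or.inl (by finiteness)), mul_comm]
    exact hcheb

/-! ### The spaces `H̃^s(Ω)` and `L̃²(Ω)` -/

section FunctionSpaces

variable {n : ℕ} {s : ℝ≥0} {Ω : Set (Space n)}

theorem toL2_mem_LTilde (u : ↥(HTilde s Ω)) : toL2 u ∈ LTilde Ω := by
  have h := u.2
  unfold HTilde at h
  have hc : Continuous ((WithLp.fstL 2 ℝ (L2 n) (L2C n)) ∘L (Hs n s).subtypeL) :=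
    ContinuousLinearMap.continuous _
  exact map_mem_closure (f := (WithLp.fstL 2 ℝ (L2 n) (L2C n)) ∘L (Hs n s).subtypeL) hc h
    (fun x hx => hx)

/-- The embedding of `H̃^s(Ω)` into `L̃²(Ω)`. -/
def toLT : ↥(HTilde s Ω) →L[ℝ] ↥(LTilde Ω) := toL2.codRestrict (LTilde Ω) toL2_mem_LTilde

@[simp] theorem coe_toLT (u : ↥(HTilde s Ω)) : (toLT u : L2 n) = toL2 u := rfl

theorem isFracLap_HTilde (u : ↥(HTilde s Ω)) : IsFracLap s (toL2 u) (fracLap u) := u.1.2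

theorem toL2_injective : Function.Injective (toL2 : ↥(HTilde s Ω) →L[ℝ] L2 n) := by
  rw [injective_iff_map_eq_zero]
  intro u hu
  have h := isFracLap_HTilde u
  have h0 : (𝓕 (0 : L2C n) : L2C n) = 0 := (Lp.fourierTransformₗᵢ (Space n) ℂ).map_zero
  rw [IsFracLap, hu, map_zero, h0] at h
  have h1 : (𝓕 (fracLap u) : L2C n) = 0 := by
    apply Lp.ext
    filter_upwards [h, Lp.coeFn_zero ℂ 2 (volume : Measure (Space n))] with ξ e1 e2
    rw [e1, e2]; simp
  have h2 : fracLap u = 0 := by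
    rw [← fourierInv_fourier_L2 (fracLap u), h1]
    exact (Lp.fourierTransformₗᵢ (Space n) ℂ).symm.map_zero
  apply Subtype.ext
  apply Subtype.ext
  exact WithLp.ofLp_injective 2 (Prod.ext hu h2)

theorem toLT_injective : Function.Injective (toLT : ↥(HTilde s Ω) →L[ℝ] ↥(LTilde Ω)) := fun u v h =>
  toL2_injective (by rw [← coe_toLT, h, coe_toLT])

theorem denseRange_toLT : DenseRange (toLT : ↥(HTilde s Ω) →L[ℝ] ↥(LTilde Ω)) := by
  intro x
  have hx : (x : L2 n) ∈ closure (testL2 Ω : Set (L2 n)) := x.2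
  rw [Metric.mem_closure_iff] at hx ⊢
  intro ε hε
  obtain ⟨y, ⟨φ, hφ, hy⟩, hxy⟩ := hx ε hε
  refine ⟨toLT (hφ.toHTilde s), ⟨_, rfl⟩, ?_⟩
  have : toL2 (hφ.toHTilde s) = y := Lp.ext ((hφ.toL2_toHTilde s).trans hy.symm)
  rw [Subtype.dist_eq, coe_toLT, this]
  exact hxy

/-- Elements of `L̃²(Ω)` vanish outside of `Ω`. -/
theorem ae_eq_zero_of_mem_LTilde {u : L2 n} (hu : u ∈ LTilde Ω) :
    u =ᵐ[volume.restrict Ωᶜ] 0 := by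
  have hu : u ∈ closure (testL2 Ω : Set (L2 n)) := hu
  rw [← eLpNorm_eq_zero_iff (p := 2) (Lp.aestronglyMeasurable u).restrict (by norm_num)]
  refine le_antisymm (le_of_forall_pos_le_add fun ε hε => ?_) zero_le
  rcases eq_or_ne ε ⊤ with rfl | hεt
  · simp
  obtain ⟨v, ⟨φ, hφ, hv⟩, huv⟩ := EMetric.mem_closure_iff.1 hu ε hε
  rw [zero_add]
  have hv0 : v =ᵐ[volume.restrict Ωᶜ] 0 := by
    have h1 : ∀ᵐ x ∂(volume.restrict (tsupport φ)ᶜ), φ x = 0 := by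
      rw [ae_restrict_iff' (isClosed_tsupport φ).measurableSet.compl]
      exact Eventually.of_forall fun x hx => image_eq_zero_of_notMem_tsupport hx
    filter_upwards [ae_restrict_of_ae hv,
      ae_restrict_of_ae_restrict_of_subset (compl_subset_compl.2 hφ.2.2) h1] with x e1 e2
    rw [e1, e2]; rfl
  calc eLpNorm u 2 (volume.restrict Ωᶜ) = eLpNorm (u - v : L2 n) 2 (volume.restrict Ωᶜ) := by
        refine eLpNorm_congr_ae ?_
        filter_upwards [hv0, ae_restrict_of_ae (Lp.coeFn_sub u v)] with x e1 e2
        rw [e2, Pi.sub_apply, e1]; simp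
    _ ≤ eLpNorm (u - v : L2 n) 2 volume := eLpNorm_mono_measure _ Measure.restrict_le_self
    _ = edist u v := by rw [edist_eq_enorm_sub, Lp.enorm_def]
    _ ≤ ε := huv.le

/-- Conversely to `ae_eq_zero_of_mem_LTilde`, square integrable functions vanishing outside of the
open set `Ω` belong to `L̃²(Ω)`: their component orthogonal to all test functions vanishes on `Ω`.
-/
theorem mem_LTilde_of_ae_eq_zero (hΩ : IsOpen Ω) {u : L2 n} (hu : u =ᵐ[volume.restrict Ωᶜ] 0) :
    u ∈ LTilde Ω := by
  set w : L2 n := u - (LTilde Ω).starProjection u with hw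
  have hwm : w ∈ (LTilde Ω)ᗮ := Submodule.sub_starProjection_mem_orthogonal u
  have hpm : (LTilde Ω).starProjection u ∈ LTilde Ω := Submodule.starProjection_apply_mem _ _
  have hw0 : w =ᵐ[volume.restrict Ωᶜ] 0 := by
    filter_upwards [hu, ae_eq_zero_of_mem_LTilde hpm, ae_restrict_of_ae (Lp.coeFn_sub u _)]
      with x e1 e2 e3
    rw [hw, e3, Pi.sub_apply, e1, e2]; simp
  have hw1 : ∀ᵐ x, x ∈ Ω → w x = 0 := by
    refine hΩ.ae_eq_zero_of_integral_contDiff_smul_eq_zero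
      (((Lp.memLp w).locallyIntegrable (by norm_num)).locallyIntegrableOn Ω) fun φ hφ hφc hφΩ => ?_
    have hm : MemLp φ 2 (volume : Measure (Space n)) := hφ.continuous.memLp_of_hasCompactSupport hφc
    have hmem : hm.toLp φ ∈ LTilde Ω :=
      Submodule.le_topologicalClosure _ ⟨φ, ⟨hφ, hφc, hφΩ⟩, hm.coeFn_toLp⟩
    have h := (Submodule.mem_orthogonal _ _).1 hwm _ hmem
    rw [L2.inner_def] at h
    rw [← h]
    refine integral_congr_ae ?_
    filter_upwards [hm.coeFn_toLp] with x e
    rw [e]; simp [mul_comm]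
  have : w = 0 := by
    apply Lp.ext
    have hw2 := (ae_restrict_iff' hΩ.measurableSet.compl).1 hw0
    filter_upwards [hw1, hw2, Lp.coeFn_zero ℝ 2 (volume : Measure (Space n))] with x e1 e2 e3
    rw [e3]
    by_cases hx : x ∈ Ω
    · exact e1 hx
    · exact e2 hx
  rw [sub_eq_zero.1 this]
  exact hpm

theorem indicator_toLp_mem_LTilde (hΩ : IsOpen Ω) {g : Space n → ℝ}
    (hg : MemLp (Ω.indicator g) 2 (volume : Measure (Space n))) : hg.toLp _ ∈ LTilde Ω := by
  refine mem_LTilde_of_ae_eq_zero hΩ ?_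
  filter_upwards [ae_restrict_of_ae hg.coeFn_toLp, ae_restrict_mem hΩ.measurableSet.compl]
    with x e1 e2
  rw [e1, indicator_of_notMem e2]; rfl

theorem memLp_indicator_of_restrict (hΩ : IsOpen Ω) {g : Space n → ℝ}
    (hg : MemLp g 2 (volume.restrict Ω)) : MemLp (Ω.indicator g) 2 (volume : Measure (Space n)) :=
  (memLp_indicator_iff_restrict hΩ.measurableSet).2 hg

/-- An element of `L²(Ω)`, extended by zero. -/
def extendZero (hΩ : IsOpen Ω) (g : Space n → ℝ) (hg : MemLp g 2 (volume.restrict Ω)) :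
    ↥(LTilde Ω) :=
  ⟨(memLp_indicator_of_restrict hΩ hg).toLp _, indicator_toLp_mem_LTilde hΩ _⟩

theorem coeFn_extendZero (hΩ : IsOpen Ω) (g : Space n → ℝ) (hg : MemLp g 2 (volume.restrict Ω)) :
    ((extendZero hΩ g hg : ↥(LTilde Ω)) : L2 n) =ᵐ[volume.restrict Ω] g := by
  filter_upwards [ae_restrict_of_ae (memLp_indicator_of_restrict hΩ hg).coeFn_toLp,
    ae_restrict_mem hΩ.measurableSet] with x e1 e2
  rw [extendZero, e1, indicator_of_mem e2]

theorem eLpNorm_restrict_of_mem_LTilde (hΩ : IsOpen Ω) (u : ↥(LTilde Ω)) :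
    eLpNorm (u : L2 n) 2 (volume.restrict Ω) = ‖u‖ₑ := by
  rw [← eLpNorm_indicator_eq_eLpNorm_restrict hΩ.measurableSet]
  have h := (ae_restrict_iff' hΩ.measurableSet.compl).1 (ae_eq_zero_of_mem_LTilde u.2)
  rw [show ‖u‖ₑ = ‖(u : L2 n)‖ₑ from rfl, Lp.enorm_def]
  refine eLpNorm_congr_ae ?_
  filter_upwards [h] with x hx
  by_cases hxΩ : x ∈ Ω
  · rw [indicator_of_mem hxΩ]
  · rw [indicator_of_notMem hxΩ, hx hxΩ]; rfl

theorem ext_LTilde (hΩ : IsOpen Ω) {u v : ↥(LTilde Ω)}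
    (h : (u : L2 n) =ᵐ[volume.restrict Ω] (v : L2 n)) : u = v := by
  apply Subtype.ext
  apply Lp.ext
  have h1 := (ae_restrict_iff' hΩ.measurableSet.compl).1 (ae_eq_zero_of_mem_LTilde u.2)
  have h2 := (ae_restrict_iff' hΩ.measurableSet.compl).1 (ae_eq_zero_of_mem_LTilde v.2)
  have h3 := (ae_restrict_iff' hΩ.measurableSet).1 h
  filter_upwards [h1, h2, h3] with x e1 e2 e3
  by_cases hxΩ : x ∈ Ω
  · exact e3 hxΩ
  · rw [e1 hxΩ, e2 hxΩ]

theorem inner_LTilde (hΩ : IsOpen Ω) (u v : ↥(LTilde Ω)) :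
    ⟪u, v⟫_ℝ = ∫ x in Ω, (u : L2 n) x * (v : L2 n) x := by
  rw [show ⟪u, v⟫_ℝ = ⟪(u : L2 n), (v : L2 n)⟫_ℝ from rfl, L2.inner_def,
    ← integral_indicator hΩ.measurableSet]
  have h := (ae_restrict_iff' hΩ.measurableSet.compl).1 (ae_eq_zero_of_mem_LTilde u.2)
  refine integral_congr_ae ?_
  filter_upwards [h] with x hx
  by_cases hxΩ : x ∈ Ω
  · rw [indicator_of_mem hxΩ]; simp [mul_comm]
  · rw [indicator_of_notMem hxΩ, hx hxΩ]; simp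

end FunctionSpaces

/-! ### The Poincaré inequality and Sobolev embeddings -/

section Embeddings

variable {n : ℕ} {s : ℝ≥0} {Ω : Set (Space n)}

theorem coeFn_complexify (u : L2 n) : (complexify n u : L2C n) =ᵐ[volume] fun x => (u x : ℂ) :=
  Complex.ofRealCLM.coeFn_compLpL (p := 2) u

theorem norm_complexify (u : L2 n) : ‖complexify n u‖ = ‖u‖ := by
  rw [Lp.norm_def, Lp.norm_def]
  congr 1
  refine eLpNorm_congr_norm_ae ?_
  filter_upwards [coeFn_complexify u] with x hx
  rw [hx, Complex.norm_real]

/-- Square integrable functions vanishing outside of a set of finite measure are integrable. -/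
theorem integrable_of_vanishing (hΩ : IsOpen Ω) (hb : volume Ω ≠ ⊤) {U : L2C n}
    (hU : U =ᵐ[volume.restrict Ωᶜ] 0) :
    Integrable U ∧ ∫ x, ‖U x‖ ≤ √(volume.real Ω) * ‖U‖ := by
  have hU' := (ae_restrict_iff' hΩ.measurableSet.compl).1 hU
  have : IsFiniteMeasure (volume.restrict Ω) := ⟨by simpa using hb.lt_top⟩
  have h1 : eLpNorm U 1 volume = eLpNorm U 1 (volume.restrict Ω) := by
    rw [← eLpNorm_indicator_eq_eLpNorm_restrict hΩ.measurableSet]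
    refine eLpNorm_congr_ae ?_
    filter_upwards [hU'] with x hx
    by_cases hxΩ : x ∈ Ω
    · rw [indicator_of_mem hxΩ]
    · rw [indicator_of_notMem hxΩ, hx hxΩ]; rfl
  have h2 : eLpNorm U 1 volume ≤ ENNReal.ofReal (√(volume.real Ω) * ‖U‖) := by
    rw [h1]
    refine (eLpNorm_le_eLpNorm_mul_rpow_measure_univ (q := 2) (by norm_num)
      (Lp.aestronglyMeasurable U).restrict).trans ?_
    rw [mul_comm, ENNReal.ofReal_mul (by positivity), Measure.restrict_apply_univ]
    refine mul_le_mul' (le_of_eq ?_) ?_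
    · rw [Real.sqrt_eq_rpow, ← ENNReal.ofReal_rpow_of_nonneg measureReal_nonneg (by norm_num),
        ofReal_measureReal hb]
      norm_num
    · rw [ofReal_norm, Lp.enorm_def]
      exact eLpNorm_mono_measure _ Measure.restrict_le_self
  have hi : Integrable U :=
    memLp_one_iff_integrable.1 ⟨Lp.aestronglyMeasurable U, h2.trans_lt ENNReal.ofReal_lt_top⟩
  refine ⟨hi, ?_⟩
  rw [integral_norm_eq_lintegral_enorm hi.1, ← eLpNorm_one_eq_lintegral_enorm]
  exact ENNReal.toReal_le_of_le_ofReal (by positivity) h2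

theorem complexify_vanishing (u : ↥(HTilde s Ω)) :
    (complexify n (toL2 u) : L2C n) =ᵐ[volume.restrict Ωᶜ] 0 := by
  filter_upwards [ae_restrict_of_ae (coeFn_complexify (toL2 u)),
    ae_eq_zero_of_mem_LTilde (toL2_mem_LTilde u)] with x e1 e2
  rw [e1, e2]; simp

theorem exists_small_ball (hn : 1 ≤ n) {ε : ℝ} (hε : 0 < ε) :
    ∃ r : ℝ, 0 < r ∧ volume (Metric.ball (0 : Space n) r) ≤ ENNReal.ofReal ε := by
  have h0 : Tendsto (fun r : ℝ => r ^ n * volume.real (Metric.ball (0 : Space n) 1)) (𝓝[>] 0)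
      (𝓝 (0 ^ n * volume.real (Metric.ball (0 : Space n) 1))) :=
    ((continuous_pow n).mul continuous_const).continuousAt.tendsto.mono_left nhdsWithin_le_nhds
  rw [zero_pow (by omega), zero_mul] at h0
  obtain ⟨r, hr1, hr2⟩ := ((h0.eventually (gt_mem_nhds hε)).and self_mem_nhdsWithin).exists
  have hr2 : 0 < r := hr2
  refine ⟨r, hr2, ?_⟩
  rw [Measure.addHaar_ball_of_pos _ _ hr2, finrank_euclideanSpace, Fintype.card_fin,
    ← ofReal_measureReal (measure_ball_lt_top.ne), ← ENNReal.ofReal_mul (by positivity)]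
  exact ENNReal.ofReal_le_ofReal hr1.le

/-- The Poincaré inequality in `H̃^s(Ω)`: the transform of a function with small support is small at
low frequencies, and at high frequencies it is controlled by the symbol. -/
theorem exists_poincare (hn : 1 ≤ n) (hΩ : IsOpen Ω) (hb : volume Ω ≠ ⊤) :
    ∃ C : ℝ, 0 < C ∧ ∀ u : ↥(HTilde s Ω), ‖toL2 u‖ ≤ C * ‖fracLap u‖ := by
  obtain ⟨r, hr, hrv⟩ := exists_small_ball (n := n) hn
    (ε := 1 / (2 * (volume.real Ω + 1))) (by positivity)
  have hfs : 0 < (2 * Real.pi * r) ^ (s : ℝ) := by positivity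
  refine ⟨√2 * ((2 * Real.pi * r) ^ (s : ℝ))⁻¹, by positivity, fun u => ?_⟩
  set k : ℝ := (2 * Real.pi * r) ^ (s : ℝ) with hk
  set U : L2C n := complexify n (toL2 u) with hU
  set w : L2C n := fracLap u with hw
  obtain ⟨hUi, hUn⟩ := integrable_of_vanishing hΩ hb (complexify_vanishing u)
  have hlap : (𝓕 w : L2C n) =ᵐ[volume] fun ξ => (fracSymbol s ξ : ℂ) * (𝓕 U : L2C n) ξ :=
    isFracLap_HTilde u
  set B : Set (Space n) := Metric.ball 0 r with hB
  have hpt : ∀ᵐ ξ, ‖(𝓕 U : L2C n) ξ‖ₑ ^ 2 ≤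
      B.indicator (fun _ => ENNReal.ofReal (volume.real Ω * ‖U‖ ^ 2)) ξ +
        ENNReal.ofReal (k⁻¹ ^ 2) * ‖(𝓕 w : L2C n) ξ‖ₑ ^ 2 := by
    filter_upwards [norm_fourier_le U hUi, hlap] with ξ e1 e2
    by_cases hξ : ξ ∈ B
    · rw [indicator_of_mem hξ]
      refine le_trans ?_ le_self_add
      rw [← ofReal_norm, ← ENNReal.ofReal_pow (norm_nonneg _)]
      apply ENNReal.ofReal_le_ofReal
      calc _ ≤ (√(volume.real Ω) * ‖U‖) ^ 2 := by gcongr; exact e1.trans hUn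
        _ = _ := by rw [mul_pow, Real.sq_sqrt measureReal_nonneg]
    · refine le_trans ?_ le_add_self
      have hξr : r ≤ ‖ξ‖ := by simpa [hB] using hξ
      have hs : k ≤ fracSymbol s ξ := by
        rw [hk, fracSymbol]
        exact Real.rpow_le_rpow (by positivity) (by gcongr) s.2
      rw [e2, ← ofReal_norm, ← ofReal_norm, ← ENNReal.ofReal_pow (norm_nonneg _),
        ← ENNReal.ofReal_pow (norm_nonneg _), ← ENNReal.ofReal_mul (by positivity)]
      apply ENNReal.ofReal_le_ofReal
      rw [norm_mul, Complex.norm_real, Real.norm_of_nonneg (hfs.le.trans hs), ← mul_pow, ← mul_assoc]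
      gcongr
      refine le_mul_of_one_le_left (norm_nonneg _) ?_
      rw [inv_mul_eq_div, one_le_div hfs]
      exact hs
  have hint := lintegral_mono_ae hpt
  rw [lintegral_add_left' ((measurable_const.indicator Metric.isOpen_ball.measurableSet).aemeasurable),
    lintegral_indicator_const Metric.isOpen_ball.measurableSet,
    lintegral_const_mul' _ _ ENNReal.ofReal_ne_top, lintegral_enorm_sq_eq, lintegral_enorm_sq_eq,
    enorm_fourier_eq, enorm_fourier_eq] at hint
  have hint2 : ‖U‖ ^ 2 ≤ volume.real Ω * ‖U‖ ^ 2 * (1 / (2 * (volume.real Ω + 1))) +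
      k⁻¹ ^ 2 * ‖w‖ ^ 2 := by
    rw [← ENNReal.ofReal_le_ofReal_iff (by positivity), ENNReal.ofReal_add (by positivity) (by positivity),
      ENNReal.ofReal_pow (norm_nonneg _), ofReal_norm, ENNReal.ofReal_mul (by positivity),
      ENNReal.ofReal_mul (p := k⁻¹ ^ 2) (by positivity), ENNReal.ofReal_pow (norm_nonneg w), ofReal_norm]
    exact hint.trans (by gcongr)
  have h3 : volume.real Ω * ‖U‖ ^ 2 * (1 / (2 * (volume.real Ω + 1))) ≤ ‖U‖ ^ 2 / 2 := by
    have : (0 : ℝ) ≤ volume.real Ω := measureReal_nonneg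
    rw [mul_one_div, div_le_div_iff₀ (by positivity) (by norm_num)]
    nlinarith [sq_nonneg ‖U‖]
  have h4 : ‖toL2 u‖ = ‖U‖ := (norm_complexify _).symm
  rw [h4, ← abs_of_nonneg (norm_nonneg U)]
  refine abs_le_of_sq_le_sq ?_ (by positivity)
  rw [mul_pow, mul_pow, Real.sq_sqrt (by norm_num)]
  linarith

/-- `H̃^s(Ω)` is embedded into `L^ρ(Ω)`, with a bound in terms of `‖(-Δ)^{s/2} u‖`. -/
def EmbedsIn (s : ℝ≥0) (Ω : Set (Space n)) (ρ : ℝ≥0∞) : Prop :=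
  ∃ C : ℝ, 0 < C ∧ ∀ u : ↥(HTilde s Ω),
    eLpNorm (toL2 u) ρ (volume.restrict Ω) ≤ ENNReal.ofReal (C * ‖fracLap u‖)

/-- On a set of finite measure, the exponent of an embedding can be lowered by Hölder's
inequality. -/
theorem EmbedsIn.of_le (hb : volume Ω ≠ ⊤) {ρ ρ' : ℝ≥0∞} (h : ρ ≤ ρ')
    (h' : EmbedsIn s Ω ρ') : EmbedsIn s Ω ρ := by
  rcases eq_or_ne ρ 0 with rfl | h0
  · exact ⟨1, one_pos, fun u => by simp⟩
  obtain ⟨C, hC, hu⟩ := h'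
  set e : ℝ := 1 / ρ.toReal - 1 / ρ'.toReal with he
  have he0 : 0 ≤ e := by
    rcases eq_or_ne ρ' ⊤ with rfl | ht
    · simp [he]
    · have h1 : 0 < ρ.toReal := ENNReal.toReal_pos h0 (ne_top_of_le_ne_top ht h)
      have := ENNReal.toReal_mono ht h
      rw [he, sub_nonneg]
      gcongr
  refine ⟨C * (volume.real Ω ^ e + 1), by positivity, fun u => ?_⟩
  refine (eLpNorm_le_eLpNorm_mul_rpow_measure_univ h (Lp.aestronglyMeasurable _).restrict).trans ?_
  rw [Measure.restrict_apply_univ, ← ofReal_measureReal hb,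
    ENNReal.ofReal_rpow_of_nonneg measureReal_nonneg he0]
  calc _ ≤ ENNReal.ofReal (C * ‖fracLap u‖) * ENNReal.ofReal (volume.real Ω ^ e) := by
        gcongr; exact hu u
    _ ≤ _ := by
        rw [← ENNReal.ofReal_mul (by positivity)]
        apply ENNReal.ofReal_le_ofReal
        have : 0 ≤ C * ‖fracLap u‖ := by positivity
        nlinarith

theorem embedsIn_two (hn : 1 ≤ n) (hΩ : IsOpen Ω) (hb : volume Ω ≠ ⊤) : EmbedsIn s Ω 2 := by
  obtain ⟨C, hC, h⟩ := exists_poincare (s := s) hn hΩ hb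
  refine ⟨C, hC, fun u => ?_⟩
  refine (eLpNorm_mono_measure _ Measure.restrict_le_self).trans ?_
  rw [← Lp.enorm_def, ← ofReal_norm]
  exact ENNReal.ofReal_le_ofReal (h u)

theorem rpow_le_one_add_fracSymbol_sq {σ : ℝ} (h0 : 0 ≤ σ) (h : σ ≤ s) (ξ : Space n) :
    ‖ξ‖ ^ (2 * σ) ≤ 1 + fracSymbol s ξ ^ 2 := by
  have h1 : fracSymbol s ξ ^ 2 = (2 * Real.pi * ‖ξ‖) ^ (2 * (s : ℝ)) := by
    rw [fracSymbol, ← Real.rpow_natCast, ← Real.rpow_mul (by positivity)]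
    congr 1; push_cast; ring
  rw [h1]
  rcases le_total ‖ξ‖ 1 with h2 | h2
  · have := Real.rpow_le_one (norm_nonneg ξ) h2 (by linarith : 0 ≤ 2 * σ)
    have : 0 ≤ (2 * Real.pi * ‖ξ‖) ^ (2 * (s : ℝ)) := by positivity
    linarith
  · have h3 : ‖ξ‖ ≤ 2 * Real.pi * ‖ξ‖ :=
      le_mul_of_one_le_left (norm_nonneg _) (by linarith [Real.pi_gt_three])
    calc ‖ξ‖ ^ (2 * σ) ≤ ‖ξ‖ ^ (2 * (s : ℝ)) := Real.rpow_le_rpow_of_exponent_le h2 (by linarith)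
      _ ≤ (2 * Real.pi * ‖ξ‖) ^ (2 * (s : ℝ)) := Real.rpow_le_rpow (norm_nonneg _) h3 (by positivity)
      _ ≤ _ := by linarith

/-- Weighted Plancherel identity for the squared norm of `H^s(ℝⁿ)`. -/
theorem lintegral_one_add_fracSymbol_sq (u : ↥(HTilde s Ω)) :
    ∫⁻ ξ, ENNReal.ofReal (1 + fracSymbol s ξ ^ 2) * ‖(𝓕 (complexify n (toL2 u)) : L2C n) ξ‖ₑ ^ 2
      = ENNReal.ofReal (‖toL2 u‖ ^ 2 + ‖fracLap u‖ ^ 2) := by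
  have hlap := isFracLap_HTilde u
  have h : ∀ᵐ ξ, ENNReal.ofReal (1 + fracSymbol s ξ ^ 2) *
      ‖(𝓕 (complexify n (toL2 u)) : L2C n) ξ‖ₑ ^ 2 =
      ‖(𝓕 (complexify n (toL2 u)) : L2C n) ξ‖ₑ ^ 2 + ‖(𝓕 (fracLap u) : L2C n) ξ‖ₑ ^ 2 := by
    filter_upwards [hlap] with ξ e
    rw [e, ENNReal.ofReal_add (by norm_num) (by positivity), add_mul, ENNReal.ofReal_one, one_mul,
      enorm_mul, mul_pow, ← ofReal_norm ((fracSymbol s ξ : ℂ)), Complex.norm_real, Real.norm_eq_abs,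
      ← ENNReal.ofReal_pow (abs_nonneg _), sq_abs]
  rw [lintegral_congr_ae h, lintegral_add_left' ((Lp.aestronglyMeasurable _).enorm.pow_const 2),
    lintegral_enorm_sq_eq, lintegral_enorm_sq_eq, enorm_fourier_eq, enorm_fourier_eq,
    ENNReal.ofReal_add (by positivity) (by positivity), ENNReal.ofReal_pow (norm_nonneg _),
    ENNReal.ofReal_pow (norm_nonneg _), ← norm_complexify, ofReal_norm, ofReal_norm]

/-- By the Poincaré inequality, `‖(-Δ)^{s/2} u‖` is equivalent to the norm of `H^s(ℝⁿ)`. -/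
theorem exists_Hs_norm_le (hn : 1 ≤ n) (hΩ : IsOpen Ω) (hb : volume Ω ≠ ⊤) :
    ∃ K : ℝ, 0 < K ∧ ∀ u : ↥(HTilde s Ω), ‖toL2 u‖ ^ 2 + ‖fracLap u‖ ^ 2 ≤ (K * ‖fracLap u‖) ^ 2 := by
  obtain ⟨C, hC, h⟩ := exists_poincare (s := s) hn hΩ hb
  refine ⟨√(C ^ 2 + 1), by positivity, fun u => ?_⟩
  rw [mul_pow, Real.sq_sqrt (by positivity), add_mul, one_mul, ← mul_pow]
  gcongr
  exact h u

/-- The embedding into `L^ρ(Ω)` for finite `ρ > 2`: the homogeneous inequality of order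
`σ = n/2 - n/ρ ≤ s`, together with `|ξ|^{2σ} ≤ 1 + (2π|ξ|)^{2s}`. -/
theorem embedsIn_rpow (hn : 1 ≤ n) (hΩ : IsOpen Ω) (hb : volume Ω ≠ ⊤) {ρ : ℝ} (hρ : 2 < ρ)
    (hρs : (n : ℝ) / 2 - n / ρ ≤ s) : EmbedsIn s Ω (ENNReal.ofReal ρ) := by
  obtain ⟨C, hC, hS⟩ := exists_homogeneous_sobolev hn hρ
  obtain ⟨K, hK, hKu⟩ := exists_Hs_norm_le (s := s) hn hΩ hb
  have hρ0 : 0 < ρ := by linarith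
  refine ⟨C ^ (1 / ρ) * K, by positivity, fun u => ?_⟩
  rcases eq_or_ne (fracLap u) 0 with h0 | h0
  · have h1 : toL2 u = 0 := by
      obtain ⟨C', _, h⟩ := exists_poincare (s := s) hn hΩ hb
      have := h u
      rw [h0, norm_zero, mul_zero] at this
      exact norm_le_zero_iff.1 this
    rw [h1, eLpNorm_congr_ae (ae_restrict_of_ae (Lp.coeFn_zero ℝ 2 volume)), eLpNorm_zero]
    exact zero_le
  have hM : 0 < K * ‖fracLap u‖ := mul_pos hK (norm_pos_iff.2 h0)
  have h0σ : 0 ≤ (n : ℝ) / 2 - n / ρ := by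
    rw [sub_nonneg]; gcongr
  have h1 := hS (complexify n (toL2 u)) (K * ‖fracLap u‖) hM (by
    refine le_trans ?_ (ENNReal.ofReal_le_ofReal (hKu u))
    rw [← lintegral_one_add_fracSymbol_sq]
    refine lintegral_mono fun ξ => ?_
    gcongr
    exact rpow_le_one_add_fracSymbol_sq h0σ hρs ξ)
  refine (eLpNorm_mono_measure _ Measure.restrict_le_self).trans ?_
  rw [eLpNorm_eq_lintegral_rpow_enorm_toReal (by simpa using hρ0) ENNReal.ofReal_ne_top,
    ENNReal.toReal_ofReal hρ0.le]
  have h2 : ∫⁻ x, ‖toL2 u x‖ₑ ^ ρ = ∫⁻ x, ENNReal.ofReal (‖(complexify n (toL2 u) : L2C n) x‖ ^ ρ) := by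
    refine lintegral_congr_ae ?_
    filter_upwards [coeFn_complexify (toL2 u)] with x hx
    rw [hx, Complex.norm_real, ← ofReal_norm, ENNReal.ofReal_rpow_of_nonneg (norm_nonneg _) hρ0.le]
  rw [h2]
  refine (ENNReal.rpow_le_rpow h1 (by positivity)).trans (le_of_eq ?_)
  rw [ENNReal.ofReal_rpow_of_nonneg (by positivity) (by positivity),
    Real.mul_rpow (by positivity) (by positivity), ← Real.rpow_mul hM.le, mul_one_div_cancel hρ0.ne',
    Real.rpow_one, mul_assoc]

/-- For `2s > n`, the transform of `u` is integrable, so `u` is bounded. -/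
theorem embedsIn_top (hn : 1 ≤ n) (hΩ : IsOpen Ω) (hb : volume Ω ≠ ⊤) (hs : (n : ℝ) < 2 * s) :
    EmbedsIn s Ω ⊤ := by
  obtain ⟨K, hK, hKu⟩ := exists_Hs_norm_le (s := s) hn hΩ hb
  have hint := integrable_rpow_neg_one_add_norm_sq (E := Space n) (μ := volume) (r := 2 * s)
    (by simpa using hs)
  set J : ℝ := ∫ ξ : Space n, (1 + ‖ξ‖ ^ 2) ^ (-(2 * (s : ℝ)) / 2) with hJ
  have hJ0 : 0 ≤ J := integral_nonneg fun ξ => by positivity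
  refine ⟨√J * √(2 ^ (s : ℝ)) * K + 1, by positivity, fun u => ?_⟩
  set U : L2C n := complexify n (toL2 u) with hU
  have hmain : ∫⁻ ξ, ‖(𝓕 U : L2C n) ξ‖ₑ ≤ ENNReal.ofReal (√J * √(2 ^ (s : ℝ)) * (K * ‖fracLap u‖)) := by
    refine (lintegral_enorm_le_of_weight (κ := fun ξ : Space n => (1 + ‖ξ‖ ^ 2) ^ (s : ℝ)) (by fun_prop)
      (Eventually.of_forall fun ξ => by positivity) (Lp.aestronglyMeasurable _)).trans ?_
    have h1 : ∫⁻ ξ : Space n, ENNReal.ofReal ((1 + ‖ξ‖ ^ 2) ^ (s : ℝ))⁻¹ = ENNReal.ofReal J := by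
      rw [hJ, ofReal_integral_eq_lintegral_ofReal hint (Eventually.of_forall fun ξ => by positivity)]
      refine lintegral_congr fun ξ => ?_
      rw [← Real.rpow_neg (by positivity)]
      congr 2; ring
    have h2 : ∫⁻ ξ, ENNReal.ofReal ((1 + ‖ξ‖ ^ 2) ^ (s : ℝ)) * ‖(𝓕 U : L2C n) ξ‖ₑ ^ 2 ≤
        ENNReal.ofReal (2 ^ (s : ℝ) * (K * ‖fracLap u‖) ^ 2) := by
      rw [ENNReal.ofReal_mul (by positivity)]
      refine le_trans ?_ (mul_le_mul_right (ENNReal.ofReal_le_ofReal (hKu u)) _)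
      rw [← lintegral_one_add_fracSymbol_sq, ← lintegral_const_mul' _ _ ENNReal.ofReal_ne_top]
      refine lintegral_mono fun ξ => ?_
      rw [← mul_assoc, ← ENNReal.ofReal_mul (by positivity)]
      gcongr
      have h3 := rpow_le_one_add_fracSymbol_sq (s := s) (σ := s) s.2 le_rfl ξ
      rcases le_total ‖ξ‖ 1 with h4 | h4
      · calc (1 + ‖ξ‖ ^ 2) ^ (s : ℝ) ≤ 2 ^ (s : ℝ) :=
              Real.rpow_le_rpow (by positivity) (by nlinarith [norm_nonneg ξ]) s.2
          _ ≤ _ := le_mul_of_one_le_right (by positivity) (by nlinarith [sq_nonneg (fracSymbol s ξ)])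
      · calc (1 + ‖ξ‖ ^ 2) ^ (s : ℝ) ≤ (2 * ‖ξ‖ ^ 2) ^ (s : ℝ) :=
              Real.rpow_le_rpow (by positivity) (by nlinarith [norm_nonneg ξ]) s.2
          _ = 2 ^ (s : ℝ) * ‖ξ‖ ^ (2 * (s : ℝ)) := by
              rw [Real.mul_rpow (by norm_num) (by positivity), ← Real.rpow_natCast ‖ξ‖ 2,
                ← Real.rpow_mul (norm_nonneg _)]
              norm_num
          _ ≤ _ := by gcongr
    rw [h1]
    calc _ ≤ ENNReal.ofReal J ^ (1 / 2 : ℝ) *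
          ENNReal.ofReal (2 ^ (s : ℝ) * (K * ‖fracLap u‖) ^ 2) ^ (1 / 2 : ℝ) := by gcongr
      _ = _ := by
          rw [ENNReal.ofReal_rpow_of_nonneg hJ0 (by norm_num),
            ENNReal.ofReal_rpow_of_nonneg (by positivity) (by norm_num),
            ← ENNReal.ofReal_mul (by positivity), ← Real.sqrt_eq_rpow, ← Real.sqrt_eq_rpow,
            Real.sqrt_mul (by positivity), Real.sqrt_sq (by positivity), mul_assoc]
  have hi : Integrable (𝓕 U : L2C n) :=
    ⟨Lp.aestronglyMeasurable _, hmain.trans_lt ENNReal.ofReal_lt_top⟩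
  have hb := norm_fourierInv_le (𝓕 U : L2C n) hi
  rw [fourierInv_fourier_L2, integral_norm_eq_lintegral_enorm hi.1] at hb
  have h5 := ENNReal.toReal_le_of_le_ofReal (by positivity) hmain
  refine (eLpNorm_mono_measure _ Measure.restrict_le_self).trans ?_
  rw [eLpNorm_exponent_top]
  refine eLpNormEssSup_le_of_ae_bound ?_
  filter_upwards [hb, coeFn_complexify (toL2 u)] with x e1 e2
  rw [e2, Complex.norm_real] at e1
  have : 0 ≤ ‖fracLap u‖ := norm_nonneg _
  nlinarith

/-- The Sobolev embedding theorem for `H̃^s(Ω)`. -/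
theorem embedsIn_of_subcritical (hn : 1 ≤ n) (hΩ : IsOpen Ω) (hb : volume Ω ≠ ⊤) {ρ : ℝ≥0∞}
    (h1 : 2 * (s : ℝ) < n → ρ ≤ ENNReal.ofReal (2 * n / (n - 2 * s)))
    (h2 : 2 * (s : ℝ) = n → ρ < ⊤) : EmbedsIn s Ω ρ := by
  rcases lt_trichotomy (2 * (s : ℝ)) n with h | h | h
  · refine EmbedsIn.of_le hb (h1 h) ?_
    have hp : 0 < (n : ℝ) - 2 * s := by linarith
    have hn0 : (0 : ℝ) < n := by exact_mod_cast hn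
    rcases eq_or_ne (s : ℝ) 0 with hs0 | hs0
    · have : 2 * (n : ℝ) / (n - 2 * s) = 2 := by
        rw [hs0, mul_zero, sub_zero, mul_div_assoc, div_self hn0.ne', mul_one]
      rw [this]
      convert embedsIn_two (s := s) hn hΩ hb
      norm_num
    · have hs : 0 < (s : ℝ) := lt_of_le_of_ne s.2 (Ne.symm hs0)
      refine embedsIn_rpow hn hΩ hb ?_ (le_of_eq ?_)
      · rw [lt_div_iff₀ hp]; linarith
      · field_simp; ring
  · have hρ := (h2 h).ne
    refine EmbedsIn.of_le (ρ' := ENNReal.ofReal (ρ.toReal + 3)) hb ?_ ?_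
    · rw [← ENNReal.ofReal_toReal hρ]
      exact ENNReal.ofReal_le_ofReal (by rw [ENNReal.toReal_ofReal ENNReal.toReal_nonneg]; linarith)
    · refine embedsIn_rpow hn hΩ hb (by linarith [ENNReal.toReal_nonneg (a := ρ)]) ?_
      have : 0 ≤ (n : ℝ) / (ρ.toReal + 3) := by
        have := ENNReal.toReal_nonneg (a := ρ); positivity
      linarith
  · exact EmbedsIn.of_le hb le_top (embedsIn_top hn hΩ hb h)

end Embeddings

/-! ### Nemytskii operators -/

section Measurability

theorem aestronglyMeasurable_caratheodory_comp {α V H : Type*} [MeasurableSpace α] {μ : Measure α}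
    [TopologicalSpace V] [TopologicalSpace H] [TopologicalSpace.PseudoMetrizableSpace H]
    [AddCommMonoid H] [ContinuousAdd H] {N : α → V → H} (hc : ∀ᵐ a ∂μ, Continuous (N a))
    (hm : ∀ v, AEStronglyMeasurable (fun a => N a v) μ) {u : α → V} (hu : AEStronglyMeasurable u μ) :
    AEStronglyMeasurable (fun a => N a (u a)) μ := by
  obtain ⟨u', hu', huu⟩ := hu
  have hk : ∀ k, AEStronglyMeasurable (fun a => N a (hu'.approx k a)) μ := by
    intro k
    set φ := hu'.approx k
    have : (fun a => N a (φ a)) =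
        fun a => ∑ v ∈ φ.range, (φ ⁻¹' {v}).indicator (fun a => N a v) a := by
      funext a
      rw [Finset.sum_eq_single (φ a)]
      · rw [indicator_of_mem (by simp)]
      · intro v _ hv
        rw [indicator_of_notMem]
        simpa using hv.symm
      · intro h
        exact absurd (SimpleFunc.mem_range_self φ a) h
    rw [this]
    exact Finset.aestronglyMeasurable_fun_sum _ fun v _ =>
      (hm v).indicator (φ.measurableSet_preimage _)
  have hlim : AEStronglyMeasurable (fun a => N a (u' a)) μ := by
    refine aestronglyMeasurable_of_tendsto_ae atTop hk ?_
    filter_upwards [hc] with a ha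
    exact (ha.tendsto _).comp (hu'.tendsto_approx a)
  refine hlim.congr ?_
  filter_upwards [huu] with a ha
  rw [ha]

/-- Pettis' theorem: in a separable Hilbert space weak measurability implies strong measurability.
-/
theorem aestronglyMeasurable_of_inner {α H : Type*} [MeasurableSpace α] {μ : Measure α}
    [NormedAddCommGroup H] [InnerProductSpace ℝ H] [CompleteSpace H] [SecondCountableTopology H]
    {G : α → H} (h : ∀ y : H, AEMeasurable (fun a => ⟪y, G a⟫_ℝ) μ) : AEStronglyMeasurable G μ := by
  let _ : MeasurableSpace H := borel H
  have : BorelSpace H := ⟨rfl⟩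
  set e : H → ℕ → ℝ := fun x k => ⟪TopologicalSpace.denseSeq H k, x⟫_ℝ with he
  have hec : Continuous e := by fun_prop
  have hei : Function.Injective e := by
    intro x y hxy
    refine ext_inner_left ℝ fun v => ?_
    have : (fun v : H => ⟪v, x⟫_ℝ) = fun v => ⟪v, y⟫_ℝ :=
      (TopologicalSpace.denseRange_denseSeq H).equalizer (by fun_prop) (by fun_prop)
        (funext fun k => congrFun hxy k)
    exact congrFun this v
  refine AEMeasurable.aestronglyMeasurable ?_
  rw [← (hec.measurableEmbedding hei).aemeasurable_comp_iff]
  exact aemeasurable_pi_iff.2 fun k => h _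

variable {n : ℕ} {s : ℝ≥0} {Ω : Set (Space n)} {T : ℝ}

theorem restrict_cylinder (Ω : Set (Space n)) (T : ℝ) :
    (volume.restrict (cylinder Ω T) : Measure (Space n × ℝ)) =
      (volume.restrict Ω).prod (timeMeasure T) := by
  rw [cylinder, Measure.volume_eq_prod, Measure.prod_restrict]

theorem ae_ae_of_ae_cylinder {P : Space n × ℝ → Prop}
    (h : ∀ᵐ z ∂(volume.restrict (cylinder Ω T)), P z) :
    ∀ᵐ t ∂(timeMeasure T), ∀ᵐ x ∂(volume.restrict Ω), P (x, t) := by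
  rw [restrict_cylinder] at h
  exact Measure.ae_ae_of_ae_prod (Measure.measurePreserving_swap.quasiMeasurePreserving.ae h)

/-- Almost every time slice of a Carathéodory function is a Carathéodory function. -/
theorem IsCaratheodory.slice {f : Space n × ℝ → ℝ → ℝ} (hf : IsCaratheodory Ω T f) :
    ∀ᵐ t ∂(timeMeasure T), (∀ᵐ x ∂(volume.restrict Ω), Continuous (f (x, t))) ∧
      ∀ τ : ℝ, AEStronglyMeasurable (fun x => f (x, t) τ) (volume.restrict Ω) := by
  have h1 : ∀ᵐ t ∂(timeMeasure T), ∀ τ : ℚ,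
      AEStronglyMeasurable (fun x => f (x, t) τ) (volume.restrict Ω) := by
    rw [ae_all_iff]
    intro τ
    have := hf.2 τ
    rw [restrict_cylinder] at this
    exact this.aestronglyMeasurable.prod_swap.prodMk_left
  filter_upwards [ae_ae_of_ae_cylinder hf.1, h1] with t e1 e2
  refine ⟨e1, fun τ => ?_⟩
  obtain ⟨a, ha, hlim⟩ := mem_closure_iff_seq_limit.1 (Rat.denseRange_cast (𝕜 := ℝ) τ)
  refine aestronglyMeasurable_of_tendsto_ae atTop (f := fun k x => f (x, t) (a k)) (fun k => ?_) ?_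
  · obtain ⟨q, hq⟩ := ha k
    rw [← hq]
    exact e2 q
  · filter_upwards [e1] with x hx
    exact (hx.tendsto τ).comp hlim

open Classical in
/-- The Nemytskii operator of `f` at time `t`: the function `x ↦ f(x,t,w(x))` on `Ω`, extended by
zero; it is given the value `0` if this function is not square integrable. -/
def nemytskii (hΩ : IsOpen Ω) (f : Space n × ℝ → ℝ → ℝ) (t : ℝ) (w : L2 n) : ↥(LTilde Ω) :=
  if h : MemLp (fun x => f (x, t) (w x)) 2 (volume.restrict Ω) then
    extendZero hΩ (fun x => f (x, t) (w x)) h else 0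

theorem coeFn_nemytskii (hΩ : IsOpen Ω) {f : Space n × ℝ → ℝ → ℝ} {t : ℝ} {w : L2 n}
    (h : MemLp (fun x => f (x, t) (w x)) 2 (volume.restrict Ω)) :
    (nemytskii hΩ f t w : L2 n) =ᵐ[volume.restrict Ω] fun x => f (x, t) (w x) := by
  rw [nemytskii, dif_pos h]
  exact coeFn_extendZero hΩ _ h

theorem secondCountableTopology_LTilde : SecondCountableTopology ↥(LTilde Ω) :=
  have : Fact ((2 : ℝ≥0∞) ≠ ⊤) := ⟨by norm_num⟩
  have : SecondCountableTopology (L2 n) := Lp.SecondCountableTopology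
  TopologicalSpace.Subtype.secondCountableTopology _

theorem inner_nemytskii (hΩ : IsOpen Ω) {f : Space n × ℝ → ℝ → ℝ} {t : ℝ} {w : L2 n}
    (h : MemLp (fun x => f (x, t) (w x)) 2 (volume.restrict Ω)) (y : ↥(LTilde Ω)) :
    ⟪nemytskii hΩ f t w, y⟫_ℝ = ∫ x in Ω, f (x, t) (w x) * (y : L2 n) x := by
  rw [inner_LTilde hΩ]
  refine integral_congr_ae ?_
  filter_upwards [coeFn_nemytskii hΩ h] with x hx
  rw [hx]

theorem norm_sub_LTilde (hΩ : IsOpen Ω) {u v : ↥(LTilde Ω)} {g h : Space n → ℝ} {B : ℝ} (hB : 0 ≤ B)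
    (hu : (u : L2 n) =ᵐ[volume.restrict Ω] g) (hv : (v : L2 n) =ᵐ[volume.restrict Ω] h)
    (hgh : eLpNorm (fun x => g x - h x) 2 (volume.restrict Ω) ≤ ENNReal.ofReal B) : ‖u - v‖ ≤ B := by
  rw [← toReal_enorm, ← eLpNorm_restrict_of_mem_LTilde hΩ]
  refine ENNReal.toReal_le_of_le_ofReal hB (le_trans (le_of_eq (eLpNorm_congr_ae ?_)) hgh)
  filter_upwards [ae_restrict_of_ae (Lp.coeFn_sub (u : L2 n) (v : L2 n)), hu, hv] with x e1 e2 e3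
  rw [show ((u - v : ↥(LTilde Ω)) : L2 n) = (u : L2 n) - v from rfl, e1, Pi.sub_apply, e2, e3]

theorem aestronglyMeasurable_nemytskii_const (hΩ : IsOpen Ω) {f : Space n × ℝ → ℝ → ℝ}
    (hf : IsCaratheodory Ω T f) (w : L2 n)
    (hw : ∀ᵐ t ∂(timeMeasure T), MemLp (fun x => f (x, t) (w x)) 2 (volume.restrict Ω)) :
    AEStronglyMeasurable (fun t => nemytskii hΩ f t w) (timeMeasure T) := by
  have := secondCountableTopology_LTilde (Ω := Ω)
  refine aestronglyMeasurable_of_inner fun y => ?_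
  have hjoint : AEStronglyMeasurable (fun z : Space n × ℝ => f z (w z.1) * (y : L2 n) z.1)
      ((volume.restrict Ω).prod (timeMeasure T)) := by
    refine AEStronglyMeasurable.mul ?_ ((Lp.aestronglyMeasurable (y : L2 n)).restrict.comp_fst)
    rw [← restrict_cylinder]
    refine aestronglyMeasurable_caratheodory_comp hf.1 (fun τ => (hf.2 τ).aestronglyMeasurable) ?_
    rw [restrict_cylinder]
    exact (Lp.aestronglyMeasurable w).restrict.comp_fst
  refine (hjoint.prod_swap.integral_prod_right').aemeasurable.congr ?_
  filter_upwards [hw] with t ht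
  rw [real_inner_comm, inner_nemytskii hΩ ht]
  rfl

/-- The Nemytskii operator is strongly measurable along strongly measurable functions with values in
`H̃^s(Ω)`, if it is continuous there. -/
theorem aestronglyMeasurable_nemytskii (hΩ : IsOpen Ω) {f : Space n × ℝ → ℝ → ℝ}
    (hf : IsCaratheodory Ω T f)
    (hmem : ∀ᵐ t ∂(timeMeasure T), ∀ w : ↥(HTilde s Ω),
      MemLp (fun x => f (x, t) (toL2 w x)) 2 (volume.restrict Ω))
    (hc : ∀ᵐ t ∂(timeMeasure T), Continuous fun w : ↥(HTilde s Ω) => nemytskii hΩ f t (toL2 w))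
    {u : ℝ → ↥(HTilde s Ω)} (hu : AEStronglyMeasurable u (timeMeasure T)) :
    AEStronglyMeasurable (fun t => nemytskii hΩ f t (toL2 (u t))) (timeMeasure T) := by
  refine aestronglyMeasurable_caratheodory_comp
    (N := fun t (w : ↥(HTilde s Ω)) => nemytskii hΩ f t (toL2 w)) hc (fun w => ?_) hu
  refine aestronglyMeasurable_nemytskii_const hΩ hf _ ?_
  filter_upwards [hmem] with t ht using ht w

/-- Composition with a slice of a Carathéodory function preserves measurability. -/
theorem aestronglyMeasurable_slice_comp {f : Space n × ℝ → ℝ → ℝ} (hf : IsCaratheodory Ω T f) :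
    ∀ᵐ t ∂(timeMeasure T), ∀ w : L2 n,
      AEStronglyMeasurable (fun x => f (x, t) (w x)) (volume.restrict Ω) := by
  filter_upwards [hf.slice] with t ht w
  exact aestronglyMeasurable_caratheodory_comp ht.1 ht.2 (Lp.aestronglyMeasurable w).restrict

end Measurability

section Bounds

variable {n : ℕ} {s : ℝ≥0} {Ω : Set (Space n)} {T : ℝ}

/-- Hölder's inequality with the exponents `2(e+1)/e` and `2(e+1)`. -/
theorem eLpNorm_rpow_mul_le {α : Type*} [MeasurableSpace α] {μ : Measure α} {e : ℝ} (he : 0 < e)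
    {A B : α → ℝ} (hA : AEStronglyMeasurable A μ) (hB : AEStronglyMeasurable B μ) :
    eLpNorm (fun x => |A x| ^ e * |B x|) 2 μ ≤
      eLpNorm A (ENNReal.ofReal (2 * (e + 1))) μ ^ e * eLpNorm B (ENNReal.ofReal (2 * (e + 1))) μ := by
  have hT : ENNReal.HolderTriple (ENNReal.ofReal (2 * (e + 1) / e)) (ENNReal.ofReal (2 * (e + 1))) 2 := by
    constructor
    rw [← ENNReal.ofReal_inv_of_pos (by positivity), ← ENNReal.ofReal_inv_of_pos (by positivity),
      ← ENNReal.ofReal_add (by positivity) (by positivity),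
      show (2 : ℝ≥0∞) = ENNReal.ofReal 2 by norm_num, ← ENNReal.ofReal_inv_of_pos (by norm_num)]
    congr 1
    field_simp
  have h1 : eLpNorm (fun x => ‖A x‖ ^ e) (ENNReal.ofReal (2 * (e + 1) / e)) μ =
      eLpNorm A (ENNReal.ofReal (2 * (e + 1))) μ ^ e := by
    rw [eLpNorm_norm_rpow _ he, ← ENNReal.ofReal_mul (by positivity)]
    congr 3
    field_simp
  rw [← h1, ← eLpNorm_norm B]
  exact eLpNorm_smul_le_mul_eLpNorm (φ := fun x => ‖A x‖ ^ e) (f := fun x => ‖B x‖) hB.norm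
    (hA.norm.aemeasurable.pow_const e).aestronglyMeasurable

/-- The products occurring in a difference of powers of order `e + 1` are bounded in `L²(Ω)`,
provided that `H̃^s(Ω)` embeds into `L^{2(e+1)}(Ω)`. -/
theorem exists_power_bound {e : ℝ} (he : 0 < e) (hE : EmbedsIn s Ω (ENNReal.ofReal (2 * (e + 1)))) :
    ∃ K : ℝ, 0 < K ∧ ∀ w w' : ↥(HTilde s Ω),
      eLpNorm (fun x => (|toL2 w x| ^ e + |toL2 w' x| ^ e) * |toL2 w x - toL2 w' x|) 2
        (volume.restrict Ω) ≤
      ENNReal.ofReal (K * (‖fracLap w‖ ^ e + ‖fracLap w'‖ ^ e) * ‖fracLap (w - w')‖) := by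
  obtain ⟨K, hK, h⟩ := hE
  refine ⟨K ^ e * K, by positivity, fun w w' => ?_⟩
  have hw := (Lp.aestronglyMeasurable (toL2 w)).restrict (s := Ω)
  have hw' := (Lp.aestronglyMeasurable (toL2 w')).restrict (s := Ω)
  have hd := (Lp.aestronglyMeasurable (toL2 (w - w'))).restrict (s := Ω)
  have hsub : ∀ᵐ x ∂(volume.restrict Ω), toL2 (w - w') x = toL2 w x - toL2 w' x := by
    filter_upwards [ae_restrict_of_ae (Lp.coeFn_sub (toL2 w) (toL2 w'))] with x hx
    rw [map_sub, hx, Pi.sub_apply]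
  have h1 : eLpNorm (fun x => (|toL2 w x| ^ e + |toL2 w' x| ^ e) * |toL2 w x - toL2 w' x|) 2
        (volume.restrict Ω) = eLpNorm ((fun x => |toL2 w x| ^ e * |toL2 (w - w') x|) +
          fun x => |toL2 w' x| ^ e * |toL2 (w - w') x|) 2 (volume.restrict Ω) := by
    refine eLpNorm_congr_ae ?_
    filter_upwards [hsub] with x hx
    simp only [Pi.add_apply]
    rw [hx, add_mul]
  have hpow : ∀ v : ↥(HTilde s Ω), eLpNorm (fun x => |toL2 v x| ^ e * |toL2 (w - w') x|) 2
      (volume.restrict Ω) ≤ ENNReal.ofReal (K ^ e * K * ‖fracLap v‖ ^ e * ‖fracLap (w - w')‖) := by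
    intro v
    refine (eLpNorm_rpow_mul_le he (Lp.aestronglyMeasurable (toL2 v)).restrict hd).trans ?_
    calc _ ≤ ENNReal.ofReal (K * ‖fracLap v‖) ^ e * ENNReal.ofReal (K * ‖fracLap (w - w')‖) := by
          gcongr
          · exact h v
          · exact h _
      _ = _ := by
          rw [ENNReal.ofReal_rpow_of_nonneg (by positivity) he.le, ← ENNReal.ofReal_mul (by positivity),
            Real.mul_rpow hK.le (norm_nonneg _)]
          congr 1; ring
  have hm : ∀ v : ↥(HTilde s Ω), AEStronglyMeasurable
      (fun x => |toL2 v x| ^ e * |toL2 (w - w') x|) (volume.restrict Ω) := fun v =>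
    (((Lp.aestronglyMeasurable (toL2 v)).restrict.norm.aemeasurable.pow_const e).aestronglyMeasurable).mul
      hd.norm
  rw [h1]
  refine (eLpNorm_add_le (hm w) (hm w') (by norm_num)).trans ((add_le_add (hpow w) (hpow w')).trans ?_)
  rw [← ENNReal.ofReal_add (by positivity) (by positivity)]
  exact ENNReal.ofReal_le_ofReal (le_of_eq (by ring))

/-- The mean value theorem for a function whose derivative has power growth. -/
theorem abs_sub_le_of_deriv_growth {g : ℝ → ℝ} (hg : Differentiable ℝ g) {C γ r : ℝ} (hγ : 0 < γ)
    (hr : 0 < r) (h : ∀ τ, |deriv g τ| ≤ C * (|τ| ^ γ + |τ| ^ r)) (τ τ' : ℝ) :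
    |g τ - g τ'| ≤ |C| * ((|τ| ^ γ + |τ'| ^ γ) + (|τ| ^ r + |τ'| ^ r)) * |τ - τ'| := by
  have hb : ∀ x ∈ uIcc τ' τ, ‖deriv g x‖ ≤
      |C| * ((|τ| ^ γ + |τ'| ^ γ) + (|τ| ^ r + |τ'| ^ r)) := by
    intro x hx
    have hx1 : |x| ≤ max |τ| |τ'| := by
      rw [mem_uIcc] at hx
      rcases hx with hx | hx
      · have := abs_le_max_abs_abs hx.1 hx.2; rwa [max_comm]
      · exact abs_le_max_abs_abs hx.1 hx.2
    have hpow : ∀ e : ℝ, 0 < e → |x| ^ e ≤ |τ| ^ e + |τ'| ^ e := by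
      intro e he
      refine (Real.rpow_le_rpow (abs_nonneg _) hx1 he.le).trans ?_
      have h1 : 0 ≤ |τ| ^ e := by positivity
      have h2 : 0 ≤ |τ'| ^ e := by positivity
      rcases max_cases |τ| |τ'| with h | h <;> rw [h.1] <;> linarith
    refine (h x).trans ((mul_le_mul_of_nonneg_right (le_abs_self C) (by positivity)).trans ?_)
    gcongr
    · exact hpow γ hγ
    · exact hpow r hr
  exact Convex.norm_image_sub_le_of_norm_deriv_le (fun x _ => hg x) hb (convex_uIcc _ _)
    left_mem_uIcc right_mem_uIcc

theorem eLpNorm_sub_le_of_growth {α : Type*} [MeasurableSpace α] {μ : Measure α} {γ r C P Q : ℝ}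
    (hP : 0 ≤ P) (hQ : 0 ≤ Q) {g : α → ℝ → ℝ} {W W' : α → ℝ} (hW : AEStronglyMeasurable W μ)
    (hW' : AEStronglyMeasurable W' μ)
    (h1 : eLpNorm (fun x => (|W x| ^ γ + |W' x| ^ γ) * |W x - W' x|) 2 μ ≤ ENNReal.ofReal P)
    (h2 : eLpNorm (fun x => (|W x| ^ r + |W' x| ^ r) * |W x - W' x|) 2 μ ≤ ENNReal.ofReal Q)
    (h : ∀ᵐ x ∂μ, ∀ τ τ',
      |g x τ - g x τ'| ≤ |C| * ((|τ| ^ γ + |τ'| ^ γ) + (|τ| ^ r + |τ'| ^ r)) * |τ - τ'|) :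
    eLpNorm (fun x => g x (W x) - g x (W' x)) 2 μ ≤ ENNReal.ofReal ((|C| + 1) * (P + Q)) := by
  have hme : ∀ e : ℝ, AEStronglyMeasurable (fun x => (|W x| ^ e + |W' x| ^ e) * |W x - W' x|) μ :=
    fun e => ((hW.norm.aemeasurable.pow_const e).add
      (hW'.norm.aemeasurable.pow_const e)).aestronglyMeasurable.mul (hW.sub hW').norm
  have step1 : eLpNorm (fun x => g x (W x) - g x (W' x)) 2 μ ≤
      eLpNorm (|C| • ((fun x => (|W x| ^ γ + |W' x| ^ γ) * |W x - W' x|) +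
        fun x => (|W x| ^ r + |W' x| ^ r) * |W x - W' x|)) 2 μ := by
    refine eLpNorm_mono_ae ?_
    filter_upwards [h] with x hx
    simp only [Pi.smul_apply, Pi.add_apply, smul_eq_mul]
    rw [Real.norm_eq_abs]
    refine (hx _ _).trans (le_trans (le_of_eq (by ring)) (le_abs_self _))
  refine step1.trans ?_
  rw [eLpNorm_const_smul]
  refine (mul_le_mul_right ((eLpNorm_add_le (hme γ) (hme r) (by norm_num)).trans
    (add_le_add h1 h2)) _).trans ?_
  rw [← ofReal_norm, Real.norm_eq_abs, abs_abs, ← ENNReal.ofReal_add hP hQ,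
    ← ENNReal.ofReal_mul (abs_nonneg _)]
  apply ENNReal.ofReal_le_ofReal
  gcongr
  linarith

/-- The Nemytskii operator of the nonlinearity is locally Lipschitz continuous from `H̃^s(Ω)` to
`L²(Ω)`, uniformly in time. -/
theorem exists_nemytskii_lipschitz (hΩ : IsOpen Ω) {γ r : ℝ} (hγ : 0 < γ) (hr : 0 < r)
    (hEγ : EmbedsIn s Ω (ENNReal.ofReal (2 * (γ + 1))))
    (hEr : EmbedsIn s Ω (ENNReal.ofReal (2 * (r + 1)))) {f : Space n × ℝ → ℝ → ℝ}
    (hf : IsNonlinearity Ω T γ r f) :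
    ∃ K : ℝ, 0 < K ∧ ∀ᵐ t ∂(timeMeasure T),
      (∀ w : ↥(HTilde s Ω), MemLp (fun x => f (x, t) (toL2 w x)) 2 (volume.restrict Ω)) ∧
      (nemytskii hΩ f t 0 = 0) ∧
      ∀ w w' : ↥(HTilde s Ω), ‖nemytskii hΩ f t (toL2 w) - nemytskii hΩ f t (toL2 w')‖ ≤
        K * ((‖fracLap w‖ ^ γ + ‖fracLap w'‖ ^ γ) + (‖fracLap w‖ ^ r + ‖fracLap w'‖ ^ r)) *
          ‖fracLap (w - w')‖ := by
  obtain ⟨hcar, h0, hdiff, -, C, hC⟩ := hf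
  obtain ⟨K₁, hK₁, h1⟩ := exists_power_bound hγ hEγ
  obtain ⟨K₂, hK₂, h2⟩ := exists_power_bound hr hEr
  refine ⟨(|C| + 1) * (K₁ + K₂), by positivity, ?_⟩
  have hgr : ∀ᵐ z ∂(volume.restrict (cylinder Ω T)), f z 0 = 0 ∧ ∀ τ τ',
      |f z τ - f z τ'| ≤ |C| * ((|τ| ^ γ + |τ'| ^ γ) + (|τ| ^ r + |τ'| ^ r)) * |τ - τ'| := by
    filter_upwards [h0, hdiff, hC] with z e0 e1 e2
    exact ⟨e0, abs_sub_le_of_deriv_growth e1 hγ hr e2⟩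
  filter_upwards [ae_ae_of_ae_cylinder hgr, aestronglyMeasurable_slice_comp hcar] with t e1 e2
  have hkey : ∀ w w' : ↥(HTilde s Ω),
      eLpNorm (fun x => f (x, t) (toL2 w x) - f (x, t) (toL2 w' x)) 2 (volume.restrict Ω) ≤
      ENNReal.ofReal ((|C| + 1) * (K₁ + K₂) * ((‖fracLap w‖ ^ γ + ‖fracLap w'‖ ^ γ) +
        (‖fracLap w‖ ^ r + ‖fracLap w'‖ ^ r)) * ‖fracLap (w - w')‖) := by
    intro w w'
    refine (eLpNorm_sub_le_of_growth (g := fun x => f (x, t)) (C := C) ?_ ?_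
      (Lp.aestronglyMeasurable (toL2 w)).restrict (Lp.aestronglyMeasurable (toL2 w')).restrict
      (h1 w w') (h2 w w') (e1.mono fun x hx => hx.2)).trans (ENNReal.ofReal_le_ofReal ?_)
    · positivity
    · positivity
    have a1 : 0 ≤ (‖fracLap w‖ ^ γ + ‖fracLap w'‖ ^ γ) * ‖fracLap (w - w')‖ := by positivity
    have a2 : 0 ≤ (‖fracLap w‖ ^ r + ‖fracLap w'‖ ^ r) * ‖fracLap (w - w')‖ := by positivity
    have a3 : 0 ≤ |C| + 1 := by positivity
    nlinarith [mul_nonneg a3 (mul_nonneg hK₂.le a1), mul_nonneg a3 (mul_nonneg hK₁.le a2)]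
  have hzero : ∀ᵐ x ∂(volume.restrict Ω), f (x, t) (toL2 (0 : ↥(HTilde s Ω)) x) = 0 := by
    filter_upwards [e1, ae_restrict_of_ae (Lp.coeFn_zero ℝ 2 (volume : Measure (Space n)))] with x e1 e3
    rw [map_zero, e3]; exact e1.1
  have hmem : ∀ w : ↥(HTilde s Ω), MemLp (fun x => f (x, t) (toL2 w x)) 2 (volume.restrict Ω) := by
    intro w
    refine ⟨e2 _, lt_of_le_of_lt (le_of_eq (eLpNorm_congr_ae ?_))
      ((hkey w 0).trans_lt ENNReal.ofReal_lt_top)⟩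
    filter_upwards [hzero] with x hx
    rw [hx, sub_zero]
  refine ⟨hmem, ?_, fun w w' => ?_⟩
  · have h3 := coeFn_nemytskii hΩ (hmem 0)
    rw [map_zero] at h3 hzero
    refine ext_LTilde hΩ ?_
    filter_upwards [h3, hzero, ae_restrict_of_ae (Lp.coeFn_zero ℝ 2 (volume : Measure (Space n)))]
      with x a b c
    rw [a, b]; exact c.symm
  · exact norm_sub_LTilde hΩ (by positivity) (coeFn_nemytskii hΩ (hmem w))
      (coeFn_nemytskii hΩ (hmem w')) (hkey w w')

theorem isCaratheodory_potential {q : Space n × ℝ → ℝ} {p : ℝ≥0∞} (hq : IsPotential Ω T p q) :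
    IsCaratheodory Ω T fun z τ => q z * τ :=
  ⟨Eventually.of_forall fun _ => continuous_const.mul continuous_id,
    fun τ => hq.1.aemeasurable.mul_const τ⟩

/-- Multiplication with the potential is bounded from `H̃^s(Ω)` to `L²(Ω)`, uniformly in time. -/
theorem exists_potential_bound (hn : 1 ≤ n) (hs : 0 < s) (hΩ : IsOpen Ω) (hb : volume Ω ≠ ⊤)
    {p : ℝ≥0∞} (hp : AdmissiblePotentialExponent n s p) {q : Space n × ℝ → ℝ}
    (hq : IsPotential Ω T p q) :
    ∃ K : ℝ, 0 < K ∧ ∀ᵐ t ∂(timeMeasure T),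
      (∀ w : ↥(HTilde s Ω), MemLp (fun x => q (x, t) * toL2 w x) 2 (volume.restrict Ω)) ∧
      ∀ w w' : ↥(HTilde s Ω), ‖nemytskii hΩ (fun z τ => q z * τ) t (toL2 w) -
        nemytskii hΩ (fun z τ => q z * τ) t (toL2 w')‖ ≤ K * ‖fracLap (w - w')‖ := by
  obtain ⟨hp2, hp3, hp4⟩ := hp
  have hn0 : (0 : ℝ) < n := by exact_mod_cast hn
  have hs0 : (0 : ℝ) < s := by exact_mod_cast hs
  -- Hölder: `1/p + 1/ρ = 1/2`; for `2s < n`, the Sobolev embedding admits `ρ` if and only if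
  -- `p ≥ n/s`
  set ρ : ℝ≥0∞ := (2⁻¹ - p⁻¹)⁻¹ with hρ
  have hpinv : p⁻¹ ≤ 2⁻¹ := ENNReal.inv_le_inv.2 hp2
  have hT : ENNReal.HolderTriple p ρ 2 := by
    constructor
    rw [hρ, inv_inv, add_tsub_cancel_of_le hpinv]
  obtain ⟨K, hK, hE⟩ : EmbedsIn s Ω ρ := by
    refine embedsIn_of_subcritical hn hΩ hb (fun h => ?_) fun h => ?_
    · have hp5 := hp3 h
      have h6 : p⁻¹ ≤ ENNReal.ofReal (s / n) := by
        rw [ENNReal.inv_le_iff_inv_le, ← ENNReal.ofReal_inv_of_pos (by positivity), inv_div]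
        exact hp5
      have h7 : ENNReal.ofReal ((n - 2 * s) / (2 * n)) ≤ 2⁻¹ - p⁻¹ := by
        refine le_trans (le_of_eq ?_) (tsub_le_tsub_left h6 _)
        rw [show (2 : ℝ≥0∞) = ENNReal.ofReal 2 by norm_num, ← ENNReal.ofReal_inv_of_pos (by norm_num),
          ← ENNReal.ofReal_sub _ (by positivity)]
        congr 1
        field_simp
      rw [hρ, ENNReal.inv_le_iff_inv_le, ← ENNReal.ofReal_inv_of_pos (div_pos (by positivity) (by linarith)),
        inv_div]
      exact h7
    · have := ENNReal.inv_lt_inv.2 (hp4 h)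
      rw [hρ, ENNReal.inv_lt_top]
      exact tsub_pos_of_lt this
  obtain ⟨hqm, M, hM⟩ := hq
  refine ⟨M * K + 1, by positivity, ?_⟩
  have hqs : ∀ᵐ t ∂(timeMeasure T), AEStronglyMeasurable (fun x => q (x, t)) (volume.restrict Ω) := by
    rw [restrict_cylinder] at hqm
    exact hqm.prod_swap.prodMk_left
  filter_upwards [hM, hqs] with t e1 e2
  have hkey : ∀ w : ↥(HTilde s Ω), eLpNorm (fun x => q (x, t) * toL2 w x) 2 (volume.restrict Ω) ≤
      ENNReal.ofReal ((M * K + 1) * ‖fracLap w‖) := by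
    intro w
    refine (eLpNorm_smul_le_mul_eLpNorm (φ := fun x => q (x, t)) (f := toL2 w)
      (Lp.aestronglyMeasurable (toL2 w)).restrict e2 (p := p) (q := ρ)).trans ?_
    calc _ ≤ (M : ℝ≥0∞) * ENNReal.ofReal (K * ‖fracLap w‖) := mul_le_mul' e1 (hE w)
      _ = ENNReal.ofReal (M * (K * ‖fracLap w‖)) := by
          rw [ENNReal.ofReal_mul (NNReal.coe_nonneg M), ENNReal.ofReal_coe_nnreal]
      _ ≤ _ := by
          apply ENNReal.ofReal_le_ofReal
          have : 0 ≤ ‖fracLap w‖ := norm_nonneg _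
          nlinarith
  have hmem : ∀ w : ↥(HTilde s Ω), MemLp (fun x => q (x, t) * toL2 w x) 2 (volume.restrict Ω) :=
    fun w => ⟨e2.mul (Lp.aestronglyMeasurable (toL2 w)).restrict,
      (hkey w).trans_lt ENNReal.ofReal_lt_top⟩
  refine ⟨hmem, fun w w' => ?_⟩
  refine norm_sub_LTilde hΩ (by positivity) (coeFn_nemytskii hΩ (hmem w))
    (coeFn_nemytskii hΩ (hmem w')) (le_trans (le_of_eq (eLpNorm_congr_ae ?_)) (hkey (w - w')))
  filter_upwards [ae_restrict_of_ae (Lp.coeFn_sub (toL2 w) (toL2 w'))] with x hx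
  rw [map_sub, hx, Pi.sub_apply]
  ring

end Bounds

/-! ### Test functions and the energy space -/

section TestFunctions

variable {n : ℕ} {s : ℝ≥0} {Ω : Set (Space n)} {T : ℝ}

theorem secondCountableTopology_HTilde : SecondCountableTopology ↥(HTilde s Ω) := by
  have : Fact ((2 : ℝ≥0∞) ≠ ⊤) := ⟨by norm_num⟩
  have : SecondCountableTopology (L2 n) := Lp.SecondCountableTopology
  have : SecondCountableTopology (L2C n) := Lp.SecondCountableTopology
  have : SecondCountableTopology (WithLp 2 (L2 n × L2C n)) := inferInstance
  have : SecondCountableTopology ↥(Hs n s) := TopologicalSpace.Subtype.secondCountableTopology _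
  exact TopologicalSpace.Subtype.secondCountableTopology _

/-- Measurability in `H̃^s(Ω)` can be tested in `L̃²(Ω)`, by the Lusin–Souslin theorem. -/
theorem aestronglyMeasurable_of_toLT {α : Type*} [MeasurableSpace α] {μ : Measure α}
    {u : α → ↥(HTilde s Ω)} (hu : AEStronglyMeasurable (fun a => toLT (u a)) μ) :
    AEStronglyMeasurable u μ := by
  have := secondCountableTopology_HTilde (s := s) (Ω := Ω)
  have := secondCountableTopology_LTilde (Ω := Ω)
  let _ : MeasurableSpace ↥(HTilde s Ω) := borel _
  have : BorelSpace ↥(HTilde s Ω) := ⟨rfl⟩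
  let _ : MeasurableSpace ↥(LTilde Ω) := borel _
  have : BorelSpace ↥(LTilde Ω) := ⟨rfl⟩
  refine AEMeasurable.aestronglyMeasurable ?_
  rw [← ((toLT : ↥(HTilde s Ω) →L[ℝ] ↥(LTilde Ω)).continuous.measurableEmbedding
    toLT_injective).aemeasurable_comp_iff]
  exact hu.aemeasurable

/-- The complexification of a test function as a Schwartz function. -/
def IsTest.toSchwartz {φ : Space n → ℝ} (hφ : IsTest Ω φ) : SchwartzMap (Space n) ℂ :=
  (hφ.2.1.comp_left (g := fun y : ℝ => (y : ℂ)) Complex.ofReal_zero :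
    HasCompactSupport fun x => (φ x : ℂ)).toSchwartzMap (Complex.ofRealCLM.contDiff.comp hφ.1)

theorem IsTest.toSchwartz_apply {φ : Space n → ℝ} (hφ : IsTest Ω φ) (x : Space n) :
    hφ.toSchwartz x = φ x := rfl

theorem fracSymbol_le (s : ℝ≥0) (ξ : Space n) :
    fracSymbol s ξ ≤ (2 * Real.pi) ^ (s : ℝ) * (1 + ‖ξ‖ ^ 2) ^ ((s : ℝ) / 2) := by
  rw [fracSymbol, Real.mul_rpow (by positivity) (norm_nonneg _)]
  gcongr
  calc ‖ξ‖ ^ (s : ℝ) = (‖ξ‖ ^ 2) ^ ((s : ℝ) / 2) := by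
        rw [← Real.rpow_natCast, ← Real.rpow_mul (norm_nonneg _)]; congr 1; push_cast; ring
    _ ≤ _ := Real.rpow_le_rpow (by positivity) (by linarith) (by positivity)

/-- The norm of a test function in `H̃^s(Ω)` is controlled by finitely many Schwartz seminorms. -/
theorem exists_fracLap_le_seminorm (s : ℝ≥0) (Ω : Set (Space n)) :
    ∃ (S : Finset (ℕ × ℕ)) (C : ℝ≥0), ∀ (φ : Space n → ℝ) (hφ : IsTest Ω φ),
      ‖fracLap (hφ.toHTilde s)‖ ≤ C * (S.sup (schwartzSeminormFamily ℂ (Space n) ℂ)) hφ.toSchwartz := by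
  set m : Space n → ℂ := fun ξ => (((1 + ‖ξ‖ ^ 2) ^ ((s : ℝ) / 2) : ℝ) : ℂ) with hm
  have htg : Function.HasTemperateGrowth m := by fun_prop
  set A : SchwartzMap (Space n) ℂ →L[ℂ] L2C n :=
    SchwartzMap.toLpCLM ℂ ℂ 2 volume ∘L SchwartzMap.smulLeftCLM ℂ m ∘L
      FourierTransform.fourierCLM ℂ (SchwartzMap (Space n) ℂ) with hA
  obtain ⟨S, C, -, hSC⟩ := Seminorm.bound_of_continuous (schwartz_withSeminorms ℂ (Space n) ℂ)
    ((normSeminorm ℂ (L2C n)).comp A.toLinearMap) (continuous_norm.comp A.continuous)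
  refine ⟨S, Real.toNNReal ((2 * Real.pi) ^ (s : ℝ)) * C, fun φ hφ => ?_⟩
  set g := hφ.toSchwartz with hg
  have hc : complexify n (toL2 (hφ.toHTilde s)) = g.toLp 2 := by
    apply Lp.ext
    filter_upwards [coeFn_complexify (toL2 (hφ.toHTilde s)), hφ.toL2_toHTilde s,
      g.coeFn_toLp 2 volume] with x h1 h2 h3
    rw [h3, h1, h2, hg, hφ.toSchwartz_apply]
  have h1 : ‖A g‖ ≤ C * (S.sup (schwartzSeminormFamily ℂ (Space n) ℂ)) g := hSC g
  have h2 : ‖fracLap (hφ.toHTilde s)‖ ≤ (2 * Real.pi) ^ (s : ℝ) * ‖A g‖ := by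
    rw [← Lp.norm_fourier_eq]
    refine Lp.norm_le_mul_norm_of_ae_le_mul ?_
    have h3 := isFracLap_HTilde (hφ.toHTilde s)
    rw [IsFracLap, hc, SchwartzMap.toLp_fourier_eq] at h3
    have h4 : (A g : Space n → ℂ) =ᵐ[volume] SchwartzMap.smulLeftCLM ℂ m (𝓕 g) :=
      SchwartzMap.coeFn_toLp _ 2 volume
    filter_upwards [h3, (𝓕 g).coeFn_toLp 2 volume, h4] with ξ e1 e2 e3
    rw [e1, e2, e3, SchwartzMap.smulLeftCLM_apply_apply htg, norm_smul, norm_mul, ← mul_assoc]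
    gcongr
    rw [Complex.norm_real, hm, Complex.norm_real, Real.norm_of_nonneg (by unfold fracSymbol; positivity),
      Real.norm_of_nonneg (by positivity)]
    exact fracSymbol_le s ξ
  refine h2.trans ((mul_le_mul_of_nonneg_left h1 (by positivity)).trans (le_of_eq ?_))
  rw [NNReal.coe_mul, Real.coe_toNNReal _ (by positivity), mul_assoc]

/-- The time slices of a test function are bounded in `H̃^s(Ω)`. -/
theorem SpaceTimeTest.exists_fracLap_slice_le (s : ℝ≥0) (φ : SpaceTimeTest Ω T) :
    ∃ B : ℝ, ∀ t, ‖fracLap (φ.slice s t)‖ ≤ B := by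
  obtain ⟨S, C, h⟩ := exists_fracLap_le_seminorm s Ω
  set φC : Space n × ℝ → ℂ := fun z => (φ.toFun z : ℂ) with hφC
  have hsm : ContDiff ℝ ∞ φC := Complex.ofRealCLM.contDiff.comp φ.contDiff
  have hcs : HasCompactSupport φC :=
    φ.hasCompactSupport.comp_left (g := fun y : ℝ => (y : ℂ)) Complex.ofReal_zero
  have hb : ∀ i : ℕ × ℕ, ∃ B : ℝ, 0 ≤ B ∧ ∀ t,
      schwartzSeminormFamily ℂ (Space n) ℂ i (φ.isTest t).toSchwartz ≤ B := by
    rintro ⟨k, l⟩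
    have hcont : Continuous fun z : Space n × ℝ => ‖z.1‖ ^ k • iteratedFDeriv ℝ l φC z :=
      (continuous_fst.norm.pow k).smul (hsm.continuous_iteratedFDeriv (by exact_mod_cast le_top))
    obtain ⟨B, hB⟩ := hcont.bounded_above_of_compact_support
      ((hcs.iteratedFDeriv (𝕜 := ℝ) l).smul_left (f := fun z : Space n × ℝ => ‖z.1‖ ^ k))
    have hB0 : 0 ≤ B := (norm_nonneg _).trans (hB 0)
    refine ⟨B, hB0, fun t => SchwartzMap.seminorm_le_bound ℂ k l _ hB0 fun x => ?_⟩
    set ι := ContinuousLinearMap.inl ℝ (Space n) ℝ with hι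
    have e1 : ((φ.isTest t).toSchwartz : Space n → ℂ) = (fun z => φC (z + (0, t))) ∘ ι := by
      funext y
      simp [IsTest.toSchwartz_apply, hφC, hι]
    have hsm' : ContDiff ℝ ∞ fun z => φC (z + (0, t)) := hsm.comp (contDiff_id.add contDiff_const)
    rw [e1, ContinuousLinearMap.iteratedFDeriv_comp_right ι hsm' x (by exact_mod_cast le_top),
      iteratedFDeriv_comp_add_right]
    have e2 := ContinuousMultilinearMap.norm_compContinuousLinearMap_le
      (iteratedFDeriv ℝ l φC (ι x + (0, t))) fun _ => ι
    have e3 : ∏ _i : Fin l, ‖ι‖ ≤ 1 :=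
      Finset.prod_le_one (fun _ _ => norm_nonneg _) fun _ _ => ContinuousLinearMap.norm_inl_le_one ..
    have e4 := hB (ι x + (0, t))
    rw [norm_smul, Real.norm_of_nonneg (by positivity)] at e4
    refine le_trans ?_ e4
    have e5 : (ι x + (0, t) : Space n × ℝ).1 = x := by simp [hι]
    rw [e5]
    gcongr
    exact e2.trans (mul_le_of_le_one_right (norm_nonneg _) e3)
  choose B hB0 hB using hb
  refine ⟨C * ∑ i ∈ S, B i, fun t => (h _ _).trans ?_⟩
  gcongr
  refine Seminorm.finset_sup_apply_le (Finset.sum_nonneg fun i _ => hB0 i) fun i hi => ?_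
  exact (hB i t).trans (Finset.single_le_sum (f := B) (fun i _ => hB0 i) hi)

/-- The time derivative of a test function. -/
def SpaceTimeTest.timeDeriv (φ : SpaceTimeTest Ω T) : SpaceTimeTest Ω T where
  toFun z := fderiv ℝ φ.toFun z (0, 1)
  contDiff := (φ.contDiff.fderiv_right (m := ∞) (by norm_num)).clm_apply contDiff_const
  hasCompactSupport := φ.hasCompactSupport.fderiv_apply (𝕜 := ℝ) (0, 1)
  tsupport_subset := (tsupport_fderiv_apply_subset ℝ (0, 1)).trans φ.tsupport_subset

theorem SpaceTimeTest.hasDerivAt (φ : SpaceTimeTest Ω T) (x : Space n) (t : ℝ) :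
    HasDerivAt (fun τ => φ.toFun (x, τ)) (φ.timeDeriv.toFun (x, t)) t := by
  have h1 : HasFDerivAt φ.toFun (fderiv ℝ φ.toFun (x, t)) (x, t) :=
    (φ.contDiff.differentiable (by norm_num) _).hasFDerivAt
  have h2 : HasDerivAt (fun τ : ℝ => (x, τ)) ((0 : Space n), (1 : ℝ)) t :=
    (hasDerivAt_const t x).prodMk (hasDerivAt_id t)
  exact h1.comp_hasDerivAt t h2

theorem norm_le_of_ae_bound (hΩ : IsOpen Ω) (hb : volume Ω ≠ ⊤) {v : ↥(LTilde Ω)} {B : ℝ} (hB : 0 ≤ B)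
    (h : ∀ᵐ x ∂(volume.restrict Ω), |(v : L2 n) x| ≤ B) : ‖v‖ ≤ √(volume.real Ω) * B := by
  rw [← toReal_enorm, ← eLpNorm_restrict_of_mem_LTilde hΩ]
  refine ENNReal.toReal_le_of_le_ofReal (by positivity) ?_
  refine (eLpNorm_le_of_ae_bound h).trans (le_of_eq ?_)
  rw [Measure.restrict_apply_univ, ENNReal.ofReal_mul (by positivity), Real.sqrt_eq_rpow,
    ← ENNReal.ofReal_rpow_of_nonneg measureReal_nonneg (by norm_num), ofReal_measureReal hb]
  norm_num

theorem SpaceTimeTest.coeFn_slice (φ : SpaceTimeTest Ω T) (s : ℝ≥0) (t : ℝ) :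
    toL2 (φ.slice s t) =ᵐ[volume] fun x => φ.toFun (x, t) := (φ.isTest t).toL2_toHTilde s

/-- In `L²(Ω)`, a test function is differentiable with respect to time. -/
theorem SpaceTimeTest.hasDerivAt_slice (hΩ : IsOpen Ω) (hb : volume Ω ≠ ⊤) (φ : SpaceTimeTest Ω T)
    (s : ℝ≥0) (t : ℝ) :
    HasDerivAt (fun τ => toLT (φ.slice s τ)) (toLT (φ.timeDeriv.slice s t)) t := by
  rw [hasDerivAt_iff_isLittleO, Asymptotics.isLittleO_iff]
  intro c hc
  have huc : UniformContinuous φ.timeDeriv.toFun :=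
    φ.timeDeriv.hasCompactSupport.uniformContinuous_of_continuous φ.timeDeriv.contDiff.continuous
  obtain ⟨δ, hδ, hδc⟩ := Metric.uniformContinuous_iff.1 huc (c / (√(volume.real Ω) + 1)) (by positivity)
  filter_upwards [Metric.ball_mem_nhds t hδ] with τ hτ
  have hpt : ∀ x, |φ.toFun (x, τ) - φ.toFun (x, t) - (τ - t) * φ.timeDeriv.toFun (x, t)| ≤
      c / (√(volume.real Ω) + 1) * |τ - t| := by
    intro x
    have h := Convex.norm_image_sub_le_of_norm_hasDerivWithin_le (𝕜 := ℝ)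
      (f := fun σ => φ.toFun (x, σ) - σ * φ.timeDeriv.toFun (x, t))
      (f' := fun σ => φ.timeDeriv.toFun (x, σ) - 1 * φ.timeDeriv.toFun (x, t))
      (C := c / (√(volume.real Ω) + 1)) (s := uIcc t τ) (x := t) (y := τ)
      (fun σ _ => ((φ.hasDerivAt x σ).sub ((hasDerivAt_id σ).mul_const _)).hasDerivWithinAt)
      (fun σ hσ => by
        rw [one_mul, Real.norm_eq_abs, ← Real.dist_eq]
        refine (hδc ?_).le
        rw [dist_prod_same_left, Real.dist_eq]
        exact lt_of_le_of_lt (abs_sub_left_of_mem_uIcc hσ) (by simpa [Real.dist_eq] using hτ))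
      (convex_uIcc _ _) left_mem_uIcc right_mem_uIcc
    rw [Real.norm_eq_abs, Real.norm_eq_abs] at h
    refine le_trans (le_of_eq (congrArg _ ?_)) h
    ring
  have h := norm_le_of_ae_bound hΩ hb
    (v := toLT (φ.slice s τ) - toLT (φ.slice s t) - (τ - t) • toLT (φ.timeDeriv.slice s t))
    (B := c / (√(volume.real Ω) + 1) * |τ - t|) (by positivity) (by
      refine ae_restrict_of_ae ?_
      filter_upwards [φ.coeFn_slice s τ, φ.coeFn_slice s t, φ.timeDeriv.coeFn_slice s t,
        Lp.coeFn_sub (toL2 (φ.slice s τ) - toL2 (φ.slice s t)) ((τ - t) • toL2 (φ.timeDeriv.slice s t)),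
        Lp.coeFn_sub (toL2 (φ.slice s τ)) (toL2 (φ.slice s t)),
        Lp.coeFn_smul (τ - t) (toL2 (φ.timeDeriv.slice s t))] with x e1 e2 e3 e4 e5 e6
      have e7 : ((toLT (φ.slice s τ) - toLT (φ.slice s t) - (τ - t) • toLT (φ.timeDeriv.slice s t) :
        ↥(LTilde Ω)) : L2 n) x = φ.toFun (x, τ) - φ.toFun (x, t) - (τ - t) * φ.timeDeriv.toFun (x, t) := by
        change (toL2 (φ.slice s τ) - toL2 (φ.slice s t) -
          (τ - t) • toL2 (φ.timeDeriv.slice s t) : L2 n) x = _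
        rw [e4, Pi.sub_apply, e5, Pi.sub_apply, e6, Pi.smul_apply, e1, e2, e3, smul_eq_mul]
      rw [e7]
      exact hpt x)
  refine h.trans ?_
  rw [Real.norm_eq_abs, ← mul_assoc]
  gcongr
  rw [mul_div_assoc', div_le_iff₀ (by positivity)]
  nlinarith [Real.sqrt_nonneg (volume.real Ω)]

theorem SpaceTimeTest.continuous_toLT_slice (hΩ : IsOpen Ω) (hb : volume Ω ≠ ⊤)
    (φ : SpaceTimeTest Ω T) (s : ℝ≥0) : Continuous fun τ => toLT (φ.slice s τ) :=
  continuous_iff_continuousAt.2 fun t => (φ.hasDerivAt_slice hΩ hb s t).continuousAt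

theorem SpaceTimeTest.slice_final (φ : SpaceTimeTest Ω T) (s : ℝ≥0) : φ.slice s T = 0 := by
  apply toL2_injective
  rw [map_zero]
  apply Lp.ext
  filter_upwards [φ.coeFn_slice s T, Lp.coeFn_zero ℝ 2 (volume : Measure (Space n))] with x e1 e2
  rw [e1, e2]
  refine image_eq_zero_of_notMem_tsupport fun h => ?_
  exact lt_irrefl T (φ.tsupport_subset h).2

theorem exists_norm_HTilde_le (hn : 1 ≤ n) (hΩ : IsOpen Ω) (hb : volume Ω ≠ ⊤) :
    ∃ K : ℝ, 0 < K ∧ ∀ u : ↥(HTilde s Ω), ‖u‖ ≤ K * ‖fracLap u‖ := by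
  obtain ⟨K, hK, h⟩ := exists_Hs_norm_le (s := s) hn hΩ hb
  refine ⟨K, hK, fun u => ?_⟩
  have h1 : ‖u‖ ^ 2 = ‖toL2 u‖ ^ 2 + ‖fracLap u‖ ^ 2 :=
    WithLp.prod_norm_sq_eq_of_L2 (u : ↥(Hs n s)).1
  exact (sq_le_sq₀ (norm_nonneg _) (by positivity)).1 (h1 ▸ h u)

theorem SpaceTimeTest.memLp_slice (hn : 1 ≤ n) (hΩ : IsOpen Ω) (hb : volume Ω ≠ ⊤)
    (φ : SpaceTimeTest Ω T) (s : ℝ≥0) (p : ℝ≥0∞) : MemLp (φ.slice s) p (timeMeasure T) := by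
  obtain ⟨K, hK, h⟩ := exists_norm_HTilde_le (s := s) hn hΩ hb
  obtain ⟨B, hB⟩ := φ.exists_fracLap_slice_le s
  refine MemLp.of_bound (aestronglyMeasurable_of_toLT
    (φ.continuous_toLT_slice hΩ hb s).aestronglyMeasurable) (K * B) (Eventually.of_forall fun t => ?_)
  exact (h _).trans (by gcongr; exact hB t)

/-- The test function `η(t) ψ(x)`. -/
def IsTest.tensor {ψ : Space n → ℝ} (hψ : IsTest Ω ψ) {η : ℝ → ℝ} (hη : ContDiff ℝ ∞ η)
    (hηc : HasCompactSupport η) (hηT : tsupport η ⊆ Iio T) : SpaceTimeTest Ω T where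
  toFun z := η z.2 * ψ z.1
  contDiff := (hη.comp contDiff_snd).mul (hψ.1.comp contDiff_fst)
  hasCompactSupport := by
    refine HasCompactSupport.intro (hψ.2.1.isCompact.prod hηc.isCompact) fun z hz => ?_
    rw [mem_prod, not_and_or] at hz
    rcases hz with hz | hz
    · rw [image_eq_zero_of_notMem_tsupport hz, mul_zero]
    · rw [image_eq_zero_of_notMem_tsupport hz, zero_mul]
  tsupport_subset := by
    refine (closure_minimal ?_ ((isClosed_tsupport ψ).prod (isClosed_tsupport η))).trans
      (prod_mono hψ.2.2 hηT)
    intro z hz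
    rw [Function.mem_support, mul_ne_zero_iff] at hz
    exact ⟨subset_tsupport _ hz.2, subset_tsupport _ hz.1⟩

theorem IsTest.slice_tensor {ψ : Space n → ℝ} (hψ : IsTest Ω ψ) {η : ℝ → ℝ} (hη : ContDiff ℝ ∞ η)
    (hηc : HasCompactSupport η) (hηT : tsupport η ⊆ Iio T) (s : ℝ≥0) (t : ℝ) :
    (hψ.tensor hη hηc hηT).slice s t = η t • hψ.toHTilde s := by
  apply toL2_injective
  apply Lp.ext
  filter_upwards [(hψ.tensor hη hηc hηT).coeFn_slice s t, hψ.toL2_toHTilde s,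
    Lp.coeFn_smul (η t) (toL2 (hψ.toHTilde s))] with x e1 e2 e3
  rw [e1, map_smul, e3, Pi.smul_apply, e2]
  rfl

theorem IsTest.slice_timeDeriv_tensor {ψ : Space n → ℝ} (hψ : IsTest Ω ψ) {η : ℝ → ℝ}
    (hη : ContDiff ℝ ∞ η) (hηc : HasCompactSupport η) (hηT : tsupport η ⊆ Iio T) (s : ℝ≥0) (t : ℝ) :
    (hψ.tensor hη hηc hηT).timeDeriv.slice s t = deriv η t • hψ.toHTilde s := by
  apply toL2_injective
  apply Lp.ext
  filter_upwards [(hψ.tensor hη hηc hηT).timeDeriv.coeFn_slice s t, hψ.toL2_toHTilde s,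
    Lp.coeFn_smul (deriv η t) (toL2 (hψ.toHTilde s))] with x e1 e2 e3
  rw [e1, map_smul, e3, Pi.smul_apply, e2, ← ((hψ.tensor hη hηc hηT).hasDerivAt x t).deriv]
  have h : HasDerivAt η (deriv η t) t := (hη.differentiable (by norm_num) t).hasDerivAt
  exact (h.mul_const (ψ x)).deriv

theorem IsTest.dense_toHTilde (s : ℝ≥0) (Ω : Set (Space n)) :
    Dense {u : ↥(HTilde s Ω) | ∃ (ψ : Space n → ℝ) (hψ : IsTest Ω ψ), u = hψ.toHTilde s} := by
  intro x
  have hx := x.2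
  unfold HTilde at hx
  have hx : (x : ↥(Hs n s)) ∈ closure (((testL2 Ω).comap
    ((WithLp.fstL 2 ℝ (L2 n) (L2C n)).toLinearMap ∘ₗ (Hs n s).subtype) : Submodule ℝ ↥(Hs n s)) :
      Set ↥(Hs n s)) := hx
  rw [Metric.mem_closure_iff] at hx ⊢
  intro ε hε
  obtain ⟨y, ⟨ψ, hψ, hy⟩, hxy⟩ := hx ε hε
  have hyT : y ∈ HTilde s Ω := Submodule.le_topologicalClosure _ ⟨ψ, hψ, hy⟩
  refine ⟨⟨y, hyT⟩, ⟨ψ, hψ, ?_⟩, hxy⟩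
  apply toL2_injective
  exact Lp.ext (EventuallyEq.trans hy (hψ.toL2_toHTilde s).symm)

end TestFunctions

/-- `H̃^s(Ω)` with the scalar product `b ⟨(-Δ)^{s/2} u, (-Δ)^{s/2} v⟩`, as a Hilbert space `V`: the
maps `e` and `e'` identify `H̃^s(Ω)` with `V`, and `j` is the embedding into `L̃²(Ω)`. -/
structure EnergySpace {n : ℕ} (s : ℝ≥0) (Ω : Set (Space n)) (b : ℝ) (V : Type) [NormedAddCommGroup V]
    [InnerProductSpace ℝ V] where
  /-- the embedding into `L̃²(Ω)` -/
  j : V →L[ℝ] ↥(LTilde Ω)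
  /-- the identification of `H̃^s(Ω)` with `V` -/
  e : ↥(HTilde s Ω) → V
  /-- the inverse of `e` -/
  e' : V → ↥(HTilde s Ω)
  e_add : ∀ u v, e (u + v) = e u + e v
  e_smul : ∀ (c : ℝ) u, e (c • u) = c • e u
  continuous_e : Continuous e
  continuous_e' : Continuous e'
  e'_e : ∀ u, e' (e u) = u
  e_e' : ∀ v, e (e' v) = v
  j_e : ∀ u, j (e u) = toLT u
  inner_e : ∀ u v, ⟪e u, e v⟫_ℝ = b * ⟪fracLap u, fracLap v⟫_ℝ

/-- The range of an injective map with closed range, as a Hilbert space. -/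
theorem exists_rangeSpace {X Y H : Type} [NormedAddCommGroup X] [Module ℝ X] [CompleteSpace X]
    [NormedAddCommGroup Y] [InnerProductSpace ℝ Y] [CompleteSpace Y] [NormedAddCommGroup H]
    [NormedSpace ℝ H] (A : X →ₗ[ℝ] Y) (hA : Continuous A) (J : X →ₗ[ℝ] H) {K C : ℝ}
    (hK : ∀ u, ‖u‖ ≤ K * ‖A u‖) (hJ : ∀ u, ‖J u‖ ≤ C * ‖A u‖) :
    ∃ (V : Type) (_ : NormedAddCommGroup V) (_ : InnerProductSpace ℝ V) (_ : CompleteSpace V)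
      (j : V →L[ℝ] H) (e : X → V) (e' : V → X), (∀ u v, e (u + v) = e u + e v) ∧
      (∀ (c : ℝ) u, e (c • u) = c • e u) ∧ Continuous e ∧ Continuous e' ∧ (∀ u, e' (e u) = u) ∧
      (∀ v, e (e' v) = v) ∧ (∀ u, j (e u) = J u) ∧ ∀ u v, ⟪e u, e v⟫_ℝ = ⟪A u, A v⟫_ℝ := by
  have hanti : AntilipschitzWith (Real.toNNReal K) A := by
    refine AddMonoidHomClass.antilipschitz_of_bound A fun u => ?_
    refine (hK u).trans ?_
    gcongr
    exact Real.le_coe_toNNReal K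
  have huc : UniformContinuous A := uniformContinuous_addMonoidHom_of_continuous hA
  have hcl : IsClosed (range A) := hanti.isClosed_range huc
  have hcomp : CompleteSpace ↥(A.range) := by
    have : IsClosed ((A.range : Submodule ℝ Y) : Set Y) := by
      rwa [LinearMap.coe_range]
    exact this.completeSpace_coe
  have hinj := hanti.injective
  have hmem : ∀ u, A u ∈ A.range := fun u => ⟨u, rfl⟩
  set e : X → ↥(A.range) := fun u => ⟨A u, hmem u⟩ with he
  set e' : ↥(A.range) → X := fun v => (LinearMap.mem_range.1 v.2).choose with he'
  have hAe' : ∀ v, A (e' v) = v := fun v => (LinearMap.mem_range.1 v.2).choose_spec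
  have hee' : ∀ v, e (e' v) = v := fun v => Subtype.ext (hAe' v)
  have he'e : ∀ u, e' (e u) = u := fun u => hinj (hAe' (e u))
  have hec : Continuous e := hA.subtype_mk hmem
  have he'c : Continuous e' := by
    have : AntilipschitzWith (Real.toNNReal K) e := hanti
    exact (this.to_rightInverse hee').continuous
  have hadd : ∀ u v, e' (u + v) = e' u + e' v := fun u v => hinj (by
    rw [map_add, hAe', hAe', hAe']; rfl)
  have hsmul : ∀ (c : ℝ) v, e' (c • v) = c • e' v := fun c v => hinj (by
    rw [map_smul, hAe', hAe']; rfl)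
  let jl : ↥(A.range) →ₗ[ℝ] H :=
    { toFun := fun v => J (e' v)
      map_add' := fun u v => by rw [hadd, map_add]
      map_smul' := fun c v => by rw [hsmul, map_smul]; rfl }
  have hjb : ∀ v, ‖jl v‖ ≤ C * ‖v‖ := fun v => by
    have h1 : ‖v‖ = ‖A (e' v)‖ := by rw [hAe']; rfl
    rw [h1]
    exact hJ (e' v)
  refine ⟨↥(A.range), inferInstance, inferInstance, hcomp, jl.mkContinuous C hjb, e, e',
    fun u v => Subtype.ext (map_add A u v), fun c u => Subtype.ext (map_smul A c u), hec, he'c, he'e, hee',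
    fun u => ?_, fun u v => rfl⟩
  change J (e' (e u)) = J u
  rw [he'e]

/-- The energy space is realized as the range of `u ↦ √b (-Δ)^{s/2} u`, which is closed by the
Poincaré inequality. -/
theorem exists_energySpace {n : ℕ} (s : ℝ≥0) {Ω : Set (Space n)} (hn : 1 ≤ n) (hΩ : IsOpen Ω)
    (hΩb : volume Ω ≠ ⊤) {b : ℝ} (hb : 0 < b) :
    ∃ (V : Type) (_ : NormedAddCommGroup V) (_ : InnerProductSpace ℝ V) (_ : CompleteSpace V),
      Nonempty (EnergySpace s Ω b V) := by
  obtain ⟨K, hK, h⟩ := exists_norm_HTilde_le (s := s) hn hΩ hΩb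
  obtain ⟨C, hC, hP⟩ := exists_poincare (s := s) hn hΩ hΩb
  have hsb : 0 < √b := Real.sqrt_pos.2 hb
  have hAu : ∀ u : ↥(HTilde s Ω), ‖(√b • fracLap.toLinearMap : ↥(HTilde s Ω) →ₗ[ℝ] L2C n) u‖ =
      √b * ‖fracLap u‖ := fun u => by
    rw [LinearMap.smul_apply, norm_smul, Real.norm_of_nonneg hsb.le]; rfl
  obtain ⟨V, i1, i2, i3, j, e, e', h1, h2, h3, h4, h5, h6, h7, h8⟩ := exists_rangeSpace
    (√b • fracLap.toLinearMap : ↥(HTilde s Ω) →ₗ[ℝ] L2C n)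
    ((fracLap : ↥(HTilde s Ω) →L[ℝ] L2C n).continuous.const_smul √b)
    (toLT : ↥(HTilde s Ω) →L[ℝ] ↥(LTilde Ω)).toLinearMap (K := K / √b) (C := C / √b)
    (fun u => by
      rw [hAu]
      refine (h u).trans (le_of_eq ?_)
      field_simp)
    (fun u => by
      rw [hAu]
      have h2 : ‖toLT u‖ ≤ C * ‖fracLap u‖ := hP u
      refine h2.trans (le_of_eq ?_)
      field_simp)
  refine ⟨V, i1, i2, i3, ⟨⟨j, e, e', h1, h2, h3, h4, h5, h6, h7, fun u v => ?_⟩⟩⟩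
  rw [h8, LinearMap.smul_apply, LinearMap.smul_apply, real_inner_smul_left, real_inner_smul_right,
    ← mul_assoc, Real.mul_self_sqrt hb.le]
  rfl

/-! ### The weak formulation in the energy space -/

/-- Continuous linear maps commute with the weak derivative. Linearity is stated for a plain
function `L`, since the maps `e` and `e'` of an `EnergySpace` are not bundled. -/
theorem hasWeakDeriv_comp_linear {X Y : Type*} [NormedAddCommGroup X] [NormedSpace ℝ X]
    [NormedAddCommGroup Y] [NormedSpace ℝ Y] {T : ℝ} {u v : ℝ → X} (h : HasWeakDeriv T u v)
    (hu : Integrable u (timeMeasure T)) (hv : Integrable v (timeMeasure T)) [CompleteSpace X]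
    [CompleteSpace Y] {L : X → Y} (hadd : ∀ x y, L (x + y) = L x + L y)
    (hsmul : ∀ (c : ℝ) x, L (c • x) = c • L x) (hc : Continuous L) :
    HasWeakDeriv T (fun t => L (u t)) (fun t => L (v t)) := by
  intro η hη hηc hηT
  set A : X →L[ℝ] Y := ⟨⟨⟨L, hadd⟩, hsmul⟩, hc⟩
  have hb : ∀ {f : ℝ → ℝ}, Continuous f → HasCompactSupport f → ∀ {k : ℝ → X},
      Integrable k (timeMeasure T) → ∫ t in Ioo 0 T, f t • L (k t) = L (∫ t in Ioo 0 T, f t • k t) := by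
    intro f hf hfc k hk
    obtain ⟨C, hC⟩ := hf.bounded_above_of_compact_support hfc
    have h1 : Integrable (fun t => f t • k t) (timeMeasure T) :=
      hk.bdd_smul C hf.aestronglyMeasurable (Eventually.of_forall hC)
    rw [show L (∫ t in Ioo 0 T, f t • k t) = A (∫ t in Ioo 0 T, f t • k t) from rfl,
      ← A.integral_comp_comm h1]
    exact integral_congr_ae (Eventually.of_forall fun t => (hsmul _ _).symm)
  rw [hb hη.continuous hηc hv, hb (hη.continuous_deriv (by norm_num)) hηc.deriv hu, h η hη hηc hηT]
  exact map_neg A _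

section WeakForm

variable {n : ℕ} {s : ℝ≥0} {Ω : Set (Space n)} {T b : ℝ} {V : Type} [NormedAddCommGroup V]
  [InnerProductSpace ℝ V]

theorem norm_fracLap_le (u : ↥(HTilde s Ω)) : ‖fracLap u‖ ≤ ‖u‖ := by
  have h1 : ‖u‖ ^ 2 = ‖toL2 u‖ ^ 2 + ‖fracLap u‖ ^ 2 :=
    WithLp.prod_norm_sq_eq_of_L2 (u : ↥(Hs n s)).1
  refine (sq_le_sq₀ (norm_nonneg _) (norm_nonneg _)).1 ?_
  exact (le_add_of_nonneg_left (sq_nonneg _)).trans h1.ge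

namespace EnergySpace

variable (E : EnergySpace s Ω b V)
include E

theorem e_zero : E.e 0 = 0 := by
  have h := E.e_smul 0 0
  rwa [zero_smul, zero_smul] at h

theorem e_sub (u v : ↥(HTilde s Ω)) : E.e (u - v) = E.e u - E.e v := by
  have h := E.e_add (u - v) v
  rw [sub_add_cancel] at h
  rw [h, add_sub_cancel_right]

theorem e'_add (x y : V) : E.e' (x + y) = E.e' x + E.e' y := by
  rw [← E.e'_e (E.e' x + E.e' y), E.e_add, E.e_e', E.e_e']

theorem e'_smul (c : ℝ) (x : V) : E.e' (c • x) = c • E.e' x := by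
  rw [← E.e'_e (c • E.e' x), E.e_smul, E.e_e']

theorem norm_e (hb : 0 ≤ b) (u : ↥(HTilde s Ω)) : ‖E.e u‖ = √b * ‖fracLap u‖ := by
  rw [← sq_eq_sq₀ (norm_nonneg _) (by positivity), mul_pow, Real.sq_sqrt hb,
    ← real_inner_self_eq_norm_sq, ← real_inner_self_eq_norm_sq, E.inner_e]

theorem j_injective : Function.Injective E.j := by
  intro x y h
  rw [← E.e_e' x, ← E.e_e' y, E.j_e, E.j_e] at h
  rw [← E.e_e' x, ← E.e_e' y, toLT_injective h]

theorem j_eq (x : V) : E.j x = toLT (E.e' x) := by rw [← E.j_e, E.e_e']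

theorem denseRange_j : DenseRange E.j := by
  refine (denseRange_toLT (s := s) (Ω := Ω)).mono ?_
  rintro _ ⟨u, rfl⟩
  exact ⟨E.e u, E.j_e u⟩

theorem memLp_e (hb : 0 ≤ b) {u : ℝ → ↥(HTilde s Ω)} {p : ℝ≥0∞} (hu : MemLp u p (timeMeasure T)) :
    MemLp (fun t => E.e (u t)) p (timeMeasure T) := by
  refine MemLp.of_le_mul (c := √b) hu (E.continuous_e.comp_aestronglyMeasurable hu.1)
    (Eventually.of_forall fun t => ?_)
  rw [E.norm_e hb]
  gcongr
  exact norm_fracLap_le _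

theorem e_slice_eq_integral [CompleteSpace V] (hn : 1 ≤ n) (hΩ : IsOpen Ω) (hΩb : volume Ω ≠ ⊤)
    (hb : 0 ≤ b) (φ : SpaceTimeTest Ω T) {t : ℝ} (ht : t ∈ Icc 0 T) :
    E.e (φ.slice s t) = -∫ τ in t..T, E.e (φ.timeDeriv.slice s τ) := by
  have hi : Integrable (fun t => E.e (φ.timeDeriv.slice s t)) (timeMeasure T) :=
    (E.memLp_e hb (φ.timeDeriv.memLp_slice hn hΩ hΩb s ∞)).integrable le_top
  have hT : T ∈ Icc 0 T := ⟨ht.1.trans ht.2, le_rfl⟩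
  have hii : IntervalIntegrable (fun t => E.e (φ.timeDeriv.slice s t)) volume t T :=
    (intervalIntegrable_of_timeMeasure hi ht).symm.trans (intervalIntegrable_of_timeMeasure hi hT)
  apply E.j_injective
  rw [map_neg, ← E.j.intervalIntegral_comp_comm hii, E.j_e]
  simp only [E.j_e]
  rw [intervalIntegral.integral_eq_sub_of_hasDerivAt (f := fun τ => toLT (φ.slice s τ))
    (fun τ _ => φ.hasDerivAt_slice hΩ hΩb s τ)
    ((φ.timeDeriv.continuous_toLT_slice hΩ hΩb s).intervalIntegrable _ _), φ.slice_final, map_zero,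
    zero_sub, neg_neg]

variable [CompleteSpace V]

theorem inner_adjoint_slice (hΩ : IsOpen Ω) (φ : SpaceTimeTest Ω T) (t : ℝ) (w : ↥(LTilde Ω)) :
    ⟪E.j.adjoint w, E.e (φ.slice s t)⟫_ℝ = ∫ x in Ω, (w : L2 n) x * φ.toFun (x, t) := by
  rw [ContinuousLinearMap.adjoint_inner_left, E.j_e, inner_LTilde hΩ]
  refine integral_congr_ae ?_
  filter_upwards [ae_restrict_of_ae (φ.coeFn_slice s t)] with x hx
  rw [coe_toLT, hx]

theorem inner_adjoint_slice_timeDeriv (hΩ : IsOpen Ω) (φ : SpaceTimeTest Ω T) (t : ℝ)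
    (w : ↥(LTilde Ω)) : ⟪E.j.adjoint w, E.e (φ.timeDeriv.slice s t)⟫_ℝ =
      ∫ x in Ω, (w : L2 n) x * deriv (fun τ => φ.toFun (x, τ)) t := by
  rw [E.inner_adjoint_slice hΩ]
  simp only [(φ.hasDerivAt _ t).deriv]

theorem inner_adjoint_nemytskii (hΩ : IsOpen Ω) (φ : SpaceTimeTest Ω T) (t : ℝ)
    {f : Space n × ℝ → ℝ → ℝ} {w : L2 n}
    (h : MemLp (fun x => f (x, t) (w x)) 2 (volume.restrict Ω)) :
    ⟪E.j.adjoint (nemytskii hΩ f t w), E.e (φ.slice s t)⟫_ℝ =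
      ∫ x in Ω, f (x, t) (w x) * φ.toFun (x, t) := by
  rw [E.inner_adjoint_slice hΩ]
  refine integral_congr_ae ?_
  filter_upwards [coeFn_nemytskii hΩ h] with x hx
  rw [hx]

end EnergySpace

theorem integrable_inner_of_memLp {α X : Type*} [MeasurableSpace α] {μ : Measure α}
    [IsFiniteMeasure μ] [NormedAddCommGroup X] [InnerProductSpace ℝ X] {g h : α → X}
    (hg : MemLp g 2 μ) (hh : MemLp h ∞ μ) : Integrable (fun a => ⟪g a, h a⟫_ℝ) μ := by
  have h2 : MemLp h 2 μ := hh.mono_exponent le_top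
  refine Integrable.mono' ((hg.integrable_norm_pow (p := 2) (by norm_num)).add
    (h2.integrable_norm_pow (p := 2) (by norm_num))) (hg.1.inner h2.1)
    (Eventually.of_forall fun a => ?_)
  refine (norm_inner_le_norm _ _).trans ?_
  simp only [Pi.add_apply]
  nlinarith [sq_nonneg (‖g a‖ - ‖h a‖)]

/-- Splitting of the weak formulation into its terms, in an abstract Hilbert space. -/
theorem integral_inner_split {X : Type*} [NormedAddCommGroup X] [InnerProductSpace ℝ X]
    {A₁ A₂ A₃ A₄ A₅ A₆ φ : ℝ → X} {α κ : ℝ} (h₁ : MemLp A₁ 2 (timeMeasure T))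
    (h₂ : MemLp A₂ 2 (timeMeasure T)) (h₃ : MemLp A₃ 2 (timeMeasure T))
    (h₄ : MemLp A₄ 2 (timeMeasure T)) (h₅ : MemLp A₅ 2 (timeMeasure T))
    (h₆ : MemLp A₆ 2 (timeMeasure T)) (hφ : MemLp φ ∞ (timeMeasure T)) :
    ∫ t in Ioo 0 T, ⟪A₂ t + κ • A₃ t + (α • A₁ t + (A₄ t + A₅ t - A₆ t)), φ t⟫_ℝ =
      (∫ t in Ioo 0 T, (α * ⟪A₁ t, φ t⟫_ℝ + ⟪A₂ t, φ t⟫_ℝ + κ * ⟪A₃ t, φ t⟫_ℝ + ⟪A₄ t, φ t⟫_ℝ))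
        + (∫ t in Ioo 0 T, ⟪A₅ t, φ t⟫_ℝ) - ∫ t in Ioo 0 T, ⟪A₆ t, φ t⟫_ℝ := by
  have i₁ := integrable_inner_of_memLp h₁ hφ
  have i₂ := integrable_inner_of_memLp h₂ hφ
  have i₃ := integrable_inner_of_memLp h₃ hφ
  have i₄ := integrable_inner_of_memLp h₄ hφ
  have i₅ := integrable_inner_of_memLp h₅ hφ
  have i₆ := integrable_inner_of_memLp h₆ hφ
  have i : Integrable (fun t => α * ⟪A₁ t, φ t⟫_ℝ + ⟪A₂ t, φ t⟫_ℝ + κ * ⟪A₃ t, φ t⟫_ℝ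
      + ⟪A₄ t, φ t⟫_ℝ) (timeMeasure T) :=
    (((i₁.const_mul α).add i₂).add (i₃.const_mul κ)).add i₄
  have i' : Integrable (fun t => (α * ⟪A₁ t, φ t⟫_ℝ + ⟪A₂ t, φ t⟫_ℝ + κ * ⟪A₃ t, φ t⟫_ℝ
      + ⟪A₄ t, φ t⟫_ℝ) + ⟪A₅ t, φ t⟫_ℝ) (timeMeasure T) := i.add i₅
  rw [← integral_add i i₅, ← integral_sub i' i₆]
  refine integral_congr_ae (Eventually.of_forall fun t => ?_)
  simp only [inner_add_left, inner_sub_left, real_inner_smul_left]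
  ring

/-- The weak formulation, for one test function, in the energy space `V`: all terms become inner
products of `V`, where `L²(Ω)` acts through the adjoint of the embedding `j`. -/
theorem weak_iff [CompleteSpace V] (E : EnergySpace s Ω b V) (hn : 1 ≤ n) (hΩ : IsOpen Ω)
    (hΩb : volume Ω ≠ ⊤) (hb : 0 < b) {α c : ℝ} {q : Space n × ℝ → ℝ} {f : Space n × ℝ → ℝ → ℝ}
    {u₂ : ↥(LTilde Ω)} {F : ℝ → ↥(LTilde Ω)} (hF : MemLp F 2 (timeMeasure T))
    (u : EnergyFun s Ω T)
    (hq : ∀ᵐ t ∂timeMeasure T,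
      MemLp (fun x => q (x, t) * toL2 (u.toFun t) x) 2 (volume.restrict Ω))
    (hf : ∀ᵐ t ∂timeMeasure T,
      MemLp (fun x => f (x, t) (toL2 (u.toFun t) x)) 2 (volume.restrict Ω))
    (hQ : MemLp (fun t => nemytskii hΩ (fun z τ => q z * τ) t (toL2 (u.toFun t))) 2 (timeMeasure T))
    (hf' : MemLp (fun t => nemytskii hΩ f t (toL2 (u.toFun t))) 2 (timeMeasure T))
    (φ : SpaceTimeTest Ω T) :
    -(∫ t in Ioo 0 T, ∫ x in Ω,
        (u.dtt t : L2 n) x * deriv (fun τ => φ.toFun (x, τ)) t)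
      + (∫ t in Ioo 0 T,
          (α * (∫ x in Ω, (u.dtt t : L2 n) x * φ.toFun (x, t))
            + b * ⟪fracLap (u.dt t), fracLap (φ.slice s t)⟫_ℝ
            + c * ⟪fracLap (u.toFun t), fracLap (φ.slice s t)⟫_ℝ
            + ∫ x in Ω, q (x, t) * toL2 (u.toFun t) x * φ.toFun (x, t)))
      + (∫ t in Ioo 0 T, ∫ x in Ω, f (x, t) (toL2 (u.toFun t) x) * φ.toFun (x, t))
    = (∫ t in Ioo 0 T, ∫ x in Ω, (F t : L2 n) x * φ.toFun (x, t))
      + (∫ x in Ω, (u₂ : L2 n) x * φ.toFun (x, 0)) ↔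
    ∫ t in Ioo 0 T, ⟪E.j.adjoint (u.dtt t), E.e (φ.timeDeriv.slice s t)⟫_ℝ =
      -⟪E.j.adjoint u₂, E.e (φ.slice s 0)⟫_ℝ +
      ∫ t in Ioo 0 T, ⟪E.e (u.dt t) + (c / b) • E.e (u.toFun t) + E.j.adjoint (α • u.dtt t +
        (nemytskii hΩ (fun z τ => q z * τ) t (toL2 (u.toFun t)) +
          nemytskii hΩ f t (toL2 (u.toFun t)) - F t)), E.e (φ.slice s t)⟫_ℝ := by
  have hφ : MemLp (fun t => E.e (φ.slice s t)) ∞ (timeMeasure T) :=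
    E.memLp_e hb.le (φ.memLp_slice hn hΩ hΩb s ∞)
  have hsplit := integral_inner_split (α := α) (κ := c / b)
    (A₁ := fun t => E.j.adjoint (u.dtt t)) (A₂ := fun t => E.e (u.dt t))
    (A₃ := fun t => E.e (u.toFun t))
    (A₄ := fun t => E.j.adjoint (nemytskii hΩ (fun z τ => q z * τ) t (toL2 (u.toFun t))))
    (A₅ := fun t => E.j.adjoint (nemytskii hΩ f t (toL2 (u.toFun t))))
    (A₆ := fun t => E.j.adjoint (F t))
    (E.j.adjoint.comp_memLp' (u.memLp_dtt.mono_exponent le_top))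
    ((E.memLp_e hb.le u.memLp_dt).mono_exponent le_top)
    ((E.memLp_e hb.le u.memLp).mono_exponent le_top)
    (E.j.adjoint.comp_memLp' hQ) (E.j.adjoint.comp_memLp' hf') (E.j.adjoint.comp_memLp' hF) hφ
  have e0 : ∀ t, E.j.adjoint (α • u.dtt t +
        (nemytskii hΩ (fun z τ => q z * τ) t (toL2 (u.toFun t)) +
          nemytskii hΩ f t (toL2 (u.toFun t)) - F t)) = α • E.j.adjoint (u.dtt t) +
      (E.j.adjoint (nemytskii hΩ (fun z τ => q z * τ) t (toL2 (u.toFun t))) +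
        E.j.adjoint (nemytskii hΩ f t (toL2 (u.toFun t))) - E.j.adjoint (F t)) := by
    intro t
    simp only [map_add, map_sub, map_smul]
  simp only [e0, hsplit, E.inner_adjoint_slice_timeDeriv hΩ, E.inner_adjoint_slice hΩ φ _ (u.dtt _),
    E.inner_adjoint_slice hΩ φ _ (F _), E.inner_adjoint_slice hΩ φ _ u₂, E.inner_e]
  have e1 : ∫ t in Ioo 0 T,
      ⟪E.j.adjoint (nemytskii hΩ f t (toL2 (u.toFun t))), E.e (φ.slice s t)⟫_ℝ =
      ∫ t in Ioo 0 T, ∫ x in Ω, f (x, t) (toL2 (u.toFun t) x) * φ.toFun (x, t) := by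
    refine integral_congr_ae ?_
    filter_upwards [hf] with t ht
    exact E.inner_adjoint_nemytskii hΩ φ t ht
  rw [e1]
  have e2 : ∫ t in Ioo 0 T, (α * (∫ x in Ω, (u.dtt t : L2 n) x * φ.toFun (x, t))
        + b * ⟪fracLap (u.dt t), fracLap (φ.slice s t)⟫_ℝ
        + c / b * (b * ⟪fracLap (u.toFun t), fracLap (φ.slice s t)⟫_ℝ) +
        ⟪E.j.adjoint (nemytskii hΩ (fun z τ => q z * τ) t (toL2 (u.toFun t))),
          E.e (φ.slice s t)⟫_ℝ) = ∫ t in Ioo 0 T,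
          (α * (∫ x in Ω, (u.dtt t : L2 n) x * φ.toFun (x, t))
            + b * ⟪fracLap (u.dt t), fracLap (φ.slice s t)⟫_ℝ
            + c * ⟪fracLap (u.toFun t), fracLap (φ.slice s t)⟫_ℝ
            + ∫ x in Ω, q (x, t) * toL2 (u.toFun t) x * φ.toFun (x, t)) := by
    refine integral_congr_ae ?_
    filter_upwards [hq] with t ht
    rw [E.inner_adjoint_nemytskii hΩ φ t ht]
    field_simp
  rw [e2]
  constructor <;> intro h <;> linarith

end WeakForm

/-! ### Weak solutions and the integrated equation -/

section Mild

variable {n : ℕ} {s : ℝ≥0} {Ω : Set (Space n)} {T b : ℝ} {V : Type} [NormedAddCommGroup V]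
  [InnerProductSpace ℝ V] [CompleteSpace V]

/-- The superposition `f(·, t, u(t))` belongs to `L²(Ω)` for almost every `t`, and to
`L²(0,T;L̃²(Ω))` as a function of `t`. -/
structure HasL2Superposition (hΩ : IsOpen Ω) (T : ℝ) (f : Space n × ℝ → ℝ → ℝ)
    (u : ℝ → ↥(HTilde s Ω)) : Prop where
  slice : ∀ᵐ t ∂timeMeasure T, MemLp (fun x => f (x, t) (toL2 (u t) x)) 2 (volume.restrict Ω)
  memLp : MemLp (fun t => nemytskii hΩ f t (toL2 (u t))) 2 (timeMeasure T)

/-- The lower order term `q u + f(u) - F`, as a function of time. -/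
def lowerOrder (hΩ : IsOpen Ω) (q : Space n × ℝ → ℝ) (f : Space n × ℝ → ℝ → ℝ)
    (F : ℝ → ↥(LTilde Ω)) (u : ℝ → ↥(HTilde s Ω)) (t : ℝ) : ↥(LTilde Ω) :=
  nemytskii hΩ (fun z τ => q z * τ) t (toL2 (u t)) + nemytskii hΩ f t (toL2 (u t)) - F t

theorem memLp_lowerOrder {hΩ : IsOpen Ω} {q : Space n × ℝ → ℝ} {f : Space n × ℝ → ℝ → ℝ}
    {F : ℝ → ↥(LTilde Ω)} {u : ℝ → ↥(HTilde s Ω)} (hF : MemLp F 2 (timeMeasure T))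
    (hq : HasL2Superposition hΩ T (fun z τ => q z * τ) u) (hf : HasL2Superposition hΩ T f u) :
    MemLp (lowerOrder hΩ q f F u) 2 (timeMeasure T) :=
  (hq.memLp.add hf.memLp).sub hF

/-- In a Hilbert space, the integration by parts that characterizes a primitive of `h` with
initial value `x` can be tested with the vectors of a dense set. -/
theorem smul_by_parts_of_inner {X : Type*} [NormedAddCommGroup X] [InnerProductSpace ℝ X]
    [CompleteSpace X] {g h : ℝ → X} {x : X} (hg : Integrable g (timeMeasure T))
    (hh : Integrable h (timeMeasure T)) {D : Set X} (hD : Dense D) {η : ℝ → ℝ} (hη : ContDiff ℝ ∞ η)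
    (hηc : HasCompactSupport η)
    (hv : ∀ v ∈ D, ∫ t in Ioo 0 T, ⟪g t, deriv η t • v⟫_ℝ =
      -⟪x, η 0 • v⟫_ℝ + ∫ t in Ioo 0 T, ⟪-h t, η t • v⟫_ℝ) :
    ∫ t in Ioo 0 T, deriv η t • g t = -(η 0 • x) - ∫ t in Ioo 0 T, η t • h t := by
  have hb : ∀ {f : ℝ → ℝ}, Continuous f → HasCompactSupport f → ∀ {k : ℝ → X},
      Integrable k (timeMeasure T) → Integrable (fun t => f t • k t) (timeMeasure T) := by
    intro f hf hfc k hk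
    obtain ⟨C, hC⟩ := hf.bounded_above_of_compact_support hfc
    exact hk.bdd_smul C hf.aestronglyMeasurable (Eventually.of_forall hC)
  have i1 := hb (hη.continuous_deriv (by norm_num)) hηc.deriv hg
  have i2 := hb hη.continuous hηc hh
  rw [← sub_eq_zero]
  refine hD.eq_zero_of_inner_left ℝ fun v hvD => ?_
  have e1 : ⟪v, ∫ t in Ioo 0 T, deriv η t • g t⟫_ℝ = ∫ t in Ioo 0 T, ⟪g t, deriv η t • v⟫_ℝ := by
    rw [← integral_inner i1]
    refine integral_congr_ae (Eventually.of_forall fun t => ?_)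
    simp only [real_inner_smul_right, real_inner_comm]
  have e2 : ⟪v, ∫ t in Ioo 0 T, η t • h t⟫_ℝ = -∫ t in Ioo 0 T, ⟪-h t, η t • v⟫_ℝ := by
    rw [← integral_inner i2, ← integral_neg]
    refine integral_congr_ae (Eventually.of_forall fun t => ?_)
    simp only [real_inner_smul_right, inner_neg_left, real_inner_comm]
    ring
  have e3 := hv v hvD
  rw [real_inner_comm, inner_sub_right, inner_sub_right, inner_neg_right, e1, e2, e3, real_inner_smul_right,
    real_inner_smul_right, real_inner_comm]
  ring

/-- A weak solution solves the integrated equation in the energy space. -/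
theorem IsWeakSolution.isThirdOrder (E : EnergySpace s Ω b V) (hn : 1 ≤ n) (hΩ : IsOpen Ω)
    (hΩb : volume Ω ≠ ⊤) (hb : 0 < b) (hT : 0 < T) {α c : ℝ} {q : Space n × ℝ → ℝ}
    {f : Space n × ℝ → ℝ → ℝ} {u₀ u₁ : ↥(HTilde s Ω)} {u₂ : ↥(LTilde Ω)} {F : ℝ → ↥(LTilde Ω)}
    (hF : MemLp F 2 (timeMeasure T)) {u : EnergyFun s Ω T}
    (hq : HasL2Superposition hΩ T (fun z τ => q z * τ) u.toFun)
    (hf : HasL2Superposition hΩ T f u.toFun) (h : IsWeakSolution α b c q f u₀ u₁ u₂ F u) :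
    ∀ᵐ t ∂timeMeasure T, IsThirdOrder E.j (c / b) α (E.e u₀) (E.e u₁) u₂
      (lowerOrder hΩ q f F u.toFun) (fun t => E.e (u.toFun t)) (fun t => E.e (u.dt t)) u.dtt t := by
  have hu : MemLp (fun t => E.e (u.toFun t)) ∞ (timeMeasure T) := E.memLp_e hb.le u.memLp
  have hv : MemLp (fun t => E.e (u.dt t)) ∞ (timeMeasure T) := E.memLp_e hb.le u.memLp_dt
  have hw : Integrable u.dtt (timeMeasure T) := u.memLp_dtt.integrable le_top
  have hg : Integrable (lowerOrder hΩ q f F u.toFun) (timeMeasure T) :=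
    (memLp_lowerOrder hF hq hf).integrable (by norm_num)
  -- `e(u) = e(u₀) + ∫ e(∂ₜu)`, from the weak derivative and the initial value of `u`
  have c1 : ∀ᵐ t ∂timeMeasure T, E.e (u.toFun t) = E.e u₀ + ∫ τ in 0..t, E.e (u.dt τ) := by
    refine primitive_of_initialValue hT (hu.integrable le_top) (hv.integrable le_top) ?_ ?_
    · exact hasWeakDeriv_comp_linear u.hasWeakDeriv (u.memLp.integrable le_top)
        (u.memLp_dt.integrable le_top) E.e_add E.e_smul
        E.continuous_e
    · obtain ⟨w, h1, h2, h3⟩ := h.initial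
      exact ⟨fun t => E.e (w t), E.continuous_e.comp_continuousOn h1,
        h2.mono fun t ht => congrArg E.e ht, congrArg E.e h3⟩
  -- `∂ₜu = u₁ + ∫ ∂ₜ²u` in `L²(ℝⁿ)`
  have c2 : ∀ᵐ t ∂timeMeasure T, toL2 (u.dt t) = toL2 u₁ + ∫ τ in 0..t, (u.dtt τ : L2 n) := by
    refine primitive_of_initialValue hT ?_ ?_ u.hasWeakDeriv_dt h.initial_dt
    · have h1 : MemLp (fun t => E.j (E.e (u.dt t))) ∞ (timeMeasure T) := E.j.comp_memLp' hv
      have h2 := (LTilde Ω).subtypeL.comp_memLp' h1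
      refine (h2.integrable le_top).congr (Eventually.of_forall fun t => ?_)
      exact congrArg Subtype.val (E.j_e _)
    · exact (LTilde Ω).subtypeL.integrable_comp hw
  -- the equation, from test functions `η(t) ψ(x)`, where the `ψ` are dense in `H̃^s(Ω)`; as `η`
  -- need not vanish at `0`, it contains the initial value `u₂`
  have i1 : Integrable (fun t => E.e (u.dt t) + (c / b) • E.e (u.toFun t) +
      E.j.adjoint (α • u.dtt t + lowerOrder hΩ q f F u.toFun t)) (timeMeasure T) :=
    ((hv.integrable le_top).add ((hu.integrable le_top).smul (c / b))).add
      (E.j.adjoint.integrable_comp ((hw.smul α).add hg))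
  have c3 : ∀ᵐ t ∂timeMeasure T, E.j.adjoint (u.dtt t) = E.j.adjoint u₂ +
      ∫ τ in 0..t, -(E.e (u.dt τ) + (c / b) • E.e (u.toFun τ) +
        E.j.adjoint (α • u.dtt τ + lowerOrder hΩ q f F u.toFun τ)) := by
    refine primitive_of_weak_initial hT (E.j.adjoint.integrable_comp hw) i1.neg ?_
    intro η hη hηc hηT
    refine smul_by_parts_of_inner (E.j.adjoint.integrable_comp hw) i1.neg
      (D := E.e '' {u | ∃ (ψ : Space n → ℝ) (hψ : IsTest Ω ψ), u = hψ.toHTilde s}) ?_ hη hηc ?_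
    · have hr : DenseRange E.e := by
        refine Function.Surjective.denseRange fun v => ⟨E.e' v, E.e_e' v⟩
      exact hr.dense_image E.continuous_e (IsTest.dense_toHTilde s Ω)
    · rintro _ ⟨_, ⟨ψ, hψ, rfl⟩, rfl⟩
      have h1 := (weak_iff E hn hΩ hΩb hb hF u hq.slice hf.slice hq.memLp hf.memLp
        (hψ.tensor hη hηc hηT)).1 (h.weak _)
      simp only [hψ.slice_tensor hη hηc hηT, hψ.slice_timeDeriv_tensor hη hηc hηT, E.e_smul] at h1
      simp only [Pi.neg_apply, neg_neg]
      exact h1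
  filter_upwards [c1, c2, c3, ae_restrict_mem measurableSet_Ioo] with t h1 h2 h3 ht
  refine ⟨h1, ?_, ?_⟩
  · apply Subtype.ext
    rw [E.j_e, E.j_e]
    have h4 : ((∫ τ in 0..t, u.dtt τ : ↥(LTilde Ω)) : L2 n) = ∫ τ in 0..t, (u.dtt τ : L2 n) :=
      ((LTilde Ω).subtypeL.intervalIntegral_comp_comm
        (intervalIntegrable_of_timeMeasure hw (Ioo_subset_Icc_self ht))).symm
    rw [coe_toLT, h2, Submodule.coe_add, coe_toLT, h4]
  · rw [h3, intervalIntegral.integral_neg, ← sub_eq_add_neg]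

/-- A solution of the integrated equation is a weak solution. -/
theorem isWeakSolution_of_isThirdOrder (E : EnergySpace s Ω b V) (hn : 1 ≤ n) (hΩ : IsOpen Ω)
    (hΩb : volume Ω ≠ ⊤) (hb : 0 < b) (hT : 0 < T) {α c : ℝ} {q : Space n × ℝ → ℝ}
    {f : Space n × ℝ → ℝ → ℝ} {u₀ u₁ : ↥(HTilde s Ω)} {u₂ : ↥(LTilde Ω)} {F : ℝ → ↥(LTilde Ω)}
    (hF : MemLp F 2 (timeMeasure T)) {u : EnergyFun s Ω T}
    (hq : HasL2Superposition hΩ T (fun z τ => q z * τ) u.toFun)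
    (hf : HasL2Superposition hΩ T f u.toFun) (h0 : HasInitialValue T u.toFun u₀)
    (h1 : HasInitialValue T (fun t => toL2 (u.dt t)) (toL2 u₁))
    (h : ∀ᵐ t ∂timeMeasure T, IsThirdOrder E.j (c / b) α (E.e u₀) (E.e u₁) u₂
      (lowerOrder hΩ q f F u.toFun) (fun t => E.e (u.toFun t)) (fun t => E.e (u.dt t)) u.dtt t) :
    IsWeakSolution α b c q f u₀ u₁ u₂ F u := by
  have hu : MemLp (fun t => E.e (u.toFun t)) ∞ (timeMeasure T) := E.memLp_e hb.le u.memLp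
  have hv : MemLp (fun t => E.e (u.dt t)) ∞ (timeMeasure T) := E.memLp_e hb.le u.memLp_dt
  have hw : Integrable u.dtt (timeMeasure T) := u.memLp_dtt.integrable le_top
  have hg : Integrable (lowerOrder hΩ q f F u.toFun) (timeMeasure T) :=
    (memLp_lowerOrder hF hq hf).integrable (by norm_num)
  have i1 : Integrable (fun t => E.e (u.dt t) + (c / b) • E.e (u.toFun t) +
      E.j.adjoint (α • u.dtt t + lowerOrder hΩ q f F u.toFun t)) (timeMeasure T) :=
    ((hv.integrable le_top).add ((hu.integrable le_top).smul (c / b))).add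
      (E.j.adjoint.integrable_comp ((hw.smul α).add hg))
  refine ⟨h0, h1, fun φ => ?_⟩
  refine (weak_iff E hn hΩ hΩb hb hF u hq.slice hf.slice hq.memLp hf.memLp φ).2 ?_
  have h2 := integral_inner_by_parts hT.le (g := fun t => E.j.adjoint (u.dtt t))
    (c := E.j.adjoint u₂) i1.neg
    ((E.memLp_e hb.le (φ.timeDeriv.memLp_slice hn hΩ hΩb s ∞)).integrable le_top)
    (h.mono fun t ht => by
      simp only [Pi.neg_apply]
      rw [ht.2.2, intervalIntegral.integral_neg, ← sub_eq_add_neg])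
    (fun t ht => E.e_slice_eq_integral hn hΩ hΩb hb.le φ ht)
  rw [h2, sub_eq_add_neg, ← integral_neg]
  simp only [Pi.neg_apply, inner_neg_left, neg_neg]
  rfl

/-- A continuous solution of the integrated equation is an element of the solution space. -/
theorem exists_energyFun (E : EnergySpace s Ω b V) (hT : 0 < T) {α κ : ℝ} {u₀ u₁ : ↥(HTilde s Ω)}
    {u₂ : ↥(LTilde Ω)} {g : ℝ → ↥(LTilde Ω)} {u v : ℝ → V} {w : ℝ → ↥(LTilde Ω)}
    (hu : Continuous u) (hv : Continuous v) (hw : Continuous w)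
    (h : ∀ t ∈ Icc 0 T, IsThirdOrder E.j κ α (E.e u₀) (E.e u₁) u₂ g u v w t) :
    ∃ U : EnergyFun s Ω T, (∀ t, U.toFun t = E.e' (u t)) ∧ (∀ t, U.dt t = E.e' (v t)) ∧
      U.dtt = w ∧ HasInitialValue T U.toFun u₀ ∧
      HasInitialValue T (fun t => toL2 (U.dt t)) (toL2 u₁) := by
  have h0 : (0 : ℝ) ∈ Icc 0 T := ⟨le_rfl, hT.le⟩
  have hae : ∀ᵐ t ∂timeMeasure T, t ∈ Icc 0 T :=
    (ae_restrict_mem measurableSet_Ioo).mono fun t ht => Ioo_subset_Icc_self ht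
  have d1 : HasWeakDeriv T u v := hasWeakDeriv_of_primitive hT.le (hu.integrable_timeMeasure T)
    (hv.integrable_timeMeasure T) (hae.mono fun t ht => (h t ht).1)
  have d2 : HasWeakDeriv T (fun t => E.j (v t)) w :=
    hasWeakDeriv_of_primitive hT.le ((E.j.continuous.comp hv).integrable_timeMeasure T)
      (hw.integrable_timeMeasure T) (hae.mono fun t ht => (h t ht).2.1)
  have mu := hu.memLp_timeMeasure T ∞
  have mv := hv.memLp_timeMeasure T ∞
  have mw := hw.memLp_timeMeasure T ∞
  have cu : Continuous fun t => E.e' (u t) := E.continuous_e'.comp hu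
  have cv : Continuous fun t => E.e' (v t) := E.continuous_e'.comp hv
  have e0 : E.e' (u 0) = u₀ := by
    have := (h 0 h0).1
    rw [intervalIntegral.integral_same, add_zero] at this
    rw [this, E.e'_e]
  have e1 : E.e' (v 0) = u₁ := by
    have := (h 0 h0).2.1
    rw [intervalIntegral.integral_same, add_zero] at this
    rw [E.j_injective this, E.e'_e]
  refine ⟨⟨fun t => E.e' (u t), fun t => E.e' (v t), w, cu.memLp_timeMeasure T ∞,
    cv.memLp_timeMeasure T ∞, mw, ?_, ?_⟩, fun _ => rfl, fun _ => rfl, rfl, ?_, ?_⟩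
  · exact hasWeakDeriv_comp_linear d1 (mu.integrable le_top) (mv.integrable le_top) E.e'_add
      E.e'_smul E.continuous_e'
  · have d3 := hasWeakDeriv_comp_linear d2 ((E.j.comp_memLp' mv).integrable le_top)
      (mw.integrable le_top) (L := (LTilde Ω).subtypeL)
      (map_add _) (map_smul _) (LTilde Ω).subtypeL.continuous
    have e2 : (fun t => toL2 (E.e' (v t))) = fun t => (LTilde Ω).subtypeL (E.j (v t)) := by
      funext t
      rw [E.j_eq]
      rfl
    rw [e2]
    exact d3
  · exact ⟨_, cu.continuousOn, EventuallyEq.rfl, e0⟩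
  · exact ⟨_, (toL2.continuous.comp cv).continuousOn, EventuallyEq.rfl, congrArg toL2 e1⟩

end Mild

/-! ### Norms in time and the radial retraction -/

section Norms

variable {T : ℝ}

theorem ae_norm_le_timeNorm {X : Type*} [NormedAddCommGroup X] {g : ℝ → X}
    (hg : MemLp g ∞ (timeMeasure T)) : ∀ᵐ t ∂timeMeasure T, ‖g t‖ ≤ timeNorm T ∞ g := by
  have h1 := hg.2
  rw [eLpNorm_exponent_top] at h1
  filter_upwards [enorm_ae_le_eLpNormEssSup g (timeMeasure T)] with t ht
  rw [timeNorm, eLpNorm_exponent_top, ← toReal_enorm]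
  exact ENNReal.toReal_mono h1.ne ht

theorem timeNorm_top_le {X : Type*} [NormedAddCommGroup X] {g : ℝ → X} {B : ℝ} (hB : 0 ≤ B)
    (h : ∀ᵐ t ∂timeMeasure T, ‖g t‖ ≤ B) : timeNorm T ∞ g ≤ B := by
  refine ENNReal.toReal_le_of_le_ofReal hB ?_
  rw [eLpNorm_exponent_top]
  exact eLpNormEssSup_le_of_ae_bound h

theorem timeNorm_two_le {X : Type*} [NormedAddCommGroup X] (hT : 0 ≤ T) {g : ℝ → X} {B : ℝ} (hB : 0 ≤ B)
    (h : ∀ᵐ t ∂timeMeasure T, ‖g t‖ ≤ B) : timeNorm T 2 g ≤ √T * B := by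
  refine ENNReal.toReal_le_of_le_ofReal (by positivity) ?_
  refine (eLpNorm_le_of_ae_bound h).trans (le_of_eq ?_)
  rw [Measure.restrict_apply_univ, Real.volume_Ioo, sub_zero, ENNReal.ofReal_mul (by positivity),
    Real.sqrt_eq_rpow, ← ENNReal.ofReal_rpow_of_nonneg hT (by norm_num)]
  norm_num

theorem timeNorm_nonneg {X : Type*} [NormedAddCommGroup X] (p : ℝ≥0∞) (g : ℝ → X) :
    0 ≤ timeNorm T p g := ENNReal.toReal_nonneg

theorem timeNorm_sub_le {X : Type*} [NormedAddCommGroup X] {g h : ℝ → X} (hg : MemLp g 2 (timeMeasure T))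
    (hh : MemLp h 2 (timeMeasure T)) :
    timeNorm T 2 (fun t => g t - h t) ≤ timeNorm T 2 g + timeNorm T 2 h := by
  rw [timeNorm, timeNorm, timeNorm, ← ENNReal.toReal_add hg.2.ne hh.2.ne]
  exact ENNReal.toReal_mono (ENNReal.add_ne_top.2 ⟨hg.2.ne, hh.2.ne⟩)
    (eLpNorm_sub_le hg.1 hh.1 (by norm_num))

theorem timeNorm_sq {X : Type*} [NormedAddCommGroup X] {g : ℝ → X} (hg : MemLp g 2 (timeMeasure T)) :
    ∫ t in Ioo 0 T, ‖g t‖ ^ 2 = timeNorm T 2 g ^ 2 := integral_norm_sq_eq hg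

theorem hasWeakDeriv_sub {X : Type*} [NormedAddCommGroup X] [NormedSpace ℝ X] {u v u' v' : ℝ → X}
    (h : HasWeakDeriv T u v) (h' : HasWeakDeriv T u' v') (hu : Integrable u (timeMeasure T))
    (hv : Integrable v (timeMeasure T)) (hu' : Integrable u' (timeMeasure T))
    (hv' : Integrable v' (timeMeasure T)) :
    HasWeakDeriv T (fun t => u t - u' t) (fun t => v t - v' t) := by
  intro η hη hηc hηT
  have hb : ∀ {f : ℝ → ℝ}, Continuous f → HasCompactSupport f → ∀ {k : ℝ → X},
      Integrable k (timeMeasure T) → Integrable (fun t => f t • k t) (timeMeasure T) := by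
    intro f hf hfc k hk
    obtain ⟨C, hC⟩ := hf.bounded_above_of_compact_support hfc
    exact hk.bdd_smul C hf.aestronglyMeasurable (Eventually.of_forall hC)
  have hη' := hη.continuous_deriv (by norm_num)
  simp only [smul_sub]
  rw [integral_sub (hb hη' hηc.deriv hu) (hb hη' hηc.deriv hu'), h η hη hηc hηT, h' η hη hηc hηT,
    integral_sub (hb hη.continuous hηc hv) (hb hη.continuous hηc hv')]
  abel

theorem HasInitialValue.sub {X : Type*} [NormedAddCommGroup X] {u u' : ℝ → X} {x x' : X}
    (h : HasInitialValue T u x) (h' : HasInitialValue T u' x') :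
    HasInitialValue T (fun t => u t - u' t) (x - x') := by
  obtain ⟨v, h1, h2, h3⟩ := h
  obtain ⟨v', h1', h2', h3'⟩ := h'
  exact ⟨fun t => v t - v' t, h1.sub h1', h2.sub h2', by simp only [h3, h3']⟩

/-- The radial retraction of a normed space to the closed ball with radius `R`. -/
def radialRetraction {X : Type*} [NormedAddCommGroup X] [NormedSpace ℝ X] (R : ℝ) (x : X) : X :=
  (R / max R ‖x‖) • x

section Retraction

variable {X : Type*} [NormedAddCommGroup X] [NormedSpace ℝ X] {R : ℝ}

theorem radialRetraction_of_le (hR : 0 < R) {x : X} (h : ‖x‖ ≤ R) : radialRetraction R x = x := by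
  rw [radialRetraction, max_eq_left h, div_self hR.ne', one_smul]

theorem norm_radialRetraction_le (hR : 0 < R) (x : X) : ‖radialRetraction R x‖ ≤ R := by
  have hm : 0 < max R ‖x‖ := lt_max_of_lt_left hR
  rw [radialRetraction, norm_smul, Real.norm_of_nonneg (by positivity), div_mul_eq_mul_div,
    div_le_iff₀ hm]
  gcongr
  exact le_max_right _ _

theorem norm_radialRetraction_sub_le (hR : 0 < R) (x y : X) :
    ‖radialRetraction R x - radialRetraction R y‖ ≤ 2 * ‖x - y‖ := by
  set m := max R ‖x‖ with hm
  set k := max R ‖y‖ with hk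
  have hm0 : 0 < m := lt_max_of_lt_left hR
  have hk0 : 0 < k := lt_max_of_lt_left hR
  have hmR : R / m ≤ 1 := (div_le_one hm0).2 (le_max_left _ _)
  have hyk : ‖y‖ / k ≤ 1 := (div_le_one hk0).2 (le_max_right _ _)
  have h1 : radialRetraction R x - radialRetraction R y =
      (R / m) • (x - y) + ((R / m) * ((k - m) / k)) • y := by
    rw [radialRetraction, radialRetraction, smul_sub, sub_add, ← sub_smul]
    congr 2
    field_simp
    ring
  have h2 : |k - m| ≤ ‖x - y‖ := by
    refine (abs_max_sub_max_le_max R ‖y‖ R ‖x‖).trans (max_le (by simp) ?_)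
    rw [norm_sub_rev]
    exact abs_norm_sub_norm_le y x
  rw [h1]
  refine (norm_add_le _ _).trans ?_
  rw [norm_smul, norm_smul, norm_mul, Real.norm_of_nonneg (by positivity : 0 ≤ R / m), norm_div,
    Real.norm_eq_abs, Real.norm_of_nonneg hk0.le, two_mul]
  refine add_le_add (mul_le_of_le_one_left (norm_nonneg _) hmR) ?_
  calc R / m * (|k - m| / k) * ‖y‖ = R / m * (|k - m| * (‖y‖ / k)) := by ring
    _ ≤ 1 * (‖x - y‖ * 1) := by gcongr
    _ = ‖x - y‖ := by ring

theorem continuous_radialRetraction (hR : 0 < R) : Continuous (radialRetraction R : X → X) := by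
  refine LipschitzWith.continuous (K := 2) (LipschitzWith.of_dist_le_mul fun x y => ?_)
  rw [dist_eq_norm, dist_eq_norm]
  exact norm_radialRetraction_sub_le hR x y

end Retraction

/-- Composition with an operator `X → V` carries weak derivatives in the Hilbert space `V` to weak
derivatives in the dual space of `X`. -/
theorem exists_weakDeriv_dual {X V : Type*} [NormedAddCommGroup X] [NormedSpace ℝ X]
    [NormedAddCommGroup V] [InnerProductSpace ℝ V] [CompleteSpace V] {G : ℝ → StrongDual ℝ X}
    {e : X → V} (hadd : ∀ x y, e (x + y) = e x + e y) (hsmul : ∀ (c : ℝ) x, e (c • x) = c • e x)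
    (hc : Continuous e) {g z : ℝ → V} (hG : ∀ t x, G t x = ⟪g t, e x⟫_ℝ)
    (hg : Integrable g (timeMeasure T)) (hz : MemLp z 2 (timeMeasure T)) (h : HasWeakDeriv T g z) :
    ∃ w : ℝ → StrongDual ℝ X, MemLp w 2 (timeMeasure T) ∧ HasWeakDeriv T G w := by
  set A : X →L[ℝ] V := ⟨⟨⟨e, hadd⟩, hsmul⟩, hc⟩
  set Φ : V →L[ℝ] StrongDual ℝ X := (ContinuousLinearMap.compL ℝ X V ℝ).flip A ∘L innerSL ℝ with hΦ
  have hGΦ : G = fun t => Φ (g t) := by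
    funext t
    ext x
    exact hG t x
  rw [hGΦ]
  exact ⟨fun t => Φ (z t), Φ.comp_memLp' hz, hasWeakDeriv_comp_linear (L := Φ) h hg
    (hz.integrable (by norm_num)) (map_add _) (map_smul _) Φ.continuous⟩

end Norms

/-! ### Superposition operators along solutions -/

section Superposition

variable {n : ℕ} {s : ℝ≥0} {Ω : Set (Space n)} {T b : ℝ}

/-- The superposition operator of `f` is Lipschitz from bounded subsets of `H̃^s(Ω)` to `L²(Ω)`,
with growth exponents `γ` and `r`, and a constant `K` that does not depend on the time. -/
def LocallyLipschitzSuperposition (hΩ : IsOpen Ω) (s : ℝ≥0) (T K γ r : ℝ)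
    (f : Space n × ℝ → ℝ → ℝ) : Prop :=
  ∀ᵐ t ∂(timeMeasure T),
    (∀ w : ↥(HTilde s Ω), MemLp (fun x => f (x, t) (toL2 w x)) 2 (volume.restrict Ω)) ∧
    (nemytskii hΩ f t 0 = 0) ∧
    ∀ w w' : ↥(HTilde s Ω), ‖nemytskii hΩ f t (toL2 w) - nemytskii hΩ f t (toL2 w')‖ ≤
      K * ((‖fracLap w‖ ^ γ + ‖fracLap w'‖ ^ γ) + (‖fracLap w‖ ^ r + ‖fracLap w'‖ ^ r)) *
        ‖fracLap (w - w')‖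

/-- Multiplication with `q(·,t)` is bounded from `H̃^s(Ω)` to `L²(Ω)`, with a bound `K` that does
not depend on `t`. -/
def BoundedPotential (hΩ : IsOpen Ω) (s : ℝ≥0) (T K : ℝ) (q : Space n × ℝ → ℝ) : Prop :=
  ∀ᵐ t ∂(timeMeasure T),
    (∀ w : ↥(HTilde s Ω), MemLp (fun x => q (x, t) * toL2 w x) 2 (volume.restrict Ω)) ∧
    ∀ w w' : ↥(HTilde s Ω), ‖nemytskii hΩ (fun z τ => q z * τ) t (toL2 w) -
      nemytskii hΩ (fun z τ => q z * τ) t (toL2 w')‖ ≤ K * ‖fracLap (w - w')‖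

theorem continuous_of_norm_sub_le {X Y : Type*} [TopologicalSpace X] [NormedAddCommGroup Y] {G : X → Y}
    {Φ : X → X → ℝ} (h : ∀ w w', ‖G w - G w'‖ ≤ Φ w w') (hΦ : ∀ w', Continuous fun w => Φ w w')
    (h0 : ∀ w, Φ w w = 0) : Continuous G := by
  rw [continuous_iff_continuousAt]
  intro w'
  rw [ContinuousAt, tendsto_iff_norm_sub_tendsto_zero]
  refine squeeze_zero (fun _ => norm_nonneg _) (fun w => h w w') ?_
  have := (hΦ w').tendsto w'
  rwa [h0] at this

theorem continuous_norm_fracLap_sub (w' : ↥(HTilde s Ω)) :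
    Continuous fun w : ↥(HTilde s Ω) => ‖fracLap (w - w')‖ := by
  have h : Continuous fun w : ↥(HTilde s Ω) => fracLap w := fracLap.continuous
  simp only [map_sub]
  exact (h.sub continuous_const).norm

theorem continuous_norm_fracLap : Continuous fun w : ↥(HTilde s Ω) => ‖fracLap w‖ :=
  fracLap.continuous.norm

theorem LocallyLipschitzSuperposition.ae_continuous {hΩ : IsOpen Ω} {K γ r : ℝ} (hγ : 0 ≤ γ) (hr : 0 ≤ r)
    {f : Space n × ℝ → ℝ → ℝ} (h : LocallyLipschitzSuperposition hΩ s T K γ r f) :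
    ∀ᵐ t ∂(timeMeasure T), Continuous fun w : ↥(HTilde s Ω) => nemytskii hΩ f t (toL2 w) := by
  filter_upwards [h] with t ht
  refine continuous_of_norm_sub_le ht.2.2 (fun w' => ?_) fun w => ?_
  · exact (continuous_const.mul (((continuous_norm_fracLap.rpow_const fun _ => Or.inr hγ).add
      continuous_const).add ((continuous_norm_fracLap.rpow_const fun _ => Or.inr hr).add
      continuous_const))).mul (continuous_norm_fracLap_sub w')
  · rw [sub_self, map_zero, norm_zero, mul_zero]

theorem BoundedPotential.ae_continuous {hΩ : IsOpen Ω} {K : ℝ} {q : Space n × ℝ → ℝ}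
    (h : BoundedPotential hΩ s T K q) : ∀ᵐ t ∂(timeMeasure T),
      Continuous fun w : ↥(HTilde s Ω) => nemytskii hΩ (fun z τ => q z * τ) t (toL2 w) := by
  filter_upwards [h] with t ht
  refine continuous_of_norm_sub_le ht.2 (fun w' => ?_) fun w => ?_
  · exact continuous_const.mul (continuous_norm_fracLap_sub w')
  · rw [sub_self, map_zero, norm_zero, mul_zero]

theorem nemytskii_eq_zero (hΩ : IsOpen Ω) {f : Space n × ℝ → ℝ → ℝ} {t : ℝ} {w : L2 n}
    (h : ∀ᵐ x ∂(volume.restrict Ω), f (x, t) (w x) = 0) : nemytskii hΩ f t w = 0 := by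
  have h0 : (fun x => f (x, t) (w x)) =ᵐ[volume.restrict Ω] fun _ => 0 := h
  have hm : MemLp (fun x => f (x, t) (w x)) 2 (volume.restrict Ω) :=
    (memLp_congr_ae h0).2 MemLp.zero
  apply ext_LTilde hΩ
  filter_upwards [coeFn_nemytskii hΩ hm, h,
    ae_restrict_of_ae (Lp.coeFn_zero ℝ 2 (volume : Measure (Space n)))] with x e1 e2 e3
  rw [e1, e2, Submodule.coe_zero, e3]
  rfl

theorem nemytskii_zero (hΩ : IsOpen Ω) (t : ℝ) (w : L2 n) : nemytskii hΩ (fun _ _ => 0) t w = 0 :=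
  nemytskii_eq_zero hΩ (Eventually.of_forall fun _ => rfl)

theorem nemytskii_potential_zero (hΩ : IsOpen Ω) (q : Space n × ℝ → ℝ) (t : ℝ) :
    nemytskii hΩ (fun z τ => q z * τ) t 0 = 0 := by
  refine nemytskii_eq_zero hΩ ?_
  filter_upwards [ae_restrict_of_ae (Lp.coeFn_zero ℝ 2 (volume : Measure (Space n)))] with x hx
  rw [hx, Pi.zero_apply, mul_zero]

theorem nemytskii_potential_sub (hΩ : IsOpen Ω) {q : Space n × ℝ → ℝ} {t : ℝ} {w w' : L2 n}
    (h : MemLp (fun x => q (x, t) * w x) 2 (volume.restrict Ω))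
    (h' : MemLp (fun x => q (x, t) * w' x) 2 (volume.restrict Ω)) :
    nemytskii hΩ (fun z τ => q z * τ) t (w - w') =
      nemytskii hΩ (fun z τ => q z * τ) t w - nemytskii hΩ (fun z τ => q z * τ) t w' := by
  have e0 : (fun x => q (x, t) * (w - w') x) =ᵐ[volume.restrict Ω]
      fun x => q (x, t) * w x - q (x, t) * w' x := by
    filter_upwards [ae_restrict_of_ae (Lp.coeFn_sub w w')] with x hx
    rw [hx, Pi.sub_apply, mul_sub]
  have h2 : MemLp (fun x => q (x, t) * (w - w') x) 2 (volume.restrict Ω) :=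
    (memLp_congr_ae e0).2 (h.sub h')
  apply ext_LTilde hΩ
  filter_upwards [coeFn_nemytskii hΩ (f := fun z τ => q z * τ) h,
    coeFn_nemytskii hΩ (f := fun z τ => q z * τ) h', coeFn_nemytskii hΩ (f := fun z τ => q z * τ) h2,
    e0, ae_restrict_of_ae (Lp.coeFn_sub (nemytskii hΩ (fun z τ => q z * τ) t w : L2 n)
      (nemytskii hΩ (fun z τ => q z * τ) t w' : L2 n))] with x e1 e2 e3 e4 e5
  rw [e3, Submodule.coe_sub, e5, Pi.sub_apply, e1, e2]
  exact e4

theorem BoundedPotential.norm_le {hΩ : IsOpen Ω} {K : ℝ} {q : Space n × ℝ → ℝ}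
    (h : BoundedPotential hΩ s T K q) : ∀ᵐ t ∂(timeMeasure T), ∀ w : ↥(HTilde s Ω),
      ‖nemytskii hΩ (fun z τ => q z * τ) t (toL2 w)‖ ≤ K * ‖fracLap w‖ := by
  filter_upwards [h] with t ht w
  have := ht.2 w 0
  rwa [map_zero, nemytskii_potential_zero, sub_zero, sub_zero] at this

theorem LocallyLipschitzSuperposition.norm_le {hΩ : IsOpen Ω} {K γ r : ℝ} (hγ : 0 < γ) (hr : 0 < r)
    {f : Space n × ℝ → ℝ → ℝ} (h : LocallyLipschitzSuperposition hΩ s T K γ r f) :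
    ∀ᵐ t ∂(timeMeasure T), ∀ w : ↥(HTilde s Ω), ‖nemytskii hΩ f t (toL2 w)‖ ≤
      K * (‖fracLap w‖ ^ γ + ‖fracLap w‖ ^ r) * ‖fracLap w‖ := by
  filter_upwards [h] with t ht w
  have := ht.2.2 w 0
  rwa [map_zero, ht.2.1, sub_zero, sub_zero, map_zero, norm_zero, Real.zero_rpow hγ.ne',
    Real.zero_rpow hr.ne', add_zero, add_zero] at this

theorem hasL2Superposition_zero (hΩ : IsOpen Ω) (T : ℝ) (u : ℝ → ↥(HTilde s Ω)) :
    HasL2Superposition hΩ T (fun _ _ => 0) u := by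
  refine ⟨Eventually.of_forall fun t => MemLp.zero, ?_⟩
  simp only [nemytskii_zero]
  exact MemLp.zero

theorem ae_norm_fracLap_le {u : ℝ → ↥(HTilde s Ω)} (hu : MemLp u ∞ (timeMeasure T)) :
    ∀ᵐ t ∂timeMeasure T, ‖fracLap (u t)‖ ≤ supNorm T u := by
  refine ae_norm_le_timeNorm (MemLp.of_le_mul (c := 1) hu
    (fracLap.continuous.comp_aestronglyMeasurable hu.1) (Eventually.of_forall fun t => ?_))
  rw [one_mul]
  exact norm_fracLap_le _

theorem supNorm_le {u : ℝ → ↥(HTilde s Ω)} {B : ℝ} (hB : 0 ≤ B)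
    (h : ∀ᵐ t ∂timeMeasure T, ‖fracLap (u t)‖ ≤ B) : supNorm T u ≤ B := timeNorm_top_le hB h

theorem supNorm_nonneg (u : ℝ → ↥(HTilde s Ω)) : 0 ≤ supNorm T u := ENNReal.toReal_nonneg

theorem supNorm_le_norm (u : EnergyFun s Ω T) : supNorm T u.toFun ≤ u.norm :=
  (le_max_left _ _).trans (le_add_of_nonneg_right (timeNorm_nonneg _ _))

theorem memLp_two_of_ae_bound {X : Type*} [NormedAddCommGroup X] {g : ℝ → X} {B : ℝ}
    (hg : AEStronglyMeasurable g (timeMeasure T)) (h : ∀ᵐ t ∂timeMeasure T, ‖g t‖ ≤ B) :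
    MemLp g 2 (timeMeasure T) := MemLp.of_bound hg B h

theorem BoundedPotential.hasL2Superposition {hΩ : IsOpen Ω} {K : ℝ} (hK : 0 ≤ K) {q : Space n × ℝ → ℝ}
    {p : ℝ≥0∞} (hq : IsPotential Ω T p q) (h : BoundedPotential hΩ s T K q)
    {u : ℝ → ↥(HTilde s Ω)} (hu : MemLp u ∞ (timeMeasure T)) :
    HasL2Superposition hΩ T (fun z τ => q z * τ) u := by
  refine ⟨h.mono fun t ht => ht.1 _, memLp_two_of_ae_bound (B := K * supNorm T u)
    (aestronglyMeasurable_nemytskii hΩ (isCaratheodory_potential hq) (h.mono fun _ ht => ht.1)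
      h.ae_continuous hu.1) ?_⟩
  filter_upwards [h.norm_le, ae_norm_fracLap_le hu] with t h1 h2
  exact (h1 _).trans (by gcongr)

theorem LocallyLipschitzSuperposition.ae_norm_le {hΩ : IsOpen Ω} {K γ r : ℝ} (hK : 0 ≤ K) (hγ : 0 < γ)
    (hr : 0 < r) {f : Space n × ℝ → ℝ → ℝ} (h : LocallyLipschitzSuperposition hΩ s T K γ r f)
    {u : ℝ → ↥(HTilde s Ω)} {R : ℝ} (hu : ∀ᵐ t ∂timeMeasure T, ‖fracLap (u t)‖ ≤ R) :
    ∀ᵐ t ∂timeMeasure T, ‖nemytskii hΩ f t (toL2 (u t))‖ ≤ K * (R ^ γ + R ^ r) * R := by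
  filter_upwards [h.norm_le hγ hr, hu] with t h1 h2
  have : 0 ≤ R := (norm_nonneg _).trans h2
  exact (h1 _).trans (by gcongr)

theorem LocallyLipschitzSuperposition.ae_norm_sub_le {hΩ : IsOpen Ω} {K γ r : ℝ} (hK : 0 ≤ K)
    (hγ : 0 < γ) (hr : 0 < r) {f : Space n × ℝ → ℝ → ℝ}
    (h : LocallyLipschitzSuperposition hΩ s T K γ r f)
    {R : ℝ} : ∀ᵐ t ∂timeMeasure T, ∀ w w' : ↥(HTilde s Ω), ‖fracLap w‖ ≤ R → ‖fracLap w'‖ ≤ R →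
      ‖nemytskii hΩ f t (toL2 w) - nemytskii hΩ f t (toL2 w')‖ ≤
        2 * K * (R ^ γ + R ^ r) * ‖fracLap (w - w')‖ := by
  filter_upwards [h] with t ht w w' h1 h2
  have h3 : 0 ≤ R := (norm_nonneg _).trans h1
  refine (ht.2.2 w w').trans ?_
  calc K * ((‖fracLap w‖ ^ γ + ‖fracLap w'‖ ^ γ) + (‖fracLap w‖ ^ r + ‖fracLap w'‖ ^ r)) *
        ‖fracLap (w - w')‖ ≤ K * ((R ^ γ + R ^ γ) + (R ^ r + R ^ r)) * ‖fracLap (w - w')‖ := by gcongr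
    _ = _ := by ring

theorem LocallyLipschitzSuperposition.hasL2Superposition {hΩ : IsOpen Ω} {K γ r : ℝ} (hK : 0 ≤ K)
    (hγ : 0 < γ) (hr : 0 < r) {f : Space n × ℝ → ℝ → ℝ} (hf : IsCaratheodory Ω T f)
    (h : LocallyLipschitzSuperposition hΩ s T K γ r f) {u : ℝ → ↥(HTilde s Ω)}
    (hu : MemLp u ∞ (timeMeasure T)) : HasL2Superposition hΩ T f u :=
  ⟨h.mono fun _ ht => ht.1 _, memLp_two_of_ae_bound
    (aestronglyMeasurable_nemytskii hΩ hf (h.mono fun _ ht => ht.1)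
      (h.ae_continuous hγ.le hr.le) hu.1) (h.ae_norm_le hK hγ hr (ae_norm_fracLap_le hu))⟩

end Superposition

/-! ### The linear equation -/

section Linear

theorem IsThirdOrder.sub {V H : Type*} [NormedAddCommGroup V] [InnerProductSpace ℝ V] [CompleteSpace V]
    [NormedAddCommGroup H] [InnerProductSpace ℝ H] [CompleteSpace H] {j : V →L[ℝ] H} {κ α : ℝ}
    {u₀ u₁ u₀' u₁' : V} {u₂ u₂' : H} {g g' : ℝ → H} {u v u' v' : ℝ → V} {w w' : ℝ → H} {T t : ℝ}
    (hu : Integrable u (timeMeasure T)) (hv : Integrable v (timeMeasure T))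
    (hw : Integrable w (timeMeasure T)) (hg : Integrable g (timeMeasure T))
    (hu' : Integrable u' (timeMeasure T)) (hv' : Integrable v' (timeMeasure T))
    (hw' : Integrable w' (timeMeasure T)) (hg' : Integrable g' (timeMeasure T)) (ht : t ∈ Icc 0 T)
    (h : IsThirdOrder j κ α u₀ u₁ u₂ g u v w t)
    (h' : IsThirdOrder j κ α u₀' u₁' u₂' g' u' v' w' t) :
    IsThirdOrder j κ α (u₀ - u₀') (u₁ - u₁') (u₂ - u₂') (fun τ => g τ - g' τ) (fun τ => u τ - u' τ)
      (fun τ => v τ - v' τ) (fun τ => w τ - w' τ) t := by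
  have hz : IntervalIntegrable (fun τ => v τ + κ • u τ + j.adjoint (α • w τ + g τ)) volume 0 t :=
    intervalIntegrable_of_timeMeasure ((hv.add (hu.smul κ)).add
      (j.adjoint.integrable_comp ((hw.smul α).add hg))) ht
  have hz' : IntervalIntegrable (fun τ => v' τ + κ • u' τ + j.adjoint (α • w' τ + g' τ)) volume 0 t :=
    intervalIntegrable_of_timeMeasure ((hv'.add (hu'.smul κ)).add
      (j.adjoint.integrable_comp ((hw'.smul α).add hg'))) ht
  refine ⟨?_, ?_, ?_⟩
  · simp only
    rw [h.1, h'.1, intervalIntegral.integral_sub (intervalIntegrable_of_timeMeasure hv ht)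
      (intervalIntegrable_of_timeMeasure hv' ht)]
    abel
  · simp only
    rw [map_sub, h.2.1, h'.2.1, intervalIntegral.integral_sub (intervalIntegrable_of_timeMeasure hw ht)
      (intervalIntegrable_of_timeMeasure hw' ht), map_sub]
    abel
  · have e : ∀ τ, v τ - v' τ + κ • (u τ - u' τ) + j.adjoint (α • (w τ - w' τ) + (g τ - g' τ)) =
        (v τ + κ • u τ + j.adjoint (α • w τ + g τ)) -
          (v' τ + κ • u' τ + j.adjoint (α • w' τ + g' τ)) := by
      intro τ
      simp only [map_add, map_sub, map_smul, smul_sub]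
      abel
    simp only [e]
    rw [map_sub, h.2.2, h'.2.2, intervalIntegral.integral_sub hz hz', map_sub]
    abel

variable {n : ℕ} {s : ℝ≥0} {Ω : Set (Space n)} {T b : ℝ} {V : Type} [NormedAddCommGroup V]
  [InnerProductSpace ℝ V] [CompleteSpace V]

theorem lowerOrder_linear (hΩ : IsOpen Ω) (q : Space n × ℝ → ℝ) (f : Space n × ℝ → ℝ → ℝ)
    (F : ℝ → ↥(LTilde Ω)) (u : ℝ → ↥(HTilde s Ω)) :
    lowerOrder hΩ q (fun _ _ => 0) (fun t => F t - nemytskii hΩ f t (toL2 (u t))) u =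
      lowerOrder hΩ q f F u := by
  funext t
  rw [lowerOrder, lowerOrder, nemytskii_zero]
  abel

/-- The nonlinear term can be moved to the right-hand side. In the weak formulation it is a
function on `Ω`, while the source is an element of `L²(0,T;L̃²(Ω))`, so this is not a mere
rearrangement. -/
theorem isWeakSolution_iff_linear (E : EnergySpace s Ω b V) (hn : 1 ≤ n) (hΩ : IsOpen Ω)
    (hΩb : volume Ω ≠ ⊤) (hb : 0 < b) (hT : 0 < T) {α c : ℝ} {q : Space n × ℝ → ℝ}
    {f : Space n × ℝ → ℝ → ℝ} {u₀ u₁ : ↥(HTilde s Ω)} {u₂ : ↥(LTilde Ω)} {F : ℝ → ↥(LTilde Ω)}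
    (hF : MemLp F 2 (timeMeasure T)) {u : EnergyFun s Ω T}
    (hq : HasL2Superposition hΩ T (fun z τ => q z * τ) u.toFun)
    (hf : HasL2Superposition hΩ T f u.toFun) :
    IsWeakSolution α b c q f u₀ u₁ u₂ F u ↔ IsWeakSolution α b c q (fun _ _ => 0) u₀ u₁ u₂
      (fun t => F t - nemytskii hΩ f t (toL2 (u.toFun t))) u := by
  have hF' : MemLp (fun t => F t - nemytskii hΩ f t (toL2 (u.toFun t))) 2 (timeMeasure T) :=
    hF.sub hf.memLp
  have h0 := hasL2Superposition_zero hΩ T u.toFun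
  constructor
  · intro h
    refine isWeakSolution_of_isThirdOrder E hn hΩ hΩb hb hT hF' hq h0 h.initial h.initial_dt ?_
    rw [lowerOrder_linear]
    exact h.isThirdOrder E hn hΩ hΩb hb hT hF hq hf
  · intro h
    refine isWeakSolution_of_isThirdOrder E hn hΩ hΩb hb hT hF hq hf h.initial h.initial_dt ?_
    rw [← lowerOrder_linear]
    exact h.isThirdOrder E hn hΩ hΩb hb hT hF' hq h0

/-- The difference of two solutions of the linear equation. -/
theorem exists_difference (E : EnergySpace s Ω b V) (hn : 1 ≤ n) (hΩ : IsOpen Ω)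
    (hΩb : volume Ω ≠ ⊤) (hb : 0 < b) (hT : 0 < T) {α c K : ℝ} (hK : 0 ≤ K) {q : Space n × ℝ → ℝ}
    {p : ℝ≥0∞} (hq : IsPotential Ω T p q) (hB : BoundedPotential hΩ s T K q)
    {u₀ u₁ : ↥(HTilde s Ω)} {u₂ : ↥(LTilde Ω)} {F G : ℝ → ↥(LTilde Ω)}
    (hF : MemLp F 2 (timeMeasure T)) (hG : MemLp G 2 (timeMeasure T)) {u v : EnergyFun s Ω T}
    (hu : IsWeakSolution α b c q (fun _ _ => 0) u₀ u₁ u₂ F u)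
    (hv : IsWeakSolution α b c q (fun _ _ => 0) u₀ u₁ u₂ G v) :
    ∃ d : EnergyFun s Ω T, (∀ t, d.toFun t = u.toFun t - v.toFun t) ∧
      IsWeakSolution α b c q (fun _ _ => 0) 0 0 0 (fun t => F t - G t) d := by
  have j0 : ∀ w : EnergyFun s Ω T, Integrable w.toFun (timeMeasure T) := fun w =>
    w.memLp.integrable le_top
  have j1 : ∀ w : EnergyFun s Ω T, Integrable w.dt (timeMeasure T) := fun w =>
    w.memLp_dt.integrable le_top
  have j2 : ∀ w : EnergyFun s Ω T, Integrable w.dtt (timeMeasure T) := fun w =>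
    w.memLp_dtt.integrable le_top
  have k0 : ∀ w : EnergyFun s Ω T, Integrable (fun t => E.e (w.toFun t)) (timeMeasure T) := fun w =>
    (E.memLp_e hb.le w.memLp).integrable le_top
  have k1 : ∀ w : EnergyFun s Ω T, Integrable (fun t => E.e (w.dt t)) (timeMeasure T) := fun w =>
    (E.memLp_e hb.le w.memLp_dt).integrable le_top
  have k2 : ∀ w : EnergyFun s Ω T, Integrable (fun t => toL2 (w.dt t)) (timeMeasure T) := fun w => by
    refine ((LTilde Ω).subtypeL.integrable_comp (E.j.integrable_comp (k1 w))).congr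
      (Eventually.of_forall fun t => ?_)
    exact congrArg Subtype.val (E.j_e _)
  have k3 : ∀ w : EnergyFun s Ω T, Integrable (fun t => (w.dtt t : L2 n)) (timeMeasure T) := fun w =>
    (LTilde Ω).subtypeL.integrable_comp (j2 w)
  have hq' := fun w : EnergyFun s Ω T => hB.hasL2Superposition hK hq w.memLp
  have h0 := fun w : EnergyFun s Ω T => hasL2Superposition_zero hΩ T w.toFun
  let d : EnergyFun s Ω T :=
    { toFun := fun t => u.toFun t - v.toFun t
      dt := fun t => u.dt t - v.dt t
      dtt := fun t => u.dtt t - v.dtt t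
      memLp := u.memLp.sub v.memLp
      memLp_dt := u.memLp_dt.sub v.memLp_dt
      memLp_dtt := u.memLp_dtt.sub v.memLp_dtt
      hasWeakDeriv := hasWeakDeriv_sub u.hasWeakDeriv v.hasWeakDeriv (j0 u) (j1 u) (j0 v) (j1 v)
      hasWeakDeriv_dt := by
        simp only [map_sub, Submodule.coe_sub]
        exact hasWeakDeriv_sub u.hasWeakDeriv_dt v.hasWeakDeriv_dt (k2 u) (k3 u) (k2 v) (k3 v) }
  refine ⟨d, fun _ => rfl, ?_⟩
  refine isWeakSolution_of_isThirdOrder E hn hΩ hΩb hb hT (hF.sub hG) (hq' d) (h0 d) ?_ ?_ ?_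
  · have := hu.initial.sub hv.initial
    rwa [sub_self] at this
  · have := hu.initial_dt.sub hv.initial_dt
    rw [sub_self] at this
    rw [map_zero]
    simpa only [d, map_sub] using this
  · have e1 : lowerOrder hΩ q (fun _ _ => 0) (fun t => F t - G t) d.toFun =ᵐ[timeMeasure T]
        fun t => lowerOrder hΩ q (fun _ _ => 0) F u.toFun t -
          lowerOrder hΩ q (fun _ _ => 0) G v.toFun t := by
      filter_upwards [hB] with t ht
      simp only [lowerOrder, nemytskii_zero, d]
      rw [map_sub, nemytskii_potential_sub hΩ (ht.1 _) (ht.1 _)]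
      abel
    filter_upwards [hu.isThirdOrder E hn hΩ hΩb hb hT hF (hq' u) (h0 u),
      hv.isThirdOrder E hn hΩ hΩb hb hT hG (hq' v) (h0 v), ae_restrict_mem measurableSet_Ioo]
      with t h1 h2 ht
    have ht' := Ioo_subset_Icc_self ht
    have h3 := h1.sub (k0 u) (k1 u) (j2 u) ((memLp_lowerOrder hF (hq' u) (h0 u)).integrable (by norm_num))
      (k0 v) (k1 v) (j2 v) ((memLp_lowerOrder hG (hq' v) (h0 v)).integrable (by norm_num)) ht' h2
    simp only [sub_self] at h3
    simp only [d, E.e_sub, E.e_zero]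
    refine ⟨h3.1, h3.2.1, h3.2.2.trans ?_⟩
    congr 1
    refine intervalIntegral_congr_timeMeasure ?_ ht'
    filter_upwards [e1] with τ hτ
    rw [← hτ]
    rfl

/-- The energy estimate for the linear equation: `thirdOrder_estimate` for the integrated
equation, with the potential as a lower order term. -/
theorem exists_isEnergyConstant (E : EnergySpace s Ω b V) (hn : 1 ≤ n) (hΩ : IsOpen Ω)
    (hΩb : volume Ω ≠ ⊤) (hb : 0 < b) (hT : 0 < T) {K : ℝ} (hK : 0 ≤ K) {q : Space n × ℝ → ℝ}
    {p : ℝ≥0∞} (hq : IsPotential Ω T p q) (hB : BoundedPotential hΩ s T K q) (α c : ℝ) :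
    ∃ C₀ : ℝ, 0 < C₀ ∧ IsEnergyConstant s Ω T α b c q C₀ := by
  obtain ⟨C, hC, h⟩ := thirdOrder_estimate E.j_injective E.denseRange_j hT.le (c / b) α (K / √b)
  have hsb : 0 < √b := Real.sqrt_pos.2 hb
  set A := √(C * (b + 1)) with hA
  refine ⟨A / √b + A + 1, by positivity, fun u₀ u₁ u₂ F hF u hu => ?_⟩
  have hq' := hB.hasL2Superposition hK hq u.memLp
  have h0 := hasL2Superposition_zero hΩ T u.toFun
  set N := dataNorm T u₀ u₁ u₂ F with hN
  have hF0 := timeNorm_nonneg (T := T) 2 F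
  have hN0 : 0 ≤ N := by rw [hN, dataNorm]; positivity
  have h1 := h (E.e u₀) (E.e u₁) u₂ _ F _ _ _ (memLp_lowerOrder hF hq' h0) hF
    (E.memLp_e hb.le u.memLp) (E.memLp_e hb.le u.memLp_dt) u.memLp_dtt (by
      filter_upwards [hB.norm_le] with t ht
      rw [lowerOrder, nemytskii_zero, add_zero]
      refine (norm_sub_le _ _).trans (add_le_add_left ((ht _).trans (le_of_eq ?_)) _)
      rw [E.norm_e hb.le]
      field_simp) (hu.isThirdOrder E hn hΩ hΩb hb hT hF hq' h0)
  rw [timeNorm_sq hF] at h1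
  have h2 : ∀ᵐ t ∂timeMeasure T,
      b * ‖fracLap (u.toFun t)‖ ^ 2 + b * ‖fracLap (u.dt t)‖ ^ 2 + ‖u.dtt t‖ ^ 2 ≤ (A * N) ^ 2 := by
    filter_upwards [h1] with t ht
    simp only [E.norm_e hb.le, mul_pow, Real.sq_sqrt hb.le] at ht
    refine ht.trans ?_
    rw [mul_pow, hA, Real.sq_sqrt (by positivity), mul_assoc]
    refine mul_le_mul_of_nonneg_left ?_ hC
    have a0 := norm_nonneg (fracLap u₀)
    have a1 := norm_nonneg (fracLap u₁)
    have a2 := norm_nonneg u₂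
    have key : ‖fracLap u₀‖ ^ 2 + ‖fracLap u₁‖ ^ 2 + ‖u₂‖ ^ 2 + timeNorm T 2 F ^ 2 ≤ N ^ 2 := by
      rw [hN, dataNorm]
      generalize ‖fracLap u₀‖ = x at *
      generalize ‖fracLap u₁‖ = y at *
      generalize ‖u₂‖ = z at *
      generalize timeNorm T 2 F = w at *
      nlinarith [mul_nonneg a0 a1, mul_nonneg a0 a2, mul_nonneg a0 hF0, mul_nonneg a1 a2,
        mul_nonneg a1 hF0, mul_nonneg a2 hF0]
    have k1 : 0 ≤ ‖fracLap u₀‖ ^ 2 := sq_nonneg _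
    have k2 : 0 ≤ ‖fracLap u₁‖ ^ 2 := sq_nonneg _
    have k3 : 0 ≤ ‖u₂‖ ^ 2 := sq_nonneg _
    have k4 : 0 ≤ timeNorm T 2 F ^ 2 := sq_nonneg _
    refine le_trans ?_ (mul_le_mul_of_nonneg_left key (by positivity))
    nlinarith
  have e1 : ∀ x : ℝ, 0 ≤ x → b * x ^ 2 ≤ (A * N) ^ 2 → x ≤ A / √b * N := by
    intro x hx hx2
    have h3 : (√b * x) ^ 2 ≤ (A * N) ^ 2 := by rwa [mul_pow, Real.sq_sqrt hb.le]
    have h4 := (sq_le_sq₀ (by positivity) (by positivity)).1 h3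
    rw [div_mul_eq_mul_div, le_div_iff₀ hsb]
    linarith
  have s1 : supNorm T u.toFun ≤ A / √b * N := supNorm_le (by positivity) (by
    filter_upwards [h2] with t ht
    refine e1 _ (norm_nonneg _) (le_trans ?_ ht)
    have : 0 ≤ b * ‖fracLap (u.dt t)‖ ^ 2 + ‖u.dtt t‖ ^ 2 := by positivity
    linarith)
  have s2 : supNorm T u.dt ≤ A / √b * N := supNorm_le (by positivity) (by
    filter_upwards [h2] with t ht
    refine e1 _ (norm_nonneg _) (le_trans ?_ ht)
    have : 0 ≤ b * ‖fracLap (u.toFun t)‖ ^ 2 + ‖u.dtt t‖ ^ 2 := by positivity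
    linarith)
  have s3 : timeNorm T ∞ u.dtt ≤ A * N := timeNorm_top_le (by positivity) (by
    filter_upwards [h2] with t ht
    refine (sq_le_sq₀ (norm_nonneg _) (by positivity)).1 (le_trans ?_ ht)
    have : 0 ≤ b * ‖fracLap (u.toFun t)‖ ^ 2 + b * ‖fracLap (u.dt t)‖ ^ 2 := by positivity
    linarith)
  have h4 := max_le s1 s2
  rw [EnergyFun.norm]
  nlinarith

end Linear

/-! ### The nonlinear equation -/

section Nonlinear

variable {n : ℕ} {s : ℝ≥0} {Ω : Set (Space n)} {T b : ℝ} {V : Type} [NormedAddCommGroup V]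
  [InnerProductSpace ℝ V]

theorem EnergySpace.norm_fracLap_e' (E : EnergySpace s Ω b V) (hb : 0 < b) (x : V) :
    ‖fracLap (E.e' x)‖ = ‖x‖ / √b := by
  have h := E.norm_e hb.le (E.e' x)
  rw [E.e_e'] at h
  rw [h, mul_div_cancel_left₀ _ (Real.sqrt_pos.2 hb).ne']

theorem EnergySpace.e'_zero (E : EnergySpace s Ω b V) : E.e' 0 = 0 := by
  rw [← E.e_zero, E.e'_e]

theorem EnergySpace.e'_sub (E : EnergySpace s Ω b V) (x y : V) : E.e' (x - y) = E.e' x - E.e' y := by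
  rw [← E.e'_e (E.e' x - E.e' y), E.e_sub, E.e_e', E.e_e']

theorem dataNorm_sub_le (u₀ u₁ : ↥(HTilde s Ω)) (u₂ : ↥(LTilde Ω)) {F G : ℝ → ↥(LTilde Ω)}
    (hF : MemLp F 2 (timeMeasure T)) (hG : MemLp G 2 (timeMeasure T)) :
    dataNorm T u₀ u₁ u₂ (fun t => F t - G t) ≤ dataNorm T u₀ u₁ u₂ F + timeNorm T 2 G := by
  have := timeNorm_sub_le hF hG
  rw [dataNorm, dataNorm]
  linarith

theorem dataNorm_zero (F : ℝ → ↥(LTilde Ω)) :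
    dataNorm T (0 : ↥(HTilde s Ω)) 0 0 F = timeNorm T 2 F := by
  rw [dataNorm, map_zero, norm_zero, norm_zero, add_zero, add_zero, zero_add]

/-- The weak formulation depends only on the class of the right-hand side. -/
theorem IsWeakSolution.congr_source {α b c : ℝ} {q : Space n × ℝ → ℝ} {f : Space n × ℝ → ℝ → ℝ}
    {u₀ u₁ : ↥(HTilde s Ω)} {u₂ : ↥(LTilde Ω)} {F G : ℝ → ↥(LTilde Ω)} {u : EnergyFun s Ω T}
    (h : IsWeakSolution α b c q f u₀ u₁ u₂ F u) (hFG : F =ᵐ[timeMeasure T] G) :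
    IsWeakSolution α b c q f u₀ u₁ u₂ G u := by
  refine ⟨h.initial, h.initial_dt, fun φ => (h.weak φ).trans ?_⟩
  congr 1
  refine integral_congr_ae ?_
  filter_upwards [hFG] with t ht
  rw [ht]

variable [CompleteSpace V]

/-- On a ball of the solution space where the nonlinearity is a small perturbation, solutions are
unique: the energy estimate bounds the difference of two solutions by half of itself. -/
theorem IsWeakSolution.same (E : EnergySpace s Ω b V) (hn : 1 ≤ n) (hΩ : IsOpen Ω)
    (hΩb : volume Ω ≠ ⊤) (hb : 0 < b) (hT : 0 < T) {α c K : ℝ} (hK : 0 ≤ K) {q : Space n × ℝ → ℝ}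
    {p : ℝ≥0∞} (hq : IsPotential Ω T p q) (hB : BoundedPotential hΩ s T K q) {C₀ : ℝ} (hC₀ : 0 < C₀)
    (hE : IsEnergyConstant s Ω T α b c q C₀) {γ r L : ℝ} (hγ : 0 < γ) (hr : 0 < r) (hL : 0 ≤ L)
    {f : Space n × ℝ → ℝ → ℝ} (hf : IsCaratheodory Ω T f)
    (hfL : LocallyLipschitzSuperposition hΩ s T L γ r f) {δ : ℝ}
    (hδ : C₀ * (√T * (2 * L * (δ ^ γ + δ ^ r))) ≤ 1 / 2) {u₀ u₁ : ↥(HTilde s Ω)}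
    {u₂ : ↥(LTilde Ω)} {F : ℝ → ↥(LTilde Ω)} (hF : MemLp F 2 (timeMeasure T)) {u v : EnergyFun s Ω T}
    (hu : IsWeakSolution α b c q f u₀ u₁ u₂ F u) (hv : IsWeakSolution α b c q f u₀ u₁ u₂ F v)
    (hun : u.norm ≤ δ) (hvn : v.norm ≤ δ) : u.Same v := by
  have hq' := fun w : EnergyFun s Ω T => hB.hasL2Superposition hK hq w.memLp
  have hf' := fun w : EnergyFun s Ω T => hfL.hasL2Superposition hL hγ hr hf w.memLp
  have hFw : ∀ w : EnergyFun s Ω T, MemLp (fun t => F t - nemytskii hΩ f t (toL2 (w.toFun t))) 2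
    (timeMeasure T) := fun w => hF.sub (hf' w).memLp
  obtain ⟨d, hd, hdw⟩ := exists_difference E hn hΩ hΩb hb hT hK hq hB (hFw u) (hFw v)
    ((isWeakSolution_iff_linear E hn hΩ hΩb hb hT hF (hq' u) (hf' u)).1 hu)
    ((isWeakSolution_iff_linear E hn hΩ hΩb hb hT hF (hq' v) (hf' v)).1 hv)
  have h1 := hE 0 0 0 _ ((hFw u).sub (hFw v)) d hdw
  rw [dataNorm_zero] at h1
  have hδ0 : 0 ≤ δ := (supNorm_nonneg _).trans ((supNorm_le_norm u).trans hun)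
  have hS := supNorm_nonneg (T := T) d.toFun
  set S := supNorm T d.toFun with hSdef
  set Λ := 2 * L * (δ ^ γ + δ ^ r) with hΛ
  have hΛ0 : 0 ≤ Λ := by positivity
  have h2 : timeNorm T 2 (fun t => F t - nemytskii hΩ f t (toL2 (u.toFun t)) -
      (F t - nemytskii hΩ f t (toL2 (v.toFun t)))) ≤ √T * (Λ * S) := by
    refine timeNorm_two_le hT.le (by positivity) ?_
    filter_upwards [hfL.ae_norm_sub_le hL hγ hr (R := δ), ae_norm_fracLap_le u.memLp,
      ae_norm_fracLap_le v.memLp, ae_norm_fracLap_le d.memLp] with t e1 e2 e3 e4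
    rw [sub_sub_sub_cancel_left, norm_sub_rev]
    refine (e1 _ _ (e2.trans ((supNorm_le_norm u).trans hun))
      (e3.trans ((supNorm_le_norm v).trans hvn))).trans ?_
    rw [← hd]
    gcongr
  have h3 : d.norm ≤ 1 / 2 * S := by
    refine h1.trans ((mul_le_mul_of_nonneg_left h2 hC₀.le).trans ?_)
    calc C₀ * (√T * (Λ * S)) = C₀ * (√T * Λ) * S := by ring
      _ ≤ 1 / 2 * S := by gcongr
  have h4 : S ≤ 0 := by
    have := supNorm_le_norm d
    linarith
  filter_upwards [ae_norm_fracLap_le d.memLp] with t ht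
  have h5 : ‖fracLap (d.toFun t)‖ = 0 := le_antisymm (ht.trans h4) (norm_nonneg _)
  have h6 : E.e (d.toFun t) = 0 := by
    rw [← norm_eq_zero, E.norm_e hb.le, h5, mul_zero]
  have h7 : d.toFun t = 0 := by rw [← E.e'_e (d.toFun t), h6, E.e'_zero]
  rwa [hd, sub_eq_zero] at h7

/-- Small data admit a solution. The nonlinearity is first composed with the retraction to a ball
of the energy space, which makes it globally Lipschitz; the energy estimate then shows that the
solution of the modified equation stays in the ball. -/
theorem exists_weakSolution (E : EnergySpace s Ω b V) (hn : 1 ≤ n) (hΩ : IsOpen Ω)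
    (hΩb : volume Ω ≠ ⊤) (hb : 0 < b) (hT : 0 < T) {α c K : ℝ} (hK : 0 ≤ K) {q : Space n × ℝ → ℝ}
    {p : ℝ≥0∞} (hq : IsPotential Ω T p q) (hB : BoundedPotential hΩ s T K q) {C₀ : ℝ} (hC₀ : 0 < C₀)
    (hE : IsEnergyConstant s Ω T α b c q C₀) {γ r L : ℝ} (hγ : 0 < γ) (hr : 0 < r) (hL : 0 ≤ L)
    {f : Space n × ℝ → ℝ → ℝ} (hf : IsCaratheodory Ω T f)
    (hfL : LocallyLipschitzSuperposition hΩ s T L γ r f) {δ : ℝ} (hδ0 : 0 < δ)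
    (hδ : C₀ * (√T * (2 * L * (δ ^ γ + δ ^ r))) ≤ 1 / 2) {u₀ u₁ : ↥(HTilde s Ω)}
    {u₂ : ↥(LTilde Ω)} {F : ℝ → ↥(LTilde Ω)} (hF : MemLp F 2 (timeMeasure T))
    (hN : dataNorm T u₀ u₁ u₂ F ≤ δ / (2 * C₀)) :
    ∃ u : EnergyFun s Ω T, IsWeakSolution α b c q f u₀ u₁ u₂ F u ∧ u.norm ≤ δ := by
  have hsb : 0 < √b := Real.sqrt_pos.2 hb
  set R := √b * δ with hR
  have hR0 : 0 < R := by positivity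
  set Λ := 2 * L * (δ ^ γ + δ ^ r) with hΛ
  have hΛ0 : 0 ≤ Λ := by positivity
  -- the retraction is taken in the Hilbert space `V`, where the ball `‖fracLap u‖ ≤ δ` has radius
  -- `√b δ`
  set τr : V → ↥(HTilde s Ω) := fun x => E.e' (radialRetraction R x) with hτr
  have hτc : Continuous τr := E.continuous_e'.comp (continuous_radialRetraction hR0)
  have hτb : ∀ x, ‖fracLap (τr x)‖ ≤ δ := by
    intro x
    rw [hτr, E.norm_fracLap_e' hb, div_le_iff₀ hsb, mul_comm]
    exact norm_radialRetraction_le hR0 x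
  have hτ0 : τr 0 = 0 := by
    simp only [hτr]
    rw [radialRetraction, smul_zero, E.e'_zero]
  have hτm : ∀ {u : ℝ → V}, Continuous u →
      AEStronglyMeasurable (fun t => nemytskii hΩ f t (toL2 (τr (u t)))) (timeMeasure T) := by
    intro u hu
    exact aestronglyMeasurable_nemytskii hΩ hf (hfL.mono fun _ ht => ht.1)
      (hfL.ae_continuous hγ.le hr.le) (u := fun t => τr (u t))
      (hτc.comp_aestronglyMeasurable hu.aestronglyMeasurable)
  obtain ⟨u, v, w, hu, hv, hw, -, h⟩ := exists_thirdOrder E.j_injective E.denseRange_j hT (c / b) α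
    (E.e u₀) (E.e u₁) u₂ (M := K / √b + Λ * (2 / √b))
    (g := fun t x => nemytskii hΩ (fun z τ => q z * τ) t (toL2 (E.e' x)) +
      nemytskii hΩ f t (toL2 (τr x)) - F t) (by positivity)
    (fun u hu => ((aestronglyMeasurable_nemytskii hΩ (isCaratheodory_potential hq)
      (hB.mono fun _ ht => ht.1) hB.ae_continuous (u := fun t => E.e' (u t))
      (E.continuous_e'.comp_aestronglyMeasurable hu.aestronglyMeasurable)).add (hτm hu)).sub hF.1)
    (by
      filter_upwards [hB, hfL.ae_norm_sub_le hL hγ hr (R := δ)] with t h1 h2 x y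
      rw [sub_sub_sub_cancel_right, add_sub_add_comm, add_mul]
      refine (norm_add_le _ _).trans (add_le_add ((h1.2 _ _).trans (le_of_eq ?_))
        ((h2 _ _ (hτb x) (hτb y)).trans ?_))
      · rw [← E.e'_sub, E.norm_fracLap_e' hb]
        ring
      · rw [← E.e'_sub, E.norm_fracLap_e' hb, ← hΛ, mul_assoc Λ, div_mul_eq_mul_div]
        gcongr
        exact norm_radialRetraction_sub_le hR0 x y)
    (by
      refine (memLp_congr_ae ?_).2 hF.neg
      filter_upwards [hfL] with t ht
      rw [E.e'_zero, hτ0, map_zero, nemytskii_potential_zero, ht.2.1, add_zero, zero_sub]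
      rfl)
  obtain ⟨U, hU, hUt, hUtt, hi0, hi1⟩ := exists_energyFun E hT hu hv hw h
  have hqU := hB.hasL2Superposition hK hq U.memLp
  have hfU := hfL.hasL2Superposition hL hγ hr hf U.memLp
  have hGb : ∀ᵐ t ∂timeMeasure T, ‖nemytskii hΩ f t (toL2 (τr (u t)))‖ ≤ L * (δ ^ γ + δ ^ r) * δ :=
    hfL.ae_norm_le hL hγ hr (u := fun t => τr (u t)) (Eventually.of_forall fun t => hτb _)
  have hG : MemLp (fun t => nemytskii hΩ f t (toL2 (τr (u t)))) 2 (timeMeasure T) :=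
    memLp_two_of_ae_bound (hτm hu) hGb
  have hFG : MemLp (fun t => F t - nemytskii hΩ f t (toL2 (τr (u t)))) 2 (timeMeasure T) := hF.sub hG
  have hlin : IsWeakSolution α b c q (fun _ _ => 0) u₀ u₁ u₂
      (fun t => F t - nemytskii hΩ f t (toL2 (τr (u t)))) U := by
    refine isWeakSolution_of_isThirdOrder E hn hΩ hΩb hb hT hFG hqU
      (hasL2Superposition_zero hΩ T U.toFun) hi0 hi1 ?_
    filter_upwards [ae_restrict_mem measurableSet_Ioo] with t ht
    have e1 : lowerOrder hΩ q (fun _ _ => 0) (fun t => F t - nemytskii hΩ f t (toL2 (τr (u t))))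
        U.toFun = fun t => nemytskii hΩ (fun z τ => q z * τ) t (toL2 (E.e' (u t))) +
          nemytskii hΩ f t (toL2 (τr (u t))) - F t := by
      funext τ
      rw [lowerOrder, nemytskii_zero, hU]
      abel
    have e2 : (fun t => E.e (U.toFun t)) = u := by
      funext τ
      rw [hU, E.e_e']
    have e3 : (fun t => E.e (U.dt t)) = v := by
      funext τ
      rw [hUt, E.e_e']
    rw [e1, e2, e3, hUtt]
    exact h t (Ioo_subset_Icc_self ht)
  have hnorm : U.norm ≤ δ := by
    refine (hE u₀ u₁ u₂ _ hFG U hlin).trans ?_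
    have h1 := dataNorm_sub_le u₀ u₁ u₂ hF hG
    have h2 := timeNorm_two_le hT.le (by positivity) hGb
    calc C₀ * dataNorm T u₀ u₁ u₂ (fun t => F t - nemytskii hΩ f t (toL2 (τr (u t))))
        ≤ C₀ * (δ / (2 * C₀) + √T * (L * (δ ^ γ + δ ^ r) * δ)) := by
          refine mul_le_mul_of_nonneg_left ?_ hC₀.le
          linarith
      _ = δ / 2 + C₀ * (√T * Λ) * (δ / 2) := by
          rw [hΛ]
          field_simp
      _ ≤ δ / 2 + 1 / 2 * (δ / 2) := by gcongr
      _ ≤ δ := by linarith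
  refine ⟨U, (isWeakSolution_iff_linear E hn hΩ hΩb hb hT hF hqU hfU).2 (hlin.congr_source ?_), hnorm⟩
  -- the solution stays in the ball on which the truncation is the identity
  filter_upwards [ae_norm_fracLap_le U.memLp] with t ht
  have h1 : ‖u t‖ ≤ R := by
    have h2 : ‖fracLap (U.toFun t)‖ ≤ δ := ht.trans ((supNorm_le_norm U).trans hnorm)
    rw [hU, E.norm_fracLap_e' hb, div_le_iff₀ hsb] at h2
    rwa [hR, mul_comm]
  rw [hτr, hU]
  simp only [radialRetraction_of_le hR0 h1]

set_option synthInstance.maxHeartbeats 200000 in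
/-- By the equation, the third time derivative is square integrable with values in the dual space.
-/
theorem IsWeakSolution.memH3 (E : EnergySpace s Ω b V) (hn : 1 ≤ n) (hΩ : IsOpen Ω)
    (hΩb : volume Ω ≠ ⊤) (hb : 0 < b) (hT : 0 < T) {α c : ℝ} {q : Space n × ℝ → ℝ}
    {f : Space n × ℝ → ℝ → ℝ} {u₀ u₁ : ↥(HTilde s Ω)} {u₂ : ↥(LTilde Ω)} {F : ℝ → ↥(LTilde Ω)}
    (hF : MemLp F 2 (timeMeasure T)) {u : EnergyFun s Ω T}
    (hq : HasL2Superposition hΩ T (fun z τ => q z * τ) u.toFun)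
    (hf : HasL2Superposition hΩ T f u.toFun) (h : IsWeakSolution α b c q f u₀ u₁ u₂ F u) :
    u.MemH3 := by
  have h1 := h.isThirdOrder E hn hΩ hΩb hb hT hF hq hf
  have hw : MemLp u.dtt 2 (timeMeasure T) := u.memLp_dtt.mono_exponent le_top
  have hz : MemLp (fun t => -(E.e (u.dt t) + (c / b) • E.e (u.toFun t) +
      E.j.adjoint (α • u.dtt t + lowerOrder hΩ q f F u.toFun t))) 2 (timeMeasure T) :=
    ((((E.memLp_e hb.le u.memLp_dt).mono_exponent le_top).add
      (((E.memLp_e hb.le u.memLp).mono_exponent le_top).const_smul (c / b))).add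
      (E.j.adjoint.comp_memLp' ((hw.const_smul α).add (memLp_lowerOrder hF hq hf)))).neg
  have hg : Integrable (fun t => E.j.adjoint (u.dtt t)) (timeMeasure T) :=
    E.j.adjoint.integrable_comp (hw.integrable (by norm_num))
  have hd := hasWeakDeriv_of_primitive hT.le hg (hz.integrable (by norm_num))
    (c := E.j.adjoint u₂) (h1.mono fun t ht => by
      rw [ht.2.2, intervalIntegral.integral_neg, ← sub_eq_add_neg])
  have hG : ∀ t y, toDual s (u.dtt t) y = ⟪E.j.adjoint (u.dtt t), E.e y⟫_ℝ := by
    intro t y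
    rw [ContinuousLinearMap.adjoint_inner_left, E.j_e]
    rfl
  exact exists_weakDeriv_dual (X := ↥(HTilde s Ω)) E.e_add E.e_smul E.continuous_e hG hg hz hd

/-- The a priori estimate of a solution of the nonlinear equation. -/
theorem IsWeakSolution.norm_le (E : EnergySpace s Ω b V) (hn : 1 ≤ n) (hΩ : IsOpen Ω)
    (hΩb : volume Ω ≠ ⊤) (hb : 0 < b) (hT : 0 < T) {α c : ℝ} {q : Space n × ℝ → ℝ} {C₀ : ℝ}
    (hC₀ : 0 < C₀) (hE : IsEnergyConstant s Ω T α b c q C₀) {γ r L : ℝ} (hγ : 0 < γ) (hr : 0 < r)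
    (hL : 0 ≤ L) {f : Space n × ℝ → ℝ → ℝ}
    (hfL : LocallyLipschitzSuperposition hΩ s T L γ r f) {u₀ u₁ : ↥(HTilde s Ω)}
    {u₂ : ↥(LTilde Ω)} {F : ℝ → ↥(LTilde Ω)} (hF : MemLp F 2 (timeMeasure T)) {u : EnergyFun s Ω T}
    (hq : HasL2Superposition hΩ T (fun z τ => q z * τ) u.toFun)
    (hf : HasL2Superposition hΩ T f u.toFun) (h : IsWeakSolution α b c q f u₀ u₁ u₂ F u) :
    u.norm ≤ C₀ * (1 + √T * L) * (dataNorm T u₀ u₁ u₂ F + supNorm T u.toFun ^ (γ + 1)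
      + supNorm T u.toFun ^ (r + 1)) := by
  have hS := supNorm_nonneg (T := T) u.toFun
  have h1 := hE _ _ _ _ (hF.sub hf.memLp) u
    ((isWeakSolution_iff_linear E hn hΩ hΩb hb hT hF hq hf).1 h)
  have h2 := dataNorm_sub_le u₀ u₁ u₂ hF hf.memLp
  have h3 := timeNorm_two_le hT.le (by positivity)
    (hfL.ae_norm_le hL hγ hr (ae_norm_fracLap_le u.memLp))
  have hN : 0 ≤ dataNorm T u₀ u₁ u₂ F := by
    have := timeNorm_nonneg (T := T) 2 F
    rw [dataNorm]
    positivity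
  rw [Real.rpow_add_one' hS (by positivity), Real.rpow_add_one' hS (by positivity)]
  set S := supNorm T u.toFun
  refine h1.trans ?_
  rw [mul_assoc]
  refine mul_le_mul_of_nonneg_left (h2.trans ((add_le_add_right h3 _).trans ?_)) hC₀.le
  have a1 : 0 ≤ S ^ γ * S := by positivity
  have a2 : 0 ≤ S ^ r * S := by positivity
  have a3 : 0 ≤ √T * L * dataNorm T u₀ u₁ u₂ F := by positivity
  nlinarith

/-- Since the exponents are positive, the Lipschitz constant of the nonlinearity on small balls is
small. -/
theorem exists_small_radius {γ r : ℝ} (hγ : 0 < γ) (hr : 0 < r) (A : ℝ) :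
    ∃ δ : ℝ, 0 < δ ∧ A * (δ ^ γ + δ ^ r) ≤ 1 / 2 := by
  have hc : ContinuousAt (fun δ : ℝ => A * (δ ^ γ + δ ^ r)) 0 :=
    continuousAt_const.mul ((Real.continuousAt_rpow_const _ _ (Or.inr hγ.le)).add
      (Real.continuousAt_rpow_const _ _ (Or.inr hr.le)))
  have h0 : A * ((0 : ℝ) ^ γ + (0 : ℝ) ^ r) < 1 / 2 := by
    rw [Real.zero_rpow hγ.ne', Real.zero_rpow hr.ne']
    norm_num
  have h1 : ∀ᶠ δ in 𝓝[>] (0 : ℝ), A * (δ ^ γ + δ ^ r) < 1 / 2 :=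
    (hc.eventually (gt_mem_nhds h0)).filter_mono nhdsWithin_le_nhds
  obtain ⟨δ, h1, h2⟩ := (h1.and self_mem_nhdsWithin).exists
  exact ⟨δ, h2, h1.le⟩

/-- The growth exponents of the nonlinearity are admissible in the Sobolev embedding. -/
theorem embedsIn_of_growth (hn : 1 ≤ n) (hΩ : IsOpen Ω) (hΩb : volume Ω ≠ ⊤) {e r : ℝ} (her : e ≤ r)
    (hr : AdmissibleGrowthExponent n s r) : EmbedsIn s Ω (ENNReal.ofReal (2 * (e + 1))) := by
  refine embedsIn_of_subcritical hn hΩ hΩb (fun h => ENNReal.ofReal_le_ofReal ?_)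
    fun _ => ENNReal.ofReal_lt_top
  have h1 := hr.2 h
  have hd : 0 < (n : ℝ) - 2 * s := by linarith
  rw [le_div_iff₀ hd] at h1
  rw [le_div_iff₀ hd]
  nlinarith

end Nonlinear

end MGT

end

theorem theorem3p8 (n : ℕ) (hn : 1 ≤ n) (Ω : Set (MGT.Space n))
    (hΩ : MGT.IsBoundedLipschitzDomain Ω) (T : ℝ) (hT : 0 < T) (s : ℝ≥0) (hs : 0 < s)
    (α b c : ℝ) (hb : 0 < b) (p : ℝ≥0∞) (hp : MGT.AdmissiblePotentialExponent n s p)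
    (q : MGT.Space n × ℝ → ℝ) (hq : MGT.IsPotential Ω T p q) :
    (∃ C₀ : ℝ, 0 < C₀ ∧ MGT.IsEnergyConstant s Ω T α b c q C₀) ∧
    ∀ C₀ : ℝ, 0 < C₀ → MGT.IsEnergyConstant s Ω T α b c q C₀ →
    ∀ (γ r : ℝ), 0 < γ → γ ≤ r → MGT.AdmissibleGrowthExponent n s r →
    ∀ f : MGT.Space n × ℝ → ℝ → ℝ, MGT.IsNonlinearity Ω T γ r f →
    ∃ δ₀ : ℝ, 0 < δ₀ ∧ ∃ C : ℝ, 0 < C ∧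
      (∀ δ : ℝ, 0 < δ → δ ≤ δ₀ →
        ∀ (u₀ u₁ : ↥(MGT.HTilde s Ω)) (u₂ : ↥(MGT.LTilde Ω)) (F : ℝ → ↥(MGT.LTilde Ω)),
        MemLp F 2 (MGT.timeMeasure T) →
        MGT.dataNorm T u₀ u₁ u₂ F ≤ δ / (2 * C₀) →
        ∃ u : MGT.EnergyFun s Ω T,
          MGT.IsWeakSolution α b c q f u₀ u₁ u₂ F u ∧ u.norm ≤ δ ∧ u.MemH3 ∧
          u.norm ≤ C * (MGT.dataNorm T u₀ u₁ u₂ F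
            + MGT.supNorm T u.toFun ^ (γ + 1) + MGT.supNorm T u.toFun ^ (r + 1)) ∧
          ∀ v : MGT.EnergyFun s Ω T,
            MGT.IsWeakSolution α b c q f u₀ u₁ u₂ F v → v.norm ≤ δ → v.Same u) ∧
      (∀ δ₁ δ₂ : ℝ, 0 < δ₁ → δ₁ ≤ δ₂ → δ₂ ≤ δ₀ →
        ∀ (u₀ u₁ : ↥(MGT.HTilde s Ω)) (u₂ : ↥(MGT.LTilde Ω)) (F : ℝ → ↥(MGT.LTilde Ω)),
        MemLp F 2 (MGT.timeMeasure T) →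
        MGT.dataNorm T u₀ u₁ u₂ F ≤ δ₁ / (2 * C₀) →
        ∀ u v : MGT.EnergyFun s Ω T,
          MGT.IsWeakSolution α b c q f u₀ u₁ u₂ F u → u.norm ≤ δ₁ →
          MGT.IsWeakSolution α b c q f u₀ u₁ u₂ F v → v.norm ≤ δ₂ → u.Same v) := by
  obtain ⟨hΩo, -, hΩbd, -⟩ := hΩ
  have hΩb : volume Ω ≠ ⊤ := hΩbd.measure_lt_top.ne
  obtain ⟨K, hK, hB⟩ := MGT.exists_potential_bound hn hs hΩo hΩb hp hq
  obtain ⟨V, _, _, _, ⟨E⟩⟩ := MGT.exists_energySpace s hn hΩo hΩb hb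
  refine ⟨MGT.exists_isEnergyConstant E hn hΩo hΩb hb hT hK.le hq hB α c, ?_⟩
  intro C₀ hC₀ hE γ r hγ hγr hr f hf
  have hr0 : 0 < r := hγ.trans_le hγr
  obtain ⟨L, hL, hfL⟩ := MGT.exists_nemytskii_lipschitz hΩo hγ hr0
    (MGT.embedsIn_of_growth hn hΩo hΩb hγr hr) (MGT.embedsIn_of_growth hn hΩo hΩb le_rfl hr) hf
  obtain ⟨δ₀, hδ₀, hsmall⟩ := MGT.exists_small_radius hγ hr0 (C₀ * (√T * (2 * L)))
  have hδ : ∀ δ, 0 < δ → δ ≤ δ₀ → C₀ * (√T * (2 * L * (δ ^ γ + δ ^ r))) ≤ 1 / 2 := by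
    intro δ h0 h1
    calc C₀ * (√T * (2 * L * (δ ^ γ + δ ^ r))) = C₀ * (√T * (2 * L)) * (δ ^ γ + δ ^ r) := by ring
      _ ≤ C₀ * (√T * (2 * L)) * (δ₀ ^ γ + δ₀ ^ r) := by gcongr
      _ ≤ 1 / 2 := hsmall
  refine ⟨δ₀, hδ₀, C₀ * (1 + √T * L), by positivity, ?_, ?_⟩
  · intro δ h0 h1 u₀ u₁ u₂ F hF hN
    obtain ⟨u, hu, hun⟩ := MGT.exists_weakSolution E hn hΩo hΩb hb hT hK.le hq hB hC₀ hE hγ hr0 hL.le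
      hf.1 hfL h0 (hδ δ h0 h1) hF hN
    have hqu := MGT.BoundedPotential.hasL2Superposition hK.le hq hB u.memLp
    have hfu := MGT.LocallyLipschitzSuperposition.hasL2Superposition hL.le hγ hr0 hf.1 hfL u.memLp
    refine ⟨u, hu, hun, hu.memH3 E hn hΩo hΩb hb hT hF hqu hfu,
      hu.norm_le E hn hΩo hΩb hb hT hC₀ hE hγ hr0 hL.le hfL hF hqu hfu, fun v hv hvn => ?_⟩
    exact hv.same E hn hΩo hΩb hb hT hK.le hq hB hC₀ hE hγ hr0 hL.le hf.1 hfL (hδ δ h0 h1) hF hu hvn hun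
  · intro δ₁ δ₂ h0 h1 h2 u₀ u₁ u₂ F hF _ u v hu hun hv hvn
    exact hu.same E hn hΩo hΩb hb hT hK.le hq hB hC₀ hE hγ hr0 hL.le hf.1 hfL
      (hδ δ₂ (h0.trans_le h1) h2) hF hv (hun.trans h1) hvn
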